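/- **Setting.** Let $d\ge 2$, let $M$ be a compact $\mathcal C^\infty$ manifold without boundary of dimension $d+1$, let $V$ be a $\mathcal C^\infty$ vector field on $M$ generating a $\mathcal C^\infty$ flow $(\phi^t)_{t\in\mathbb R}$, and let $g:M\to\mathbb C$ be $\mathcal C^\infty$. Assume that the flow is Anosov: $V$ does not vanish and for every $x\in M$ there is a splitting $T_xM=E^u_x\oplus E^s_x\oplus\mathbb R V(x)$ such that $D_x\phi^t(E^\sigma_x)=E^\sigma_{\phi^t(x)}$ for $t\in\mathbb R$, $\sigma\in\{u,s\}$, and, for some Riemannian metric on $M$ and constants $C>0$, $0<\theta<1$, one has $|D_x\phi^t v|\le C\theta^t|v|$ for $v\in E^s_x$ and $|D_x\phi^{-t}v|\le C\theta^t|v|$ for $v\in E^u_x$, for all $t\ge 0$ and $x\in M$. **Ruelle resonances.** Let $X=V+g$ and, for $t\ge 0$, let $\mathcal L_t u=\exp\left(\int_0^t g\circ\phi^\tau\,d\tau\right)u\circ\phi^t$, acting on distributions $u\in\mathcal D'(M)$ (functions being embedded in $\mathcal D'(M)$ as usual by pairing with smooth densities). For $\lambda\in\mathbb C$ and an integer $m\ge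 1$, $\lambda$ is a Ruelle resonance of $X$ of multiplicity $m$ if for some $A>0$ with $\operatorname{Re}\lambda>-A$ there is a Banach space $\mathcal B$ such that: (a) $\mathcal C^\infty(M)\subseteq\mathcal B\subseteq\mathcal D'(M)$, both inclusions being continuous and the first one having dense image; (b) $\mathcal L_t$ is bounded on $\mathcal B$ for every $t\ge 0$; (c) $(\mathcal L_t)_{t\ge 0}$ is a strongly continuous semigroup on $\mathcal B$ whose generator is $X$ (with domain $\{u\in\mathcal B: Xu\in\mathcal B\}$); (d) the spectrum of $X$ on $\mathcal B$ in $\{\operatorname{Re}z>-A\}$ consists of isolated eigenvalues of finite multiplicity; and $\lambda$ is an isolated eigenvalue of $X$ on $\mathcal B$ of algebraic multiplicity $m$, i.e. $m$ is the rank of the spectral projector $\frac1{2i\pi}\oint_{|z-\lambda|=r}(z-X)^{-1}dz$ for small $r>0$. All sums and products over resonances below take multiplicities into account. **Periodic orbits.** A periodic orbit $\gamma$ is an orbit of the flow together with a length $T_\gamma>0$ such that $\phi^{T_\gamma}$ fixes its points; $T^\#_\gamma$ is the smallest length of a periodic orbit with the same image, $\int_\gamma g=\int_0^{T_\gamma}g(\phi^\tau(x))\,d\tau$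 and $\mathcal P_\gamma$ is the endomorphism of $E^u_x\oplus E^s_x$ induced by $D_x\phi^{T_\gamma}$, for any $x$ in the image of $\gamma$. The dynamical determinant is defined, for $\operatorname{Re}s$ large enough, by $$d_g(s)=\exp\left(-\sum_\gamma\frac{T_\gamma^\#}{T_\gamma}\,e^{\int_\gamma g}\,\frac{e^{-sT_\gamma}}{|\det(I-\mathcal P_\gamma)|}\right)$$ (an absolutely convergent series). The *trace formula* is the statement that both sides of $$\sum_{\lambda\text{ resonance}}e^{\lambda t}=\sum_\gamma\frac{T_\gamma^\#\,e^{\int_\gamma g}}{|\det(I-\mathcal P_\gamma)|}\,\delta_{T_\gamma}$$ converge (unconditionally, when tested against any smooth function with compact support in $\mathbb R_+^*=\left]0,+\infty\right[$) to one and the same distribution on $\mathbb R_+^*$. The order of an entire function $f$ is $\limsup_{r\to+\infty}\sup_{|z|=r}\frac{\log(1+\log_+|f(z)|)}{\log r}$. **Proposition.** The following two statements are equivalent: (i) $d_g$ extends to an entire function of finite order whose zeros, counted with multiplicity, are the Ruelle resonances of $X$; (ii) the trace formula holds and there is a real number $\rho\ge 0$ such that $$\sum_{\lambda\text{ resonance}}\frac1{1+|\lambda|^\rho}<+\infty.$$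 Moreover, when (i) and (ii) hold, then for every $\rho\ge 0$ for which this last sum is finite, the entire extension of $d_g$ has order at most $\lceil\rho\rceil$, and there is a polynomial $P$ of degree at most $\lceil\rho\rceil$ such that $d_g(z)=e^{P(z)}Q(z)$ for all $z\in\mathbb C$, where $Q$ is the canonical product of minimal genus whose zeros are the resonances: $$Q(z)=z^{m_0}\prod_{\lambda\neq 0}E_p(z/\lambda),\qquad E_p(w)=(1-w)\exp\Big(\sum_{k=1}^p\frac{w^k}{k}\Big),$$ with $m_0\ge 0$ the multiplicity of $0$ as a resonance ($m_0=0$ if it is not one) and $p\ge 0$ the smallest integer such that $\sum_{\lambda\ne 0}|\lambda|^{-(p+1)}<+\infty$. -/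

import Mathlib

open scoped Manifold ContDiff Distributions

noncomputable section

namespace RuelleTrace

universe u

/-! ### Smooth functions and distributions on a compact manifold -/

section Smooth

variable (d : ℕ) (M : Type u) [TopologicalSpace M]
  [ChartedSpace (EuclideanSpace ℝ (Fin (d + 1))) M]

/-- The complex vector space `C^∞(M)` of smooth complex-valued functions on `M`,
as a subspace of all functions. -/
def smoothSubmodule : Submodule ℂ (M → ℂ) where
  carrier := {f | ContMDiff (𝓡 (d + 1)) 𝓘(ℝ, ℂ) ∞ f}
  add_mem' := fun hf hg => ContMDiff.add hf hg
  zero_mem' := contMDiff_const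
  smul_mem' := fun c _ hf =>
    (((contDiff_const (c := c)).mul contDiff_id).contMDiff (n := ∞)).comp hf

/-- `C^∞(M)` as a type of its own: it carries the Fréchet topology defined below, and not the
topology of pointwise convergence. -/
def SmoothFn : Type u := ↥(smoothSubmodule d M)

instance : AddCommGroup (SmoothFn d M) := inferInstanceAs (AddCommGroup ↥(smoothSubmodule d M))

instance : Module ℂ (SmoothFn d M) := inferInstanceAs (Module ℂ ↥(smoothSubmodule d M))

instance : CoeFun (SmoothFn d M) (fun _ => M → ℂ) := ⟨fun f => f.1⟩

/-- A (not necessarily continuous) vector field on `M`. -/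
abbrev VField : Type u := (x : M) → TangentSpace (𝓡 (d + 1)) x

variable {d M}

/-- The vector field `V` is smooth. -/
def IsSmoothVField [IsManifold (𝓡 (d + 1)) ∞ M] (V : VField d M) : Prop :=
  ContMDiff (𝓡 (d + 1)) (𝓡 (d + 1)).tangent ∞
    (fun x => (⟨x, V x⟩ : TangentBundle (𝓡 (d + 1)) M))

/-- The derivative `V f` of a complex-valued function `f` along the vector field `V`. -/
def dirDeriv (V : VField d M) (f : M → ℂ) : M → ℂ :=
  fun x => mfderiv (𝓡 (d + 1)) 𝓘(ℝ, ℂ) f x (V x)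

/-- The iterated derivative `W₁ W₂ ⋯ Wₖ f` along a list of smooth vector fields. -/
def iterDirDeriv [IsManifold (𝓡 (d + 1)) ∞ M] (w : List {W : VField d M // IsSmoothVField W})
    (f : M → ℂ) : M → ℂ :=
  w.foldr (fun W h => dirDeriv W.1 h) f

/-- The `C^∞` topology: the coarsest topology for which every iterated derivative
`f ↦ W₁ ⋯ Wₖ f` along smooth vector fields is continuous for uniform convergence on `M`.
For compact `M` it is the Fréchet topology given by the seminorms `sup |W₁ ⋯ Wₖ f|`. -/
instance [IsManifold (𝓡 (d + 1)) ∞ M] : TopologicalSpace (SmoothFn d M) :=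
  ⨅ w : List {W : VField d M // IsSmoothVField W},
    TopologicalSpace.induced (fun f : SmoothFn d M => UniformFun.ofFun (iterDirDeriv w f))
      inferInstance

variable (d M) in
/-- Distributions on `M`: continuous linear functionals on `C^∞(M)`. Smooth densities are
identified with smooth functions through a fixed smooth volume `μ`, `ψ ↔ ψ μ`. -/
abbrev Distr [IsManifold (𝓡 (d + 1)) ∞ M] : Type u := SmoothFn d M →L[ℂ] ℂ

/-- `μ` is a smooth positive volume on `M`: in every chart it has a smooth positive density
with respect to Lebesgue measure. -/
def IsSmoothVolume [MeasurableSpace M] (μ : MeasureTheory.Measure M) : Prop :=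
  ∀ e ∈ atlas (EuclideanSpace ℝ (Fin (d + 1))) M,
    ∃ r : EuclideanSpace ℝ (Fin (d + 1)) → ℝ,
      ContDiffOn ℝ ∞ r e.target ∧ (∀ y ∈ e.target, 0 < r y) ∧
      (μ.restrict e.source).map e =
        (MeasureTheory.volume.restrict e.target).withDensity (fun y => ENNReal.ofReal (r y))

/-- Extension of an operator `A` from smooth functions to distributions, by duality:
`v = A u` in the sense of distributions. Here `ψ' μ` is the image of the smooth density `ψ μ`
under the formal transpose of `A`, and the condition is `⟨v, ψ μ⟩ = ⟨u, ψ' μ⟩`. -/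
def DistrApply [IsManifold (𝓡 (d + 1)) ∞ M] [MeasurableSpace M] (μ : MeasureTheory.Measure M)
    (A : (M → ℂ) → (M → ℂ)) (u v : Distr d M) : Prop :=
  ∀ ψ ψ' : SmoothFn d M,
    (∀ f : SmoothFn d M, ∫ x, A f x * ψ x ∂μ = ∫ x, f x * ψ' x ∂μ) → v ψ = u ψ'

/-- The Koopman operator `𝓛_t f = exp (∫₀ᵗ g ∘ φ^τ dτ) · f ∘ φ^t`. -/
def koopman (φ : Flow ℝ M) (g : M → ℂ) (t : ℝ) (f : M → ℂ) : M → ℂ :=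
  fun x => Complex.exp (∫ τ in (0 : ℝ)..t, g (φ τ x)) * f (φ t x)

/-- The operator `X = V + g`. -/
def opX (V : VField d M) (g : M → ℂ) (f : M → ℂ) : M → ℂ :=
  fun x => dirDeriv V f x + g x * f x

end Smooth

/-! ### Spectrum of unbounded operators, given by their graphs -/

section Spectral

variable {B : Type u} [NormedAddCommGroup B] [NormedSpace ℂ B]

/-- The bounded operator `R` is the inverse of `z - X`, where `X` is the operator with graph
`G = {(b, X b)}`. -/
def IsResolventAt (G : Set (B × B)) (z : ℂ) (R : B →L[ℂ] B) : Prop :=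
  ∀ b c : B, R b = c ↔ (c, z • c - b) ∈ G

/-- The resolvent set of the operator with graph `G`. -/
def resSet (G : Set (B × B)) : Set ℂ := {z | ∃ R : B →L[ℂ] B, IsResolventAt G z R}

open Classical in
/-- The resolvent `(z - X)⁻¹` (zero outside of the resolvent set). -/
def resolv (G : Set (B × B)) (z : ℂ) : B →L[ℂ] B :=
  if h : ∃ R : B →L[ℂ] B, IsResolventAt G z R then h.choose else 0

/-- The spectral projector `(2 i π)⁻¹ ∮_{|z - a| = r} (z - X)⁻¹ dz`. -/
def spectralProj (G : Set (B × B)) (a : ℂ) (r : ℝ) : B →L[ℂ] B :=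
  (2 * Real.pi * Complex.I)⁻¹ • ∮ z in C(a, r), resolv G z

/-- `a` is an isolated eigenvalue of finite algebraic multiplicity `m` of the operator with
graph `G`: it is an isolated point of the spectrum and the spectral projector has rank `m`. -/
def IsIsolatedEigenvalue (G : Set (B × B)) (a : ℂ) (m : ℕ) : Prop :=
  a ∉ resSet G ∧ ∃ r : ℝ, 0 < r ∧ (∀ z ∈ Metric.closedBall a r, z ≠ a → z ∈ resSet G) ∧
    FiniteDimensional ℂ (LinearMap.range (spectralProj G a r).toLinearMap) ∧
    Module.finrank ℂ (LinearMap.range (spectralProj G a r).toLinearMap) = m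

end Spectral

/-! ### Ruelle resonances -/

section Resonances

variable {d : ℕ} {M : Type u} [TopologicalSpace M]
  [ChartedSpace (EuclideanSpace ℝ (Fin (d + 1))) M] [IsManifold (𝓡 (d + 1)) ∞ M]
  [MeasurableSpace M]

/-- The graph of `X = V + g` acting on a space `B` of distributions, with domain
`{b ∈ B : X b ∈ B}`. -/
def graphX (μ : MeasureTheory.Measure M) (V : VField d M) (g : M → ℂ)
    {B : Type u} (j : B → Distr d M) : Set (B × B) :=
  {p | DistrApply μ (opX V g) (j p.1) (j p.2)}

/-- A Banach space `B` with `C^∞(M) ⊆ B ⊆ 𝒟'(M)` on which the Koopman operators form a strongly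
continuous semigroup with generator `X = V + g`, the spectrum of which in `{Re z > -A}` consists
of isolated eigenvalues of finite multiplicity. -/
structure AnisotropicSpace (μ : MeasureTheory.Measure M) (V : VField d M) (φ : Flow ℝ M)
    (g : M → ℂ) (A : ℝ) (B : Type u) [NormedAddCommGroup B] [NormedSpace ℂ B] where
  /-- the inclusion `C^∞(M) ⊆ B` -/
  incl : SmoothFn d M →L[ℂ] B
  /-- the inclusion `B ⊆ 𝒟'(M)` -/
  toDistr : B →ₗ[ℂ] Distr d M
  toDistr_injective : Function.Injective toDistr
  /-- continuity of `B ⊆ 𝒟'(M)`, for the weak topology of `𝒟'(M)` -/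
  toDistr_continuous : ∀ ψ : SmoothFn d M, Continuous (fun b => toDistr b ψ)
  /-- the composition of the inclusions is the usual inclusion of functions in distributions -/
  toDistr_incl : ∀ f ψ : SmoothFn d M, toDistr (incl f) ψ = ∫ x, f x * ψ x ∂μ
  denseRange_incl : DenseRange incl
  /-- the operator induced by `𝓛_t` on `B` -/
  L : NNReal → B →L[ℂ] B
  L_spec : ∀ (t : NNReal) (b : B), DistrApply μ (koopman φ g t) (toDistr b) (toDistr (L t b))
  L_zero : L 0 = ContinuousLinearMap.id ℂ B
  L_add : ∀ s t : NNReal, L (s + t) = (L s).comp (L t)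
  L_tendsto : ∀ b : B, Filter.Tendsto (fun t => L t b) (nhdsWithin 0 (Set.Ioi 0)) (nhds b)
  /-- the generator of the semigroup is `X` -/
  generator : ∀ b c : B,
    Filter.Tendsto (fun t : NNReal => ((t : ℝ) : ℂ)⁻¹ • (L t b - b))
      (nhdsWithin 0 (Set.Ioi 0)) (nhds c) ↔ (b, c) ∈ graphX μ V g toDistr
  spectrum_discrete : ∀ a : ℂ, -A < a.re → a ∉ resSet (graphX μ V g toDistr) →
    ∃ m : ℕ, IsIsolatedEigenvalue (graphX μ V g toDistr) a m

/-- `a` is a Ruelle resonance of `X = V + g` of multiplicity `m`. -/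
def IsRuelleResonance (μ : MeasureTheory.Measure M) (V : VField d M) (φ : Flow ℝ M) (g : M → ℂ)
    (a : ℂ) (m : ℕ) : Prop :=
  0 < m ∧ ∃ A : ℝ, 0 < A ∧ -A < a.re ∧
    ∃ (B : Type u) (_ : NormedAddCommGroup B) (_ : NormedSpace ℂ B) (_ : CompleteSpace B)
      (S : AnisotropicSpace μ V φ g A B), IsIsolatedEigenvalue (graphX μ V g S.toDistr) a m

/-- The multiplicity of `a` as a Ruelle resonance (`0` if it is not a resonance). The set below
has at most one element, since resonances do not depend on the choice of the space `B`. -/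
def resMult (μ : MeasureTheory.Measure M) (V : VField d M) (φ : Flow ℝ M) (g : M → ℂ)
    (a : ℂ) : ℕ :=
  sInf {m | IsRuelleResonance μ V φ g a m}

end Resonances

/-! ### Anosov flows and their periodic orbits -/

section Anosov

variable {d : ℕ} {M : Type u} [TopologicalSpace M]
  [ChartedSpace (EuclideanSpace ℝ (Fin (d + 1))) M] [IsManifold (𝓡 (d + 1)) ∞ M]

/-- The flow `φ` generated by `V` is Anosov, with unstable and stable spaces `Eu`, `Es`. -/
structure IsAnosov (V : VField d M) (φ : Flow ℝ M)
    (Eu Es : (x : M) → Submodule ℝ (TangentSpace (𝓡 (d + 1)) x)) : Prop where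
  ne_zero : ∀ x, V x ≠ 0
  isInternal : ∀ x, DirectSum.IsInternal ![Eu x, Es x, Submodule.span ℝ {V x}]
  map_unstable : ∀ (t : ℝ) (x : M),
    (Eu x).map (mfderiv (𝓡 (d + 1)) (𝓡 (d + 1)) (φ t) x).toLinearMap = Eu (φ t x)
  map_stable : ∀ (t : ℝ) (x : M),
    (Es x).map (mfderiv (𝓡 (d + 1)) (𝓡 (d + 1)) (φ t) x).toLinearMap = Es (φ t x)
  hyperbolic : ∃ (m : Bundle.ContMDiffRiemannianMetric (𝓡 (d + 1)) ∞
      (EuclideanSpace ℝ (Fin (d + 1))) (fun x : M => TangentSpace (𝓡 (d + 1)) x)) (C l : ℝ),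
    0 < C ∧ 0 < l ∧ l < 1 ∧ ∀ (t : ℝ), 0 ≤ t → ∀ x : M,
      (∀ v ∈ Es x,
        √(m.inner (φ t x) (mfderiv (𝓡 (d + 1)) (𝓡 (d + 1)) (φ t) x v)
            (mfderiv (𝓡 (d + 1)) (𝓡 (d + 1)) (φ t) x v)) ≤ C * l ^ t * √(m.inner x v v)) ∧
      (∀ v ∈ Eu x,
        √(m.inner (φ (-t) x) (mfderiv (𝓡 (d + 1)) (𝓡 (d + 1)) (φ (-t)) x v)
            (mfderiv (𝓡 (d + 1)) (𝓡 (d + 1)) (φ (-t)) x v)) ≤ C * l ^ t * √(m.inner x v v))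

/-- A periodic orbit: an orbit of the flow together with a period, not necessarily the
smallest one. -/
structure PeriodicOrbit (φ : Flow ℝ M) where
  /-- the image of the orbit -/
  carrier : Set M
  /-- the length `T_γ` -/
  len : ℝ
  len_pos : 0 < len
  isOrbit : ∃ x, carrier = Set.range (fun t : ℝ => φ t x)
  isPeriod : ∀ x ∈ carrier, φ len x = x

namespace PeriodicOrbit

variable {φ : Flow ℝ M} (γ : PeriodicOrbit φ)

/-- The primitive length `T_γ^#`: the smallest length of a periodic orbit with the same image. -/
def primLen : ℝ := sInf {T | ∃ γ' : PeriodicOrbit φ, γ'.carrier = γ.carrier ∧ γ'.len = T}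

theorem carrier_nonempty : γ.carrier.Nonempty := by
  obtain ⟨x, hx⟩ := γ.isOrbit
  rw [hx]
  exact ⟨_, 0, rfl⟩

/-- A point on the orbit. -/
def base : M := γ.carrier_nonempty.some

theorem flow_len_base : φ γ.len γ.base = γ.base :=
  γ.isPeriod _ γ.carrier_nonempty.some_mem

/-- The integral of `g` along the orbit. -/
def integral (g : M → ℂ) : ℂ := ∫ τ in (0 : ℝ)..γ.len, g (φ τ γ.base)

/-- The differential at the base point `x` of the time `T_γ` map of the flow, which is an
endomorphism of the tangent space at `x` as `φ^{T_γ} x = x`. -/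
def monodromy : TangentSpace (𝓡 (d + 1)) γ.base →ₗ[ℝ] TangentSpace (𝓡 (d + 1)) γ.base :=
  (mfderiv (𝓡 (d + 1)) (𝓡 (d + 1)) (φ γ.len) γ.base).toLinearMap

theorem mem_of_mem_map {F : (x : M) → Submodule ℝ (TangentSpace (𝓡 (d + 1)) x)}
    (hF : (F γ.base).map (mfderiv (𝓡 (d + 1)) (𝓡 (d + 1)) (φ γ.len) γ.base).toLinearMap
      = F (φ γ.len γ.base)) :
    F γ.base ≤ (F γ.base).comap γ.monodromy := by
  intro v hv
  have key : ∀ y : M, y = γ.base → ∀ w : EuclideanSpace ℝ (Fin (d + 1)),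
      w ∈ (F y : Submodule ℝ (EuclideanSpace ℝ (Fin (d + 1)))) →
      w ∈ (F γ.base : Submodule ℝ (EuclideanSpace ℝ (Fin (d + 1)))) := by
    rintro _ rfl w hw
    exact hw
  refine key _ γ.flow_len_base _ ?_
  have h := Submodule.mem_map_of_mem
    (f := (mfderiv (𝓡 (d + 1)) (𝓡 (d + 1)) (φ γ.len) γ.base).toLinearMap) hv
  rw [hF] at h
  exact h

variable {V : VField d M} {Eu Es : (x : M) → Submodule ℝ (TangentSpace (𝓡 (d + 1)) x)}

theorem monodromy_mem (h : IsAnosov V φ Eu Es) :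
    ∀ v ∈ Eu γ.base ⊔ Es γ.base, γ.monodromy v ∈ Eu γ.base ⊔ Es γ.base := by
  have hu := γ.mem_of_mem_map (h.map_unstable γ.len γ.base)
  have hs := γ.mem_of_mem_map (h.map_stable γ.len γ.base)
  have : Eu γ.base ⊔ Es γ.base ≤ (Eu γ.base ⊔ Es γ.base).comap γ.monodromy :=
    sup_le (hu.trans (Submodule.comap_mono le_sup_left))
      (hs.trans (Submodule.comap_mono le_sup_right))
  exact fun v hv => this hv

/-- The linearized Poincaré map `𝒫_γ` of `E^u ⊕ E^s`. -/
def poincare (h : IsAnosov V φ Eu Es) :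
    ↥(Eu γ.base ⊔ Es γ.base) →ₗ[ℝ] ↥(Eu γ.base ⊔ Es γ.base) :=
  γ.monodromy.restrict (γ.monodromy_mem h)

/-- `|det (I - 𝒫_γ)|`. -/
def absDet (h : IsAnosov V φ Eu Es) : ℝ := |LinearMap.det (LinearMap.id - γ.poincare h)|

/-- The weight `T_γ^# e^{∫_γ g} / |det (I - 𝒫_γ)|` of the orbit in the trace formula. -/
def weight (h : IsAnosov V φ Eu Es) (g : M → ℂ) : ℂ :=
  γ.primLen * Complex.exp (γ.integral g) / γ.absDet h

/-- The term
`(T_γ^# / T_γ) e^{∫_γ g} e^{-s T_γ} / |det (I - 𝒫_γ)|` of the dynamical determinant. -/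
def detTerm (h : IsAnosov V φ Eu Es) (g : M → ℂ) (s : ℂ) : ℂ :=
  (γ.primLen / γ.len) * Complex.exp (γ.integral g) * Complex.exp (-s * γ.len) / γ.absDet h

end PeriodicOrbit

variable {V : VField d M} {φ : Flow ℝ M}
  {Eu Es : (x : M) → Submodule ℝ (TangentSpace (𝓡 (d + 1)) x)}

/-- `f` is an entire function that extends the dynamical determinant
`d_g(s) = exp (- ∑_γ (T_γ^# / T_γ) e^{∫_γ g} e^{-s T_γ} / |det (I - 𝒫_γ)|)`, which is defined by
an absolutely convergent series when `Re s` is large enough. -/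
def IsEntireExtension (h : IsAnosov V φ Eu Es) (g : M → ℂ) (f : ℂ → ℂ) : Prop :=
  Differentiable ℂ f ∧ ∃ σ : ℝ, ∀ s : ℂ, σ < s.re →
    Summable (fun γ : PeriodicOrbit φ => γ.detTerm h g s) ∧
    f s = Complex.exp (-∑' γ : PeriodicOrbit φ, γ.detTerm h g s)

/-- The open half-line `ℝ_+^*`. -/
def posHalfLine : TopologicalSpace.Opens ℝ := ⟨Set.Ioi 0, isOpen_Ioi⟩

/-- The trace formula: both sides converge, in the sense of distributions on `ℝ_+^*`, to the
same distribution: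
`∑_{resonances} e^{a t} = ∑_γ T_γ^# e^{∫_γ g} / |det (I - 𝒫_γ)| δ_{T_γ}`. -/
def TraceFormula [MeasurableSpace M] (μ : MeasureTheory.Measure M) (h : IsAnosov V φ Eu Es)
    (g : M → ℂ) : Prop :=
  ∃ T : 𝓓'(posHalfLine, ℂ), ∀ χ : 𝓓(posHalfLine, ℝ),
    HasSum (fun a : ℂ => (resMult μ V φ g a : ℂ) *
      ∫ t in Set.Ioi (0 : ℝ), Complex.exp (a * t) * χ t) (T χ) ∧
    HasSum (fun γ : PeriodicOrbit φ => γ.weight h g * χ γ.len) (T χ)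

end Anosov

/-! ### Entire functions -/

section Entire

/-- The order of an entire function:
`limsup_{r → ∞} sup_{|z| = r} log (1 + log_+ |f z|) / log r`. -/
def entireOrder (f : ℂ → ℂ) : EReal :=
  Filter.limsup (fun r : ℝ => ⨆ z ∈ Metric.sphere (0 : ℂ) r,
    ((Real.log (1 + Real.posLog ‖f z‖) / Real.log r : ℝ) : EReal)) Filter.atTop

/-- The Weierstrass primary factor `(1 - w) exp (w + w² / 2 + ⋯ + w^p / p)`. -/
def primaryFactor (p : ℕ) (w : ℂ) : ℂ :=
  (1 - w) * Complex.exp (∑ k ∈ Finset.Icc 1 p, w ^ k / k)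

/-- The smallest `p` such that `∑_{a ≠ 0} |a|^{-(p+1)} < ∞`, each `a` counted `m a` times. -/
def minGenus (m : ℂ → ℕ) : ℕ :=
  sInf {p : ℕ | Summable (fun a : {a : ℂ // a ≠ 0} => (m a : ℝ) / ‖(a : ℂ)‖ ^ (p + 1))}

open Classical in
/-- `Q` is the canonical product of minimal genus with zeros `a`, of multiplicity `m a`:
`Q z = z ^ (m 0) ∏_{a ≠ 0} E_p (z / a) ^ (m a)`. -/
def IsCanonicalProduct (m : ℂ → ℕ) (Q : ℂ → ℂ) : Prop :=
  ∀ z : ℂ, HasProd (fun a : ℂ =>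
    if a = 0 then z ^ m 0 else primaryFactor (minGenus m) (z / a) ^ m a) (Q z)

end Entire

end RuelleTrace

end

open RuelleTrace

/-! The proof has an analytic core, about lengths `T`, weights `w` and a multiplicity function `m`,
and two dynamical inputs that place the Anosov flow under its hypotheses.

Core. Where the series converges, `f = exp (-∑ (w / T) e^{-sT})` satisfies `(f'/f)^{(k)} = (-1)^k ∑
w T^k e^{-sT}`. On the other hand, let `f` be entire with zeros of multiplicities `m`, of growth
below `exp (ε r^{k+1})` for every `ε > 0`, and let `∑ m(a) (s - a)^{-(k+1)}` converge absolutely.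
Then `(f'/f)^{(k)}(s) = (-1)^k k! ∑ m(a) / (s - a)^{k+1}` at every `s` with `f(s) ≠ 0`: this is the
differentiated Hadamard factorization, obtained in `hasSum_iteratedDeriv_logDeriv` by dividing out
the zeros of a large disc and applying Borel-Carathéodory to the quotient. Since `k! / (s -
a)^{k+1}` is the Laplace transform of `t^k e^{at}`, equality of the two sums is the trace formula
tested against `t^k e^{-st}`. Differentiating `k` times is what makes the sum over the zeros
absolutely convergent.

From (i) to (ii): Jensen's inequality bounds the number of zeros in discs, hence the exponent of
convergence (`exists_summable_order`). The identity then holds on a whole vertical line, and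
integrating it against a Schwartz function of the ordinate recovers an arbitrary test function by
Fourier inversion (`traceIdentity_of_tsum_eq`).

From (ii) to (i): `t^k e^{-xt}` is not an admissible test function, so it is truncated and
mollified, and both approximations are removed by dominated convergence (`tsum_pow_mul_exp_eq`).
With `k = ⌈ρ⌉`, the same sum over resonances is the derivative `(Q'/Q)^{(k)}` of the canonical
product `Q`. So `f'/f - Q'/Q` is a polynomial of degree less than `k` on a half-plane and `f = e^P
Q` there with `deg P ≤ k`; the right side is the entire extension. The estimate of `Q` then bounds
the order (`exists_polynomial_of_traceIdentity`).

First input: the series over periodic orbits converges absolutely far to the right. An entire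
extension contains this by definition, but the direction from (ii) to (i) needs a proof. A blow-up
argument shows that an Anosov flow is expansive; hence periodic orbits are separated at a scale
exponentially small in their length, and they are at most exponentially many
(`exists_summable_exp_len`). Hyperbolicity bounds `|det (I - 𝒫_γ)|` below on long orbits
(`exists_absDet_ge`).

Second input: resonances have bounded real part (`exists_re_le_of_resMult_ne_zero`). For smooth `f`
and `ψ` the correlation `⟨𝓛_t f, ψ⟩` is at most a constant times `e^{t sup |g|}`, so its Laplace
transform, which is a matrix coefficient of the resolvent, is holomorphic for `Re z > sup |g|`.
Smooth functions are dense and separate the vectors of the space, so spectral projectors vanish in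
that half-plane. -/

noncomputable section

namespace RuelleTrace

open Filter Topology Metric

set_option linter.unusedSectionVars false

/-! ### Zeros of entire functions: division and Jensen's inequality. -/

section EntireZeros

/-- Division of an entire function by the zero at a given point. -/
theorem exists_entire_div_pow {f : ℂ → ℂ} (hf : Differentiable ℂ f) {a : ℂ} {n : ℕ}
    (hn : analyticOrderAt f a = n) :
    ∃ g : ℂ → ℂ, Differentiable ℂ g ∧ g a ≠ 0 ∧ ∀ z, f z = (z - a) ^ n * g z := by
  obtain ⟨g₀, hg₀, hne, heq⟩ := (hf.analyticAt a).analyticOrderAt_eq_natCast.1 hn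
  classical
  let g : ℂ → ℂ := fun z => if z = a then g₀ a else f z / (z - a) ^ n
  have hga : g =ᶠ[𝓝 a] g₀ := by
    filter_upwards [heq] with z hz
    by_cases h : z = a
    · simp [g, h]
    · have : (z - a) ^ n ≠ 0 := pow_ne_zero _ (sub_ne_zero.2 h)
      simp [g, h, hz, this]
  refine ⟨g, fun z => ?_, by simpa [g] using hne, fun z => ?_⟩
  · by_cases h : z = a
    · rw [h]
      exact (hg₀.differentiableAt).congr_of_eventuallyEq hga
    · have h1 : g =ᶠ[𝓝 z] fun w => f w / (w - a) ^ n := by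
        filter_upwards [isOpen_ne.mem_nhds h] with w hw
        simp only [g]
        rw [if_neg hw]
      refine DifferentiableAt.congr_of_eventuallyEq ?_ h1
      exact (hf z).div (by fun_prop) (pow_ne_zero _ (sub_ne_zero.2 h))
  · by_cases h : z = a
    · have := heq.self_of_nhds
      rw [h, this]
      simp [g]
    · have : (z - a) ^ n ≠ 0 := pow_ne_zero _ (sub_ne_zero.2 h)
      simp [g, h]
      field_simp

/-- Division of an entire function by finitely many of its zeros. -/
theorem exists_entire_div_prod {f : ℂ → ℂ} (hf : Differentiable ℂ f) {m : ℂ → ℕ}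
    (hm : ∀ a, analyticOrderAt f a = m a) (Z : Finset ℂ) :
    ∃ g : ℂ → ℂ, Differentiable ℂ g ∧ (∀ a ∈ Z, g a ≠ 0) ∧
      (∀ a ∉ Z, analyticOrderAt g a = m a) ∧ ∀ z, f z = (∏ a ∈ Z, (z - a) ^ m a) * g z := by
  classical
  induction Z using Finset.induction_on with
  | empty => exact ⟨f, hf, by simp, by simpa using hm, by simp⟩
  | insert b Z hb ih =>
    obtain ⟨g, hg, hgZ, hgo, hfg⟩ := ih
    obtain ⟨h, hh, hhb, hgh⟩ := exists_entire_div_pow hg (hgo b hb)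
    refine ⟨h, hh, ?_, ?_, ?_⟩
    · intro a ha
      rcases Finset.mem_insert.1 ha with rfl | ha
      · exact hhb
      · intro h0
        exact hgZ a ha (by rw [hgh, h0, mul_zero])
    · intro a ha
      rw [Finset.mem_insert, not_or] at ha
      have h1 : g = (fun z => (z - b) ^ m b) * h := funext hgh
      have h2 : AnalyticAt ℂ (fun z => (z - b) ^ m b) a := by fun_prop
      have h3 : analyticOrderAt (fun z => (z - b) ^ m b) a = 0 :=
        h2.analyticOrderAt_eq_zero.2 (pow_ne_zero _ (sub_ne_zero.2 ha.1))
      have h4 := hgo a ha.2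
      rw [h1, analyticOrderAt_mul h2 (hh.analyticAt a), h3, zero_add] at h4
      exact h4
    · intro z
      rw [Finset.prod_insert hb, hfg, hgh]
      ring

/-- The orders are finite, so the function vanishes identically near no point; an accumulation point
of zeros would contradict the principle of isolated zeros. -/
theorem finite_zeros_closedBall {f : ℂ → ℂ} (hf : Differentiable ℂ f) {m : ℂ → ℕ}
    (hm : ∀ a, analyticOrderAt f a = m a) (c : ℂ) (R : ℝ) :
    {a | dist a c ≤ R ∧ m a ≠ 0}.Finite := by
  by_contra hinf
  obtain ⟨x, -, hx⟩ := Set.Infinite.exists_accPt_of_subset_isCompact hinf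
    (isCompact_closedBall c R) (fun a ha => ha.1)
  have hfz : ∀ a, m a ≠ 0 → f a = 0 := by
    intro a ha
    by_contra h0
    have := (hf.analyticAt a).analyticOrderAt_eq_zero.2 h0
    rw [hm a] at this
    exact ha (by exact_mod_cast this)
  rcases (hf.analyticAt x).eventually_eq_zero_or_eventually_ne_zero with h | h
  · have := analyticOrderAt_eq_top.2 h
    rw [hm x] at this
    exact ENat.natCast_ne_top _ this
  · rw [accPt_iff_frequently_nhdsNE] at hx
    obtain ⟨a, ha, ha'⟩ := (hx.and_eventually h).exists
    exact ha' (hfz a ha.2)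

/-- Division by all the zeros in a ball, with control of the quotient. -/
theorem exists_entire_div_ball {f : ℂ → ℂ} (hf : Differentiable ℂ f) {m : ℂ → ℕ}
    (hm : ∀ a, analyticOrderAt f a = m a) {c : ℂ} (hc : f c ≠ 0) {R B : ℝ} (hR : 0 < R)
    (hB : ∀ z ∈ sphere c (3 * R), ‖f z‖ ≤ B) :
    ∃ (Z : Finset ℂ) (G : ℂ → ℂ), (∀ a, a ∈ Z ↔ dist a c ≤ R ∧ m a ≠ 0) ∧ Differentiable ℂ G ∧
      (∀ z ∈ closedBall c R, G z ≠ 0) ∧ G c = f c ∧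
      (∀ z, f z = (∏ a ∈ Z, ((z - a) / (c - a)) ^ m a) * G z) ∧
      ∀ z ∈ closedBall c (3 * R), ‖G z‖ * 2 ^ (∑ a ∈ Z, m a) ≤ B := by
  have hfin := finite_zeros_closedBall hf hm c R
  let Z := hfin.toFinset
  have hZ : ∀ a, a ∈ Z ↔ dist a c ≤ R ∧ m a ≠ 0 := fun a => by simp [Z]
  obtain ⟨g, hg, hgZ, hgo, hfg⟩ := exists_entire_div_prod hf hm Z
  have hcZ : ∀ a ∈ Z, c - a ≠ 0 := by
    intro a ha h0
    have hac : a = c := (sub_eq_zero.1 h0).symm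
    have := (hf.analyticAt c).analyticOrderAt_eq_zero.2 hc
    rw [hm c] at this
    exact ((hZ a).1 ha).2 (by rw [hac]; exact_mod_cast this)
  -- Normalizing every factor to be 1 at the center makes the quotient agree with `f` there.
  let K : ℂ := ∏ a ∈ Z, (c - a) ^ m a
  have hK : K ≠ 0 := Finset.prod_ne_zero_iff.2 fun a ha => pow_ne_zero _ (hcZ a ha)
  let G : ℂ → ℂ := fun z => K * g z
  have hG : Differentiable ℂ G := hg.const_mul K
  have hprod : ∀ z, (∏ a ∈ Z, ((z - a) / (c - a)) ^ m a) = (∏ a ∈ Z, (z - a) ^ m a) / K := by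
    intro z
    simp only [K, div_pow, Finset.prod_div_distrib]
  have hfG : ∀ z, f z = (∏ a ∈ Z, ((z - a) / (c - a)) ^ m a) * G z := by
    intro z
    rw [hprod, hfg]
    simp only [G]
    field_simp
  have hGc : G c = f c := by
    simp only [G]; rw [hfg]
  -- On the sphere `|z - a| ≥ 3R - R = 2R ≥ 2 |c - a|`, so each normalized factor has modulus at
  -- least 2: the quotient gains a power of 2 for each zero.
  have hbd : ∀ z ∈ sphere c (3 * R), ‖G z‖ ≤ B / 2 ^ (∑ a ∈ Z, m a) := by
    intro z hz
    rw [le_div_iff₀ (by positivity), mul_comm]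
    refine le_trans ?_ (hB z hz)
    have hn : ‖f z‖ = (∏ a ∈ Z, ‖((z - a) / (c - a)) ^ m a‖) * ‖G z‖ := by
      conv_lhs => rw [hfG z]
      rw [← norm_prod]
      exact norm_mul _ _
    rw [hn]
    refine mul_le_mul_of_nonneg_right ?_ (norm_nonneg (G z))
    rw [← Finset.prod_pow_eq_pow_sum]
    refine Finset.prod_le_prod (fun _ _ => by positivity) fun a ha => ?_
    rw [norm_pow]
    refine pow_le_pow_left₀ (by norm_num) ?_ _
    have h1 : 0 < ‖c - a‖ := norm_pos_iff.2 (hcZ a ha)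
    rw [norm_div, le_div_iff₀ h1]
    have h2 : ‖c - a‖ ≤ R := by
      have := ((hZ a).1 ha).1
      rwa [dist_comm, dist_eq_norm] at this
    have h3 : ‖z - c‖ = 3 * R := by simpa [dist_eq_norm] using hz
    have h4 : ‖z - c‖ ≤ ‖z - a‖ + ‖c - a‖ := by
      have : z - c = (z - a) - (c - a) := by ring
      rw [this]; exact norm_sub_le _ _
    linarith
  refine ⟨Z, G, hZ, hG, ?_, hGc, hfG, ?_⟩
  · intro z hz
    refine mul_ne_zero hK ?_
    by_cases hzZ : z ∈ Z
    · exact hgZ z hzZ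
    · have h0 : m z = 0 := by
        by_contra h
        exact hzZ ((hZ z).2 ⟨hz, h⟩)
      have := hgo z hzZ
      rw [h0] at this
      exact (hg.analyticAt z).analyticOrderAt_eq_zero.1 (by exact_mod_cast this)
  · intro z hz
    rw [← le_div_iff₀ (by positivity)]
    refine Complex.norm_le_of_forall_mem_frontier_norm_le (U := ball c (3 * R)) isBounded_ball
      hG.diffContOnCl ?_ ?_
    · intro w hw
      rw [frontier_ball c (by positivity)] at hw
      exact hbd w hw
    · rw [closure_ball c (by positivity)]
      exact hz

/-- The number of zeros of an entire function in a ball. -/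
theorem sum_order_le {f : ℂ → ℂ} (hf : Differentiable ℂ f) {m : ℂ → ℕ}
    (hm : ∀ a, analyticOrderAt f a = m a) {c : ℂ} (hc : f c ≠ 0) {R B : ℝ} (hR : 0 < R)
    (hB : ∀ z ∈ sphere c (3 * R), ‖f z‖ ≤ Real.exp B) (S : Finset ℂ)
    (hS : ∀ a ∈ S, dist a c ≤ R) :
    (∑ a ∈ S, (m a : ℝ)) * Real.log 2 ≤ B - Real.log ‖f c‖ := by
  obtain ⟨Z, G, hZ, -, -, hGc, -, hbd⟩ := exists_entire_div_ball hf hm hc hR hB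
  -- Jensen's inequality: at the center the quotient is `f c`, so the gain `2 ^ (number of zeros)`
  -- is bounded by the ratio of the maximum of `f` to `|f c|`.
  have h1 := hbd c (mem_closedBall_self (by positivity))
  rw [hGc] at h1
  have hpos : 0 < ‖f c‖ := norm_pos_iff.2 hc
  have h2 := Real.log_le_log (by positivity) h1
  rw [Real.log_exp, Real.log_mul hpos.ne' (by positivity), Real.log_pow] at h2
  have h3 : ∑ a ∈ S, (m a : ℝ) ≤ ((∑ a ∈ Z, m a : ℕ) : ℝ) := by
    push_cast
    classical
    calc ∑ a ∈ S, (m a : ℝ) = ∑ a ∈ S with m a ≠ 0, (m a : ℝ) := by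
          rw [Finset.sum_filter]
          refine Finset.sum_congr rfl fun a _ => ?_
          by_cases h : m a = 0 <;> simp [h]
      _ ≤ ∑ a ∈ Z, (m a : ℝ) := by
          refine Finset.sum_le_sum_of_subset_of_nonneg ?_ fun _ _ _ => by positivity
          intro a ha
          rw [Finset.mem_filter] at ha
          exact (hZ a).2 ⟨hS a ha.1, ha.2⟩
  have h4 : 0 ≤ Real.log 2 := Real.log_nonneg (by norm_num)
  nlinarith [mul_le_mul_of_nonneg_right h3 h4]

theorem iteratedDeriv_inv_sub (k : ℕ) (a : ℂ) {w : ℂ} (hw : w ≠ a) :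
    iteratedDeriv k (fun z => (z - a)⁻¹) w = (-1) ^ k * k.factorial / (w - a) ^ (k + 1) := by
  induction k generalizing w with
  | zero => simp
  | succ k ih =>
    rw [iteratedDeriv_succ]
    have h1 : iteratedDeriv k (fun z => (z - a)⁻¹) =ᶠ[𝓝 w]
        fun w => (-1) ^ k * k.factorial / (w - a) ^ (k + 1) := by
      filter_upwards [isOpen_ne.mem_nhds hw] with z hz using ih hz
    rw [h1.deriv_eq]
    have h0 : w - a ≠ 0 := sub_ne_zero.2 hw
    have h2 : HasDerivAt (fun w : ℂ => (w - a) ^ (k + 1)) (((k + 1 : ℕ) : ℂ) * (w - a) ^ k * 1) w :=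
      ((hasDerivAt_id w).sub_const a).pow (k + 1)
    have h3 : HasDerivAt (fun w : ℂ => (-1 : ℂ) ^ k * k.factorial / (w - a) ^ (k + 1)) _ w :=
      (hasDerivAt_const w ((-1 : ℂ) ^ k * k.factorial)).div h2 (pow_ne_zero _ h0)
    rw [h3.deriv, Nat.factorial_succ]
    push_cast
    field_simp
    ring

end EntireZeros

/-! ### Logarithmic derivative of a zero-free function. -/

section EntireZeros

/-- A zero-free holomorphic function in a disc whose modulus is controlled: the derivatives of
its logarithmic derivative at the center are controlled. -/
theorem norm_iteratedDeriv_logDeriv_le {G : ℂ → ℂ} (hG : Differentiable ℂ G) {c : ℂ} {R A : ℝ}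
    (hR : 0 < R) (hA : 0 < A) (h0 : ∀ z ∈ ball c R, G z ≠ 0)
    (hbd : ∀ z ∈ ball c R, ‖G z‖ ≤ ‖G c‖ * Real.exp A) (k : ℕ) :
    ‖iteratedDeriv k (logDeriv G) c‖ ≤ (k + 1).factorial * (2 * A) / (R / 2) ^ (k + 1) := by
  have hcb : c ∈ ball c R := mem_ball_self hR
  have hGan : AnalyticOnNhd ℂ G Set.univ := fun z _ => hG.analyticAt z
  have hLD : DifferentiableOn ℂ (logDeriv G) (ball c R) := by
    intro z hz
    exact ((hG.analyticAt z).deriv.differentiableAt.div (hG z) (h0 z hz)).differentiableWithinAt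
  -- A primitive of the logarithmic derivative on the disc, that is, a branch of `log (G / G c)`;
  -- the bound on `|G|` is a bound on its real part.
  obtain ⟨h, hhc, hh⟩ := (hLD.isExactOn_ball).with_val_at c 0
  -- `G = G c * exp h` on the ball
  have hGh : ∀ z ∈ ball c R, G z = G c * Complex.exp (h z) := by
    have key : ∀ z ∈ ball c R, G z * Complex.exp (-h z) = G c * Complex.exp (-h c) := by
      intro z hz
      refine (convex_ball c R).is_const_of_fderivWithin_eq_zero (𝕜 := ℂ)
        (f := fun z => G z * Complex.exp (-h z)) ?_ ?_ hz hcb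
      · intro w hw
        exact ((hG w).mul ((hh w hw).differentiableAt.neg.cexp)).differentiableWithinAt
      · intro w hw
        rw [fderivWithin_of_isOpen isOpen_ball hw]
        have h1 : HasDerivAt (fun z => G z * Complex.exp (-h z))
            (deriv G w * Complex.exp (-h w) + G w * (Complex.exp (-h w) * -logDeriv G w)) w :=
          (hG w).hasDerivAt.mul ((hh w hw).neg.cexp)
        have h2 : deriv G w * Complex.exp (-h w) + G w * (Complex.exp (-h w) * -logDeriv G w)
            = 0 := by
          rw [logDeriv_apply]
          field_simp [h0 w hw]
          ring
        rw [h2] at h1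
        ext
        simpa using h1.deriv
    intro z hz
    have := key z hz
    rw [hhc, neg_zero, Complex.exp_zero, mul_one] at this
    rw [← this, mul_assoc, ← Complex.exp_add]
    simp
  have hre : ∀ z ∈ ball c R, (h z).re ≤ A := by
    intro z hz
    have h1 := hbd z hz
    rw [hGh z hz, norm_mul, Complex.norm_exp] at h1
    have h2 : 0 < ‖G c‖ := norm_pos_iff.2 (h0 c hcb)
    exact Real.exp_le_exp.1 (le_of_mul_le_mul_left h1 h2)
  have hmem : ∀ z : ℂ, z ∈ ball (0 : ℂ) R → c + z ∈ ball c R := by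
    intro z hz; simpa [dist_eq_norm] using hz
  have hbc : ∀ z ∈ closedBall c (R / 2), ‖h z‖ ≤ 2 * A := by
    intro z hz
    have hz' : ‖z - c‖ ≤ R / 2 := by simpa [dist_eq_norm] using hz
    -- Borel-Carathéodory: on the half-radius disc, `2A r / (R - r) ≤ 2A` because `r ≤ R / 2`.
    -- Cauchy's estimates on that disc then conclude.
    have := Complex.borelCaratheodory_zero (M := A) (f := fun w => h (c + w)) (R := R) (z := z - c)
      hA ?_ ?_ hR ?_ ?_
    · simp only [add_sub_cancel] at this
      refine this.trans ?_
      rw [div_le_iff₀ (by linarith)]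
      nlinarith
    · intro w hw
      have := (hh _ (hmem w hw)).differentiableAt
      exact (this.comp w (by fun_prop)).differentiableWithinAt
    · intro w hw
      exact hre _ (hmem w hw)
    · simp only [mem_ball, dist_zero_right]; linarith
    · simpa using hhc
  have hder : iteratedDeriv (k + 1) h c = iteratedDeriv k (logDeriv G) c := by
    rw [iteratedDeriv_succ']
    refine Filter.EventuallyEq.iteratedDeriv_eq k ?_
    filter_upwards [isOpen_ball.mem_nhds hcb] with z hz using (hh z hz).deriv
  rw [← hder]
  refine Complex.norm_iteratedDeriv_le_of_forall_mem_sphere_norm_le (k + 1) (by positivity) ?_ ?_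
  · refine DifferentiableOn.diffContOnCl ?_
    rw [closure_ball c (by positivity)]
    intro z hz
    exact (hh z (closedBall_subset_ball (by linarith) hz)).differentiableAt.differentiableWithinAt
  · intro z hz
    exact hbc z (sphere_subset_closedBall hz)

theorem logDeriv_prod_div_mul {G : ℂ → ℂ} (hG : Differentiable ℂ G) (Z : Finset ℂ) (m : ℂ → ℕ)
    {c : ℂ} (hc : ∀ a ∈ Z, c ≠ a) {z : ℂ} (hz : ∀ a ∈ Z, z ≠ a) (hGz : G z ≠ 0) :
    logDeriv (fun z => (∏ a ∈ Z, ((z - a) / (c - a)) ^ m a) * G z) z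
      = (∑ a ∈ Z, (m a : ℂ) * (z - a)⁻¹) + logDeriv G z := by
  have hne : ∀ a ∈ Z, ((z - a) / (c - a)) ^ m a ≠ 0 := fun a ha =>
    pow_ne_zero _ (div_ne_zero (sub_ne_zero.2 (hz a ha)) (sub_ne_zero.2 (hc a ha)))
  have hd : ∀ a ∈ Z, DifferentiableAt ℂ (fun z => ((z - a) / (c - a)) ^ m a) z := fun a _ => by
    fun_prop
  rw [logDeriv_mul z (Finset.prod_ne_zero_iff.2 hne) hGz
    (DifferentiableAt.fun_finsetProd hd) (hG z)]
  congr 1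
  have := logDeriv_prod (s := Z) (f := fun a z => ((z - a) / (c - a)) ^ m a) (x := z) hne hd
  have e : (fun z => ∏ a ∈ Z, ((z - a) / (c - a)) ^ m a)
      = ∏ a ∈ Z, fun z => ((z - a) / (c - a)) ^ m a := by
    ext w; simp
  rw [e]
  first | rw [this] | (rw [← e, this])
  refine Finset.sum_congr rfl fun a ha => ?_
  have h1 : HasDerivAt (fun z : ℂ => (z - a) / (c - a)) (1 / (c - a)) z :=
    ((hasDerivAt_id z).sub_const a).div_const _
  rw [logDeriv_fun_pow h1.differentiableAt, logDeriv_apply, h1.deriv]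
  have h2 := sub_ne_zero.2 (hz a ha)
  have h3 := sub_ne_zero.2 (hc a ha)
  field_simp

end EntireZeros

/-! ### Sums over the zeros of a function of finite order. -/

section EntireZeros

/-- `‖f‖` grows more slowly than `exp (ε r ^ n)` for every `ε > 0`. -/
def GrowthLT (f : ℂ → ℂ) (n : ℕ) : Prop :=
  ∀ ε : ℝ, 0 < ε → ∃ R₀ : ℝ, ∀ R ≥ R₀, ∀ z : ℂ, ‖z‖ ≤ R → ‖f z‖ ≤ Real.exp (ε * R ^ n)

/-- A truncated form of the differentiated Hadamard formula. Dividing out the zeros of the disc of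
radius `R` contributes exactly the finite sum, and the zero-free quotient contributes an error of
size (growth) / `R ^ (k + 1)`, which tends to 0 when the growth is `o (R ^ (k + 1))`. -/
theorem iteratedDeriv_logDeriv_sub_sum {f : ℂ → ℂ} (hf : Differentiable ℂ f) {m : ℂ → ℕ}
    (hm : ∀ a, analyticOrderAt f a = m a) {c : ℂ} (hc : f c ≠ 0) {R B : ℝ} (hR : 0 < R)
    (hB : ∀ z ∈ sphere c (3 * R), ‖f z‖ ≤ Real.exp B) (k : ℕ) :
    ∃ Z : Finset ℂ, (∀ a, a ∈ Z ↔ dist a c ≤ R ∧ m a ≠ 0) ∧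
      ‖iteratedDeriv k (logDeriv f) c
          - ∑ a ∈ Z, (m a : ℂ) * ((-1) ^ k * k.factorial / (c - a) ^ (k + 1))‖
        ≤ (k + 1).factorial * (2 * (B - Real.log ‖f c‖ + 1)) / (R / 2) ^ (k + 1) := by
  obtain ⟨Z, G, hZ, hG, hG0, hGc, hfG, hbd⟩ := exists_entire_div_ball hf hm hc hR hB
  refine ⟨Z, hZ, ?_⟩
  have hpos : 0 < ‖f c‖ := norm_pos_iff.2 hc
  have hbd' : ∀ z ∈ closedBall c (3 * R), ‖G z‖ ≤ Real.exp B := fun z hz =>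
    le_trans (le_mul_of_one_le_right (norm_nonneg _) (one_le_pow₀ (by norm_num))) (hbd z hz)
  have hBc : Real.log ‖f c‖ ≤ B := by
    have := hbd' c (mem_closedBall_self (by positivity))
    rw [hGc] at this
    simpa using Real.log_le_log hpos this
  have hcZ : ∀ a ∈ Z, c ≠ a := by
    rintro a ha rfl
    have := (hf.analyticAt c).analyticOrderAt_eq_zero.2 hc
    rw [hm c] at this
    exact ((hZ c).1 ha).2 (by exact_mod_cast this)
  -- The summand 1 keeps the bound positive when `B = log |f c|`, as Borel-Carathéodory requires.
  have hmain := norm_iteratedDeriv_logDeriv_le hG (c := c) (R := R)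
    (A := B - Real.log ‖f c‖ + 1) hR (by linarith)
    (fun z hz => hG0 z (ball_subset_closedBall hz)) (fun z hz => by
      rw [hGc]
      refine (hbd' z (ball_subset_closedBall.trans (closedBall_subset_closedBall (by linarith))
        hz)).trans ?_
      calc Real.exp B = ‖f c‖ * Real.exp (B - Real.log ‖f c‖) := by
            rw [Real.exp_sub, Real.exp_log hpos]; field_simp
        _ ≤ _ := by gcongr; linarith) k
  have heq : iteratedDeriv k (logDeriv f) c = iteratedDeriv k
      (fun z => (∑ a ∈ Z, (m a : ℂ) * (z - a)⁻¹) + logDeriv G z) c := by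
    refine Filter.EventuallyEq.iteratedDeriv_eq k ?_
    have h1 : ∀ᶠ z in 𝓝 c, ∀ a ∈ Z, z ≠ a := by
      rw [Filter.eventually_all_finset]
      exact fun a ha => isOpen_ne.mem_nhds (hcZ a ha)
    filter_upwards [h1, isOpen_ball.mem_nhds (mem_ball_self (x := c) hR)] with z hz hz2
    rw [← logDeriv_prod_div_mul hG Z m hcZ hz (hG0 z (ball_subset_closedBall hz2))]
    congr 1
    exact funext hfG
  have hcd : ∀ a ∈ Z, ContDiffAt ℂ k (fun z => (m a : ℂ) * (z - a)⁻¹) c := fun a ha =>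
    contDiffAt_const.mul ((contDiffAt_id.sub contDiffAt_const).inv (sub_ne_zero.2 (hcZ a ha)))
  have hcdG : ContDiffAt ℂ k (logDeriv G) c := by
    have : AnalyticAt ℂ (logDeriv G) c :=
      (hG.analyticAt c).deriv.div (hG.analyticAt c) (by rw [hGc]; exact hc)
    exact this.contDiffAt
  have hsum : iteratedDeriv k (fun z => (∑ a ∈ Z, (m a : ℂ) * (z - a)⁻¹) + logDeriv G z) c
      = (∑ a ∈ Z, (m a : ℂ) * ((-1) ^ k * k.factorial / (c - a) ^ (k + 1)))
        + iteratedDeriv k (logDeriv G) c := by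
    rw [iteratedDeriv_fun_add (ContDiffAt.sum hcd) hcdG, iteratedDeriv_fun_sum hcd]
    congr 1
    refine Finset.sum_congr rfl fun a ha => ?_
    rw [iteratedDeriv_const_mul_field, iteratedDeriv_inv_sub k a (hcZ a ha)]
  rw [heq, hsum, add_sub_cancel_left]
  exact hmain

/-- The derivatives of the logarithmic derivative of an entire function of finite order, as sums
over its zeros. -/
theorem hasSum_iteratedDeriv_logDeriv {f : ℂ → ℂ} (hf : Differentiable ℂ f) {m : ℂ → ℕ}
    (hm : ∀ a, analyticOrderAt f a = m a) {c : ℂ} (hc : f c ≠ 0) {k : ℕ}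
    (hgr : GrowthLT f (k + 1))
    (hs : Summable fun a : ℂ => (m a : ℂ) * ((-1) ^ k * k.factorial / (c - a) ^ (k + 1))) :
    HasSum (fun a : ℂ => (m a : ℂ) * ((-1) ^ k * k.factorial / (c - a) ^ (k + 1)))
      (iteratedDeriv k (logDeriv f) c) := by
  classical
  convert hs.hasSum using 1
  set u : ℂ → ℂ := fun a => (m a : ℂ) * ((-1) ^ k * k.factorial / (c - a) ^ (k + 1)) with hu
  rw [← sub_eq_zero, ← norm_le_zero_iff]
  refine le_of_forall_pos_le_add fun δ hδ => ?_
  obtain ⟨s, hsδ⟩ := (Metric.tendsto_nhds.1 hs.hasSum (δ / 2) (by positivity)).exists_forall_of_atTop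
  set F : ℝ := ((k + 1).factorial : ℝ) with hF
  have hFpos : 0 < F := by positivity
  -- The disc of radius `3R` about `c` lies in that of radius `4R` about 0. Against the denominator
  -- `(R / 2) ^ (k + 1)` this produces the factor `8 ^ (k + 1)`, and `ε` is chosen so that the main
  -- error is `δ / 4`.
  set ε : ℝ := δ / (8 * F * 8 ^ (k + 1)) with hε
  have hεpos : 0 < ε := by positivity
  obtain ⟨R₀, hR₀⟩ := hgr ε hεpos
  set D : ℝ := 2 * F * (|Real.log ‖f c‖| + 1) * 2 ^ (k + 1) with hD
  have htend : Tendsto (fun R : ℝ => D / R ^ (k + 1)) atTop (𝓝 0) :=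
    Tendsto.div_atTop tendsto_const_nhds (tendsto_pow_atTop (by omega))
  obtain ⟨R₁, hR₁⟩ := eventually_atTop.1 (htend.eventually (gt_mem_nhds (show 0 < δ / 4 by positivity)))
  obtain ⟨R₂, hR₂⟩ := (s.finite_toSet.isBounded).subset_closedBall c
  let R : ℝ := max (max (max R₀ R₁) R₂) (max ‖c‖ 1)
  have hRR₀ : R₀ ≤ R := by simp [R]
  have hRR₁ : R₁ ≤ R := by simp [R]
  have hRR₂ : R₂ ≤ R := by simp [R]
  have hRc : ‖c‖ ≤ R := by simp [R]
  have hR1 : 1 ≤ R := by simp [R]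
  have hR : 0 < R := by linarith
  obtain ⟨Z, hZ, hle⟩ := iteratedDeriv_logDeriv_sub_sum hf hm hc hR
    (B := ε * (4 * R) ^ (k + 1)) (fun z hz => by
      refine hR₀ (4 * R) (by linarith) z ?_
      have : ‖z - c‖ = 3 * R := by simpa [dist_eq_norm] using hz
      calc ‖z‖ = ‖(z - c) + c‖ := by ring_nf
        _ ≤ ‖z - c‖ + ‖c‖ := norm_add_le _ _
        _ ≤ 4 * R := by linarith) k
  -- `R` is so large that the disc contains `s`; the points of `s` outside `Z` have multiplicity 0,
  -- so the sum over `Z` is a partial sum containing `s`.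
  have hsum : ∑ a ∈ Z, u a = ∑ a ∈ Z ∪ s, u a := by
    refine Finset.sum_subset Finset.subset_union_left fun a ha haZ => ?_
    have has : a ∈ s := by
      rcases Finset.mem_union.1 ha with h | h
      · exact absurd h haZ
      · exact h
    have : m a = 0 := by
      by_contra h
      exact haZ ((hZ a).2 ⟨le_trans (hR₂ has) hRR₂, h⟩)
    simp [hu, this]
  have h1 : dist (∑ a ∈ Z, u a) (∑' a, u a) < δ / 2 := by
    rw [hsum]; exact hsδ _ Finset.subset_union_right
  rw [dist_eq_norm] at h1
  have h2 : F * (2 * (ε * (4 * R) ^ (k + 1) - Real.log ‖f c‖ + 1)) / (R / 2) ^ (k + 1) ≤ δ / 2 := by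
    have e1 : F * (2 * (ε * (4 * R) ^ (k + 1) - Real.log ‖f c‖ + 1)) / (R / 2) ^ (k + 1)
        ≤ F * (2 * (ε * (4 * R) ^ (k + 1) + (|Real.log ‖f c‖| + 1))) / (R / 2) ^ (k + 1) := by
      refine div_le_div_of_nonneg_right (mul_le_mul_of_nonneg_left ?_ hFpos.le) (by positivity)
      linarith [neg_abs_le (Real.log ‖f c‖)]
    have e2 : F * (2 * (ε * (4 * R) ^ (k + 1) + (|Real.log ‖f c‖| + 1))) / (R / 2) ^ (k + 1)
        = 2 * F * ε * 8 ^ (k + 1) + D / R ^ (k + 1) := by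
      have : (8 : ℝ) ^ (k + 1) = 4 ^ (k + 1) * 2 ^ (k + 1) := by
        rw [← mul_pow]; norm_num
      rw [hD, div_pow, mul_pow, this]
      field_simp
    have e3 : 2 * F * ε * 8 ^ (k + 1) = δ / 4 := by
      rw [hε]; field_simp; norm_num
    have e4 := hR₁ R hRR₁
    linarith
  have h3 : ‖iteratedDeriv k (logDeriv f) c - ∑' a, u a‖ ≤
      ‖iteratedDeriv k (logDeriv f) c - ∑ a ∈ Z, u a‖ + ‖∑ a ∈ Z, u a - ∑' a, u a‖ := by
    have : iteratedDeriv k (logDeriv f) c - ∑' a, u a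
      = (iteratedDeriv k (logDeriv f) c - ∑ a ∈ Z, u a) + (∑ a ∈ Z, u a - ∑' a, u a) := by ring
    rw [this]; exact norm_add_le _ _
  linarith

/-- The zeros of an entire function of finite order have a finite exponent of convergence. -/
theorem exists_summable_order {f : ℂ → ℂ} (hf : Differentiable ℂ f) {m : ℂ → ℕ}
    (hm : ∀ a, analyticOrderAt f a = m a) {c : ℂ} (hc : f c ≠ 0) {K : ℕ}
    (hgr : GrowthLT f K) :
    ∃ q : ℕ, Summable fun a : ℂ => (m a : ℝ) / (1 + ‖a‖ ^ (q : ℝ)) := by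
  obtain ⟨R₀, hR₀⟩ := hgr 1 one_pos
  -- counting in balls
  have hcount : ∃ C : ℝ, 0 ≤ C ∧ ∀ n : ℕ, ∀ S : Finset ℂ, (∀ a ∈ S, ‖a‖ ≤ n) →
      ∑ a ∈ S, (m a : ℝ) ≤ C * ((n : ℝ) + 1) ^ K := by
    -- `E` is such that the disc of radius `E (n + 1)` about `c` contains the points of modulus at
    -- most `n`, and that four times this radius exceeds the threshold `R₀`.
    set E : ℝ := 1 + |R₀| + ‖c‖ with hE
    have hE1 : 1 ≤ E := by
      have := abs_nonneg R₀; have := norm_nonneg c; linarith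
    have hl2 : 0 < Real.log 2 := Real.log_pos (by norm_num)
    refine ⟨((4 * E) ^ K + |Real.log ‖f c‖|) / Real.log 2, by positivity, fun n S hS => ?_⟩
    have hER : 0 < E * (n + 1) := by positivity
    have h1 := sum_order_le hf hm hc (R := E * (n + 1)) (B := 1 * (4 * (E * (n + 1))) ^ K) hER
      (fun z hz => by
        have hEn : E ≤ E * (n + 1) := le_mul_of_one_le_right (by linarith) (by linarith [n.cast_nonneg (α := ℝ)])
        refine hR₀ _ ?_ z ?_
        · have := le_abs_self R₀; have := norm_nonneg c; have := abs_nonneg R₀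
          nlinarith
        · have : ‖z - c‖ = 3 * (E * (n + 1)) := by simpa [dist_eq_norm] using hz
          calc ‖z‖ = ‖(z - c) + c‖ := by ring_nf
            _ ≤ ‖z - c‖ + ‖c‖ := norm_add_le _ _
            _ ≤ 4 * (E * (n + 1)) := by have := abs_nonneg R₀; linarith) S
      (fun a ha => by
        rw [dist_eq_norm]
        have := norm_sub_le a c
        have h2 := hS a ha
        have := abs_nonneg R₀; have := norm_nonneg c
        nlinarith [n.cast_nonneg (α := ℝ)])
    rw [div_mul_eq_mul_div, le_div_iff₀ hl2]
    refine h1.trans ?_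
    have h3 : (1 : ℝ) ≤ ((n : ℝ) + 1) ^ K := one_le_pow₀ (by linarith [n.cast_nonneg (α := ℝ)])
    have h4 := neg_abs_le (Real.log ‖f c‖)
    have h5 := abs_nonneg (Real.log ‖f c‖)
    rw [one_mul, ← mul_assoc, mul_pow, add_mul]
    nlinarith
  obtain ⟨C, hC, hcount⟩ := hcount
  -- With at most `C (n + 1) ^ K` zeros of modulus at most `n`, two more powers leave the convergent
  -- series `∑ C / (n + 1) ^ 2` after grouping the zeros by the integer ceiling of their modulus.
  refine ⟨K + 2, ?_⟩
  have hq : Summable fun n : ℕ => C * (((n : ℝ) + 1) ^ 2)⁻¹ := by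
    refine Summable.mul_left _ ?_
    have := (summable_nat_add_iff 1).2 (Real.summable_nat_pow_inv.2 (show 1 < 2 by norm_num))
    simpa using this
  -- comparison
  refine summable_of_sum_le (c := 3 ^ (K + 2) * ∑' n : ℕ, C * (((n : ℝ) + 1) ^ 2)⁻¹)
    (fun a => by positivity) fun S => ?_
  have hterm : ∀ a : ℂ, (m a : ℝ) / (1 + ‖a‖ ^ ((K + 2 : ℕ) : ℝ)) ≤
      3 ^ (K + 2) * ((m a : ℝ) * (((⌈‖a‖⌉₊ : ℝ) + 1) ^ (K + 2))⁻¹) := by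
    intro a
    rw [Real.rpow_natCast]
    have h1 : ((⌈‖a‖⌉₊ : ℝ) + 1) ^ (K + 2) ≤ 3 ^ (K + 2) * (1 + ‖a‖ ^ (K + 2)) := by
      have h0 : (⌈‖a‖⌉₊ : ℝ) + 1 ≤ ‖a‖ + 2 := by
        linarith [Nat.ceil_lt_add_one (norm_nonneg a)]
      refine (pow_le_pow_left₀ (by positivity) h0 _).trans ?_
      rcases le_total ‖a‖ 1 with h | h
      · refine (pow_le_pow_left₀ (by positivity) (show ‖a‖ + 2 ≤ 3 by linarith) _).trans ?_
        exact le_mul_of_one_le_right (by positivity) (by have := pow_nonneg (norm_nonneg a) (K+2); linarith)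
      · refine (pow_le_pow_left₀ (by positivity) (show ‖a‖ + 2 ≤ 3 * ‖a‖ by linarith) _).trans ?_
        rw [mul_pow]; gcongr; linarith
    rw [div_le_iff₀ (by positivity)]
    have h2 : (1 : ℝ) ≤ (((⌈‖a‖⌉₊ : ℝ) + 1) ^ (K + 2))⁻¹ * (3 ^ (K + 2) * (1 + ‖a‖ ^ (K + 2))) := by
      rw [inv_mul_eq_div, le_div_iff₀ (by positivity), one_mul]; exact h1
    have h3 := mul_le_mul_of_nonneg_left h2 (Nat.cast_nonneg (α := ℝ) (m a))
    linarith
  refine (Finset.sum_le_sum fun a _ => hterm a).trans ?_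
  rw [← Finset.mul_sum]
  refine mul_le_mul_of_nonneg_left ?_ (by positivity)
  classical
  rw [← Finset.sum_fiberwise_of_maps_to (t := S.image fun a => ⌈‖a‖⌉₊)
    (fun a ha => Finset.mem_image_of_mem _ ha)]
  refine le_trans (Finset.sum_le_sum fun n _ => ?_) (hq.sum_le_tsum (S.image fun a => ⌈‖a‖⌉₊) fun n _ => by positivity)
  have h1 : ∑ a ∈ S with ⌈‖a‖⌉₊ = n, (m a : ℝ) * (((⌈‖a‖⌉₊ : ℝ) + 1) ^ (K + 2))⁻¹
      = (∑ a ∈ S with ⌈‖a‖⌉₊ = n, (m a : ℝ)) * (((n : ℝ) + 1) ^ (K + 2))⁻¹ := by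
    rw [Finset.sum_mul]
    refine Finset.sum_congr rfl fun a ha => ?_
    rw [(Finset.mem_filter.1 ha).2]
  rw [h1]
  have h2 := hcount n (S.filter fun a => ⌈‖a‖⌉₊ = n) (fun a ha => by
    rw [← (Finset.mem_filter.1 ha).2]; exact Nat.le_ceil _)
  refine (mul_le_mul_of_nonneg_right h2 (by positivity)).trans (le_of_eq ?_)
  rw [pow_add]
  field_simp

end EntireZeros

/-! ### Weierstrass factors and canonical products. -/

section CanonicalProduct

/-- The exponential in the primary factor cancels the Taylor polynomial of `log (1 - w)`, so the
logarithm of the factor is a Taylor remainder. -/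
theorem exists_exp_eq_primaryFactor (p : ℕ) {w : ℂ} (hw : ‖w‖ ≤ 1 / 2) :
    ∃ l : ℂ, primaryFactor p w = Complex.exp l ∧ ‖l‖ ≤ 2 * ‖w‖ ^ (p + 1) := by
  have hw1 : ‖-w‖ < 1 := by rw [norm_neg]; linarith
  have h1w : 1 - w ≠ 0 := by
    intro h
    have : w = 1 := (sub_eq_zero.1 h).symm
    rw [this] at hw; norm_num at hw
  have hT : Complex.logTaylor (p + 1) (-w) = -∑ k ∈ Finset.Icc 1 p, w ^ k / k := by
    rw [Complex.logTaylor, Finset.range_eq_Ico, Finset.sum_eq_sum_Ico_succ_bot p.succ_pos]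
    simp only [Nat.cast_zero, div_zero, zero_add]
    rw [← Finset.sum_neg_distrib]
    have : Finset.Ico 1 (p + 1) = Finset.Icc 1 p := by ext; simp
    rw [this]
    refine Finset.sum_congr rfl fun k _ => ?_
    rw [neg_pow w k, pow_succ]
    have : (-1 : ℂ) ^ k * (-1) ^ k = 1 := by rw [← mul_pow]; norm_num
    linear_combination (-(w ^ k / k)) * this
  refine ⟨Complex.log (1 + -w) - Complex.logTaylor (p + 1) (-w), ?_, ?_⟩
  · rw [hT, sub_neg_eq_add, Complex.exp_add, ← sub_eq_add_neg, Complex.exp_log h1w, primaryFactor]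
  · refine (Complex.norm_log_sub_logTaylor_le p hw1).trans ?_
    rw [norm_neg]
    have h1 : (1 - ‖w‖)⁻¹ ≤ 2 := by
      rw [inv_le_comm₀ (by linarith) (by norm_num)]; linarith
    have h2 : (0 : ℝ) ≤ ‖w‖ ^ (p + 1) := by positivity
    rw [div_le_iff₀ (by positivity)]
    nlinarith [mul_le_mul_of_nonneg_left h1 h2, p.cast_nonneg (α := ℝ),
      mul_nonneg h2 (p.cast_nonneg (α := ℝ))]

/-- For small `w` this is the remainder estimate. For `‖w‖ ≥ 1/2`, each lower power satisfies `‖w‖ ^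
j ≤ 2 ^ (p + 1) ‖w‖ ^ (p + 1)`, so the crude bound of the factor by an exponential is enough. -/
theorem norm_primaryFactor_le (p : ℕ) (w : ℂ) :
    ‖primaryFactor p w‖ ≤ Real.exp (2 ^ (p + 1) * (p + 1) * ‖w‖ ^ (p + 1)) := by
  rcases le_total ‖w‖ (1 / 2) with hw | hw
  · obtain ⟨l, hl, hle⟩ := exists_exp_eq_primaryFactor p hw
    rw [hl, Complex.norm_exp]
    refine Real.exp_le_exp.2 ((Complex.re_le_norm l).trans (hle.trans ?_))
    refine mul_le_mul_of_nonneg_right ?_ (by positivity)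
    have h1 : (2 : ℝ) ≤ 2 ^ (p + 1) := by
      rw [pow_succ]; linarith [one_le_pow₀ (show (1 : ℝ) ≤ 2 by norm_num) (n := p)]
    have h2 : (0 : ℝ) ≤ p := p.cast_nonneg
    nlinarith
  · have hb : ∀ k ∈ Finset.range (p + 1), ‖w‖ ^ (k + 1) ≤ 2 ^ (p + 1) * ‖w‖ ^ (p + 1) := by
      intro k hk
      rw [Finset.mem_range] at hk
      obtain ⟨j, hj⟩ := Nat.exists_eq_add_of_le (show k + 1 ≤ p + 1 by omega)
      have h1 : 1 ≤ 2 ^ j * ‖w‖ ^ j := by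
        rw [← mul_pow]; exact one_le_pow₀ (by linarith)
      have h2 : (1 : ℝ) ≤ 2 ^ (k + 1) := one_le_pow₀ (by norm_num)
      have h3 : 0 ≤ ‖w‖ ^ (k + 1) := by positivity
      have e : (2 : ℝ) ^ (p + 1) * ‖w‖ ^ (p + 1)
          = 2 ^ (k + 1) * ‖w‖ ^ (k + 1) * (2 ^ j * ‖w‖ ^ j) := by
        rw [hj, pow_add _ (k + 1), pow_add _ (k + 1)]; ring
      rw [e]
      exact (le_mul_of_one_le_left h3 h2).trans (le_mul_of_one_le_right (by positivity) h1)
    have h1 : ‖1 - w‖ ≤ Real.exp ‖w‖ := by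
      refine (norm_sub_le _ _).trans ?_
      rw [norm_one]; linarith [Real.add_one_le_exp ‖w‖]
    have h2 : ‖Complex.exp (∑ k ∈ Finset.Icc 1 p, w ^ k / k)‖
        ≤ Real.exp (∑ k ∈ Finset.Icc 1 p, ‖w‖ ^ k) := by
      rw [Complex.norm_exp]
      refine Real.exp_le_exp.2 ((Complex.re_le_norm _).trans ((norm_sum_le _ _).trans ?_))
      refine Finset.sum_le_sum fun k hk => ?_
      rw [norm_div, norm_pow, Complex.norm_natCast]
      refine div_le_self (by positivity) ?_
      exact_mod_cast (Finset.mem_Icc.1 hk).1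
    rw [primaryFactor, norm_mul]
    refine (mul_le_mul h1 h2 (norm_nonneg _) (Real.exp_nonneg _)).trans ?_
    rw [← Real.exp_add, Real.exp_le_exp]
    have h3 : ∑ k ∈ Finset.Icc 1 p, ‖w‖ ^ k ≤ p * (2 ^ (p + 1) * ‖w‖ ^ (p + 1)) := by
      refine (Finset.sum_le_card_nsmul _ _ (2 ^ (p + 1) * ‖w‖ ^ (p + 1)) fun k hk => ?_).trans ?_
      · obtain ⟨h4, h5⟩ := Finset.mem_Icc.1 hk
        have := hb (k - 1) (by rw [Finset.mem_range]; omega)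
        rwa [Nat.sub_add_cancel h4] at this
      · simp
    have h4 := hb 0 (by simp)
    simp only [zero_add, pow_one] at h4
    linarith

theorem primaryFactor_ne_zero (p : ℕ) {w : ℂ} (hw : w ≠ 1) : primaryFactor p w ≠ 0 :=
  mul_ne_zero (sub_ne_zero.2 hw.symm) (Complex.exp_ne_zero _)

theorem differentiable_primaryFactor (p : ℕ) : Differentiable ℂ (primaryFactor p) := by
  unfold primaryFactor
  fun_prop

open Classical in
/-- The factor of index `a` of the canonical product of genus `p`. -/
def canonicalFactor (m : ℂ → ℕ) (p : ℕ) (a z : ℂ) : ℂ :=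
  if a = 0 then z ^ m 0 else primaryFactor p (z / a) ^ m a

theorem differentiable_canonicalFactor (m : ℂ → ℕ) (p : ℕ) (a : ℂ) :
    Differentiable ℂ (canonicalFactor m p a) := by
  unfold canonicalFactor
  by_cases h : a = 0
  · simp only [h, if_true]; fun_prop
  · simp only [h, if_false]
    exact ((differentiable_primaryFactor p).comp (by fun_prop)).pow _

theorem canonicalFactor_ne_zero (m : ℂ → ℕ) (p : ℕ) {a z : ℂ} (h : a ≠ z) :
    canonicalFactor m p a z ≠ 0 := by
  unfold canonicalFactor
  by_cases h0 : a = 0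
  · rw [if_pos h0]
    exact pow_ne_zero _ (by rw [← h0]; exact h.symm)
  · rw [if_neg h0]
    refine pow_ne_zero _ (primaryFactor_ne_zero p ?_)
    rw [Ne, div_eq_one_iff_eq h0]
    exact h.symm

theorem analyticOrderAt_canonicalFactor (m : ℂ → ℕ) (p : ℕ) (a : ℂ) :
    analyticOrderAt (canonicalFactor m p a) a = m a := by
  rw [((differentiable_canonicalFactor m p a).analyticAt a).analyticOrderAt_eq_natCast]
  by_cases h0 : a = 0
  · refine ⟨fun _ => 1, analyticAt_const, one_ne_zero, Eventually.of_forall fun z => ?_⟩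
    simp [canonicalFactor, h0]
  · refine ⟨fun z => ((-a⁻¹) * Complex.exp (∑ k ∈ Finset.Icc 1 p, (z / a) ^ k / k)) ^ m a, ?_, ?_,
      Eventually.of_forall fun z => ?_⟩
    · exact (Differentiable.analyticAt (by fun_prop) a)
    · exact pow_ne_zero _ (mul_ne_zero (neg_ne_zero.2 (inv_ne_zero h0)) (Complex.exp_ne_zero _))
    · simp only [canonicalFactor, h0, if_false, primaryFactor, smul_eq_mul]
      rw [← mul_pow]
      congr 1
      field_simp
      ring

open Classical in
/-- The summands `m a / ‖a‖ ^ (p + 1)`, extended by zero at the origin. -/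
def genusTerm (m : ℂ → ℕ) (p : ℕ) (a : ℂ) : ℝ := if a = 0 then 0 else (m a : ℝ) / ‖a‖ ^ (p + 1)

theorem genusTerm_nonneg (m : ℂ → ℕ) (p : ℕ) (a : ℂ) : 0 ≤ genusTerm m p a := by
  unfold genusTerm; split_ifs <;> positivity

theorem summable_genusTerm_iff (m : ℂ → ℕ) (p : ℕ) :
    Summable (genusTerm m p) ↔
      Summable (fun a : {a : ℂ // a ≠ 0} => (m a : ℝ) / ‖(a : ℂ)‖ ^ (p + 1)) := by
  rw [← (Subtype.val_injective (p := fun a : ℂ => a ≠ 0)).summable_iff]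
  · refine summable_congr fun a => ?_
    simp [genusTerm, a.2]
  · intro x hx
    have : x = 0 := by
      by_contra h
      exact hx ⟨⟨x, h⟩, rfl⟩
    simp [genusTerm, this]

/-- The smallness condition serves twice: as the multiplicity is at least 1 when it is not 0, it
gives `R / ‖a‖ ≤ 1/2`, so the factor has a logarithm; and it makes the logarithm times the
multiplicity at most 1 in modulus, where `|e^l - 1| ≤ 2 |l|`. -/
theorem norm_canonicalFactor_sub_one_le (m : ℂ → ℕ) (p : ℕ) {a : ℂ} (ha : a ≠ 0) {R : ℝ}
    (hR : 0 < R) (hsmall : genusTerm m p a * R ^ (p + 1) ≤ (1 / 2) ^ (p + 1)) {z : ℂ}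
    (hz : ‖z‖ ≤ R) :
    ‖canonicalFactor m p a z - 1‖ ≤ 4 * R ^ (p + 1) * genusTerm m p a := by
  rw [canonicalFactor, if_neg ha]
  by_cases hm : m a = 0
  · simp [hm, genusTerm]
  have hapos : 0 < ‖a‖ := norm_pos_iff.2 ha
  have hm1 : (1 : ℝ) ≤ m a := by exact_mod_cast Nat.one_le_iff_ne_zero.2 hm
  have hg : genusTerm m p a * R ^ (p + 1) = m a * (R / ‖a‖) ^ (p + 1) := by
    rw [genusTerm, if_neg ha, div_pow]; ring
  have hRa : R / ‖a‖ ≤ 1 / 2 := by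
    refine le_of_pow_le_pow_left₀ (n := p + 1) (by omega) (by norm_num) ?_
    refine le_trans ?_ (hg ▸ hsmall)
    exact le_mul_of_one_le_left (by positivity) hm1
  have hw : ‖z / a‖ ≤ R / ‖a‖ := by rw [norm_div]; gcongr
  obtain ⟨l, hl, hle⟩ := exists_exp_eq_primaryFactor p (hw.trans hRa)
  rw [hl, ← Complex.exp_nat_mul]
  have hb : ‖(m a : ℂ) * l‖ ≤ 2 * (genusTerm m p a * R ^ (p + 1)) := by
    rw [norm_mul, Complex.norm_natCast, hg]
    have := pow_le_pow_left₀ (norm_nonneg _) hw (p + 1)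
    calc (m a : ℝ) * ‖l‖ ≤ m a * (2 * (R / ‖a‖) ^ (p + 1)) := by gcongr; linarith
      _ = _ := by ring
  have h1 : ‖(m a : ℂ) * l‖ ≤ 1 := by
    refine hb.trans ?_
    have : ((1 : ℝ) / 2) ^ (p + 1) ≤ 1 / 2 := by
      rw [pow_succ]
      have := pow_le_one₀ (show (0 : ℝ) ≤ 1 / 2 by norm_num) (by norm_num) (n := p)
      linarith
    linarith
  refine (Complex.norm_exp_sub_one_le h1).trans ?_
  linarith

-- The factors indexed by `T` are left out: `T = ∅` gives the product itself, and `T = {b}` gives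
-- the cofactor of the factor at `b`, which does not vanish at `b` and so reduces the order at `b`
-- to that of a single factor.
open Classical in
theorem canonicalProduct_aux (m : ℂ → ℕ) (p : ℕ) (hs : Summable (genusTerm m p)) (T : Set ℂ) :
    (∀ z, Summable fun a => ‖(if a ∈ T then 1 else canonicalFactor m p a z) - 1‖) ∧
    Differentiable ℂ (fun z => ∏' a, if a ∈ T then 1 else canonicalFactor m p a z) := by
  have hev : ∀ R : ℝ, 0 < R → ∀ᶠ a in cofinite, ∀ z ∈ ball (0 : ℂ) R,
      ‖(if a ∈ T then 1 else canonicalFactor m p a z) - 1‖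
        ≤ 4 * R ^ (p + 1) * genusTerm m p a := by
    intro R hR
    have h1 : Tendsto (fun a => genusTerm m p a * R ^ (p + 1)) cofinite (𝓝 0) := by
      simpa using hs.tendsto_cofinite_zero.mul_const (R ^ (p + 1))
    have h2 : ∀ᶠ a : ℂ in cofinite, a ≠ 0 := by
      simp [Filter.eventually_cofinite]
    filter_upwards [h1.eventually_le_const (show (0 : ℝ) < (1 / 2) ^ (p + 1) by positivity), h2]
      with a ha ha0 z hz
    by_cases haT : a ∈ T
    · simp only [haT, if_true, sub_self, norm_zero]
      have := genusTerm_nonneg m p a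
      positivity
    · simp only [haT, if_false]
      exact norm_canonicalFactor_sub_one_le m p ha0 hR ha (by simpa using (mem_ball.1 hz).le)
  have hd : ∀ a, Differentiable ℂ fun z => if a ∈ T then 1 else canonicalFactor m p a z := by
    intro a
    by_cases haT : a ∈ T
    · simp [haT]
    · simp only [haT, if_false]; exact differentiable_canonicalFactor m p a
  constructor
  · intro z
    have hR : 0 < ‖z‖ + 1 := by positivity
    refine Summable.of_norm_bounded_eventually (hs.mul_left (4 * (‖z‖ + 1) ^ (p + 1))) ?_
    filter_upwards [hev _ hR] with a ha
    rw [norm_norm]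
    exact ha z (by simp)
  · intro z
    have hR : 0 < ‖z‖ + 1 := by positivity
    have hz : z ∈ ball (0 : ℂ) (‖z‖ + 1) := by simp
    have hlu := Summable.hasProdLocallyUniformlyOn_one_add
      (f := fun a z => (if a ∈ T then 1 else canonicalFactor m p a z) - 1) (K := ball (0 : ℂ) (‖z‖ + 1))
      isOpen_ball (hs.mul_left (4 * (‖z‖ + 1) ^ (p + 1))) (hev _ hR)
      (fun a => ((hd a).sub_const 1).continuous.continuousOn)
    simp only [add_sub_cancel] at hlu
    rw [hasProdLocallyUniformlyOn_iff_tendstoLocallyUniformlyOn] at hlu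
    refine (TendstoLocallyUniformlyOn.differentiableOn hlu ?_ isOpen_ball).differentiableAt
      (isOpen_ball.mem_nhds hz)
    refine Eventually.of_forall fun s => ?_
    exact (Differentiable.fun_finsetProd fun a _ => hd a).differentiableOn

/-- The canonical product. -/
def canonicalProduct (m : ℂ → ℕ) (p : ℕ) (z : ℂ) : ℂ := ∏' a, canonicalFactor m p a z

variable {m : ℂ → ℕ} {p : ℕ}

theorem hasProd_canonicalProduct (hs : Summable (genusTerm m p)) (z : ℂ) :
    HasProd (fun a => canonicalFactor m p a z) (canonicalProduct m p z) := by
  have h := (canonicalProduct_aux m p hs ∅).1 z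
  simp only [Set.mem_empty_iff_false, if_false] at h
  have := (multipliable_one_add_of_summable h).hasProd
  simpa [canonicalProduct] using this

theorem differentiable_canonicalProduct (hs : Summable (genusTerm m p)) :
    Differentiable ℂ (canonicalProduct m p) := by
  have h := (canonicalProduct_aux m p hs ∅).2
  simp only [Set.mem_empty_iff_false, if_false] at h
  exact h

theorem analyticOrderAt_canonicalProduct (hs : Summable (genusTerm m p)) (b : ℂ) :
    analyticOrderAt (canonicalProduct m p) b = m b := by
  classical
  obtain ⟨h1, h2⟩ := canonicalProduct_aux m p hs {b}
  have key : ∃ H : ℂ → ℂ, Differentiable ℂ H ∧ H b ≠ 0 ∧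
      canonicalProduct m p = canonicalFactor m p b * H := by
    refine ⟨_, h2, ?_, ?_⟩
    · have := tprod_one_add_ne_zero_of_summable ?_ (h1 b)
      · simpa using this
      · intro a
        by_cases hab : a = b
        · simp [hab]
        · simpa [hab] using canonicalFactor_ne_zero m p hab
    · ext z
      have hmul : Multipliable (Function.update (fun a => canonicalFactor m p a z) b 1) := by
        have := multipliable_one_add_of_summable (h1 z)
        convert this using 1
        ext a
        by_cases hab : a = b
        · simp [hab]
        · simp [hab]
      simp only [canonicalProduct, Pi.mul_apply]
      rw [Multipliable.tprod_eq_mul_tprod_ite' b hmul]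
      congr 1
  obtain ⟨H, hH, h0, hsplit⟩ := key
  rw [hsplit, analyticOrderAt_mul ((differentiable_canonicalFactor m p b).analyticAt b)
    (hH.analyticAt b), analyticOrderAt_canonicalFactor,
    (hH.analyticAt b).analyticOrderAt_eq_zero.2 h0, add_zero]

theorem norm_canonicalProduct_le (hs : Summable (genusTerm m p)) (z : ℂ) :
    ‖canonicalProduct m p z‖ ≤ (1 + ‖z‖) ^ m 0 *
      Real.exp (2 ^ (p + 1) * (p + 1) * (∑' a, genusTerm m p a) * ‖z‖ ^ (p + 1)) := by
  classical
  have h := (hasProd_canonicalProduct hs z).norm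
  refine le_of_tendsto h (Eventually.of_forall fun s => ?_)
  set C : ℝ := 2 ^ (p + 1) * (p + 1) with hC
  have hterm : ∀ a, ‖canonicalFactor m p a z‖ ≤ (if a = 0 then (1 + ‖z‖) ^ m 0 else 1) *
      Real.exp (C * ‖z‖ ^ (p + 1) * genusTerm m p a) := by
    intro a
    by_cases ha : a = 0
    · simp only [canonicalFactor, ha, if_true, genusTerm, mul_zero, Real.exp_zero, mul_one, norm_pow]
      gcongr; linarith
    · simp only [canonicalFactor, ha, if_false, genusTerm, one_mul, norm_pow]
      refine (pow_le_pow_left₀ (norm_nonneg _) (norm_primaryFactor_le p _) _).trans (le_of_eq ?_)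
      rw [← Real.exp_nat_mul, norm_div, div_pow]
      congr 1; ring
  refine (Finset.prod_le_prod (fun _ _ => norm_nonneg _) fun a _ => hterm a).trans ?_
  rw [Finset.prod_mul_distrib, ← Real.exp_sum, ← Finset.mul_sum]
  refine mul_le_mul ?_ ?_ (Real.exp_nonneg _) (by positivity)
  · rw [Finset.prod_ite_eq']
    split_ifs
    · exact le_rfl
    · exact one_le_pow₀ (by linarith [norm_nonneg z])
  · rw [Real.exp_le_exp]
    have := hs.sum_le_tsum s fun a _ => genusTerm_nonneg m p a
    calc C * ‖z‖ ^ (p + 1) * ∑ a ∈ s, genusTerm m p a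
        ≤ C * ‖z‖ ^ (p + 1) * ∑' a, genusTerm m p a := by gcongr
      _ = _ := by ring

end CanonicalProduct

/-! ### Exponent of convergence, genus, growth and order. -/

section Growth

/-- In a ball the nonzero terms of the series are bounded below, while the terms of a summable
family tend to 0. -/
theorem finite_support_closedBall {m : ℂ → ℕ} {ρ : ℝ} (hρ : 0 ≤ ρ)
    (hs : Summable fun a : ℂ => (m a : ℝ) / (1 + ‖a‖ ^ ρ)) (R : ℝ) :
    {a | ‖a‖ ≤ R ∧ m a ≠ 0}.Finite := by
  have h1 := hs.tendsto_cofinite_zero.eventually (gt_mem_nhds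
    (show (0 : ℝ) < 1 / (1 + |R| ^ ρ) by positivity))
  rw [Filter.eventually_cofinite] at h1
  refine h1.subset fun a ha => ?_
  simp only [Set.mem_ofPred_eq, not_lt]
  have h2 : (1 : ℝ) ≤ m a := by exact_mod_cast Nat.one_le_iff_ne_zero.2 ha.2
  have h3 : ‖a‖ ≤ |R| := ha.1.trans (le_abs_self R)
  gcongr

/-- All but finitely many points of the support satisfy `‖c - a‖ ≥ ‖a‖ / 2` and `‖a‖ ≥ 1`, where the
terms compare. The finitely many others are harmless, including `a = c`, as division by 0 gives 0.
-/
theorem summable_div_pow {m : ℂ → ℕ} {ρ : ℝ} (hρ : 0 ≤ ρ)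
    (hs : Summable fun a : ℂ => (m a : ℝ) / (1 + ‖a‖ ^ ρ)) {n : ℕ} (hn : ρ ≤ n) (c : ℂ) :
    Summable fun a : ℂ => (m a : ℝ) / ‖c - a‖ ^ n := by
  refine Summable.of_norm_bounded_eventually (hs.mul_left (2 * 2 ^ n)) ?_
  have hfin := finite_support_closedBall hρ hs (2 * ‖c‖ + 1)
  filter_upwards [hfin.compl_mem_cofinite] with a ha
  rw [Real.norm_of_nonneg (by positivity)]
  by_cases hm : m a = 0
  · simp [hm]
  have h1 : 2 * ‖c‖ + 1 < ‖a‖ := by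
    by_contra h
    exact ha ⟨not_lt.1 h, hm⟩
  have h2 : ‖a‖ / 2 ≤ ‖c - a‖ := by
    have := norm_sub_norm_le a c
    rw [norm_sub_rev] at this
    linarith
  have h3 : 1 ≤ ‖a‖ := by linarith [norm_nonneg c]
  have h4 : 1 + ‖a‖ ^ ρ ≤ 2 * ‖a‖ ^ n := by
    have h5 : ‖a‖ ^ ρ ≤ ‖a‖ ^ n := by
      rw [← Real.rpow_natCast]; exact Real.rpow_le_rpow_of_exponent_le h3 hn
    have h6 : 1 ≤ ‖a‖ ^ n := one_le_pow₀ h3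
    linarith
  have h7 : 1 + ‖a‖ ^ ρ ≤ 2 * 2 ^ n * ‖c - a‖ ^ n := by
    refine h4.trans ?_
    rw [mul_assoc, ← mul_pow]
    gcongr
    linarith
  have h8 : 0 < ‖c - a‖ := by linarith
  rw [← mul_div_assoc, div_le_div_iff₀ (by positivity) (by positivity)]
  calc (m a : ℝ) * (1 + ‖a‖ ^ ρ) ≤ m a * (2 * 2 ^ n * ‖c - a‖ ^ n) := by gcongr
    _ = _ := by ring

theorem summable_genusTerm {m : ℂ → ℕ} {ρ : ℝ} (hρ : 0 ≤ ρ)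
    (hs : Summable fun a : ℂ => (m a : ℝ) / (1 + ‖a‖ ^ ρ)) {p : ℕ} (hp : ρ ≤ (p + 1 : ℕ)) :
    Summable (genusTerm m p) := by
  refine Summable.of_nonneg_of_le (genusTerm_nonneg m p) (fun a => ?_)
    (summable_div_pow hρ hs hp 0)
  unfold genusTerm
  split_ifs
  · positivity
  · simp

/-- `minGenus` is an infimum in `ℕ`, with value 0 by default on the empty set; the exponent `ρ`
shows that the set contains `⌈ρ⌉`, so that the infimum is attained. -/
theorem summable_genusTerm_minGenus {m : ℂ → ℕ} {ρ : ℝ} (hρ : 0 ≤ ρ)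
    (hs : Summable fun a : ℂ => (m a : ℝ) / (1 + ‖a‖ ^ ρ)) :
    Summable (genusTerm m (minGenus m)) := by
  rw [summable_genusTerm_iff]
  refine Nat.sInf_mem (s := {p : ℕ | Summable
    (fun a : {a : ℂ // a ≠ 0} => (m a : ℝ) / ‖(a : ℂ)‖ ^ (p + 1))}) ⟨⌈ρ⌉₊, ?_⟩
  rw [Set.mem_ofPred_eq, ← summable_genusTerm_iff]
  exact summable_genusTerm hρ hs ((Nat.le_ceil ρ).trans (by push_cast; linarith))

theorem minGenus_le {m : ℂ → ℕ} {ρ : ℝ} (hρ : 0 ≤ ρ)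
    (hs : Summable fun a : ℂ => (m a : ℝ) / (1 + ‖a‖ ^ ρ)) {p : ℕ} (hp : ρ ≤ (p + 1 : ℕ)) :
    minGenus m ≤ p := by
  refine Nat.sInf_le ?_
  rw [Set.mem_ofPred_eq, ← summable_genusTerm_iff]
  exact summable_genusTerm hρ hs hp

/-- `‖f z‖` is at most of the size of `exp (C ‖z‖ ^ k)`, up to a polynomial factor. -/
def HasGrowth (f : ℂ → ℂ) (k : ℕ) : Prop :=
  ∃ (C : ℝ) (N : ℕ), 0 ≤ C ∧ ∀ z, ‖f z‖ ≤ Real.exp (C * (1 + ‖z‖ ^ k)) * (1 + ‖z‖) ^ N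

theorem HasGrowth.mul {f g : ℂ → ℂ} {k : ℕ} (hf : HasGrowth f k) (hg : HasGrowth g k) :
    HasGrowth (fun z => f z * g z) k := by
  obtain ⟨C, N, hC, h⟩ := hf
  obtain ⟨C', N', hC', h'⟩ := hg
  refine ⟨C + C', N + N', by positivity, fun z => ?_⟩
  rw [norm_mul, add_mul, Real.exp_add, pow_add]
  calc ‖f z‖ * ‖g z‖ ≤ _ := mul_le_mul (h z) (h' z) (norm_nonneg _) (by positivity)
    _ = _ := by ring

theorem hasGrowth_exp_polynomial (P : Polynomial ℂ) {k : ℕ} (hP : P.natDegree ≤ k) :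
    HasGrowth (fun z => Complex.exp (P.eval z)) k := by
  refine ⟨∑ i ∈ Finset.range (P.natDegree + 1), ‖P.coeff i‖, 0, by positivity, fun z => ?_⟩
  rw [pow_zero, mul_one, Complex.norm_exp]
  refine Real.exp_le_exp.2 ((Complex.re_le_norm _).trans ?_)
  rw [Polynomial.eval_eq_sum_range, Finset.sum_mul]
  refine (norm_sum_le _ _).trans (Finset.sum_le_sum fun i hi => ?_)
  rw [norm_mul, norm_pow]
  refine mul_le_mul_of_nonneg_left ?_ (norm_nonneg _)
  have hi' : i ≤ k := by rw [Finset.mem_range] at hi; omega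
  rcases le_total ‖z‖ 1 with h | h
  · have := pow_le_one₀ (norm_nonneg z) h (n := i)
    have := pow_nonneg (norm_nonneg z) k
    linarith
  · have := pow_le_pow_right₀ h hi'
    linarith

/-- If `ρ > 0`, then `⌈ρ⌉ - 1` is admissible as a genus, so `p + 1 ≤ ⌈ρ⌉` and the standard estimate
of the product suffices. If `ρ = 0`, then `p + 1 = 1` exceeds `⌈ρ⌉`, but there are finitely many
zeros and the product is a polynomial; this case is the reason for the polynomial factor in
`HasGrowth`. -/
theorem hasGrowth_canonicalProduct {m : ℂ → ℕ} {ρ : ℝ} (hρ : 0 ≤ ρ)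
    (hs : Summable fun a : ℂ => (m a : ℝ) / (1 + ‖a‖ ^ ρ)) :
    HasGrowth (canonicalProduct m (minGenus m)) ⌈ρ⌉₊ := by
  classical
  have hg := summable_genusTerm_minGenus hρ hs
  set p := minGenus m with hp
  rcases Nat.eq_zero_or_pos ⌈ρ⌉₊ with h0 | hpos
  · have hρ0 : ρ = 0 := le_antisymm (Nat.ceil_eq_zero.1 h0) hρ
    have hp0 : p = 0 := by
      have := minGenus_le hρ hs (p := 0) (by rw [hρ0]; norm_num)
      omega
    have hfin : {a | m a ≠ 0}.Finite := by
      have h1 := hs.tendsto_cofinite_zero.eventually (gt_mem_nhds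
        (show (0 : ℝ) < 1 / 2 by positivity))
      rw [Filter.eventually_cofinite] at h1
      refine h1.subset fun a ha => ?_
      have h2 : (1 : ℝ) ≤ m a := by exact_mod_cast Nat.one_le_iff_ne_zero.2 ha
      simp only [Set.mem_ofPred_eq, not_lt, hρ0, Real.rpow_zero]
      linarith
    have hprod : ∀ z, canonicalProduct m p z = ∏ a ∈ hfin.toFinset, canonicalFactor m p a z := by
      intro z
      refine tprod_eq_prod fun a ha => ?_
      have hma : m a = 0 := by simpa using ha
      by_cases ha0 : a = 0
      · subst ha0; simp [canonicalFactor, hma]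
      · simp [canonicalFactor, ha0, hma]
    have key : ∀ s : Finset ℂ, HasGrowth (fun z => ∏ a ∈ s, canonicalFactor m p a z) 0 := by
      intro s
      induction s using Finset.induction_on with
      | empty => exact ⟨0, 0, le_rfl, by simp⟩
      | insert b s hb ih =>
        simp only [Finset.prod_insert hb]
        refine HasGrowth.mul ?_ ih
        by_cases hb0 : b = 0
        · refine ⟨0, m 0, le_rfl, fun z => ?_⟩
          simp only [canonicalFactor, hb0, if_true, norm_pow, zero_mul, Real.exp_zero, one_mul]
          gcongr; linarith
        · have hbpos : 0 < ‖b‖ := norm_pos_iff.2 hb0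
          refine ⟨m b * ‖b‖⁻¹, m b, by positivity, fun z => ?_⟩
          simp only [canonicalFactor, hb0, if_false, norm_pow, hp0, primaryFactor]
          simp only [Finset.Icc_eq_empty_of_lt one_pos, Finset.sum_empty, Complex.exp_zero, mul_one,
            pow_zero]
          rw [show (m b : ℝ) * ‖b‖⁻¹ * (1 + 1) = m b * (‖b‖⁻¹ * 2) by ring, Real.exp_nat_mul,
            ← mul_pow]
          refine pow_le_pow_left₀ (norm_nonneg _) ?_ _
          refine (norm_sub_le _ _).trans ?_
          rw [norm_one, norm_div, div_eq_mul_inv]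
          have h1 := Real.add_one_le_exp (‖b‖⁻¹ * 2)
          have h2 : 0 < ‖b‖⁻¹ := by positivity
          nlinarith [norm_nonneg z, mul_nonneg (norm_nonneg z) h2.le,
            mul_le_mul_of_nonneg_right h1 (show 0 ≤ 1 + ‖z‖ by positivity)]
    rw [h0]
    have := key hfin.toFinset
    exact (funext hprod : canonicalProduct m p = _) ▸ this
  · have hpk : p + 1 ≤ ⌈ρ⌉₊ := by
      have := minGenus_le hρ hs (p := ⌈ρ⌉₊ - 1) (by
        rw [Nat.sub_add_cancel hpos]; exact Nat.le_ceil ρ)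
      omega
    have htn : 0 ≤ ∑' a, genusTerm m p a := tsum_nonneg (genusTerm_nonneg m p)
    refine ⟨2 ^ (p + 1) * (p + 1) * (∑' a, genusTerm m p a), m 0, by positivity, fun z => ?_⟩
    refine (norm_canonicalProduct_le hg z).trans ?_
    rw [mul_comm]
    refine mul_le_mul_of_nonneg_right (Real.exp_le_exp.2 ?_) (by positivity)
    refine mul_le_mul_of_nonneg_left ?_ (by positivity)
    rcases le_total ‖z‖ 1 with h | h
    · have := pow_le_one₀ (norm_nonneg z) h (n := p + 1)
      have := pow_nonneg (norm_nonneg z) ⌈ρ⌉₊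
      linarith
    · have := pow_le_pow_right₀ h hpk
      linarith

/-- A bound of the form `exp (D r ^ k (1 + log r))`. -/
theorem HasGrowth.exists_log_bound {f : ℂ → ℂ} {k : ℕ} (hf : HasGrowth f k) :
    ∃ D : ℝ, 0 < D ∧ ∀ r : ℝ, 1 ≤ r → ∀ z : ℂ, ‖z‖ ≤ r →
      ‖f z‖ ≤ Real.exp (D * (r ^ k * (1 + Real.log r))) := by
  obtain ⟨C, N, hC, h⟩ := hf
  refine ⟨2 * C + 2 * N + 1, by positivity, fun r hr z hz => ?_⟩
  have hN : (1 + ‖z‖) ^ N ≤ Real.exp (N * (1 + Real.log r)) := by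
    rw [Real.exp_nat_mul]
    refine pow_le_pow_left₀ (by positivity) ?_ _
    rw [Real.exp_add, Real.exp_log (by linarith)]
    nlinarith [Real.add_one_le_exp (1 : ℝ)]
  have hrk : 1 ≤ r ^ k := one_le_pow₀ hr
  have hl : 0 ≤ Real.log r := Real.log_nonneg hr
  have hzk : ‖z‖ ^ k ≤ r ^ k := by gcongr
  have hb : ‖f z‖ ≤ Real.exp (2 * C * r ^ k + N * (1 + Real.log r)) := by
    refine (h z).trans ?_
    rw [Real.exp_add]
    refine mul_le_mul (Real.exp_le_exp.2 ?_) hN (by positivity) (Real.exp_nonneg _)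
    nlinarith
  have hN0 : (0 : ℝ) ≤ N := N.cast_nonneg
  have hrkl : 0 ≤ r ^ k * Real.log r := by positivity
  refine hb.trans (Real.exp_le_exp.2 ?_)
  have e1 : C * r ^ k ≤ C * (r ^ k * (1 + Real.log r)) := by gcongr; nlinarith
  have e2 : N * (1 + Real.log r) ≤ N * (r ^ k * (1 + Real.log r)) := by
    gcongr; nlinarith
  have e3 : 0 ≤ r ^ k * (1 + Real.log r) := by positivity
  nlinarith [mul_nonneg hN0 e3]

/-- One more power of `r` absorbs the constant and the logarithm, as `(1 + log r) / r` tends to 0.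
-/
theorem HasGrowth.growthLT {f : ℂ → ℂ} {k : ℕ} (hf : HasGrowth f k) : GrowthLT f (k + 1) := by
  obtain ⟨D, hD, h⟩ := hf.exists_log_bound
  intro ε hε
  have h1 : Tendsto (fun r : ℝ => D * (1 / r + Real.log r / r)) atTop (𝓝 0) := by
    have e1 : Tendsto (fun r : ℝ => 1 / r) atTop (𝓝 0) := by
      simpa using tendsto_inv_atTop_zero (𝕜 := ℝ)
    have e2 : Tendsto (fun r : ℝ => Real.log r / r) atTop (𝓝 0) := by
      simpa using Real.isLittleO_log_id_atTop.tendsto_div_nhds_zero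
    simpa using (e1.add e2).const_mul D
  obtain ⟨R₀, hR₀⟩ := eventually_atTop.1 (h1.eventually (gt_mem_nhds hε))
  refine ⟨max R₀ 1, fun R hR z hz => ?_⟩
  have hR1 : 1 ≤ R := le_trans (le_max_right _ _) hR
  refine (h R hR1 z hz).trans (Real.exp_le_exp.2 ?_)
  have h2 := hR₀ R (le_trans (le_max_left _ _) hR)
  have h3 : D * (R ^ k * (1 + Real.log R)) = D * (1 / R + Real.log R / R) * R ^ (k + 1) := by
    have : R ≠ 0 := by positivity
    rw [pow_succ]
    field_simp
  rw [h3]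
  gcongr

theorem entireOrder_le {f : ℂ → ℂ} {k : ℝ}
    (h : ∀ ε : ℝ, 0 < ε → ∀ᶠ r : ℝ in atTop, ∀ z ∈ sphere (0 : ℂ) r,
      Real.log (1 + Real.posLog ‖f z‖) / Real.log r ≤ k + ε) :
    entireOrder f ≤ (k : EReal) := by
  refine EReal.le_of_forall_lt_iff_le.1 fun x hx => ?_
  have hx' : 0 < x - k := by
    have := EReal.coe_lt_coe_iff.1 hx; linarith
  refine Filter.limsup_le_of_le ?_ ?_
  · exact isCobounded_le_of_bot
  · filter_upwards [h _ hx'] with r hr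
    refine iSup₂_le fun z hz => EReal.coe_le_coe_iff.2 ?_
    have := hr z hz
    linarith

/-- The iterated logarithm is at most `k log r` plus terms of size `O (log log r)` and `O (1)`,
which disappear after division by `log r`. -/
theorem HasGrowth.entireOrder_le {f : ℂ → ℂ} {k : ℕ} (hf : HasGrowth f k) :
    entireOrder f ≤ ((k : ℝ) : EReal) := by
  obtain ⟨D, hD, h⟩ := hf.exists_log_bound
  refine RuelleTrace.entireOrder_le fun ε hε => ?_
  have e1 : Tendsto (fun r : ℝ => Real.log (1 + D) / Real.log r) atTop (𝓝 0) :=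
    tendsto_const_nhds.div_atTop Real.tendsto_log_atTop
  have e2 : Tendsto (fun r : ℝ => Real.log (2 * Real.log r) / Real.log r) atTop (𝓝 0) := by
    have a1 : Tendsto (fun x : ℝ => Real.log (2 * x) / x) atTop (𝓝 0) := by
      have b1 : Tendsto (fun x : ℝ => Real.log 2 / x + Real.log x / x) atTop (𝓝 0) := by
        have c1 : Tendsto (fun x : ℝ => Real.log 2 / x) atTop (𝓝 0) :=
          tendsto_const_nhds.div_atTop tendsto_id
        have c2 : Tendsto (fun r : ℝ => Real.log r / r) atTop (𝓝 0) := by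
          simpa using Real.isLittleO_log_id_atTop.tendsto_div_nhds_zero
        simpa using c1.add c2
      refine b1.congr' ?_
      filter_upwards [eventually_gt_atTop 0] with x hx
      rw [Real.log_mul (by norm_num) hx.ne', add_div]
    exact a1.comp Real.tendsto_log_atTop
  have e3 := (e1.add e2).eventually (gt_mem_nhds (show (0 : ℝ) + 0 < ε by simpa using hε))
  filter_upwards [e3, eventually_ge_atTop (Real.exp 1)] with r hr hr1 z hz
  have hlog1 : 1 ≤ Real.log r := by
    rw [Real.le_log_iff_exp_le (lt_of_lt_of_le (Real.exp_pos 1) hr1)]; exact hr1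
  have hrge : 1 ≤ r := le_trans (Real.one_le_exp zero_le_one) hr1
  have hz' : ‖z‖ ≤ r := by simpa using (mem_sphere.1 hz).le
  have hb := h r hrge z hz'
  have hrk : 1 ≤ r ^ k := one_le_pow₀ hrge
  have hE0 : 0 ≤ D * (r ^ k * (1 + Real.log r)) := by positivity
  have hpl : Real.posLog ‖f z‖ ≤ D * (r ^ k * (1 + Real.log r)) := by
    rw [Real.posLog_def]
    refine max_le hE0 ?_
    rcases eq_or_lt_of_le (norm_nonneg (f z)) with h0 | h0
    · rw [← h0]; simpa using hE0
    · exact (Real.log_le_iff_le_exp h0).2 hb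
  have hle : 1 + Real.posLog ‖f z‖ ≤ (1 + D) * (r ^ k * (2 * Real.log r)) := by
    have e1 : r ^ k * (1 + Real.log r) ≤ r ^ k * (2 * Real.log r) := by gcongr; linarith
    have e2 : 1 ≤ r ^ k * (2 * Real.log r) := by nlinarith
    nlinarith
  have hlog : Real.log (1 + Real.posLog ‖f z‖)
      ≤ Real.log (1 + D) + (k * Real.log r + Real.log (2 * Real.log r)) := by
    refine (Real.log_le_log (by linarith [Real.posLog_nonneg (x := ‖f z‖)]) hle).trans (le_of_eq ?_)
    rw [Real.log_mul (by positivity) (by positivity), Real.log_mul (by positivity) (by positivity),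
      Real.log_pow]
  rw [div_le_iff₀ (by linarith)]
  rw [← add_div, div_lt_iff₀ (by linarith)] at hr
  nlinarith

/-- Entire functions of finite order grow at most like the exponential of a power. -/
theorem exists_growthLT_of_entireOrder_lt_top {f : ℂ → ℂ} (hf : Differentiable ℂ f)
    (h : entireOrder f < ⊤) : ∃ K : ℕ, GrowthLT f K := by
  obtain ⟨x, hx1, -⟩ := EReal.lt_iff_exists_real_btwn.1 h
  have hev := Filter.eventually_lt_of_limsup_lt hx1
  obtain ⟨R₀, hR₀⟩ := eventually_atTop.1 hev
  obtain ⟨K, hK⟩ := exists_nat_ge (max x 0)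
  have hb : ∀ r : ℝ, max R₀ 2 ≤ r → ∀ z ∈ sphere (0 : ℂ) r, ‖f z‖ ≤ Real.exp (r ^ K) := by
    intro r hr z hz
    have hr2 : 2 ≤ r := le_trans (le_max_right _ _) hr
    have h1 := hR₀ r (le_trans (le_max_left _ _) hr)
    have h2 : ((Real.log (1 + Real.posLog ‖f z‖) / Real.log r : ℝ) : EReal) ≤ x :=
      le_trans (le_iSup₂ (f := fun (z : ℂ) (_ : z ∈ sphere (0 : ℂ) r) =>
        ((Real.log (1 + Real.posLog ‖f z‖) / Real.log r : ℝ) : EReal)) z hz) h1.le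
    have h3 := EReal.coe_le_coe_iff.1 h2
    have hlr : 0 < Real.log r := Real.log_pos (by linarith)
    have h4 : Real.log (1 + Real.posLog ‖f z‖) ≤ K * Real.log r := by
      rw [div_le_iff₀ hlr] at h3
      refine h3.trans ?_
      gcongr
      exact le_trans (le_max_left _ _) hK
    have h5 : 1 + Real.posLog ‖f z‖ ≤ r ^ K := by
      have hp : 0 < 1 + Real.posLog ‖f z‖ := by linarith [Real.posLog_nonneg (x := ‖f z‖)]
      rw [← Real.log_pow] at h4
      exact (Real.log_le_log_iff hp (by positivity)).1 h4
    rcases eq_or_lt_of_le (norm_nonneg (f z)) with h0 | h0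
    · rw [← h0]; positivity
    · rw [← Real.log_le_iff_le_exp h0]
      have : Real.log ‖f z‖ ≤ Real.posLog ‖f z‖ := le_max_right _ _
      linarith
  -- The order gives `exp (R ^ K)` on large circles, and on discs by the maximum principle; the
  -- extra power yields `R ^ K ≤ ε R ^ (K + 1)` once `R ≥ 1 / ε`.
  refine ⟨K + 1, fun ε hε => ⟨max (max R₀ 2) ε⁻¹, fun R hR z hz => ?_⟩⟩
  have hR1 : max R₀ 2 ≤ R := le_trans (le_max_left _ _) hR
  have hR2 : ε⁻¹ ≤ R := le_trans (le_max_right _ _) hR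
  have hRpos : 0 < R := lt_of_lt_of_le (by positivity) hR2
  have h1 : ‖f z‖ ≤ Real.exp (R ^ K) := by
    refine Complex.norm_le_of_forall_mem_frontier_norm_le (U := ball 0 R) isBounded_ball
      hf.diffContOnCl ?_ ?_
    · intro w hw
      rw [frontier_ball 0 hRpos.ne'] at hw
      exact hb R hR1 w hw
    · rw [closure_ball 0 hRpos.ne']
      simpa using hz
  refine h1.trans (Real.exp_le_exp.2 ?_)
  rw [pow_succ, mul_comm, mul_assoc]
  refine le_mul_of_one_le_right (by positivity) ?_
  rw [inv_le_iff_one_le_mul₀ hε] at hR2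
  linarith

end Growth

/-! ### Laplace transforms and Dirichlet series. -/

section Laplace

open MeasureTheory Set

theorem integrableOn_pow_mul_exp (k : ℕ) {x : ℝ} (hx : 0 < x) :
    IntegrableOn (fun t : ℝ => t ^ k * Real.exp (-x * t)) (Ioi 0) := by
  have := integrableOn_rpow_mul_exp_neg_mul_rpow (p := 1) (s := k) (b := x)
    (by linarith [k.cast_nonneg (α := ℝ)]) one_pos hx
  simpa using this

theorem norm_pow_mul_exp (k : ℕ) (z : ℂ) {t : ℝ} (ht : 0 ≤ t) :
    ‖(t : ℂ) ^ k * Complex.exp (-z * t)‖ = t ^ k * Real.exp (-z.re * t) := by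
  rw [norm_mul, norm_pow, Complex.norm_exp, Complex.norm_real, Real.norm_of_nonneg ht]
  simp

theorem integrableOn_pow_mul_cexp (k : ℕ) {z : ℂ} (hz : 0 < z.re) :
    IntegrableOn (fun t : ℝ => (t : ℂ) ^ k * Complex.exp (-z * t)) (Ioi 0) := by
  refine Integrable.mono' (integrableOn_pow_mul_exp k hz) ?_ ?_
  · exact (by fun_prop : Continuous fun t : ℝ => (t : ℂ) ^ k * Complex.exp (-z * t)).aestronglyMeasurable
  · rw [ae_restrict_iff' measurableSet_Ioi]
    exact Eventually.of_forall fun t ht => (norm_pow_mul_exp k z (le_of_lt ht)).le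

theorem tendsto_pow_mul_cexp (k : ℕ) {z : ℂ} (hz : 0 < z.re) :
    Tendsto (fun t : ℝ => (t : ℂ) ^ k * Complex.exp (-z * t)) atTop (𝓝 0) := by
  rw [tendsto_zero_iff_norm_tendsto_zero]
  have h := tendsto_rpow_mul_exp_neg_mul_atTop_nhds_zero k z.re hz
  refine h.congr' ?_
  filter_upwards [eventually_ge_atTop 0] with t ht
  rw [norm_pow_mul_exp k z ht, Real.rpow_natCast]

theorem integral_pow_mul_exp (k : ℕ) {z : ℂ} (hz : 0 < z.re) :
    ∫ t in Ioi (0 : ℝ), (t : ℂ) ^ k * Complex.exp (-z * t) = k.factorial / z ^ (k + 1) := by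
  have hz0 : z ≠ 0 := by
    rintro rfl; simp at hz
  have hd0 : ∀ t : ℝ, HasDerivAt (fun t : ℝ => Complex.exp (-z * t)) (-z * Complex.exp (-z * t)) t := by
    intro t
    have h1 : HasDerivAt (fun t : ℝ => -z * (t : ℂ)) (-z * 1) t :=
      (Complex.ofRealCLM.hasDerivAt).const_mul _
    simpa [mul_comm] using h1.cexp
  induction k with
  | zero =>
    have h := integral_Ioi_of_hasDerivAt_of_tendsto
      (f := fun t : ℝ => Complex.exp (-z * t)) (f' := fun t : ℝ => -z * Complex.exp (-z * t))
      (a := 0) (m := 0) (hd0 0).continuousAt.continuousWithinAt (fun t _ => hd0 t) ?_ ?_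
    · rw [integral_const_mul] at h
      simp only [Complex.ofReal_zero, mul_zero, Complex.exp_zero, zero_sub] at h
      simp only [pow_zero, one_mul, Nat.factorial_zero, Nat.cast_one, zero_add, pow_one]
      rw [eq_div_iff hz0]
      linear_combination -h
    · have := (integrableOn_pow_mul_cexp 0 hz).const_mul (-z)
      simp only [pow_zero, one_mul] at this
      exact this
    · simpa using tendsto_pow_mul_cexp 0 hz
  | succ k ih =>
    have hd : ∀ t : ℝ, HasDerivAt (fun t : ℝ => (t : ℂ) ^ (k + 1) * Complex.exp (-z * t))
        ((k + 1 : ℕ) * ((t : ℂ) ^ k * Complex.exp (-z * t))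
          + (-z) * ((t : ℂ) ^ (k + 1) * Complex.exp (-z * t))) t := by
      intro t
      have h1 : HasDerivAt (fun t : ℝ => (t : ℂ) ^ (k + 1)) (((k + 1 : ℕ) : ℂ) * (t : ℂ) ^ k * 1) t :=
        (Complex.ofRealCLM.hasDerivAt (x := t)).pow (k + 1)
      refine (h1.mul (hd0 t)).congr_deriv ?_
      ring
    have i1 := (integrableOn_pow_mul_cexp k hz).const_mul ((k + 1 : ℕ) : ℂ)
    have i2 := (integrableOn_pow_mul_cexp (k + 1) hz).const_mul (-z)
    have h := integral_Ioi_of_hasDerivAt_of_tendsto (a := 0) (m := 0)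
      (hd 0).continuousAt.continuousWithinAt (fun t _ => hd t) (i1.add i2)
      (tendsto_pow_mul_cexp (k + 1) hz)
    rw [integral_add i1 i2, integral_const_mul, integral_const_mul, ih] at h
    simp only [Complex.ofReal_zero, ne_eq, Nat.add_eq_zero_iff, one_ne_zero, and_false,
      not_false_eq_true, zero_pow, zero_mul, sub_zero] at h
    have h' : z * ∫ t in Ioi (0 : ℝ), (t : ℂ) ^ (k + 1) * Complex.exp (-z * t)
        = (k + 1 : ℕ) * (k.factorial / z ^ (k + 1)) := by linear_combination -h
    rw [eq_div_iff (pow_ne_zero _ hz0), pow_succ z (k + 1), mul_comm (z ^ (k + 1)), ← mul_assoc,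
      mul_comm _ z, h', Nat.factorial_succ]
    push_cast
    field_simp

theorem pow_mul_exp_le (k : ℕ) {δ t : ℝ} (hδ : 0 < δ) (ht : 0 ≤ t) :
    t ^ k * Real.exp (-δ * t) ≤ k.factorial / δ ^ k := by
  have h := Real.pow_div_factorial_le_exp (δ * t) (by positivity) k
  rw [neg_mul, Real.exp_neg, ← div_eq_mul_inv, div_le_div_iff₀ (Real.exp_pos _) (by positivity)]
  rw [div_le_iff₀ (by positivity), mul_pow] at h
  linarith

/-- Termwise integration of a series with countably many nonzero terms. -/
theorem hasSum_integral_of_summable {α ι : Type*} [MeasurableSpace α] {μ : Measure α}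
    {F : ι → α → ℂ} {S : Set ι} (hS : S.Countable) (h0 : ∀ i ∉ S, F i = 0)
    (hF : ∀ i, Integrable (F i) μ) {b : ι → ℝ} (hb : Summable b)
    (hFb : ∀ i, ∫ a, ‖F i a‖ ∂μ ≤ b i) :
    HasSum (fun i => ∫ a, F i a ∂μ) (∫ a, ∑' i, F i a ∂μ) := by
  have : Countable S := hS
  have hs : Summable fun i : S => ∫ a, ‖F i a‖ ∂μ :=
    Summable.of_nonneg_of_le (fun i => integral_nonneg fun a => norm_nonneg _)
      (fun i => hFb i) (hb.comp_injective Subtype.val_injective)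
  have h := hasSum_integral_of_summable_integral_norm (F := fun i : S => F i) (fun i => hF i) hs
  have e1 : ∀ a, ∑' i : S, F i a = ∑' i, F i a := by
    intro a
    refine tsum_subtype_eq_of_support_subset (f := fun i => F i a) fun i hi => ?_
    by_contra hiS
    exact hi (by simp [h0 i hiS])
  simp only [e1] at h
  refine (hasSum_subtype_iff_of_support_subset (f := fun i => ∫ a, F i a ∂μ) fun i hi => ?_).1 h
  by_contra hiS
  exact hi (by simp [h0 i hiS])

variable {Γ : Type*} {T : Γ → ℝ} {w : Γ → ℂ} {σ : ℝ}

/-- The term `(w / T) (-T) ^ j e^{-s T}`. -/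
def dirTerm (T : Γ → ℝ) (w : Γ → ℂ) (j : ℕ) (s : ℂ) (γ : Γ) : ℂ :=
  w γ / T γ * (-T γ) ^ j * Complex.exp (-s * T γ)

theorem norm_dirTerm (hT : ∀ γ, 0 < T γ) (j : ℕ) (s : ℂ) (γ : Γ) :
    ‖dirTerm T w j s γ‖ = ‖w γ‖ / T γ * T γ ^ j * Real.exp (-s.re * T γ) := by
  rw [dirTerm, norm_mul, norm_mul, norm_div, norm_pow, norm_neg, Complex.norm_real,
    Real.norm_of_nonneg (hT γ).le, Complex.norm_exp]
  simp

/-- The powers of `T` produced by differentiation are absorbed by the gap between `σ` and `σ'`, so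
that a single convergent series dominates all derivatives on `Re s ≥ σ'`. -/
theorem norm_dirTerm_le (hT : ∀ γ, 0 < T γ) (j : ℕ) {σ' : ℝ} (hσ : σ < σ') {s : ℂ}
    (hs : σ' ≤ s.re) (γ : Γ) : ‖dirTerm T w j s γ‖ ≤
      j.factorial / (σ' - σ) ^ j * (‖w γ‖ / T γ * Real.exp (-σ * T γ)) := by
  have hTγ := hT γ
  rw [norm_dirTerm hT]
  have h1 : Real.exp (-s.re * T γ) ≤ Real.exp (-(σ' - σ) * T γ) * Real.exp (-σ * T γ) := by
    rw [← Real.exp_add, Real.exp_le_exp]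
    nlinarith
  have h2 := pow_mul_exp_le j (show 0 < σ' - σ by linarith) hTγ.le
  calc ‖w γ‖ / T γ * T γ ^ j * Real.exp (-s.re * T γ)
      ≤ ‖w γ‖ / T γ * T γ ^ j * (Real.exp (-(σ' - σ) * T γ) * Real.exp (-σ * T γ)) := by gcongr
    _ = (T γ ^ j * Real.exp (-(σ' - σ) * T γ)) * (‖w γ‖ / T γ * Real.exp (-σ * T γ)) := by ring
    _ ≤ _ := by gcongr

theorem summable_norm_dirTerm (hT : ∀ γ, 0 < T γ)
    (hw : Summable fun γ => ‖w γ‖ / T γ * Real.exp (-σ * T γ)) (j : ℕ) {s : ℂ} (hs : σ < s.re) :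
    Summable fun γ => ‖dirTerm T w j s γ‖ :=
  Summable.of_nonneg_of_le (fun _ => norm_nonneg _)
    (norm_dirTerm_le hT j hs le_rfl) (hw.mul_left _)

theorem hasDerivAt_tsum_dirTerm (hT : ∀ γ, 0 < T γ)
    (hw : Summable fun γ => ‖w γ‖ / T γ * Real.exp (-σ * T γ)) (j : ℕ) {s : ℂ} (hs : σ < s.re) :
    HasDerivAt (fun s => ∑' γ, dirTerm T w j s γ) (∑' γ, dirTerm T w (j + 1) s γ) s := by
  -- An intermediate abscissa: the domination is uniform on the half-plane beyond it, which contains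
  -- `s`.
  obtain ⟨σ', h1, h2⟩ := exists_between hs
  have hopen : IsOpen {z : ℂ | σ' < z.re} := isOpen_lt continuous_const Complex.continuous_re
  have hconv : Convex ℝ {z : ℂ | σ' < z.re} := convex_halfSpace_re_gt σ'
  refine hasDerivAt_tsum_of_isPreconnected (t := {z : ℂ | σ' < z.re}) (y₀ := s)
    (g := fun γ s => dirTerm T w j s γ) (g' := fun γ s => dirTerm T w (j + 1) s γ)
    (hw.mul_left ((j + 1).factorial / (σ' - σ) ^ (j + 1))) hopen hconv.isPreconnected
    ?_ ?_ h2 (summable_norm_dirTerm hT hw j hs).of_norm h2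
  · intro γ y _
    have h3 : HasDerivAt (fun s : ℂ => -s * T γ) (-1 * T γ) y :=
      ((hasDerivAt_id y).neg).mul_const _
    have h4 := h3.cexp.const_mul (w γ / T γ * (-T γ : ℂ) ^ j)
    refine h4.congr_deriv ?_
    simp only [dirTerm, pow_succ]; ring
  · intro γ y hy
    exact norm_dirTerm_le hT (j + 1) h1 (le_of_lt hy) γ

theorem iteratedDeriv_tsum_dirTerm (hT : ∀ γ, 0 < T γ)
    (hw : Summable fun γ => ‖w γ‖ / T γ * Real.exp (-σ * T γ)) (i j : ℕ) {s : ℂ} (hs : σ < s.re) :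
    iteratedDeriv j (fun s => ∑' γ, dirTerm T w i s γ) s = ∑' γ, dirTerm T w (i + j) s γ := by
  have hopen : IsOpen {z : ℂ | σ < z.re} := isOpen_lt continuous_const Complex.continuous_re
  induction j generalizing s with
  | zero => simp
  | succ j ih =>
    rw [iteratedDeriv_succ]
    have : iteratedDeriv j (fun s => ∑' γ, dirTerm T w i s γ) =ᶠ[𝓝 s]
        fun s => ∑' γ, dirTerm T w (i + j) s γ := by
      filter_upwards [hopen.mem_nhds hs] with z hz using ih hz
    rw [this.deriv_eq, (hasDerivAt_tsum_dirTerm hT hw (i + j) hs).deriv, add_assoc]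

theorem dirTerm_succ (hT : ∀ γ, 0 < T γ) (k : ℕ) (s : ℂ) (γ : Γ) :
    -dirTerm T w (k + 1) s γ = (-1) ^ k * (w γ * T γ ^ k * Complex.exp (-s * T γ)) := by
  have : (T γ : ℂ) ≠ 0 := by exact_mod_cast (hT γ).ne'
  rw [dirTerm, pow_succ, neg_pow (T γ : ℂ) k]
  field_simp

theorem summable_pow_mul_exp (hT : ∀ γ, 0 < T γ)
    (hw : Summable fun γ => ‖w γ‖ / T γ * Real.exp (-σ * T γ)) (k : ℕ) {x : ℝ} (hs : σ < x) :
    Summable fun γ => ‖w γ‖ * (T γ ^ k * Real.exp (-x * T γ)) := by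
  refine (summable_norm_dirTerm (s := (x : ℂ)) hT hw (k + 1) (by simpa using hs)).congr fun γ => ?_
  rw [norm_dirTerm hT, pow_succ]
  have := (hT γ).ne'
  simp only [Complex.ofReal_re]
  field_simp

/-- The derivatives of the logarithmic derivative of `exp (-∑ (w / T) e^{-s T})`. -/
theorem iteratedDeriv_logDeriv_eq_tsum (hT : ∀ γ, 0 < T γ)
    (hw : Summable fun γ => ‖w γ‖ / T γ * Real.exp (-σ * T γ)) {f : ℂ → ℂ}
    (hf : ∀ s : ℂ, σ < s.re → f s = Complex.exp (-∑' γ, dirTerm T w 0 s γ)) (k : ℕ) {s : ℂ}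
    (hs : σ < s.re) :
    iteratedDeriv k (logDeriv f) s
      = (-1) ^ k * ∑' γ, w γ * T γ ^ k * Complex.exp (-s * T γ) := by
  have hopen : IsOpen {z : ℂ | σ < z.re} := isOpen_lt continuous_const Complex.continuous_re
  have h1 : logDeriv f =ᶠ[𝓝 s] fun s => -∑' γ, dirTerm T w 1 s γ := by
    filter_upwards [hopen.mem_nhds hs] with z hz
    have h2 : f =ᶠ[𝓝 z] fun s => Complex.exp (-∑' γ, dirTerm T w 0 s γ) := by
      filter_upwards [hopen.mem_nhds hz] with y hy using hf y hy
    have h3 : HasDerivAt (fun s => Complex.exp (-∑' γ, dirTerm T w 0 s γ))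
        (Complex.exp (-∑' γ, dirTerm T w 0 z γ) * -∑' γ, dirTerm T w 1 z γ) z :=
      (hasDerivAt_tsum_dirTerm hT hw 0 hz).neg.cexp
    rw [logDeriv_apply, h2.deriv_eq, h2.self_of_nhds, h3.deriv]
    exact mul_div_cancel_left₀ _ (Complex.exp_ne_zero _)
  rw [h1.iteratedDeriv_eq k, iteratedDeriv_fun_neg, iteratedDeriv_tsum_dirTerm hT hw 1 k hs,
    ← tsum_neg, ← tsum_mul_left]
  refine tsum_congr fun γ => ?_
  rw [add_comm 1 k, dirTerm_succ hT]

end Laplace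

/-! ### Laplace transform of the trace formula. -/

section FromTraceFormula

open MeasureTheory Set
open scoped Convolution Pointwise

/-- The trace formula, tested against smooth functions with compact support in `]0, +∞[`. -/
def TraceIdentity {Γ : Type*} (T : Γ → ℝ) (w : Γ → ℂ) (m : ℂ → ℕ) : Prop :=
  ∀ χ : ℝ → ℝ, ContDiff ℝ ∞ χ → HasCompactSupport χ → tsupport χ ⊆ Ioi 0 →
    ∃ v : ℂ, HasSum (fun a : ℂ => (m a : ℂ) * ∫ t in Ioi (0 : ℝ), Complex.exp (a * t) * χ t) v ∧
      HasSum (fun γ => w γ * χ (T γ)) v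

theorem exists_bump {ε : ℝ} (hε : 0 < ε) : ∃ ψ : ℝ → ℝ, ContDiff ℝ ∞ ψ ∧ HasCompactSupport ψ ∧
    tsupport ψ ⊆ Ioo 0 ε ∧ (∀ t, 0 ≤ ψ t) ∧ ∫ t, ψ t = 1 := by
  let φ : ContDiffBump (ε / 2) := ⟨ε / 8, ε / 4, by positivity, by linarith⟩
  refine ⟨φ.normed volume, φ.contDiff_normed, φ.hasCompactSupport_normed, ?_,
    fun t => φ.nonneg_normed t, φ.integral_normed⟩
  rw [φ.tsupport_normed_eq, Real.closedBall_eq_Icc]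
  intro t ht
  simp only [φ, mem_Icc, mem_Ioo] at ht ⊢
  constructor <;> linarith [ht.1, ht.2]

/-- The truncated kernel `a ^ k e^{-x a} 1_{[0, R]}`. -/
def expKernel (k : ℕ) (x R : ℝ) (a : ℝ) : ℝ :=
  (Icc 0 R).indicator (fun a => a ^ k * Real.exp (-x * a)) a

theorem integrable_expKernel (k : ℕ) (x R : ℝ) : Integrable (expKernel k x R) := by
  refine IntegrableOn.integrable_indicator ?_ measurableSet_Icc
  exact (by fun_prop : Continuous fun a : ℝ => a ^ k * Real.exp (-x * a)).continuousOn.integrableOn_Icc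

theorem expKernel_nonneg (k : ℕ) (x R a : ℝ) : 0 ≤ expKernel k x R a := by
  refine indicator_nonneg (fun a ha => ?_) a
  have := ha.1
  positivity

/-- The smoothed kernel. -/
def smoothKernel (ψ : ℝ → ℝ) (k : ℕ) (x R : ℝ) : ℝ → ℝ :=
  expKernel k x R ⋆[ContinuousLinearMap.mul ℝ ℝ, volume] ψ

theorem smoothKernel_apply (ψ : ℝ → ℝ) (k : ℕ) (x R t : ℝ) :
    smoothKernel ψ k x R t = ∫ a, expKernel k x R a * ψ (t - a) := rfl

theorem contDiff_smoothKernel {ψ : ℝ → ℝ} (h1 : ContDiff ℝ ∞ ψ) (h2 : HasCompactSupport ψ)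
    (k : ℕ) (x R : ℝ) : ContDiff ℝ ∞ (smoothKernel ψ k x R) :=
  h2.contDiff_convolution_right (n := ⊤) _ (integrable_expKernel k x R).locallyIntegrable h1

theorem support_smoothKernel (ψ : ℝ → ℝ) (k : ℕ) (x R : ℝ) :
    Function.support (smoothKernel ψ k x R) ⊆ tsupport ψ + Icc 0 R := by
  refine (support_convolution_subset_swap _).trans ?_
  refine add_subset_add (subset_tsupport _) ?_
  exact Function.support_subset_iff'.2 fun a ha => indicator_of_notMem ha _

theorem tsupport_smoothKernel {ψ : ℝ → ℝ} (h2 : HasCompactSupport ψ)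
    (k : ℕ) (x R : ℝ) :
    tsupport (smoothKernel ψ k x R) ⊆ tsupport ψ + Icc 0 R :=
  closure_minimal (support_smoothKernel ψ k x R) (h2.isCompact.add isCompact_Icc).isClosed

theorem hasCompactSupport_smoothKernel {ψ : ℝ → ℝ} (h2 : HasCompactSupport ψ)
    (k : ℕ) (x R : ℝ) : HasCompactSupport (smoothKernel ψ k x R) :=
  (h2.isCompact.add isCompact_Icc).of_isClosed_subset (isClosed_tsupport _)
    (tsupport_smoothKernel h2 k x R)

theorem setIntegral_eq_integral_of_support {u : ℝ → ℂ} {χ : ℝ → ℝ} (hχ : tsupport χ ⊆ Ioi 0) :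
    ∫ t in Ioi (0 : ℝ), u t * χ t = ∫ t, u t * χ t := by
  refine setIntegral_eq_integral_of_forall_compl_eq_zero fun t ht => ?_
  have : χ t = 0 := by
    by_contra h
    exact ht (hχ (subset_tsupport χ h))
  simp [this]

/-- Exponentials are characters, so integration against `e^{at}` turns the convolution into a
product; the mollification appears only through the factor `∫ e^{at} ψ`. -/
theorem integral_exp_mul_smoothKernel {ψ : ℝ → ℝ} {ε : ℝ} (h1 : ContDiff ℝ ∞ ψ)
    (h2 : HasCompactSupport ψ) (hψ : tsupport ψ ⊆ Ioo 0 ε) (k : ℕ) (x R : ℝ) (a : ℂ) :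
    ∫ t in Ioi (0 : ℝ), Complex.exp (a * t) * smoothKernel ψ k x R t
      = (∫ t in Icc (0 : ℝ) R, (t : ℂ) ^ k * Complex.exp (-(x - a) * t)) *
        ∫ t in Ioi (0 : ℝ), Complex.exp (a * t) * ψ t := by
  have hsub : tsupport (smoothKernel ψ k x R) ⊆ Ioi 0 := by
    refine (tsupport_smoothKernel h2 k x R).trans ?_
    rintro _ ⟨b, hb, c, hc, rfl⟩
    have := (hψ hb).1
    have := hc.1
    simp only [mem_Ioi]; linarith
  rw [setIntegral_eq_integral_of_support hsub,
    setIntegral_eq_integral_of_support (hψ.trans Ioo_subset_Ioi_self)]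
  let u : ℝ → ℂ := fun t => (Icc (0 : ℝ) R).indicator
    (fun t : ℝ => (t : ℂ) ^ k * Complex.exp (-(x - a) * t)) t
  let v : ℝ → ℂ := fun t => Complex.exp (a * t) * ψ t
  have hu : Integrable u := by
    refine IntegrableOn.integrable_indicator ?_ measurableSet_Icc
    exact (by fun_prop : Continuous fun t : ℝ => (t : ℂ) ^ k *
      Complex.exp (-(x - a) * t)).continuousOn.integrableOn_Icc
  have hv : Integrable v := by
    have hc : Continuous ψ := h1.continuous
    refine Continuous.integrable_of_hasCompactSupport (by fun_prop) ?_
    refine HasCompactSupport.mul_left ?_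
    exact h2.comp_left (g := fun r : ℝ => (r : ℂ)) (by simp)
  have h := integral_convolution (μ := volume) (ν := volume) (ContinuousLinearMap.mul ℂ ℂ) hu hv
  rw [ContinuousLinearMap.mul_apply'] at h
  rw [← integral_indicator measurableSet_Icc, ← h]
  refine integral_congr_ae (Eventually.of_forall fun t => ?_)
  simp only [convolution_def, ContinuousLinearMap.mul_apply']
  rw [smoothKernel_apply, ← integral_complex_ofReal, ← integral_const_mul]
  refine integral_congr_ae (Eventually.of_forall fun b => ?_)
  simp only [u, v, expKernel]
  by_cases hb : b ∈ Icc 0 R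
  · simp only [indicator_of_mem hb]
    push_cast
    have : Complex.exp (a * t) * Complex.exp (-x * b)
        = Complex.exp (-(x - a) * b) * Complex.exp (a * (t - b)) := by
      rw [← Complex.exp_add, ← Complex.exp_add]; congr 1; ring
    linear_combination ((b : ℂ) ^ k * ψ (t - b)) * this
  · simp [indicator_of_notMem hb]

variable {Γ : Type*} {T : Γ → ℝ} {w : Γ → ℂ} {σ : ℝ} {m : ℂ → ℕ} {C₀ : ℝ}

theorem smoothKernel_nonneg {ψ : ℝ → ℝ} (h0 : ∀ t, 0 ≤ ψ t) (k : ℕ) (x R t : ℝ) :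
    0 ≤ smoothKernel ψ k x R t :=
  integral_nonneg fun a => mul_nonneg (expKernel_nonneg k x R a) (h0 _)

/-- Averaging against a probability density supported close to `0`. -/
theorem norm_average_sub_le {ψ : ℝ → ℝ} {ε δ : ℝ} (hψ : tsupport ψ ⊆ Ioo 0 ε) (h0 : ∀ t, 0 ≤ ψ t)
    (hψ1 : ∫ t, ψ t = 1) {h : ℝ → ℂ} {y : ℂ} (hh : ∀ t ∈ Ioo 0 ε, ‖h t - y‖ ≤ δ)
    (hint : Integrable fun t => h t * ψ t) : ‖(∫ t, h t * ψ t) - y‖ ≤ δ := by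
  have hψi : Integrable ψ := by
    by_contra hn
    rw [integral_undef hn] at hψ1
    exact zero_ne_one hψ1
  have e1 : (∫ t, h t * ψ t) - y = ∫ t, (h t - y) * ψ t := by
    have : ∫ t, y * (ψ t : ℂ) = y := by
      rw [integral_const_mul, integral_complex_ofReal, hψ1]; simp
    have hyi : Integrable fun t => y * (ψ t : ℂ) := hψi.ofReal.const_mul y
    simp only [sub_mul]
    rw [integral_sub hint hyi, this]
  rw [e1]
  calc ‖∫ t, (h t - y) * ψ t‖ ≤ ∫ t, δ * ψ t := by
        refine norm_integral_le_of_norm_le (hψi.const_mul δ) (Eventually.of_forall fun t => ?_)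
        rw [norm_mul, Complex.norm_real, Real.norm_of_nonneg (h0 t)]
        by_cases ht : t ∈ Ioo 0 ε
        · exact mul_le_mul_of_nonneg_right (hh t ht) (h0 t)
        · have : ψ t = 0 := by
            by_contra hne
            exact ht (hψ (subset_tsupport ψ hne))
          simp [this]
    _ = δ := by rw [integral_const_mul, hψ1, mul_one]

theorem smoothKernel_eq {ψ : ℝ → ℝ} (k : ℕ) (x R t : ℝ) :
    smoothKernel ψ k x R t = ∫ b, expKernel k x R (t - b) * ψ b := by
  rw [smoothKernel_apply, ← integral_sub_left_eq_self _ volume t]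
  simp

/-- The mollifier lives at positive arguments, so the value at `t` depends on the kernel at
arguments below `t` only: a truncation beyond `t` is invisible. -/
theorem smoothKernel_eq_of_le {ψ : ℝ → ℝ} {ε : ℝ} (hψ : tsupport ψ ⊆ Ioo 0 ε) (k : ℕ) (x : ℝ)
    {R t : ℝ} (hR : t ≤ R) : smoothKernel ψ k x R t = smoothKernel ψ k x t t := by
  rw [smoothKernel_eq, smoothKernel_eq]
  refine integral_congr_ae (Eventually.of_forall fun b => ?_)
  by_cases hb : ψ b = 0
  · simp [hb]
  · have hb0 := (hψ (subset_tsupport ψ hb)).1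
    simp only [expKernel, indicator_apply, mem_Icc]
    have h1 : t - b ≤ R := by linarith
    have h2 : t - b ≤ t := by linarith
    simp [h1, h2]

theorem integrable_expKernel_mul {ψ : ℝ → ℝ} (h1 : ContDiff ℝ ∞ ψ) (h2 : HasCompactSupport ψ)
    (k : ℕ) (x R t : ℝ) : Integrable fun b => expKernel k x R (t - b) * ψ b := by
  obtain ⟨C, hC⟩ := h2.exists_bound_of_continuous h1.continuous
  exact ((integrable_expKernel k x R).comp_sub_left t).mul_bdd (c := C)
    h1.continuous.aestronglyMeasurable (Eventually.of_forall hC)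

/-- Mollifying evaluates the kernel at points `t - b` with `0 < b < 1`; such a shift lowers the
power and raises the exponential by at most `e^x`. The bound is independent of the truncation and of
the mollifier. -/
theorem smoothKernel_le {ψ : ℝ → ℝ} (h1 : ContDiff ℝ ∞ ψ) (h2 : HasCompactSupport ψ)
    (hψ : tsupport ψ ⊆ Ioo 0 1) (h0 : ∀ t, 0 ≤ ψ t) (hψ1 : ∫ t, ψ t = 1) (k : ℕ) {x : ℝ}
    (hx : 0 < x) (R : ℝ) {t : ℝ} (ht : 0 < t) :
    smoothKernel ψ k x R t ≤ Real.exp x * (t ^ k * Real.exp (-x * t)) := by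
  have hψi : Integrable ψ := h1.continuous.integrable_of_hasCompactSupport h2
  calc smoothKernel ψ k x R t = ∫ b, expKernel k x R (t - b) * ψ b := smoothKernel_eq k x R t
    _ ≤ ∫ b, Real.exp x * (t ^ k * Real.exp (-x * t)) * ψ b := by
        refine integral_mono (integrable_expKernel_mul h1 h2 k x R t) (hψi.const_mul _) fun b => ?_
        by_cases hb : ψ b = 0
        · simp [hb]
        · refine mul_le_mul_of_nonneg_right ?_ (h0 b)
          have hb0 := hψ (subset_tsupport ψ hb)
          simp only [expKernel, indicator_apply]
          split_ifs with hm
          · have e : Real.exp x * (t ^ k * Real.exp (-x * t)) = t ^ k * Real.exp (x - x * t) := by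
              rw [show x - x * t = x + -x * t by ring, Real.exp_add]; ring
            rw [e]
            refine mul_le_mul (pow_le_pow_left₀ hm.1 (by linarith [hb0.1]) k)
              (Real.exp_le_exp.2 ?_) (Real.exp_nonneg _) (by positivity)
            nlinarith [hb0.2]
          · positivity
    _ = _ := by rw [integral_const_mul, hψ1, mul_one]

/-- The trace formula for the truncated mollified kernels, in the limit of no truncation. The limit
is legitimate on both sides by dominated convergence, uniformly in the truncation. -/
theorem tsum_smoothed (hT : ∀ γ, 0 < T γ)
    (hw : Summable fun γ => ‖w γ‖ / T γ * Real.exp (-σ * T γ)) (hm : ∀ a, m a ≠ 0 → a.re ≤ C₀)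
    (hTF : TraceIdentity T w m) (k : ℕ) {x : ℝ} (hx0 : 0 < x) (hxσ : σ < x) (hxC : C₀ < x)
    {ψ : ℝ → ℝ} (h1 : ContDiff ℝ ∞ ψ) (h2 : HasCompactSupport ψ)
    (hψ : tsupport ψ ⊆ Ioo 0 1) (h0 : ∀ t, 0 ≤ ψ t) (hψ1 : ∫ t, ψ t = 1) :
    ∑' a : ℂ, (m a : ℂ) * (k.factorial / (x - a) ^ (k + 1) *
        ∫ t in Ioi (0 : ℝ), Complex.exp (a * t) * ψ t)
      = ∑' γ, w γ * smoothKernel ψ k x (T γ) (T γ) := by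
  have hψ0 : tsupport ψ ⊆ Ioi 0 := hψ.trans Ioo_subset_Ioi_self
  -- The trace formula for the mollifier itself supplies the dominating series over the resonances:
  -- unconditional summability in `ℂ` is absolute, and the truncated Laplace integrals are bounded
  -- uniformly because `Re a ≤ C₀ < x`.
  obtain ⟨v, hv, -⟩ := hTF ψ h1 h2 hψ0
  set ψh : ℂ → ℂ := fun a => ∫ t in Ioi (0 : ℝ), Complex.exp (a * t) * ψ t with hψh
  have hre : ∀ a, m a ≠ 0 → 0 < ((x : ℂ) - a).re := fun a ha => by
    have := hm a ha
    simp only [Complex.sub_re, Complex.ofReal_re]; linarith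
  set I : ℕ → ℂ → ℂ := fun n a =>
    ∫ t in Icc (0 : ℝ) n, (t : ℂ) ^ k * Complex.exp (-(x - a) * t) with hI
  set M : ℝ := ∫ t in Ioi (0 : ℝ), t ^ k * Real.exp (-(x - C₀) * t) with hM
  have hIM : ∀ n a, m a ≠ 0 → ‖I n a‖ ≤ M := by
    intro n a ha
    have hi := integrableOn_pow_mul_exp k (show 0 < x - C₀ by linarith)
    rw [← integrableOn_Ici_iff_integrableOn_Ioi] at hi
    rw [hM, ← integral_Ici_eq_integral_Ioi]
    calc ‖I n a‖ ≤ ∫ t in Icc (0 : ℝ) n, t ^ k * Real.exp (-(x - C₀) * t) := by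
          refine norm_integral_le_of_norm_le (hi.mono_set Icc_subset_Ici_self) ?_
          rw [ae_restrict_iff' measurableSet_Icc]
          refine Eventually.of_forall fun t ht => ?_
          rw [norm_pow_mul_exp k _ ht.1]
          refine mul_le_mul_of_nonneg_left (Real.exp_le_exp.2 ?_) (pow_nonneg ht.1 k)
          have := hm a ha
          simp only [Complex.sub_re, Complex.ofReal_re]
          nlinarith [ht.1]
      _ ≤ _ := by
          refine setIntegral_mono_set hi ?_ (Icc_subset_Ici_self.eventuallyLE)
          rw [EventuallyLE, ae_restrict_iff' measurableSet_Ici]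
          refine Eventually.of_forall fun t ht => ?_
          have : (0 : ℝ) ≤ t := ht
          simp only [Pi.zero_apply]; positivity
  have hIlim : ∀ a, m a ≠ 0 → Tendsto (fun n => I n a) atTop (𝓝 (k.factorial / (x - a) ^ (k + 1))) := by
    intro a ha
    have hi := integrableOn_pow_mul_cexp k (hre a ha)
    rw [← integral_pow_mul_exp k (hre a ha)]
    have h := intervalIntegral_tendsto_integral_Ioi 0 hi tendsto_natCast_atTop_atTop
    refine h.congr fun n => ?_
    rw [intervalIntegral.integral_of_le (by positivity), hI]
    simp only
    rw [integral_Icc_eq_integral_Ioc]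
  have hlam : Tendsto (fun n : ℕ => ∑' a, (m a : ℂ) * (I n a * ψh a)) atTop
      (𝓝 (∑' a : ℂ, (m a : ℂ) * (k.factorial / (x - a) ^ (k + 1) * ψh a))) := by
    refine tendsto_tsum_of_dominated_convergence (bound := fun a => M * ‖(m a : ℂ) * ψh a‖)
      (hv.summable.norm.mul_left M) (fun a => ?_) (Eventually.of_forall fun n a => ?_)
    · by_cases ha : m a = 0
      · simp [ha]
      · exact ((hIlim a ha).mul_const _).const_mul _
    · by_cases ha : m a = 0
      · simp [ha]
      · rw [norm_mul, norm_mul, norm_mul]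
        have := mul_le_mul_of_nonneg_right (hIM n a ha)
          (mul_nonneg (norm_nonneg (m a : ℂ)) (norm_nonneg (ψh a)))
        linarith
  have hgam : Tendsto (fun n : ℕ => ∑' γ, w γ * smoothKernel ψ k x n (T γ)) atTop
      (𝓝 (∑' γ, w γ * smoothKernel ψ k x (T γ) (T γ))) := by
    refine tendsto_tsum_of_dominated_convergence
      (bound := fun γ => Real.exp x * (‖w γ‖ * (T γ ^ k * Real.exp (-x * T γ))))
      ((summable_pow_mul_exp hT hw k hxσ).mul_left _) (fun γ => ?_)
      (Eventually.of_forall fun n γ => ?_)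
    · refine tendsto_const_nhds.congr' ?_
      filter_upwards [tendsto_natCast_atTop_atTop.eventually_ge_atTop (T γ)] with n hn
      rw [smoothKernel_eq_of_le hψ k x hn]
    · rw [norm_mul, Complex.norm_real, Real.norm_of_nonneg (smoothKernel_nonneg h0 k x _ _)]
      have := mul_le_mul_of_nonneg_left (smoothKernel_le h1 h2 hψ h0 hψ1 k hx0 (n : ℝ) (hT γ))
        (norm_nonneg (w γ))
      linarith
  refine tendsto_nhds_unique (hlam.congr fun n => ?_) hgam
  have hsub : tsupport (smoothKernel ψ k x n) ⊆ Ioi 0 := by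
    refine (tsupport_smoothKernel h2 k x n).trans ?_
    rintro _ ⟨b, hb, c, hc, rfl⟩
    have := (hψ hb).1
    have := hc.1
    simp only [mem_Ioi]; linarith
  obtain ⟨u, hu1, hu2⟩ := hTF _ (contDiff_smoothKernel h1 h2 k x n)
    (hasCompactSupport_smoothKernel h2 k x n) hsub
  rw [hu2.tsum_eq, ← hu1.tsum_eq]
  refine tsum_congr fun a => ?_
  rw [integral_exp_mul_smoothKernel h1 h2 hψ]

/-- The Laplace transform of the trace formula. -/
theorem tsum_pow_mul_exp_eq (hT : ∀ γ, 0 < T γ)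
    (hw : Summable fun γ => ‖w γ‖ / T γ * Real.exp (-σ * T γ)) (hm : ∀ a, m a ≠ 0 → a.re ≤ C₀)
    (hTF : TraceIdentity T w m) (k : ℕ) {x : ℝ} (hx0 : 0 < x) (hxσ : σ < x) (hxC : C₀ < x)
    (hs : Summable fun a : ℂ => (m a : ℝ) / ‖(x : ℂ) - a‖ ^ (k + 1)) :
    ∑' γ, w γ * T γ ^ k * Complex.exp (-x * T γ)
      = ∑' a : ℂ, (m a : ℂ) * (k.factorial / (x - a) ^ (k + 1)) := by
  have hε : ∀ n : ℕ, (0 : ℝ) < 1 / ((n : ℝ) + 1) := fun n => by positivity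
  -- Mollifiers concentrating at `0⁺`. Their transforms at `a` tend to 1 and are bounded on the
  -- half-plane of the resonances, so the series `∑ m(a) / |x - a|^{k+1}` now dominates.
  choose ψ h1 h2 hψ h0 hψ1 using fun n : ℕ => exists_bump (hε n)
  have hsub : ∀ n : ℕ, Ioo (0 : ℝ) (1 / ((n : ℝ) + 1)) ⊆ Ioo 0 1 := fun n =>
    Ioo_subset_Ioo_right (by rw [div_le_one (by positivity)]; linarith [n.cast_nonneg (α := ℝ)])
  have hlim : ∀ (h : ℝ → ℂ) (y : ℂ), (∀ n, Integrable fun t => h t * ψ n t) →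
      Tendsto h (𝓝[>] 0) (𝓝 y) → Tendsto (fun n => ∫ t, h t * ψ n t) atTop (𝓝 y) := by
    intro h y hi hy
    rw [Metric.tendsto_nhds] at hy ⊢
    intro δ hδ
    have h3 := hy (δ / 2) (by positivity)
    rw [eventually_nhdsWithin_iff, Metric.eventually_nhds_iff] at h3
    obtain ⟨η, hη, h4⟩ := h3
    have h5 := tendsto_one_div_add_atTop_nhds_zero_nat (𝕜 := ℝ)
    filter_upwards [h5.eventually (gt_mem_nhds hη)] with n hn
    rw [dist_eq_norm]
    refine lt_of_le_of_lt (norm_average_sub_le (hψ n) (h0 n) (hψ1 n) (δ := δ / 2) ?_ (hi n))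
      (by linarith)
    intro t ht
    have := h4 (y := t) (by rw [Real.dist_eq, sub_zero, abs_of_pos ht.1]; linarith [ht.2]) ht.1
    rw [dist_eq_norm] at this
    exact this.le
  have hle : ∀ n : ℕ, tsupport (ψ n) ⊆ Ioi 0 := fun n => (hψ n).trans Ioo_subset_Ioi_self
  have key := fun n => tsum_smoothed hT hw hm hTF k hx0 hxσ hxC (h1 n) (h2 n)
    ((hψ n).trans (hsub n)) (h0 n) (hψ1 n)
  have hgam : Tendsto (fun n : ℕ => ∑' γ, w γ * smoothKernel (ψ n) k x (T γ) (T γ)) atTop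
      (𝓝 (∑' γ, w γ * T γ ^ k * Complex.exp (-x * T γ))) := by
    refine tendsto_tsum_of_dominated_convergence
      (bound := fun γ => Real.exp x * (‖w γ‖ * (T γ ^ k * Real.exp (-x * T γ))))
      ((summable_pow_mul_exp hT hw k hxσ).mul_left _) (fun γ => ?_)
      (Eventually.of_forall fun n γ => ?_)
    · simp only [mul_assoc]
      refine Tendsto.const_mul _ ?_
      have hTγ := hT γ
      have e : ∀ n, ((smoothKernel (ψ n) k x (T γ) (T γ) : ℝ) : ℂ)
          = ∫ b, (expKernel k x (T γ) (T γ - b) : ℂ) * ψ n b := by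
        intro n
        rw [smoothKernel_eq, ← integral_complex_ofReal]
        simp only [Complex.ofReal_mul]
      simp only [e]
      refine hlim (fun b => (expKernel k x (T γ) (T γ - b) : ℂ)) _ (fun n => ?_) ?_
      · have := (integrable_expKernel_mul (h1 n) (h2 n) k x (T γ) (T γ)).ofReal (𝕜 := ℂ)
        simpa using this
      -- The truncation is at `T γ` exactly, where the kernel jumps; the arguments `T γ - b` with `b
      -- > 0` stay on the side where it is continuous.
      · have hc : Tendsto (fun b : ℝ => ((T γ - b : ℝ) : ℂ) ^ k * Complex.exp (-x * (T γ - b : ℝ)))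
            (𝓝[>] 0) (𝓝 (((T γ - 0 : ℝ) : ℂ) ^ k * Complex.exp (-x * (T γ - 0 : ℝ)))) :=
          ((by fun_prop : Continuous fun b : ℝ => ((T γ - b : ℝ) : ℂ) ^ k *
            Complex.exp (-x * (T γ - b : ℝ))).tendsto 0).mono_left nhdsWithin_le_nhds
        rw [sub_zero] at hc
        refine hc.congr' ?_
        filter_upwards [Ioo_mem_nhdsGT hTγ] with b hb
        have : T γ - b ∈ Icc 0 (T γ) := ⟨by linarith [hb.2], by linarith [hb.1]⟩
        simp only [expKernel, indicator_of_mem this]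
        push_cast
        rfl
    · rw [norm_mul, Complex.norm_real, Real.norm_of_nonneg (smoothKernel_nonneg (h0 n) k x _ _)]
      have := mul_le_mul_of_nonneg_left (smoothKernel_le (h1 n) (h2 n) ((hψ n).trans (hsub n))
        (h0 n) (hψ1 n) k hx0 (T γ) (hT γ)) (norm_nonneg (w γ))
      linarith
  have hlam : Tendsto (fun n : ℕ => ∑' a : ℂ, (m a : ℂ) * (k.factorial / (x - a) ^ (k + 1) *
        ∫ t in Ioi (0 : ℝ), Complex.exp (a * t) * ψ n t)) atTop
      (𝓝 (∑' a : ℂ, (m a : ℂ) * (k.factorial / (x - a) ^ (k + 1)))) := by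
    have hint : ∀ n (a : ℂ), Integrable fun t : ℝ => Complex.exp (a * t) * ψ n t := by
      intro n a
      have hc : Continuous (ψ n) := (h1 n).continuous
      refine Continuous.integrable_of_hasCompactSupport (by fun_prop) ?_
      refine HasCompactSupport.mul_left ?_
      exact (h2 n).comp_left (g := fun r : ℝ => (r : ℂ)) (by simp)
    refine tendsto_tsum_of_dominated_convergence
      (bound := fun a => (k.factorial * Real.exp |C₀|) * ((m a : ℝ) / ‖(x : ℂ) - a‖ ^ (k + 1)))
      (hs.mul_left _) (fun a => ?_) (Eventually.of_forall fun n a => ?_)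
    · refine Tendsto.const_mul _ ?_
      have h3 : Tendsto (fun n => ∫ t in Ioi (0 : ℝ), Complex.exp (a * t) * ψ n t) atTop (𝓝 1) := by
        simp only [fun n => setIntegral_eq_integral_of_support
          (u := fun t : ℝ => Complex.exp (a * t)) (hle n)]
        refine hlim (fun t : ℝ => Complex.exp (a * t)) 1 (fun n => hint n a) ?_
        have := ((by fun_prop : Continuous fun t : ℝ => Complex.exp (a * t)).tendsto 0).mono_left
          (nhdsWithin_le_nhds (s := Ioi 0))
        simpa using this
      simpa using h3.const_mul ((k.factorial : ℂ) / (x - a) ^ (k + 1))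
    · by_cases ha : m a = 0
      · simp [ha]
      have hψi : Integrable (ψ n) := (h1 n).continuous.integrable_of_hasCompactSupport (h2 n)
      have h3 : ‖∫ t in Ioi (0 : ℝ), Complex.exp (a * t) * ψ n t‖ ≤ Real.exp |C₀| := by
        rw [setIntegral_eq_integral_of_support (u := fun t : ℝ => Complex.exp (a * t)) (hle n)]
        calc ‖∫ t : ℝ, Complex.exp (a * t) * ψ n t‖ ≤ ∫ t, Real.exp |C₀| * ψ n t := by
              refine norm_integral_le_of_norm_le (hψi.const_mul _) (Eventually.of_forall fun t => ?_)
              rw [norm_mul, Complex.norm_real, Real.norm_of_nonneg (h0 n t)]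
              by_cases ht : ψ n t = 0
              · simp [ht]
              · have ht' := hsub n (hψ n (subset_tsupport _ ht))
                refine mul_le_mul_of_nonneg_right ?_ (h0 n t)
                rw [Complex.norm_exp, Real.exp_le_exp]
                simp only [Complex.mul_re, Complex.ofReal_re, Complex.ofReal_im, mul_zero, sub_zero]
                have e1 := (hm a ha).trans (le_abs_self C₀)
                have e2 := abs_nonneg C₀
                nlinarith [ht'.1, ht'.2]
          _ = Real.exp |C₀| := by rw [integral_const_mul, hψ1, mul_one]
      rw [norm_mul, norm_mul, norm_div, norm_pow, Complex.norm_natCast, Complex.norm_natCast]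
      calc (m a : ℝ) * (k.factorial / ‖(x : ℂ) - a‖ ^ (k + 1) *
            ‖∫ t in Ioi (0 : ℝ), Complex.exp (a * t) * ψ n t‖)
          ≤ (m a : ℝ) * (k.factorial / ‖(x : ℂ) - a‖ ^ (k + 1) * Real.exp |C₀|) := by gcongr
        _ = _ := by ring
  exact tendsto_nhds_unique (hgam.congr fun n => (key n).symm) hlam

end FromTraceFormula

/-! ### Trace formula from an identity on a vertical line. -/

section ToTraceFormula

open MeasureTheory Set
open scoped FourierTransform

variable {Γ : Type*} {T : Γ → ℝ} {w : Γ → ℂ} {σ : ℝ} {m : ℂ → ℕ} {C₀ : ℝ}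

theorem integral_pow_mul_exp_mul_fourierInv (k : ℕ) {z : ℂ} (hz : 0 < z.re) {h : ℝ → ℂ}
    (hh : Integrable h) :
    ∫ t in Ioi (0 : ℝ), (t : ℂ) ^ k * Complex.exp (-z * t) * 𝓕⁻ h t
      = ∫ ξ : ℝ, k.factorial / (z - 2 * Real.pi * ξ * Complex.I) ^ (k + 1) * h ξ := by
  have hre : ∀ ξ : ℝ, 0 < (z - 2 * Real.pi * ξ * Complex.I).re := fun ξ => by
    simpa using hz
  have e1 : ∀ t : ℝ, (t : ℂ) ^ k * Complex.exp (-z * t) * 𝓕⁻ h t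
      = ∫ ξ : ℝ, (t : ℂ) ^ k * Complex.exp (-(z - 2 * Real.pi * ξ * Complex.I) * t) * h ξ := by
    intro t
    rw [Real.fourierInv_eq', ← integral_const_mul]
    refine integral_congr_ae (Eventually.of_forall fun ξ => ?_)
    simp only [smul_eq_mul, RCLike.inner_apply, conj_trivial]
    rw [show -(z - 2 * Real.pi * ξ * Complex.I) * t
      = -z * t + ((2 * Real.pi * (t * ξ) : ℝ) : ℂ) * Complex.I by push_cast; ring,
      Complex.exp_add]
    ring
  simp only [e1]
  rw [integral_integral_swap]
  · refine integral_congr_ae (Eventually.of_forall fun ξ => ?_)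
    simp only
    rw [integral_mul_const, integral_pow_mul_exp k (hre ξ)]
  · have h1 := (integrableOn_pow_mul_cexp k hz).mul_prod hh
    have h2 : Continuous fun p : ℝ × ℝ => Complex.exp (2 * Real.pi * p.2 * Complex.I * p.1) := by
      fun_prop
    refine (h1.bdd_mul (c := 1) h2.aestronglyMeasurable (Eventually.of_forall fun p => ?_)).congr
      (Eventually.of_forall fun p => ?_)
    · rw [Complex.norm_exp]
      simp
    · simp only [Function.uncurry]
      rw [show -(z - 2 * Real.pi * p.2 * Complex.I) * p.1
        = 2 * Real.pi * p.2 * Complex.I * p.1 + -z * p.1 by ring, Complex.exp_add]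
      ring

/-- Fourier inversion represents `χ (t)` as `∫ t^k e^{-s(ξ) t} h(ξ) dξ` with `s(ξ) = c - 2πiξ` on
the line `Re s = c` and `h` a Schwartz function. Hence each term of either side of the trace formula
is the integral against `h` of the corresponding term of the identity at `s(ξ)`, and only the
exchange of sum and integral has to be justified. -/
theorem traceIdentity_of_tsum_eq (hT : ∀ γ, 0 < T γ)
    (hw : Summable fun γ => ‖w γ‖ / T γ * Real.exp (-σ * T γ)) (hm : ∀ a, m a ≠ 0 → a.re ≤ C₀)
    {k : ℕ} {c : ℝ} (hcσ : σ < c) (hcC : C₀ < c)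
    (hs : Summable fun a : ℂ => (m a : ℝ) / ‖(c : ℂ) - a‖ ^ (k + 1))
    (heq : ∀ s : ℂ, s.re = c → ∑' γ, w γ * T γ ^ k * Complex.exp (-s * T γ)
      = ∑' a : ℂ, (m a : ℂ) * (k.factorial / (s - a) ^ (k + 1))) : TraceIdentity T w m := by
  intro χ h1 h2 h3
  have hcont := h1.continuous
  have hsupp0 : ∀ t, ¬ 0 < t → χ t = 0 := fun t ht => by
    by_contra hne
    exact ht (h3 (subset_tsupport χ hne))
  -- The division by `t ^ k` is harmless: the support of `χ` is a compact subset of the open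
  -- half-line.
  set ψ : ℝ → ℂ := fun t => ((χ t * (t ^ k)⁻¹ * Real.exp (c * t) : ℝ) : ℂ) with hψ
  have hψs : ContDiff ℝ ∞ ψ := by
    refine Complex.ofRealCLM.contDiff.comp (ContDiff.mul ?_ (by fun_prop))
    rw [contDiff_iff_contDiffAt]
    intro t
    by_cases ht : t = 0
    · have : (fun t => χ t * (t ^ k)⁻¹) =ᶠ[𝓝 t] fun _ => 0 := by
        have h0 : t ∉ tsupport χ := fun h => by
          have : (0 : ℝ) < t := h3 h
          exact this.ne' ht
        filter_upwards [(isClosed_tsupport χ).isOpen_compl.mem_nhds h0] with u hu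
        rw [image_eq_zero_of_notMem_tsupport hu, zero_mul]
      exact contDiffAt_const.congr_of_eventuallyEq this
    · exact h1.contDiffAt.mul ((contDiffAt_id.pow k).inv (pow_ne_zero k ht))
  have hψc : HasCompactSupport ψ := by
    refine h2.mono fun t ht hχ => ht ?_
    simp only [hψ, hχ, zero_mul, Complex.ofReal_zero]
  set S := hψc.toSchwartzMap hψs with hS
  set h : ℝ → ℂ := 𝓕 ψ with hh
  have hSh : ((𝓕 S : SchwartzMap ℝ ℂ) : ℝ → ℂ) = h := SchwartzMap.fourier_coe S
  have hhi : Integrable h := by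
    rw [← hSh]; exact SchwartzMap.integrable _
  have hhk : Integrable fun ξ : ℝ => ‖ξ‖ ^ (k + 1) * ‖h ξ‖ := by
    rw [← hSh]; exact SchwartzMap.integrable_pow_mul volume _ (k + 1)
  have hinv : 𝓕⁻ h = ψ := hψs.continuous.fourierInv_fourier_eq
    (hψs.continuous.integrable_of_hasCompactSupport hψc) hhi
  have hχψ : ∀ t : ℝ, 0 < t → (χ t : ℂ) = (t : ℂ) ^ k * Complex.exp (-c * t) * 𝓕⁻ h t := by
    intro t ht
    rw [hinv, hψ]
    have ht' : (t : ℂ) ≠ 0 := by exact_mod_cast ht.ne'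
    push_cast
    rw [show -(c : ℂ) * t = -(c * t) by ring, Complex.exp_neg]
    field_simp [Complex.exp_ne_zero]
  set s : ℝ → ℂ := fun ξ => c - 2 * Real.pi * ξ * Complex.I with hs'
  have hsre : ∀ ξ, (s ξ).re = c := fun ξ => by simp [hs']
  have hscont : Continuous s := by fun_prop
  -- the sum over the exponents `T γ`
  have hγ : HasSum (fun γ => w γ * χ (T γ)) (∫ ξ, ∑' γ, w γ * T γ ^ k *
      Complex.exp (-s ξ * T γ) * h ξ) := by
    have hsum := summable_pow_mul_exp hT hw k hcσ
    have hnorm : ∀ γ ξ, ‖w γ * T γ ^ k * Complex.exp (-s ξ * T γ) * h ξ‖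
        = ‖w γ‖ * (T γ ^ k * Real.exp (-c * T γ)) * ‖h ξ‖ := by
      intro γ ξ
      have := norm_pow_mul_exp k (s ξ) (hT γ).le
      rw [hsre] at this
      rw [norm_mul, mul_assoc (w γ), norm_mul, this]
    have hc : ∀ γ, Continuous fun ξ => w γ * T γ ^ k * Complex.exp (-s ξ * T γ) := by
      intro γ; fun_prop
    have hmain := hasSum_integral_of_summable (μ := volume)
      (F := fun γ ξ => w γ * T γ ^ k * Complex.exp (-s ξ * T γ) * h ξ)
      (S := Function.support fun γ => ‖w γ‖ * (T γ ^ k * Real.exp (-c * T γ)))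
      hsum.countable_support (fun γ hγ => ?_) (fun γ => ?_)
      (hsum.mul_right (∫ ξ, ‖h ξ‖)) (fun γ => ?_)
    · have e : (fun γ => w γ * (χ (T γ) : ℂ))
          = fun γ => ∫ ξ, w γ * T γ ^ k * Complex.exp (-s ξ * T γ) * h ξ := by
        funext γ
        rw [hχψ _ (hT γ), Real.fourierInv_eq', ← integral_const_mul, ← integral_const_mul]
        refine integral_congr_ae (Eventually.of_forall fun ξ => ?_)
        simp only [smul_eq_mul, RCLike.inner_apply, conj_trivial, hs']
        rw [show -((c : ℂ) - 2 * Real.pi * ξ * Complex.I) * T γ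
          = -c * T γ + ((2 * Real.pi * (T γ * ξ) : ℝ) : ℂ) * Complex.I by push_cast; ring,
          Complex.exp_add]
        ring
      rw [e]
      exact hmain
    · funext ξ
      rw [Function.mem_support, not_not] at hγ
      have := hnorm γ ξ
      rw [hγ, zero_mul, norm_eq_zero] at this
      exact this
    · refine (hhi.norm.const_mul (‖w γ‖ * (T γ ^ k * Real.exp (-c * T γ)))).mono'
        ((hc γ).aestronglyMeasurable.mul hhi.aestronglyMeasurable)
        (Eventually.of_forall fun ξ => (hnorm γ ξ).le)
    · simp only [hnorm]
      rw [integral_const_mul]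
  -- the sum over the exponents `a`
  have ha : HasSum (fun a : ℂ => (m a : ℂ) * ∫ t in Ioi (0 : ℝ), Complex.exp (a * t) * χ t)
      (∫ ξ, ∑' a : ℂ, (m a : ℂ) * (k.factorial / (s ξ - a) ^ (k + 1)) * h ξ) := by
    set δ := c - C₀ with hδ
    have hδ0 : 0 < δ := sub_pos.2 hcC
    set A := 2 * Real.pi / δ with hA
    have hA0 : 0 < A := by positivity
    -- Integrable since `h` has a finite moment of order `k + 1`; this moment pays for moving from
    -- `s(ξ)` back to the real point `c` in the denominators.
    set b : ℝ → ℝ := fun ξ => k.factorial * (2 ^ k * (‖h ξ‖ + A ^ (k + 1) * (‖ξ‖ ^ (k + 1) * ‖h ξ‖)))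
      with hb
    have hbi : Integrable b := ((hhi.norm.add (hhk.const_mul _)).const_mul _).const_mul _
    have hdist : ∀ a, m a ≠ 0 → ∀ ξ, δ ≤ ‖s ξ - a‖ := fun a ha ξ => by
      have h4 := hm a ha
      have h5 := Complex.re_le_norm (s ξ - a)
      rw [Complex.sub_re, hsre] at h5
      linarith
    have hne : ∀ a, m a ≠ 0 → ∀ ξ, s ξ - a ≠ 0 := fun a ha ξ h0 => by
      have := hdist a ha ξ
      rw [h0, norm_zero] at this
      linarith
    have hbd : ∀ a ξ, ‖(m a : ℂ) * (k.factorial / (s ξ - a) ^ (k + 1)) * h ξ‖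
        ≤ (m a : ℝ) / ‖(c : ℂ) - a‖ ^ (k + 1) * b ξ := by
      intro a ξ
      by_cases ha : m a = 0
      · simp [ha]
      have h4 := hdist a ha ξ
      have h6 : 0 < ‖s ξ - a‖ := hδ0.trans_le h4
      have h7 : 0 < ‖(c : ℂ) - a‖ := by
        have := hdist a ha 0
        simp only [hs', Complex.ofReal_zero, mul_zero, zero_mul, sub_zero] at this
        exact hδ0.trans_le this
      -- The shift by `2πξ` is compared with `‖s ξ - a‖`, which is at least `δ` because the zeros
      -- lie to the left of `C₀`.
      have h8 : ‖(c : ℂ) - a‖ ≤ ‖s ξ - a‖ * (1 + A * ‖ξ‖) := by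
        have h9 : (c : ℂ) - a = (s ξ - a) + 2 * Real.pi * ξ * Complex.I := by
          simp only [hs']; ring
        have h10 : ‖(2 * Real.pi * ξ * Complex.I : ℂ)‖ = δ * (A * ‖ξ‖) := by
          rw [norm_mul, norm_mul, norm_mul, Complex.norm_I, Complex.norm_real, Complex.norm_real,
            Complex.norm_ofNat, Real.norm_of_nonneg Real.pi_pos.le, hA]
          field_simp
        calc ‖(c : ℂ) - a‖ ≤ ‖s ξ - a‖ + δ * (A * ‖ξ‖) := by
              rw [h9, ← h10]; exact norm_add_le _ _
          _ ≤ ‖s ξ - a‖ + ‖s ξ - a‖ * (A * ‖ξ‖) := by gcongr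
          _ = _ := by ring
      have h11 : (‖s ξ - a‖ ^ (k + 1))⁻¹
          ≤ (‖(c : ℂ) - a‖ ^ (k + 1))⁻¹ * (2 ^ k * (1 + A ^ (k + 1) * ‖ξ‖ ^ (k + 1))) := by
        rw [← div_eq_inv_mul, inv_eq_one_div, div_le_div_iff₀ (by positivity) (by positivity),
          one_mul]
        calc ‖(c : ℂ) - a‖ ^ (k + 1) ≤ (‖s ξ - a‖ * (1 + A * ‖ξ‖)) ^ (k + 1) := by gcongr
          _ = (1 + A * ‖ξ‖) ^ (k + 1) * ‖s ξ - a‖ ^ (k + 1) := by rw [mul_pow]; ring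
          _ ≤ _ := by
            gcongr
            have := add_pow_le (zero_le_one (α := ℝ)) (by positivity : 0 ≤ A * ‖ξ‖) (k + 1)
            rwa [one_pow, mul_pow, Nat.add_sub_cancel] at this
      rw [norm_mul, norm_mul, norm_div, norm_pow, Complex.norm_natCast, Complex.norm_natCast,
        div_eq_mul_inv, div_eq_mul_inv]
      calc (m a : ℝ) * (k.factorial * (‖s ξ - a‖ ^ (k + 1))⁻¹) * ‖h ξ‖
          ≤ (m a : ℝ) * (k.factorial * ((‖(c : ℂ) - a‖ ^ (k + 1))⁻¹ *
            (2 ^ k * (1 + A ^ (k + 1) * ‖ξ‖ ^ (k + 1))))) * ‖h ξ‖ := by gcongr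
        _ = _ := by simp only [hb]; ring
    have hmeas : ∀ a, Integrable fun ξ => (m a : ℂ) * (k.factorial / (s ξ - a) ^ (k + 1)) * h ξ := by
      intro a
      refine (hbi.const_mul ((m a : ℝ) / ‖(c : ℂ) - a‖ ^ (k + 1))).mono' ?_
        (Eventually.of_forall fun ξ => hbd a ξ)
      by_cases ha : m a = 0
      · simp only [ha, Nat.cast_zero, zero_mul]
        exact aestronglyMeasurable_const
      · refine AEStronglyMeasurable.mul (Continuous.aestronglyMeasurable ?_) hhi.aestronglyMeasurable
        exact continuous_const.mul (continuous_const.div₀ ((hscont.sub continuous_const).pow _)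
          fun ξ => pow_ne_zero _ (hne a ha ξ))
    have hmain := hasSum_integral_of_summable (μ := volume)
      (F := fun (a : ℂ) ξ => (m a : ℂ) * (k.factorial / (s ξ - a) ^ (k + 1)) * h ξ)
      (S := Function.support fun a : ℂ => (m a : ℝ) / ‖(c : ℂ) - a‖ ^ (k + 1))
      hs.countable_support (fun a ha => ?_) hmeas
      (hs.mul_right (∫ ξ, b ξ)) (fun a => ?_)
    · have e : (fun a : ℂ => (m a : ℂ) * ∫ t in Ioi (0 : ℝ), Complex.exp (a * t) * χ t)
          = fun a : ℂ => ∫ ξ, (m a : ℂ) * (k.factorial / (s ξ - a) ^ (k + 1)) * h ξ := by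
        funext a
        by_cases ha : m a = 0
        · simp [ha]
        have hre : 0 < ((c : ℂ) - a).re := by
          have := hm a ha
          simp only [Complex.sub_re, Complex.ofReal_re]; linarith
        simp only [mul_assoc]
        rw [integral_const_mul]
        congr 1
        have h4 := integral_pow_mul_exp_mul_fourierInv k hre hhi
        rw [show (fun ξ : ℝ => (k.factorial : ℂ) / (s ξ - a) ^ (k + 1) * h ξ) = fun ξ : ℝ =>
          (k.factorial : ℂ) / ((c : ℂ) - a - 2 * Real.pi * ξ * Complex.I) ^ (k + 1) * h ξ by
            funext ξ; simp only [hs']; congr 3; ring, ← h4]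
        refine setIntegral_congr_fun measurableSet_Ioi fun t ht => ?_
        rw [hχψ t ht, show -((c : ℂ) - a) * t = a * t + -c * t by ring, Complex.exp_add]
        ring
      rw [e]
      exact hmain
    · funext ξ
      rw [Function.mem_support, not_not] at ha
      have := hbd a ξ
      rw [ha, zero_mul] at this
      exact norm_le_zero_iff.1 this
    · rw [← integral_const_mul]
      exact integral_mono (hmeas a).norm (hbi.const_mul _) fun ξ => hbd a ξ
  refine ⟨_, ha, ?_⟩
  convert hγ using 1
  refine integral_congr_ae (Eventually.of_forall fun ξ => ?_)
  simp only
  rw [tsum_mul_right, tsum_mul_right, heq _ (hsre ξ)]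

end ToTraceFormula

/-! ### The orbit side as a distribution on the half-line. -/

section OrbitDistribution

open MeasureTheory Set
open scoped BoundedContinuousFunction

variable {Γ : Type*} {T : Γ → ℝ} {w : Γ → ℂ} {σ : ℝ}

/-- On a compact set the factor `T e^{σT}` is bounded, so the weighted convergence of the Dirichlet
series gives plain convergence: the sum of Dirac masses is locally a finite measure. -/
theorem summable_norm_indicator (hT : ∀ γ, 0 < T γ)
    (hw : Summable fun γ => ‖w γ‖ / T γ * Real.exp (-σ * T γ)) {K : Set ℝ} (hK : IsCompact K) :
    Summable fun γ => ‖K.indicator (fun _ => w γ) (T γ)‖ := by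
  obtain ⟨C, hC⟩ := (hK.image (f := fun t : ℝ => t * Real.exp (σ * t)) (by fun_prop)).bddAbove
  refine Summable.of_nonneg_of_le (fun γ => norm_nonneg _) (fun γ => ?_) (hw.mul_left |C|)
  have hTγ := hT γ
  by_cases h : T γ ∈ K
  · rw [indicator_of_mem h]
    have h1 : T γ * Real.exp (σ * T γ) ≤ |C| := (hC ⟨_, h, rfl⟩).trans (le_abs_self C)
    calc ‖w γ‖ = (T γ * Real.exp (σ * T γ)) * (‖w γ‖ / T γ * Real.exp (-σ * T γ)) := by
          rw [neg_mul, Real.exp_neg]; field_simp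
      _ ≤ _ := by gcongr
  · rw [indicator_of_notMem h, norm_zero]
    positivity

/-- The sum of Dirac masses `∑ w γ δ_{T γ}` over the `γ` with `T γ ∈ K`, as a measure. -/
def diracSumOn (hT : ∀ γ, 0 < T γ)
    (hw : Summable fun γ => ‖w γ‖ / T γ * Real.exp (-σ * T γ)) {K : Set ℝ} (hK : IsCompact K) :
    (ℝ →ᵇ ℝ) →L[ℝ] ℂ :=
  have hb : ∀ (u : ℝ →ᵇ ℝ) γ, ‖K.indicator (fun _ => w γ) (T γ) * (u (T γ) : ℂ)‖
      ≤ ‖K.indicator (fun _ => w γ) (T γ)‖ * ‖u‖ := fun u γ => by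
    rw [norm_mul, Complex.norm_real]
    exact mul_le_mul_of_nonneg_left (u.norm_coe_le_norm _) (norm_nonneg _)
  have hs := summable_norm_indicator hT hw hK
  have hsu : ∀ u : ℝ →ᵇ ℝ, Summable fun γ => K.indicator (fun _ => w γ) (T γ) * (u (T γ) : ℂ) :=
    fun u => Summable.of_norm_bounded (hs.mul_right ‖u‖) (hb u)
  LinearMap.mkContinuous
    { toFun := fun u => ∑' γ, K.indicator (fun _ => w γ) (T γ) * (u (T γ) : ℂ)
      map_add' := fun u v => by
        rw [← (hsu u).tsum_add (hsu v)]
        refine tsum_congr fun γ => ?_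
        simp only [BoundedContinuousFunction.coe_add, Pi.add_apply, Complex.ofReal_add]
        ring
      map_smul' := fun c u => by
        rw [RingHom.id_apply, Complex.real_smul, ← tsum_mul_left]
        refine tsum_congr fun γ => ?_
        simp only [BoundedContinuousFunction.coe_smul, smul_eq_mul, Complex.ofReal_mul]
        ring }
    (∑' γ, ‖K.indicator (fun _ => w γ) (T γ)‖) fun u => by
      rw [← tsum_mul_right]
      exact tsum_of_norm_bounded (hs.mul_right ‖u‖).hasSum (hb u)

/-- The distribution `∑ w γ δ_{T γ}` on the half-line. -/
def diracSum (hT : ∀ γ, 0 < T γ)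
    (hw : Summable fun γ => ‖w γ‖ / T γ * Real.exp (-σ * T γ)) : 𝓓'(posHalfLine, ℂ) :=
  TestFunction.limitCLM ℝ (fun χ => ∑' γ, w γ * (χ (T γ) : ℂ))
    (fun K _ => (diracSumOn hT hw K.isCompact).comp
      (ContDiffMapSupportedIn.toBoundedContinuousFunctionCLM ℝ))
    fun K hK f => by
      refine tsum_congr fun γ => ?_
      change w γ * ((f (T γ) : ℝ) : ℂ) = (K : Set ℝ).indicator (fun _ => w γ) (T γ) * ((f (T γ) : ℝ) : ℂ)
      by_cases h : T γ ∈ (K : Set ℝ)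
      · rw [indicator_of_mem h]
      · have : f (T γ) = 0 := by
          by_contra hne
          exact h (f.tsupport_subset (subset_tsupport _ hne))
        rw [this]; simp

theorem diracSum_apply (hT : ∀ γ, 0 < T γ)
    (hw : Summable fun γ => ‖w γ‖ / T γ * Real.exp (-σ * T γ)) (χ : 𝓓(posHalfLine, ℝ)) :
    diracSum hT hw χ = ∑' γ, w γ * (χ (T γ) : ℂ) := rfl

end OrbitDistribution

/-! ### Dictionary between periodic orbits and abstract weights. -/

section Anosov

universe u
variable {d : ℕ} {M : Type u} [TopologicalSpace M]
  [ChartedSpace (EuclideanSpace ℝ (Fin (d + 1))) M] [IsManifold (𝓡 (d + 1)) ∞ M]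
  {V : VField d M} {φ : Flow ℝ M} {g : M → ℂ}
  {Eu Es : (x : M) → Submodule ℝ (TangentSpace (𝓡 (d + 1)) x)}

theorem detTerm_eq_dirTerm (h : IsAnosov V φ Eu Es) (γ : PeriodicOrbit φ) (s : ℂ) :
    γ.detTerm h g s = dirTerm (fun γ : PeriodicOrbit φ => γ.len) (fun γ => γ.weight h g) 0 s γ := by
  simp only [PeriodicOrbit.detTerm, dirTerm, PeriodicOrbit.weight, pow_zero, mul_one]
  ring

variable [MeasurableSpace M] {μ : MeasureTheory.Measure M}

theorem TraceFormula.traceIdentity {h : IsAnosov V φ Eu Es} (H : TraceFormula μ h g) :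
    TraceIdentity (fun γ : PeriodicOrbit φ => γ.len) (fun γ => γ.weight h g) (resMult μ V φ g) := by
  obtain ⟨T, hT⟩ := H
  intro χ h1 h2 h3
  let X : 𝓓(posHalfLine, ℝ) := ⟨χ, h1, h2, h3⟩
  exact ⟨T X, hT X⟩

/-- Beyond equality for each test function, the trace formula asks for one continuous functional;
absolute convergence on the orbit side provides it. -/
theorem TraceIdentity.traceFormula {h : IsAnosov V φ Eu Es} {σ : ℝ}
    (hw : Summable fun γ : PeriodicOrbit φ => ‖γ.weight h g‖ / γ.len * Real.exp (-σ * γ.len))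
    (H : TraceIdentity (fun γ : PeriodicOrbit φ => γ.len) (fun γ => γ.weight h g)
      (resMult μ V φ g)) : TraceFormula μ h g := by
  refine ⟨diracSum (fun γ => γ.len_pos) hw, fun χ => ?_⟩
  obtain ⟨v, h1, h2⟩ := H χ χ.contDiff χ.hasCompactSupport χ.tsupport_subset
  rw [diracSum_apply, h2.tsum_eq]
  exact ⟨h1, h2⟩

end Anosov

/-! ### Hadamard factorization and the two abstract implications. -/

section Factorization

open Set

theorem eqOn_sum_of_iteratedDeriv_eq_zero {U : Set ℂ} (hU : IsOpen U) (hconv : Convex ℝ U)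
    (k : ℕ) {F : ℂ → ℂ} (hF : AnalyticOnNhd ℂ F U) (h0 : ∀ z ∈ U, iteratedDeriv k F z = 0) :
    ∃ b : ℕ → ℂ, ∀ z ∈ U, F z = ∑ j ∈ Finset.range k, b j * z ^ j := by
  induction k generalizing F with
  | zero => exact ⟨fun _ => 0, fun z hz => by simpa using h0 z hz⟩
  | succ k ih =>
    obtain ⟨b, hb⟩ := ih hF.deriv (fun z hz => by rw [← iteratedDeriv_succ']; exact h0 z hz)
    set G : ℂ → ℂ := fun z => ∑ j ∈ Finset.range k, b j / (j + 1) * z ^ (j + 1) with hG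
    have hGd : ∀ z, HasDerivAt G (∑ j ∈ Finset.range k, b j * z ^ j) z := by
      intro z
      refine (HasDerivAt.fun_sum fun j _ => ((hasDerivAt_pow (j + 1) z).const_mul
        (b j / (j + 1)))).congr_deriv ?_
      refine Finset.sum_congr rfl fun j _ => ?_
      have : (j : ℂ) + 1 ≠ 0 := by exact_mod_cast Nat.succ_ne_zero j
      push_cast
      field_simp
    have hd : ∀ z ∈ U, HasDerivAt (fun z => F z - G z) 0 z := by
      intro z hz
      have h1 := (hF z hz).differentiableAt.hasDerivAt
      rw [hb z hz] at h1
      exact (h1.sub (hGd z)).congr_deriv (sub_self _)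
    rcases U.eq_empty_or_nonempty with rfl | ⟨z₀, hz₀⟩
    · exact ⟨fun _ => 0, fun z hz => absurd hz (notMem_empty z)⟩
    refine ⟨fun j => if j = 0 then F z₀ - G z₀ else b (j - 1) / j, fun z hz => ?_⟩
    have h2 : F z - G z = F z₀ - G z₀ := by
      refine hconv.is_const_of_fderivWithin_eq_zero (𝕜 := ℂ) (f := fun z => F z - G z)
        (fun z hz => (hd z hz).differentiableAt.differentiableWithinAt) (fun z hz => ?_) hz hz₀
      rw [fderivWithin_of_isOpen hU hz, (hd z hz).hasFDerivAt.fderiv]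
      ext; simp
    rw [Finset.sum_range_succ']
    simp only [Nat.add_eq_zero_iff, one_ne_zero, and_false, if_false, if_true, pow_zero, mul_one,
      Nat.add_sub_cancel]
    rw [← h2, hG]
    push_cast
    ring

theorem eqOn_exp_polynomial_of_logDeriv {U : Set ℂ} (hU : IsOpen U) (hconv : Convex ℝ U)
    {k : ℕ} {h : ℂ → ℂ} (hh : DifferentiableOn ℂ h U) (hne : ∀ z ∈ U, h z ≠ 0)
    {b : ℕ → ℂ} (hb : ∀ z ∈ U, logDeriv h z = ∑ j ∈ Finset.range k, b j * z ^ j) :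
    ∃ P : Polynomial ℂ, P.natDegree ≤ k ∧ ∀ z ∈ U, h z = Complex.exp (P.eval z) := by
  rcases U.eq_empty_or_nonempty with rfl | ⟨z₀, hz₀⟩
  · exact ⟨0, by simp, fun z hz => absurd hz (notMem_empty z)⟩
  set P₀ : Polynomial ℂ := ∑ j ∈ Finset.range k, Polynomial.C (b j / (j + 1)) *
    Polynomial.X ^ (j + 1) with hP₀
  have hdeg : P₀.natDegree ≤ k := by
    refine Polynomial.natDegree_sum_le_of_forall_le _ _ fun j hj => ?_
    refine (Polynomial.natDegree_C_mul_X_pow_le _ _).trans ?_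
    have := Finset.mem_range.1 hj
    omega
  have hd0 : ∀ z, P₀.derivative.eval z = ∑ j ∈ Finset.range k, b j * z ^ j := by
    intro z
    simp only [hP₀, Polynomial.derivative_sum, Polynomial.derivative_C_mul_X_pow,
      Polynomial.eval_finsetSum]
    refine Finset.sum_congr rfl fun j _ => ?_
    have : (j : ℂ) + 1 ≠ 0 := by exact_mod_cast Nat.succ_ne_zero j
    rw [Polynomial.eval_mul, Polynomial.eval_C, Polynomial.eval_pow, Polynomial.eval_X,
      Nat.add_sub_cancel, Nat.cast_add, Nat.cast_one, div_mul_cancel₀ _ this]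
  have hd : ∀ z ∈ U, HasDerivAt (fun z => h z * Complex.exp (-P₀.eval z)) 0 z := by
    intro z hz
    have h1 := (hh.differentiableAt (hU.mem_nhds hz)).hasDerivAt
    have h2 := ((P₀.hasDerivAt z).neg).cexp
    refine (h1.mul h2).congr_deriv ?_
    have h3 := hb z hz
    rw [logDeriv_apply, div_eq_iff (hne z hz)] at h3
    rw [h3, hd0]
    ring
  have hc : ∀ z ∈ U, h z * Complex.exp (-P₀.eval z) = h z₀ * Complex.exp (-P₀.eval z₀) := by
    intro z hz
    refine hconv.is_const_of_fderivWithin_eq_zero (𝕜 := ℂ)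
      (f := fun z => h z * Complex.exp (-P₀.eval z))
      (fun z hz => (hd z hz).differentiableAt.differentiableWithinAt) (fun z hz => ?_) hz hz₀
    rw [fderivWithin_of_isOpen hU hz, (hd z hz).hasFDerivAt.fderiv]
    ext; simp
  set c := h z₀ * Complex.exp (-P₀.eval z₀) with hcdef
  have hc0 : c ≠ 0 := mul_ne_zero (hne z₀ hz₀) (Complex.exp_ne_zero _)
  -- The integration constant goes into the exponent; it may raise no degree, and any logarithm of
  -- it serves.
  refine ⟨P₀ + Polynomial.C (Complex.log c), ?_, fun z hz => ?_⟩
  · rw [Polynomial.natDegree_add_C]; exact hdeg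
  · rw [Polynomial.eval_add, Polynomial.eval_C, Complex.exp_add, Complex.exp_log hc0, ← hc z hz,
      Complex.exp_neg]
    field_simp [Complex.exp_ne_zero]

variable {Γ : Type*} {T : Γ → ℝ} {w : Γ → ℂ} {σ : ℝ} {m : ℂ → ℕ} {C₀ : ℝ}

/-- Both `(f'/f)^{(k)}` and `(Q'/Q)^{(k)}` equal `(-1)^k k! ∑ m(a) / (x - a)^{k+1}`: the first by
the Laplace transform of the trace formula, the second by the formula for entire functions. The
choice `k = ⌈ρ⌉` gives both the convergence (`ρ ≤ k + 1`) and the growth of `Q` below `exp (ε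
r^{k+1})`. Test functions are real, whence the equality at real points first. -/
theorem exists_polynomial_of_traceIdentity (hT : ∀ γ, 0 < T γ)
    (hw : Summable fun γ => ‖w γ‖ / T γ * Real.exp (-σ * T γ)) (hm : ∀ a, m a ≠ 0 → a.re ≤ C₀)
    (hTF : TraceIdentity T w m) {ρ : ℝ} (hρ : 0 ≤ ρ)
    (hs : Summable fun a : ℂ => (m a : ℝ) / (1 + ‖a‖ ^ ρ)) :
    ∃ P : Polynomial ℂ, P.natDegree ≤ ⌈ρ⌉₊ ∧ ∃ σ' : ℝ, σ ≤ σ' ∧ ∀ s : ℂ, σ' < s.re →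
      Complex.exp (-∑' γ, dirTerm T w 0 s γ)
        = Complex.exp (P.eval s) * canonicalProduct m (minGenus m) s := by
  set k := ⌈ρ⌉₊ with hk
  set Q := canonicalProduct m (minGenus m) with hQ
  set f : ℂ → ℂ := fun s => Complex.exp (-∑' γ, dirTerm T w 0 s γ) with hf
  have hgs := summable_genusTerm_minGenus hρ hs
  have hQd : Differentiable ℂ Q := differentiable_canonicalProduct hgs
  have hQo : ∀ b, analyticOrderAt Q b = m b := analyticOrderAt_canonicalProduct hgs
  set σ' := max σ (max C₀ 0) with hσ'
  set U : Set ℂ := {z : ℂ | σ' < z.re} with hU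
  have hUo : IsOpen U := isOpen_lt continuous_const Complex.continuous_re
  have hUc : Convex ℝ U := convex_halfSpace_re_gt σ'
  have hUσ : ∀ z ∈ U, σ < z.re := fun z hz => (le_max_left _ _).trans_lt hz
  have hUC : ∀ z ∈ U, C₀ < z.re := fun z hz =>
    ((le_max_left _ _).trans (le_max_right _ _)).trans_lt hz
  have hU0 : ∀ z ∈ U, 0 < z.re := fun z hz =>
    ((le_max_right _ _).trans (le_max_right _ _)).trans_lt hz
  have hQ0 : ∀ z ∈ U, Q z ≠ 0 := by
    intro z hz
    have : m z = 0 := by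
      by_contra h
      have h1 := hm z h
      have h2 := hUC z hz
      linarith
    have h3 := hQo z
    rw [this, Nat.cast_zero, (hQd.analyticAt z).analyticOrderAt_eq_zero] at h3
    exact h3
  have hfd : DifferentiableOn ℂ f U := fun z hz =>
    ((hasDerivAt_tsum_dirTerm hT hw 0 (hUσ z hz)).neg.cexp).differentiableAt.differentiableWithinAt
  have hf0 : ∀ z, f z ≠ 0 := fun z => Complex.exp_ne_zero _
  have hfa : AnalyticOnNhd ℂ f U := hfd.analyticOnNhd hUo
  have hQa : AnalyticOnNhd ℂ Q U := fun z _ => hQd.analyticAt z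
  have hlf : AnalyticOnNhd ℂ (logDeriv f) U := fun z hz => (hfa.deriv z hz).div (hfa z hz) (hf0 z)
  have hlQ : AnalyticOnNhd ℂ (logDeriv Q) U :=
    fun z hz => (hQa.deriv z hz).div (hQa z hz) (hQ0 z hz)
  have hF : AnalyticOnNhd ℂ (logDeriv f - logDeriv Q) U := hlf.sub hlQ
  -- on the real axis
  have hreal : ∀ x : ℝ, (x : ℂ) ∈ U → iteratedDeriv k (logDeriv f - logDeriv Q) x = 0 := by
    intro x hx
    have hsx : Summable fun a : ℂ => (m a : ℝ) / ‖(x : ℂ) - a‖ ^ (k + 1) :=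
      summable_div_pow hρ hs (by push_cast; linarith [Nat.le_ceil ρ]) x
    rw [iteratedDeriv_sub (hlf x hx).contDiffAt (hlQ x hx).contDiffAt,
      iteratedDeriv_logDeriv_eq_tsum hT hw (fun s _ => rfl) k (hUσ x hx),
      tsum_pow_mul_exp_eq hT hw hm hTF k (x := x) (by simpa using hU0 x hx) (by simpa using hUσ x hx)
        (by simpa using hUC x hx) hsx]
    have hsum : Summable fun a : ℂ => (m a : ℂ) * ((-1) ^ k * k.factorial / (x - a) ^ (k + 1)) := by
      refine Summable.of_norm ((hsx.mul_left (k.factorial : ℝ)).congr fun a => ?_)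
      simp only [norm_mul, norm_div, norm_pow, norm_neg, norm_one, one_pow, one_mul,
        Complex.norm_natCast]
      ring
    have h1 := hasSum_iteratedDeriv_logDeriv hQd hQo (hQ0 x hx)
      (hasGrowth_canonicalProduct hρ hs).growthLT hsum
    rw [← h1.tsum_eq, ← tsum_mul_left, sub_eq_zero]
    refine tsum_congr fun a => ?_
    ring
  -- From the real ray to the half-plane by the identity theorem.
  have hzero : ∀ z ∈ U, iteratedDeriv k (logDeriv f - logDeriv Q) z = 0 := by
    have hx₀ : ((σ' + 1 : ℝ) : ℂ) ∈ U := by simp [hU]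
    have han : AnalyticOnNhd ℂ (iteratedDeriv k (logDeriv f - logDeriv Q)) U := by
      rw [iteratedDeriv_eq_iterate]; exact hF.iterated_deriv k
    have := han.eqOn_zero_of_preconnected_of_frequently_eq_zero hUc.isPreconnected hx₀ ?_
    · exact fun z hz => this hz
    · have hlim : Tendsto (fun x : ℝ => (x : ℂ)) (𝓝[≠] (σ' + 1)) (𝓝[≠] ((σ' + 1 : ℝ) : ℂ)) := by
        refine tendsto_nhdsWithin_of_tendsto_nhds_of_eventually_within _
          (Complex.continuous_ofReal.continuousAt.mono_left nhdsWithin_le_nhds) ?_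
        filter_upwards [self_mem_nhdsWithin] with x hx
        exact fun h => hx (Complex.ofReal_injective h)
      refine hlim.frequently (Eventually.frequently ?_)
      refine nhdsWithin_le_nhds ?_
      filter_upwards [lt_mem_nhds (show σ' < σ' + 1 by linarith)] with x hx
      exact hreal x (by simpa [hU] using hx)
  obtain ⟨b, hb⟩ := eqOn_sum_of_iteratedDeriv_eq_zero hUo hUc k hF hzero
  obtain ⟨P, hP, hPe⟩ := eqOn_exp_polynomial_of_logDeriv (h := fun z => f z / Q z) hUo hUc (k := k)
    (fun z hz => ((hfa z hz).differentiableAt.div (hQd z) (hQ0 z hz)).differentiableWithinAt)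
    (fun z hz => div_ne_zero (hf0 z) (hQ0 z hz)) (b := b) (fun z hz => by
      rw [← hb z hz, logDeriv_div z (hf0 z) (hQ0 z hz) (hfa z hz).differentiableAt (hQd z)]
      rfl)
  refine ⟨P, hP, σ', le_max_left _ _, fun s hs' => ?_⟩
  rw [← hPe s hs']
  field_simp [hQ0 s hs']
  rfl

/-- An exponential does not vanish, so all zeros lie in `Re a ≤ σ` and both expansions of
`(f'/f)^{(k)}` are available on `Re s = σ + 1`; the integration over this line then gives the trace
formula. -/
theorem traceIdentity_of_entire (hT : ∀ γ, 0 < T γ)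
    (hw : Summable fun γ => ‖w γ‖ / T γ * Real.exp (-σ * T γ)) {f : ℂ → ℂ}
    (hf : Differentiable ℂ f) (hfo : entireOrder f < ⊤) (hm : ∀ a, analyticOrderAt f a = m a)
    (hfe : ∀ s : ℂ, σ < s.re → f s = Complex.exp (-∑' γ, dirTerm T w 0 s γ)) :
    TraceIdentity T w m ∧ ∃ ρ : ℝ, 0 ≤ ρ ∧ Summable fun a : ℂ => (m a : ℝ) / (1 + ‖a‖ ^ ρ) := by
  have hf0 : ∀ s : ℂ, σ < s.re → f s ≠ 0 := fun s hs => by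
    rw [hfe s hs]; exact Complex.exp_ne_zero _
  have hmσ : ∀ a, m a ≠ 0 → a.re ≤ σ := by
    intro a ha
    by_contra! h
    have h1 := (hf.analyticAt a).analyticOrderAt_eq_zero.2 (hf0 a h)
    rw [hm a] at h1
    exact ha (by exact_mod_cast h1)
  have hc : f ((σ + 1 : ℝ) : ℂ) ≠ 0 := hf0 _ (by simp)
  obtain ⟨K, hK⟩ := exists_growthLT_of_entireOrder_lt_top hf hfo
  obtain ⟨q, hq⟩ := exists_summable_order hf hm hc hK
  refine ⟨?_, q, Nat.cast_nonneg q, hq⟩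
  -- Large enough both for the growth of `f` and for the convergence of the sum over its zeros.
  set k := max K q with hk
  have hgr : GrowthLT f (k + 1) := by
    intro ε hε
    obtain ⟨R₀, hR₀⟩ := hK ε hε
    refine ⟨max R₀ 1, fun R hR z hz => (hR₀ R ((le_max_left _ _).trans hR) z hz).trans ?_⟩
    have : R ^ K ≤ R ^ (k + 1) := pow_le_pow_right₀ ((le_max_right _ _).trans hR)
      ((le_max_left K q).trans (Nat.le_succ _))
    gcongr
  have hqk : (q : ℝ) ≤ (k + 1 : ℕ) := by
    exact_mod_cast (le_max_right K q).trans (Nat.le_succ _)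
  have hsum := fun c => summable_div_pow (Nat.cast_nonneg q) hq hqk c
  refine traceIdentity_of_tsum_eq hT hw hmσ (c := σ + 1) (k := k) (by linarith) (by linarith)
    (hsum _) fun s hs => ?_
  have hss : σ < s.re := by rw [hs]; linarith
  have hsum' : Summable fun a : ℂ => (m a : ℂ) * ((-1) ^ k * k.factorial / (s - a) ^ (k + 1)) := by
    refine Summable.of_norm (((hsum s).mul_left (k.factorial : ℝ)).congr fun a => ?_)
    simp only [norm_mul, norm_div, norm_pow, norm_neg, norm_one, one_pow, one_mul,
      Complex.norm_natCast]
    ring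
  have h1 := (hasSum_iteratedDeriv_logDeriv hf hm (hf0 s hss) hgr hsum').tsum_eq
  rw [iteratedDeriv_logDeriv_eq_tsum hT hw hfe k hss] at h1
  have h2 : ((-1 : ℂ) ^ k) * (-1) ^ k = 1 := by
    rw [← mul_pow]; simp
  calc ∑' γ, w γ * T γ ^ k * Complex.exp (-s * T γ)
      = (-1) ^ k * ((-1) ^ k * ∑' γ, w γ * T γ ^ k * Complex.exp (-s * T γ)) := by
        rw [← mul_assoc, h2, one_mul]
    _ = _ := by
        rw [← h1, ← tsum_mul_left]
        refine tsum_congr fun a => ?_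
        linear_combination ((m a : ℂ) * (k.factorial / (s - a) ^ (k + 1))) * h2

end Factorization

/-! ### The implications for the dynamical determinant. -/

section MainEquivalence

universe u
variable {d : ℕ} {M : Type u} [TopologicalSpace M]
  [ChartedSpace (EuclideanSpace ℝ (Fin (d + 1))) M] [IsManifold (𝓡 (d + 1)) ∞ M]
  {V : VField d M} {φ : Flow ℝ M} {g : M → ℂ}
  {Eu Es : (x : M) → Submodule ℝ (TangentSpace (𝓡 (d + 1)) x)}

theorem summable_weight_of_summable_detTerm {h : IsAnosov V φ Eu Es} {σ : ℝ}
    (hs : Summable fun γ : PeriodicOrbit φ => γ.detTerm h g σ) :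
    Summable fun γ : PeriodicOrbit φ => ‖γ.weight h g‖ / γ.len * Real.exp (-σ * γ.len) := by
  refine hs.norm.congr fun γ => ?_
  rw [detTerm_eq_dirTerm, norm_dirTerm fun γ : PeriodicOrbit φ => γ.len_pos]
  simp

theorem summable_detTerm_of_summable_weight {h : IsAnosov V φ Eu Es} {σ : ℝ}
    (hw : Summable fun γ : PeriodicOrbit φ => ‖γ.weight h g‖ / γ.len * Real.exp (-σ * γ.len))
    {s : ℂ} (hs : σ < s.re) : Summable fun γ : PeriodicOrbit φ => γ.detTerm h g s := by
  simp only [detTerm_eq_dirTerm]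
  exact (summable_norm_dirTerm (fun γ : PeriodicOrbit φ => γ.len_pos) hw 0 hs).of_norm

variable [MeasurableSpace M] {μ : MeasureTheory.Measure M}

theorem exists_entireExtension_of_traceFormula (hA : IsAnosov V φ Eu Es) {σ : ℝ}
    (hw : Summable fun γ : PeriodicOrbit φ => ‖γ.weight hA g‖ / γ.len * Real.exp (-σ * γ.len))
    {C₀ : ℝ} (hres : ∀ a, resMult μ V φ g a ≠ 0 → a.re ≤ C₀) (hTF : TraceFormula μ hA g)
    {ρ : ℝ} (hρ : 0 ≤ ρ) (hs : Summable fun a : ℂ => (resMult μ V φ g a : ℝ) / (1 + ‖a‖ ^ ρ)) :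
    ∃ f : ℂ → ℂ, IsEntireExtension hA g f ∧ entireOrder f < ⊤ ∧
      ∀ a : ℂ, analyticOrderAt f a = (resMult μ V φ g a : ℕ∞) := by
  obtain ⟨P, hP, σ', hσ, hPe⟩ := exists_polynomial_of_traceIdentity (fun γ => γ.len_pos) hw hres
    hTF.traceIdentity hρ hs
  have hgs := summable_genusTerm_minGenus hρ hs
  have hQ := differentiable_canonicalProduct hgs
  have hE : Differentiable ℂ fun z => Complex.exp (P.eval z) := P.differentiable.cexp
  refine ⟨fun z => Complex.exp (P.eval z) * canonicalProduct (resMult μ V φ g)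
    (minGenus (resMult μ V φ g)) z, ⟨hE.mul hQ, σ', fun s hs' => ⟨?_, ?_⟩⟩, ?_, fun a => ?_⟩
  · exact summable_detTerm_of_summable_weight hw (hσ.trans_lt hs')
  · simp only [detTerm_eq_dirTerm]
    exact (hPe s hs').symm
  · exact lt_of_le_of_lt ((hasGrowth_exp_polynomial P hP).mul
      (hasGrowth_canonicalProduct hρ hs)).entireOrder_le (EReal.coe_lt_top _)
  · have h := analyticOrderAt_mul (hE.analyticAt a) (hQ.analyticAt a)
    rw [(hE.analyticAt a).analyticOrderAt_eq_zero.2 (Complex.exp_ne_zero _), zero_add,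
      analyticOrderAt_canonicalProduct hgs a] at h
    exact h

theorem traceFormula_of_entireExtension (hA : IsAnosov V φ Eu Es) {f : ℂ → ℂ}
    (hf : IsEntireExtension hA g f) (hfo : entireOrder f < ⊤)
    (hm : ∀ a : ℂ, analyticOrderAt f a = (resMult μ V φ g a : ℕ∞)) :
    TraceFormula μ hA g ∧ ∃ ρ : ℝ, 0 ≤ ρ ∧
      Summable fun a : ℂ => (resMult μ V φ g a : ℝ) / (1 + ‖a‖ ^ ρ) := by
  obtain ⟨hfd, σ, hσ⟩ := hf
  have hw := summable_weight_of_summable_detTerm (σ := σ + 1)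
    (hσ ((σ + 1 : ℝ) : ℂ) (by simp)).1
  obtain ⟨h1, h2⟩ := traceIdentity_of_entire (fun γ : PeriodicOrbit φ => γ.len_pos) hw hfd hfo hm
    (fun s hs => by
      simp only [← detTerm_eq_dirTerm hA]
      exact (hσ s (by linarith)).2)
  exact ⟨h1.traceFormula hw, h2⟩

/-- Convergence of the orbit series is part of the data of the extension `f`. The factorization
holds on a half-plane and propagates to `ℂ` by the identity theorem, so it applies to every entire
extension. -/
theorem factorization_of_traceFormula (hA : IsAnosov V φ Eu Es)
    {C₀ : ℝ} (hres : ∀ a, resMult μ V φ g a ≠ 0 → a.re ≤ C₀) (hTF : TraceFormula μ hA g)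
    {ρ : ℝ} (hρ : 0 ≤ ρ) (hs : Summable fun a : ℂ => (resMult μ V φ g a : ℝ) / (1 + ‖a‖ ^ ρ))
    {f : ℂ → ℂ} (hf : IsEntireExtension hA g f) :
    entireOrder f ≤ ((⌈ρ⌉₊ : ℝ) : EReal) ∧
      ∃ (P : Polynomial ℂ) (Q : ℂ → ℂ), P.natDegree ≤ ⌈ρ⌉₊ ∧
        IsCanonicalProduct (resMult μ V φ g) Q ∧
        ∀ z : ℂ, f z = Complex.exp (P.eval z) * Q z := by
  obtain ⟨hfd, σ, hσ⟩ := hf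
  have hw := summable_weight_of_summable_detTerm (σ := σ + 1)
    (hσ ((σ + 1 : ℝ) : ℂ) (by simp)).1
  obtain ⟨P, hP, σ', hσ', hPe⟩ := exists_polynomial_of_traceIdentity (fun γ => γ.len_pos) hw hres
    hTF.traceIdentity hρ hs
  have hgs := summable_genusTerm_minGenus hρ hs
  have hQ := differentiable_canonicalProduct hgs
  have hE : Differentiable ℂ fun z => Complex.exp (P.eval z) := P.differentiable.cexp
  have heq : f = fun z => Complex.exp (P.eval z) * canonicalProduct (resMult μ V φ g)
      (minGenus (resMult μ V φ g)) z := by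
    refine AnalyticOnNhd.eq_of_eventuallyEq (z₀ := ((σ' + 1 : ℝ) : ℂ))
      (fun z _ => hfd.analyticAt z) (fun z _ => (hE.mul hQ).analyticAt z) ?_
    have hopen : IsOpen {z : ℂ | σ' < z.re} := isOpen_lt continuous_const Complex.continuous_re
    filter_upwards [hopen.mem_nhds (show ((σ' + 1 : ℝ) : ℂ) ∈ {z : ℂ | σ' < z.re} by simp)]
      with s hs'
    have hs'' : σ' < s.re := hs'
    rw [← hPe s hs', (hσ s (by linarith)).2]
    simp only [detTerm_eq_dirTerm]
  refine ⟨?_, P, _, hP, fun z => hasProd_canonicalProduct hgs z, fun z => congrFun heq z⟩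
  rw [heq]
  exact ((hasGrowth_exp_polynomial P hP).mul (hasGrowth_canonicalProduct hρ hs)).entireOrder_le

end MainEquivalence

/-! ### Uniform first-order expansions in charts. -/

section LocalExpansion

open Set Asymptotics

universe u
variable {d : ℕ} {M : Type u} [TopologicalSpace M]
  [ChartedSpace (EuclideanSpace ℝ (Fin (d + 1))) M] [IsManifold (𝓡 (d + 1)) ∞ M]
  {F : Type*} [NormedAddCommGroup F] [NormedSpace ℝ F]

theorem contDiffOn_comp_extChartAt_symm {f : ℝ × M → F}
    (hf : ContMDiff (𝓘(ℝ, ℝ).prod (𝓡 (d + 1))) 𝓘(ℝ, F) ∞ f) (x : M) :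
    ContDiffOn ℝ ∞
      (fun p : ℝ × EuclideanSpace ℝ (Fin (d + 1)) => f (p.1, (extChartAt (𝓡 (d + 1)) x).symm p.2))
      (univ ×ˢ (extChartAt (𝓡 (d + 1)) x).target) := by
  have h1 : ContMDiffOn (𝓘(ℝ, ℝ).prod 𝓘(ℝ, EuclideanSpace ℝ (Fin (d + 1))))
      (𝓘(ℝ, ℝ).prod (𝓡 (d + 1))) ∞
      (fun p : ℝ × EuclideanSpace ℝ (Fin (d + 1)) => (p.1, (extChartAt (𝓡 (d + 1)) x).symm p.2))
      (univ ×ˢ (extChartAt (𝓡 (d + 1)) x).target) :=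
    ContMDiffOn.prodMk contMDiffOn_fst
      ((contMDiffOn_extChartAt_symm x).comp contMDiffOn_snd fun p hp => hp.2)
  have h2 := hf.comp_contMDiffOn h1
  rw [← contMDiffOn_iff_contDiffOn, modelWithCornersSelf_prod, ← chartedSpaceSelf_prod]
  exact h2

theorem contDiffAt_comp_extChartAt_symm {f : ℝ × M → F}
    (hf : ContMDiff (𝓘(ℝ, ℝ).prod (𝓡 (d + 1))) 𝓘(ℝ, F) ∞ f) (s : ℝ) {x y : M}
    (hy : y ∈ (extChartAt (𝓡 (d + 1)) x).source) :
    ContDiffAt ℝ ∞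
      (fun p : ℝ × EuclideanSpace ℝ (Fin (d + 1)) => f (p.1, (extChartAt (𝓡 (d + 1)) x).symm p.2))
      (s, extChartAt (𝓡 (d + 1)) x y) := by
  refine (contDiffOn_comp_extChartAt_symm hf x).contDiffAt ?_
  refine prod_mem_nhds univ_mem ?_
  exact (isOpen_extChartAt_target x).mem_nhds ((extChartAt (𝓡 (d + 1)) x).map_source hy)

theorem mfderiv_eq_fderiv_extChartAt {f : M → F} {x : M}
    (hf : MDifferentiableAt (𝓡 (d + 1)) 𝓘(ℝ, F) f x) :
    mfderiv (𝓡 (d + 1)) 𝓘(ℝ, F) f x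
      = fderiv ℝ (f ∘ (extChartAt (𝓡 (d + 1)) x).symm) (extChartAt (𝓡 (d + 1)) x x) := by
  simp [mfderiv, hf, writtenInExtChartAt, mfld_simps]
  rfl

/-- The derivative of `f (s, ·)` at `x`. -/
def spaceDeriv (f : ℝ × M → F) (s : ℝ) (x : M) : EuclideanSpace ℝ (Fin (d + 1)) →L[ℝ] F :=
  mfderiv (𝓡 (d + 1)) 𝓘(ℝ, F) (fun y => f (s, y)) x

/-- First order expansion of a smooth map `f` at `(s, x)`, uniform in pairs of points. -/
theorem strict_expansion {f : ℝ × M → F}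
    (hf : ContMDiff (𝓘(ℝ, ℝ).prod (𝓡 (d + 1))) 𝓘(ℝ, F) ∞ f) (s : ℝ) (x : M) :
    (fun p : (ℝ × M) × (ℝ × M) => f (s + p.1.1, p.1.2) - f (s + p.2.1, p.2.2) -
        (spaceDeriv f s x (extChartAt (𝓡 (d + 1)) x p.1.2 - extChartAt (𝓡 (d + 1)) x p.2.2) +
          (p.1.1 - p.2.1) • deriv (fun t => f (t, x)) s))
      =o[𝓝 (((0 : ℝ), x), ((0 : ℝ), x))] fun p => (p.1.1 - p.2.1,
        extChartAt (𝓡 (d + 1)) x p.1.2 - extChartAt (𝓡 (d + 1)) x p.2.2) := by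
  set e := extChartAt (𝓡 (d + 1)) x with he
  set Ψ : ℝ × EuclideanSpace ℝ (Fin (d + 1)) → F := fun p => f (p.1, e.symm p.2) with hΨ
  -- Smoothness in the chart gives strict differentiability, hence an error relative to the
  -- difference of two moving points.
  have hc : ContDiffAt ℝ ∞ Ψ (s, e x) := contDiffAt_comp_extChartAt_symm hf s (mem_extChartAt_source x)
  have hstrict := hc.hasStrictFDerivAt (by simp)
  set L := fderiv ℝ Ψ (s, e x) with hL
  have hex : e.symm (e x) = x := extChartAt_to_inv x
  have h1 : ∀ t : ℝ, L (t, 0) = t • deriv (fun t => f (t, x)) s := by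
    intro t
    have h := (hstrict.hasFDerivAt.comp_hasDerivAt s
      (f := fun t : ℝ => (t, e x)) ((hasDerivAt_id s).prodMk (hasDerivAt_const s (e x)))).deriv
    have e1 : (Ψ ∘ fun t : ℝ => (t, e x)) = fun t => f (t, x) := by
      funext t; simp only [hΨ, Function.comp, hex]
    rw [e1] at h
    rw [h, ← map_smul]
    simp
  have h2 : ∀ v : EuclideanSpace ℝ (Fin (d + 1)),
      L (0, v) = spaceDeriv f s x v := by
    intro v
    have hmd : MDifferentiableAt (𝓡 (d + 1)) 𝓘(ℝ, F) (fun y => f (s, y)) x :=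
      (hf.comp (contMDiff_const.prodMk contMDiff_id)).mdifferentiable (by simp) x
    rw [spaceDeriv, mfderiv_eq_fderiv_extChartAt hmd]
    have h := (hstrict.hasFDerivAt.comp (f := fun y => (s, y)) (e x)
      ((hasFDerivAt_const s (e x)).prodMk (hasFDerivAt_id (e x)))).fderiv
    have e1 : (Ψ ∘ fun y => (s, y)) = (fun y => f (s, y)) ∘ e.symm := rfl
    rw [e1] at h
    exact (congrArg (fun l => l v) h).symm
  have htend : Tendsto (fun p : (ℝ × M) × (ℝ × M) => ((s + p.1.1, e p.1.2), (s + p.2.1, e p.2.2)))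
      (𝓝 (((0 : ℝ), x), ((0 : ℝ), x))) (𝓝 ((s, e x), (s, e x))) := by
    have hce := continuousAt_extChartAt (I := 𝓡 (d + 1)) x
    have hs : Tendsto (fun t : ℝ => s + t) (𝓝 0) (𝓝 s) := by
      simpa using (by fun_prop : Continuous fun t : ℝ => s + t).tendsto 0
    have h3 : Tendsto (fun p : ℝ × M => (s + p.1, e p.2)) (𝓝 (0, x)) (𝓝 (s, e x)) := by
      rw [nhds_prod_eq, nhds_prod_eq]
      exact hs.prodMap hce.tendsto
    rw [nhds_prod_eq (x := ((0 : ℝ), x)), nhds_prod_eq (x := (s, e x))]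
    exact h3.prodMap h3
  have hlit := hstrict.isLittleO.comp_tendsto htend
  refine IsLittleO.congr' hlit ?_ ?_
  · have hsrc : ∀ᶠ y in 𝓝 x, y ∈ e.source := extChartAt_source_mem_nhds x
    have hsrc' : ∀ᶠ p in 𝓝 (((0 : ℝ), x), ((0 : ℝ), x)), p.1.2 ∈ e.source ∧ p.2.2 ∈ e.source := by
      refine Eventually.and ?_ ?_
      · exact ((continuous_snd.comp continuous_fst).tendsto
          (((0 : ℝ), x), ((0 : ℝ), x))).eventually hsrc
      · exact ((continuous_snd.comp continuous_snd).tendsto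
          (((0 : ℝ), x), ((0 : ℝ), x))).eventually hsrc
    filter_upwards [hsrc'] with p hp
    simp only [Function.comp, hΨ, e.left_inv hp.1, e.left_inv hp.2]
    congr 1
    rw [← h1, ← h2, ← map_add]
    congr 1
    ext <;> simp
  · refine Eventually.of_forall fun p => ?_
    simp

end LocalExpansion

/-! ### Flows on a manifold embedded in a Euclidean space. -/

section EmbeddedFlow

open Set Asymptotics

universe u
variable {d : ℕ} {M : Type u} [TopologicalSpace M]
  [ChartedSpace (EuclideanSpace ℝ (Fin (d + 1))) M] [IsManifold (𝓡 (d + 1)) ∞ M]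

/-- The data of a smooth flow without fixed points on `M`, together with an embedding of `M`
in a Euclidean space. -/
structure EmbeddedFlow (V : VField d M) (φ : Flow ℝ M) (N : ℕ) where
  /-- the embedding -/
  emb : M → EuclideanSpace ℝ (Fin N)
  emb_smooth : ContMDiff (𝓡 (d + 1)) (𝓡 N) ∞ emb
  emb_closed : IsClosedEmbedding emb
  emb_deriv : ∀ x, Function.Injective (mfderiv (𝓡 (d + 1)) (𝓡 N) emb x)
  flow_smooth : ContMDiff (𝓘(ℝ, ℝ).prod (𝓡 (d + 1))) (𝓡 (d + 1)) ∞ (fun p : ℝ × M => φ p.1 p.2)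
  flow_curve : ∀ x : M, IsMIntegralCurve (I := 𝓡 (d + 1)) (fun t : ℝ => φ t x) V
  ne_zero : ∀ x, V x ≠ 0

namespace EmbeddedFlow

variable {V : VField d M} {φ : Flow ℝ M} {N : ℕ} (D : EmbeddedFlow V φ N)
include D

/-- The position of `φ s x` in the Euclidean space. -/
def pos (p : ℝ × M) : EuclideanSpace ℝ (Fin N) := D.emb (φ p.1 p.2)

/-- The derivative of `pos` with respect to the point. -/
def J (s : ℝ) (x : M) : EuclideanSpace ℝ (Fin (d + 1)) →L[ℝ] EuclideanSpace ℝ (Fin N) :=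
  spaceDeriv D.pos s x

/-- The velocity of the flow in the Euclidean space. -/
def W (x : M) : EuclideanSpace ℝ (Fin N) := mfderiv (𝓡 (d + 1)) (𝓡 N) D.emb x (V x)

theorem pos_smooth : ContMDiff (𝓘(ℝ, ℝ).prod (𝓡 (d + 1))) (𝓡 N) ∞ D.pos :=
  D.emb_smooth.comp D.flow_smooth

theorem continuous_pos : Continuous D.pos := D.pos_smooth.continuous

theorem pos_zero (x : M) : D.pos (0, x) = D.emb x := by simp [pos]

theorem pos_add (s t : ℝ) (x : M) : D.pos (s + t, x) = D.pos (s, φ t x) := by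
  simp [pos, φ.map_add]

theorem eq_of_pos_eq {x y : M} {s t : ℝ} (h : D.pos (s, x) = D.pos (t, y)) : φ s x = φ t y :=
  D.emb_closed.injective h

theorem hasDerivAt_pos (s : ℝ) (x : M) :
    HasDerivAt (fun t => D.pos (t, x)) (D.W (φ s x)) s := by
  have h1 := (D.emb_smooth.mdifferentiable (by simp) (φ s x)).hasMFDerivAt
  have h2 := h1.comp s (D.flow_curve x s)
  set L : EuclideanSpace ℝ (Fin (d + 1)) →L[ℝ] EuclideanSpace ℝ (Fin N) :=
    mfderiv (𝓡 (d + 1)) (𝓡 N) D.emb (φ s x) with hL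
  set v : EuclideanSpace ℝ (Fin (d + 1)) := V (φ s x) with hv
  have h3 : HasFDerivAt (fun t => D.pos (t, x))
      (L.comp (ContinuousLinearMap.smulRight (1 : ℝ →L[ℝ] ℝ) v)) s := h2.hasFDerivAt
  refine h3.hasDerivAt.congr_deriv ?_
  rw [ContinuousLinearMap.comp_apply, ContinuousLinearMap.smulRight_apply]
  rw [one_apply_eq_self, one_smul]
  rfl

theorem J_zero (x : M) : D.J 0 x = mfderiv (𝓡 (d + 1)) (𝓡 N) D.emb x := by
  have : (fun y => D.pos (0, y)) = D.emb := funext D.pos_zero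
  rw [J, spaceDeriv, this]

/-- By the chain rule, `‖D.J s x v‖` is the size of `Dφ^s v` in the metric induced by the embedding,
so tangent vectors at different points are compared in one normed space. -/
theorem J_eq (s : ℝ) (x : M) (v : TangentSpace (𝓡 (d + 1)) x) :
    D.J s x v = D.J 0 (φ s x) (mfderiv (𝓡 (d + 1)) (𝓡 (d + 1)) (φ s) x v) := by
  have hs : MDifferentiableAt (𝓡 (d + 1)) (𝓡 (d + 1)) (φ s) x :=
    (D.flow_smooth.comp (contMDiff_const.prodMk contMDiff_id)).mdifferentiable (by simp) x
  have h := mfderiv_comp x (D.emb_smooth.mdifferentiable (by simp) (φ s x)) hs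
  have e : (D.emb ∘ φ s) = fun y => D.pos (s, y) := rfl
  rw [e] at h
  rw [J_zero]
  exact congrArg (fun l => l v) h

theorem injective_J_zero (x : M) : Function.Injective (D.J 0 x) := by
  rw [J_zero]; exact D.emb_deriv x

theorem W_eq (x : M) : D.W x = D.J 0 x (V x) := by rw [J_zero]; rfl

theorem W_ne_zero (x : M) : D.W x ≠ 0 := by
  rw [W_eq]
  intro h
  rw [← map_zero (D.J 0 x)] at h
  exact D.ne_zero x (D.injective_J_zero x h)

theorem expansion {α : Type*} {l : Filter α} (s : ℝ) {x : M} {X Y : α → M} {τ τ' : α → ℝ}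
    (hX : Tendsto X l (𝓝 x)) (hY : Tendsto Y l (𝓝 x)) (hτ : Tendsto τ l (𝓝 0))
    (hτ' : Tendsto τ' l (𝓝 0)) :
    (fun k => D.pos (s + τ k, X k) - D.pos (s + τ' k, Y k) -
        (D.J s x (extChartAt (𝓡 (d + 1)) x (X k) - extChartAt (𝓡 (d + 1)) x (Y k)) +
          (τ k - τ' k) • D.W (φ s x)))
      =o[l] fun k => (τ k - τ' k,
        extChartAt (𝓡 (d + 1)) x (X k) - extChartAt (𝓡 (d + 1)) x (Y k)) := by
  have h := strict_expansion D.pos_smooth s x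
  rw [(D.hasDerivAt_pos s x).deriv] at h
  exact h.comp_tendsto (g := fun p : (ℝ × M) × (ℝ × M) => (p.1.1 - p.2.1,
    extChartAt (𝓡 (d + 1)) x p.1.2 - extChartAt (𝓡 (d + 1)) x p.2.2))
    (k := fun k => ((τ k, X k), (τ' k, Y k))) ((hτ.prodMk_nhds hX).prodMk_nhds (hτ'.prodMk_nhds hY))

theorem expansion_space {α : Type*} {l : Filter α} (s : ℝ) {x : M} {X Y : α → M} {τ : α → ℝ}
    (hX : Tendsto X l (𝓝 x)) (hY : Tendsto Y l (𝓝 x)) (hτ : Tendsto τ l (𝓝 0)) :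
    (fun k => D.pos (s + τ k, X k) - D.pos (s + τ k, Y k) -
        D.J s x (extChartAt (𝓡 (d + 1)) x (X k) - extChartAt (𝓡 (d + 1)) x (Y k)))
      =o[l] fun k => extChartAt (𝓡 (d + 1)) x (X k) - extChartAt (𝓡 (d + 1)) x (Y k) := by
  have h := D.expansion s hX hY hτ hτ
  simp only [sub_self, zero_smul, add_zero] at h
  exact h.trans_le fun k => by simp

/-- The embedding has injective derivative, hence expands small chart differences by a definite
factor up to an error negligible with respect to them. -/
theorem isBigO_chart {α : Type*} {l : Filter α} {x : M} {X Y : α → M}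
    (hX : Tendsto X l (𝓝 x)) (hY : Tendsto Y l (𝓝 x)) :
    (fun k => extChartAt (𝓡 (d + 1)) x (X k) - extChartAt (𝓡 (d + 1)) x (Y k))
      =O[l] fun k => D.emb (X k) - D.emb (Y k) := by
  have h := D.expansion_space 0 hX hY (tendsto_const_nhds (x := (0 : ℝ)))
  simp only [zero_add, pos_zero] at h
  obtain ⟨K, hK⟩ := (D.J 0 x).toLinearMap.exists_antilipschitzWith
    (LinearMap.ker_eq_bot.2 (D.injective_J_zero x))
  have h1 : (fun k => extChartAt (𝓡 (d + 1)) x (X k) - extChartAt (𝓡 (d + 1)) x (Y k))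
      =O[l] fun k => D.J 0 x (extChartAt (𝓡 (d + 1)) x (X k) - extChartAt (𝓡 (d + 1)) x (Y k)) := by
    refine IsBigO.of_bound K (Eventually.of_forall fun k => ?_)
    have := hK.2.le_mul_dist (extChartAt (𝓡 (d + 1)) x (X k) - extChartAt (𝓡 (d + 1)) x (Y k)) 0
    simpa [dist_eq_norm] using this
  have h2 := (h.trans_isBigO h1).right_isBigO_add
  simp only [sub_add_cancel] at h2
  exact h1.trans h2

theorem isBigO_pos {α : Type*} {l : Filter α} (s : ℝ) {x : M} {X Y : α → M} {τ : α → ℝ}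
    (hX : Tendsto X l (𝓝 x)) (hY : Tendsto Y l (𝓝 x)) (hτ : Tendsto τ l (𝓝 0)) :
    (fun k => D.pos (s + τ k, X k) - D.pos (s + τ k, Y k))
      =O[l] fun k => extChartAt (𝓡 (d + 1)) x (X k) - extChartAt (𝓡 (d + 1)) x (Y k) := by
  have h := (D.expansion_space s hX hY hτ).isBigO.add
    ((D.J s x).isBigO_comp (fun k => extChartAt (𝓡 (d + 1)) x (X k) -
      extChartAt (𝓡 (d + 1)) x (Y k)) l)
  simpa using h

end EmbeddedFlow

end EmbeddedFlow

/-! ### Compactness: minimal period, Lipschitz constants, speed. -/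

section UniformBounds

open Set Asymptotics

/-- Along an ultrafilter every sequence in a compact set converges, so the blow-up arguments need no
successive extraction of subsequences. -/
theorem exists_tendsto_ultrafilter {α X : Type*} [TopologicalSpace X] (l : Ultrafilter α)
    {K : Set X} (hK : IsCompact K) {u : α → X} (hu : ∀ k, u k ∈ K) :
    ∃ x ∈ K, Tendsto u l (𝓝 x) := by
  obtain ⟨x, hx, h⟩ := hK.ultrafilter_le_nhds (l.map u) (by
    rw [le_principal_iff]
    exact (Eventually.of_forall hu : ∀ᶠ k in (l : Filter α), u k ∈ K))
  exact ⟨x, hx, h⟩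

universe u
variable {d : ℕ} {M : Type u} [TopologicalSpace M]
  [ChartedSpace (EuclideanSpace ℝ (Fin (d + 1))) M] [IsManifold (𝓡 (d + 1)) ∞ M]
  [T2Space M] [CompactSpace M]

namespace EmbeddedFlow

variable {V : VField d M} {φ : Flow ℝ M} {N : ℕ} (D : EmbeddedFlow V φ N)
include D

theorem tendsto_one_div_hyperfilter :
    Tendsto (fun k : ℕ => 1 / ((k : ℝ) + 1)) (hyperfilter ℕ) (𝓝 0) :=
  tendsto_one_div_add_atTop_nhds_zero_nat.mono_left Nat.hyperfilter_le_atTop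

theorem exists_tendsto (X : ℕ → M) : ∃ x, Tendsto X (hyperfilter ℕ) (𝓝 x) := by
  obtain ⟨x, -, h⟩ := exists_tendsto_ultrafilter (hyperfilter ℕ) isCompact_univ
    (u := X) (fun k => mem_univ _)
  exact ⟨x, h⟩

theorem tendsto_pos {α : Type*} {l : Filter α} {X : α → M} {τ : α → ℝ} {x : M} {t : ℝ}
    (hτ : Tendsto τ l (𝓝 t)) (hX : Tendsto X l (𝓝 x)) :
    Tendsto (fun k => D.pos (τ k, X k)) l (𝓝 (D.pos (t, x))) :=
  (D.continuous_pos.tendsto (t, x)).comp (hτ.prodMk_nhds hX)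

/-- The periods of the flow are bounded below. -/
theorem exists_min_period : ∃ T₀ : ℝ, 0 < T₀ ∧ ∀ (x : M) (t : ℝ), |t| ≤ T₀ → φ t x = x → t = 0 := by
  by_contra! h
  choose x t ht hx ht0 using fun k : ℕ => h (1 / ((k : ℝ) + 1)) (by positivity)
  obtain ⟨y, hy⟩ := D.exists_tendsto x
  have ht' : Tendsto t (hyperfilter ℕ) (𝓝 0) :=
    squeeze_zero_norm (fun k => by simpa using ht k) D.tendsto_one_div_hyperfilter
  -- A point returning after a time `t k` tending to 0 gives `t k • W = o (t k)`, which is absurd as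
  -- the velocity `W` does not vanish.
  have hexp := D.expansion 0 hy hy ht' tendsto_const_nhds
  have e1 : ∀ k, D.pos (0 + t k, x k) - D.pos (0 + 0, x k) = 0 := fun k => by
    simp [pos, hx k]
  simp only [e1] at hexp
  simp only [sub_self, map_zero, sub_zero, zero_add, zero_sub, φ.map_zero_apply] at hexp
  have h2 : (fun k => t k • D.W y) =o[hyperfilter ℕ] t :=
    (hexp.neg_left.congr_left fun k => neg_neg _).trans_le fun k => by simp
  have h3 := h2.def (show (0 : ℝ) < ‖D.W y‖ / 2 by
    have := norm_pos_iff.2 (D.W_ne_zero y); positivity)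
  obtain ⟨k, hk⟩ := h3.exists
  rw [norm_smul, mul_comm] at hk
  have h4 : 0 < ‖t k‖ := norm_pos_iff.2 (ht0 k)
  have h5 := norm_pos_iff.2 (D.W_ne_zero y)
  nlinarith

theorem exists_bound_emb : ∃ B : ℝ, 0 ≤ B ∧ ∀ x, ‖D.emb x‖ ≤ B := by
  obtain ⟨B, hB⟩ := (isCompact_range D.emb_smooth.continuous).isBounded.exists_norm_le
  exact ⟨max B 0, le_max_right _ _, fun x => (hB _ ⟨x, rfl⟩).trans (le_max_left _ _)⟩

/-- Pairs violating the bound with constants tending to infinity must merge, since the left side is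
bounded; at the common limit the local Lipschitz estimate contradicts them. -/
theorem exists_lipschitz : ∃ Λ : ℝ, 1 ≤ Λ ∧ ∀ (t : ℝ), |t| ≤ 1 → ∀ x y : M,
    ‖D.pos (t, x) - D.pos (t, y)‖ ≤ Λ * ‖D.emb x - D.emb y‖ := by
  by_contra! h
  choose t ht x y hxy using fun k : ℕ => h ((k : ℝ) + 1) (by linarith [k.cast_nonneg (α := ℝ)])
  obtain ⟨x₀, hx₀⟩ := D.exists_tendsto x
  obtain ⟨y₀, hy₀⟩ := D.exists_tendsto y
  obtain ⟨t₀, -, ht₀⟩ := exists_tendsto_ultrafilter (hyperfilter ℕ) (isCompact_Icc (a := (-1 : ℝ))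
    (b := 1)) (u := t) (fun k => abs_le.1 (ht k))
  obtain ⟨B, hB0, hB⟩ := D.exists_bound_emb
  have hlim : Tendsto (fun k => ‖D.emb (x k) - D.emb (y k)‖) (hyperfilter ℕ) (𝓝 0) := by
    refine squeeze_zero (fun k => norm_nonneg _) (fun k => ?_)
      (by simpa using D.tendsto_one_div_hyperfilter.const_mul (2 * B))
    have h1 : ‖D.pos (t k, x k) - D.pos (t k, y k)‖ ≤ 2 * B := by
      refine (norm_sub_le _ _).trans ?_
      have h2 := hB (φ (t k) (x k))
      have h3 := hB (φ (t k) (y k))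
      simp only [pos]; linarith
    have h2 := (hxy k).le.trans h1
    have h3 : (0 : ℝ) < (k : ℝ) + 1 := by positivity
    rw [← div_eq_mul_inv, le_div_iff₀ h3]
    linarith
  have hxy₀ : x₀ = y₀ := by
    refine D.emb_closed.injective ?_
    have h1 : Tendsto (fun k => ‖D.emb (x k) - D.emb (y k)‖) (hyperfilter ℕ)
        (𝓝 ‖D.emb x₀ - D.emb y₀‖) :=
      (((D.emb_smooth.continuous.tendsto x₀).comp hx₀).sub
        ((D.emb_smooth.continuous.tendsto y₀).comp hy₀)).norm
    exact sub_eq_zero.1 (norm_eq_zero.1 (tendsto_nhds_unique h1 hlim))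
  subst hxy₀
  have hτ : Tendsto (fun k => t k - t₀) (hyperfilter ℕ) (𝓝 0) := by
    simpa using ht₀.sub_const t₀
  have hO := (D.isBigO_pos t₀ hx₀ hy₀ hτ).trans (D.isBigO_chart hx₀ hy₀)
  obtain ⟨C, hC⟩ := hO.bound
  have hk : ∀ᶠ k : ℕ in hyperfilter ℕ, C ≤ k :=
    Nat.hyperfilter_le_atTop (tendsto_natCast_atTop_atTop.eventually_ge_atTop C)
  obtain ⟨k, h1, h2⟩ := (hC.and hk).exists
  have h3 := hxy k
  rw [add_sub_cancel] at h1
  have h4 : C * ‖D.emb (x k) - D.emb (y k)‖ ≤ ((k : ℝ) + 1) * ‖D.emb (x k) - D.emb (y k)‖ :=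
    mul_le_mul_of_nonneg_right (by linarith) (norm_nonneg _)
  linarith

theorem lipschitz_iterate {Λ : ℝ} (hΛ : 1 ≤ Λ) (h : ∀ (t : ℝ), |t| ≤ 1 → ∀ x y : M,
    ‖D.pos (t, x) - D.pos (t, y)‖ ≤ Λ * ‖D.emb x - D.emb y‖) (n : ℕ) :
    ∀ (t : ℝ), |t| ≤ n → ∀ x y : M,
      ‖D.pos (t, x) - D.pos (t, y)‖ ≤ Λ ^ n * ‖D.emb x - D.emb y‖ := by
  induction n with
  | zero =>
    intro t ht x y
    have : t = 0 := by simpa using ht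
    rw [this, pos_zero, pos_zero, pow_zero, one_mul]
  | succ n ih =>
    intro t ht x y
    obtain ⟨t₁, t₂, h1, h2, rfl⟩ : ∃ t₁ t₂ : ℝ, |t₁| ≤ 1 ∧ |t₂| ≤ n ∧ t = t₁ + t₂ := by
      push_cast at ht
      have hn : (0 : ℝ) < n + 1 := by positivity
      refine ⟨t / (n + 1), t * n / (n + 1), ?_, ?_, by field_simp; ring⟩
      · rw [abs_div, abs_of_pos hn, div_le_one hn]; exact ht
      · rw [abs_div, abs_of_pos hn, div_le_iff₀ hn, abs_mul, Nat.abs_cast, mul_comm]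
        gcongr
    rw [pos_add, pos_add]
    refine (h t₁ h1 _ _).trans ?_
    rw [pow_succ', mul_assoc]
    exact mul_le_mul_of_nonneg_left (ih t₂ h2 x y) (by linarith)

theorem W_eq_fderiv (x₀ : M) : ∀ᶠ x in 𝓝 x₀, D.W x = fderiv ℝ
    (fun p : ℝ × EuclideanSpace ℝ (Fin (d + 1)) => D.pos (p.1, (extChartAt (𝓡 (d + 1)) x₀).symm p.2))
      (0, extChartAt (𝓡 (d + 1)) x₀ x) (1, 0) := by
  filter_upwards [extChartAt_source_mem_nhds (I := 𝓡 (d + 1)) x₀] with x hx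
  have hd := (contDiffAt_comp_extChartAt_symm D.pos_smooth 0 hx).differentiableAt (by simp)
  have h := hd.hasFDerivAt.comp_hasDerivAt (0 : ℝ)
    (f := fun t : ℝ => (t, extChartAt (𝓡 (d + 1)) x₀ x))
    ((hasDerivAt_id (0 : ℝ)).prodMk (hasDerivAt_const (0 : ℝ) _))
  have h2 := D.hasDerivAt_pos 0 x
  rw [φ.map_zero_apply] at h2
  refine h2.unique (h.congr_of_eventuallyEq (Eventually.of_forall fun t => ?_))
  simp only [Function.comp, (extChartAt (𝓡 (d + 1)) x₀).left_inv hx]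

theorem continuous_W : Continuous D.W := by
  rw [continuous_iff_continuousAt]
  intro x₀
  refine ContinuousAt.congr ?_ (EventuallyEq.symm (D.W_eq_fderiv x₀))
  have hc := (contDiffAt_comp_extChartAt_symm D.pos_smooth 0 (mem_extChartAt_source
    (I := 𝓡 (d + 1)) x₀)).continuousAt_fderiv (by simp)
  have h2 : ContinuousAt (fun x => ((0 : ℝ), extChartAt (𝓡 (d + 1)) x₀ x)) x₀ :=
    continuousAt_const.prodMk (continuousAt_extChartAt x₀)
  exact (ContinuousAt.comp (f := fun x => ((0 : ℝ), extChartAt (𝓡 (d + 1)) x₀ x)) hc h2).clm_apply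
    continuousAt_const

theorem exists_W_bounds : ∃ c C : ℝ, 0 < c ∧ 0 < C ∧ ∀ x, c ≤ ‖D.W x‖ ∧ ‖D.W x‖ ≤ C := by
  rcases isEmpty_or_nonempty M with hM | hM
  · exact ⟨1, 1, one_pos, one_pos, fun x => (hM.false x).elim⟩
  obtain ⟨x₁, -, h1⟩ := isCompact_univ.exists_isMinOn univ_nonempty D.continuous_W.norm.continuousOn
  obtain ⟨x₂, -, h2⟩ := isCompact_univ.exists_isMaxOn univ_nonempty D.continuous_W.norm.continuousOn
  exact ⟨‖D.W x₁‖, ‖D.W x₂‖, norm_pos_iff.2 (D.W_ne_zero _), norm_pos_iff.2 (D.W_ne_zero _),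
    fun x => ⟨h1 (mem_univ x), h2 (mem_univ x)⟩⟩

theorem norm_pos_sub_le {C : ℝ} (hC : ∀ x, ‖D.W x‖ ≤ C) (s t : ℝ) (x : M) :
    ‖D.pos (s, x) - D.pos (t, x)‖ ≤ C * |s - t| := by
  have := convex_univ.norm_image_sub_le_of_norm_hasDerivWithin_le (f := fun t => D.pos (t, x))
    (f' := fun t => D.W (φ t x)) (C := C) (fun u _ => (D.hasDerivAt_pos u x).hasDerivWithinAt)
    (fun u _ => hC _) (mem_univ t) (mem_univ s)
  simpa [Real.norm_eq_abs] using this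

/-- The derivative along a curve through `x` with given direction in the chart. -/
theorem tendsto_slope (x : M) (v : EuclideanSpace ℝ (Fin (d + 1))) :
    ∃ X : ℝ → M, ∀ s : ℝ, Tendsto (fun h : ℝ => h⁻¹ • (D.pos (s, X h) - D.pos (s, x))) (𝓝[≠] 0)
      (𝓝 (D.J s x v)) := by
  set e := extChartAt (𝓡 (d + 1)) x with he
  refine ⟨fun h => e.symm (e x + h • v), fun s => ?_⟩
  have hmd : MDifferentiableAt (𝓡 (d + 1)) (𝓡 N) (fun y => D.pos (s, y)) x :=
    (D.pos_smooth.comp (contMDiff_const.prodMk contMDiff_id)).mdifferentiable (by simp) x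
  have h1 : HasFDerivAt ((fun y => D.pos (s, y)) ∘ e.symm) (D.J s x) (e x) := by
    have h2 : DifferentiableAt ℝ ((fun y => D.pos (s, y)) ∘ e.symm) (e x) := by
      have h3 := (contDiffAt_comp_extChartAt_symm D.pos_smooth s
        (mem_extChartAt_source (I := 𝓡 (d + 1)) x)).differentiableAt (by simp)
      exact h3.comp (f := fun y => (s, y)) (e x)
        ((differentiableAt_const s).prodMk differentiableAt_id)
    rw [J, spaceDeriv, mfderiv_eq_fderiv_extChartAt hmd]
    exact h2.hasFDerivAt
  have h4 := (h1.hasLineDerivAt v).tendsto_slope_zero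
  simpa [he, extChartAt_to_inv] using h4

/-- A Lipschitz bound passes to derivatives through difference quotients. -/
theorem norm_J_le {s K : ℝ} (hK : ∀ x y, ‖D.pos (s, x) - D.pos (s, y)‖ ≤ K * ‖D.emb x - D.emb y‖)
    (x : M) (v : EuclideanSpace ℝ (Fin (d + 1))) : ‖D.J s x v‖ ≤ K * ‖D.J 0 x v‖ := by
  obtain ⟨X, hX⟩ := D.tendsto_slope x v
  refine le_of_tendsto_of_tendsto (hX s).norm ((hX 0).norm.const_mul K)
    (Eventually.of_forall fun h => ?_)
  simp only [norm_smul, pos_zero]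
  have := mul_le_mul_of_nonneg_left (hK (X h) x) (norm_nonneg h⁻¹)
  linarith

end EmbeddedFlow

end UniformBounds

/-! ### Expansivity by a blow-up argument. -/

section Expansivity

open Set Asymptotics

universe u
variable {d : ℕ} {M : Type u} [TopologicalSpace M]
  [ChartedSpace (EuclideanSpace ℝ (Fin (d + 1))) M] [IsManifold (𝓡 (d + 1)) ∞ M]
  [T2Space M] [CompactSpace M]

namespace EmbeddedFlow

variable {V : VField d M} {φ : Flow ℝ M} {N : ℕ} (D : EmbeddedFlow V φ N)
include D

/-- For two distinct orbits that stay close, the distance at each time is first minimized over small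
time shifts. Moving the origin of time to where this transverse distance is nearly largest gives a
pair whose separation at every other time is at most twice the separation at time 0: exactly what
makes the renormalized limit bounded. -/
theorem exists_extremal_pair {x y : M} {a ε r₀ : ℝ} (hr₀ : 0 ≤ r₀)
    (hclose : ∀ s, ‖D.pos (s, x) - D.pos (a * s, y)‖ ≤ ε) (hne : ∀ r, x ≠ φ r y) :
    ∃ (X Y : M) (r : ℝ), |r| ≤ r₀ ∧ 0 < ‖D.emb X - D.pos (r, Y)‖ ∧ ‖D.emb X - D.emb Y‖ ≤ ε ∧
      (∀ r', |r'| ≤ r₀ → ‖D.emb X - D.pos (r, Y)‖ ≤ ‖D.emb X - D.pos (r', Y)‖) ∧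
      ∀ s, ∃ r', |r'| ≤ r₀ ∧
        ‖D.pos (s, X) - D.pos (a * s + r', Y)‖ ≤ 2 * ‖D.emb X - D.pos (r, Y)‖ := by
  have hmin : ∀ s, ∃ r ∈ Icc (-r₀) r₀, IsMinOn (fun r => ‖D.pos (s, x) - D.pos (a * s + r, y)‖)
      (Icc (-r₀) r₀) r := fun s => by
    refine isCompact_Icc.exists_isMinOn ⟨0, by constructor <;> linarith⟩ ?_
    have := D.continuous_pos
    exact (by fun_prop : Continuous fun r => ‖D.pos (s, x) - D.pos (a * s + r, y)‖).continuousOn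
  choose ρ hρ hρmin using hmin
  set δ : ℝ → ℝ := fun s => ‖D.pos (s, x) - D.pos (a * s + ρ s, y)‖ with hδ
  have hδε : ∀ s, δ s ≤ ε := fun s => by
    have := hρmin s (show (0 : ℝ) ∈ Icc (-r₀) r₀ by constructor <;> linarith)
    simp only [mem_ofPred_eq, add_zero] at this
    exact this.trans (hclose s)
  have hδ0 : ∀ s, 0 < δ s := fun s => by
    refine norm_pos_iff.2 fun h => hne (-s + (a * s + ρ s)) ?_
    have h1 := D.eq_of_pos_eq (sub_eq_zero.1 h)
    rw [φ.map_add, ← h1, ← φ.map_add]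
    simp
  have hbdd : BddAbove (range δ) := ⟨ε, by rintro _ ⟨s, rfl⟩; exact hδε s⟩
  have hη : 0 < ⨆ s, δ s := (hδ0 0).trans_le (le_ciSup hbdd 0)
  -- The supremum over all times need not be attained; half of it is enough.
  obtain ⟨s₀, hs₀⟩ := exists_lt_of_lt_ciSup (show (⨆ s, δ s) / 2 < ⨆ s, δ s by linarith)
  have e1 : D.emb (φ s₀ x) = D.pos (s₀, x) := rfl
  have e2 : ∀ r, D.pos (r, φ (a * s₀) y) = D.pos (a * s₀ + r, y) := fun r => by
    rw [← D.pos_add, add_comm]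
  have e3 : D.emb (φ (a * s₀) y) = D.pos (a * s₀, y) := rfl
  refine ⟨φ s₀ x, φ (a * s₀) y, ρ s₀, abs_le.2 (hρ s₀), ?_, ?_, fun r' hr' => ?_, fun s => ?_⟩
  · rw [e1, e2]; exact hδ0 s₀
  · rw [e1, e3]; exact hclose s₀
  · rw [e1, e2, e2]; exact hρmin s₀ (abs_le.1 hr')
  · refine ⟨ρ (s + s₀), abs_le.2 (hρ _), ?_⟩
    rw [e1, e2, e2, ← D.pos_add, show a * s₀ + (a * s + ρ (s + s₀)) = a * (s + s₀) + ρ (s + s₀) by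
      ring]
    have h1 := le_ciSup hbdd (s + s₀)
    simp only [hδ] at h1 hs₀ ⊢
    linarith

/-- Blow-up limit: the difference of two nearby orbits, divided by their initial separation, tends
to the image of the limiting direction under the tangent flow, up to a multiple of the velocity
coming from the time shift. -/
theorem tendsto_normalized {α : Type*} {l : Filter α} (s : ℝ) {x : M} {X Y : α → M} {τ n : α → ℝ}
    {v : EuclideanSpace ℝ (Fin (d + 1))} {c : ℝ}
    (hX : Tendsto X l (𝓝 x)) (hY : Tendsto Y l (𝓝 x)) (hτ : Tendsto τ l (𝓝 0))
    (hn : ∀ k, n k = ‖extChartAt (𝓡 (d + 1)) x (X k) - extChartAt (𝓡 (d + 1)) x (Y k)‖)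
    (hn0 : ∀ᶠ k in l, n k ≠ 0)
    (hv : Tendsto (fun k => (n k)⁻¹ •
      (extChartAt (𝓡 (d + 1)) x (X k) - extChartAt (𝓡 (d + 1)) x (Y k))) l (𝓝 v))
    (hc : Tendsto (fun k => τ k / n k) l (𝓝 c)) :
    Tendsto (fun k => (n k)⁻¹ • (D.pos (s, X k) - D.pos (s + τ k, Y k))) l
      (𝓝 (D.J s x v - c • D.W (φ s x))) := by
  have h := D.expansion s hX hY (tendsto_const_nhds (x := (0 : ℝ))) hτ
  simp only [add_zero, zero_sub] at h
  have hτO : τ =O[l] n := by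
    have h1 := hc.isBigO_one ℝ
    have h2 := h1.mul (isBigO_refl n l)
    refine (h2.congr' ?_ ?_)
    · filter_upwards [hn0] with k hk
      field_simp
    · exact Eventually.of_forall fun k => by simp
  have hΔO : (fun k => extChartAt (𝓡 (d + 1)) x (X k) - extChartAt (𝓡 (d + 1)) x (Y k)) =O[l] n := by
    refine IsBigO.of_bound 1 (Eventually.of_forall fun k => ?_)
    rw [hn, norm_norm, one_mul]
  have h3 := (h.trans_isBigO (hτO.neg_left.prod_left hΔO)).tendsto_inv_smul_nhds_zero
  have h4 : Tendsto (fun k => D.J s x ((n k)⁻¹ •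
      (extChartAt (𝓡 (d + 1)) x (X k) - extChartAt (𝓡 (d + 1)) x (Y k))) -
      (τ k / n k) • D.W (φ s x)) l (𝓝 (D.J s x v - c • D.W (φ s x))) :=
    (((D.J s x).continuous.tendsto v).comp hv).sub (hc.smul_const _)
  have h5 := h3.add h4
  rw [zero_add] at h5
  refine h5.congr fun k => ?_
  rw [map_smul, div_eq_inv_mul, mul_smul, smul_sub, smul_add, smul_sub, neg_smul, smul_neg]
  abel

/-- Expansivity of the flow, when no bounded orbit of the tangent flow is transverse to the flow. -/
theorem exists_expansivity_constant
    (hyp : ∀ (x : M) (v : EuclideanSpace ℝ (Fin (d + 1))) (B : ℝ),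
      (∀ s, ∃ c : ℝ, ‖D.J s x v - c • D.W (φ s x)‖ ≤ B) → ∃ c : ℝ, D.J 0 x v = c • D.W x) :
    ∃ ε : ℝ, 0 < ε ∧ ∀ (x y : M) (a : ℝ), |a - 1| ≤ ε →
      (∀ s, ‖D.pos (s, x) - D.pos (a * s, y)‖ ≤ ε) → ∃ r, x = φ r y := by
  by_contra! h
  choose x₀ y₀ a ha hclose hne using fun k : ℕ => h (1 / ((k : ℝ) + 1)) (by positivity)
  obtain ⟨T₀, hT₀, hper⟩ := D.exists_min_period
  -- Below the minimal period, so that a time shift in this range that fixes the limit point has to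
  -- be 0.
  set r₀ := T₀ / 2 with hr₀
  have hr₀0 : 0 < r₀ := by positivity
  choose X Y r hr hξ hXY hmin hmax using fun k => D.exists_extremal_pair hr₀0.le (hclose k) (hne k)
  set l : Filter ℕ := (hyperfilter ℕ : Filter ℕ) with hl
  have hε := D.tendsto_one_div_hyperfilter
  have hemb := D.emb_smooth.continuous
  obtain ⟨x, hX⟩ := D.exists_tendsto X
  obtain ⟨y, hY⟩ := D.exists_tendsto Y
  obtain ⟨rlim, hrlim, hrl⟩ := exists_tendsto_ultrafilter (hyperfilter ℕ) (isCompact_Icc (a := -r₀)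
    (b := r₀)) (u := r) (fun k => abs_le.1 (hr k))
  have hal : Tendsto (fun k => a k - 1) l (𝓝 0) :=
    squeeze_zero_norm (fun k => by simpa using ha k) hε
  have hXY0 : Tendsto (fun k => ‖D.emb (X k) - D.emb (Y k)‖) l (𝓝 0) :=
    squeeze_zero (fun k => norm_nonneg _) hXY hε
  -- equality of limits
  have heq : ∀ {u v : ℕ → EuclideanSpace ℝ (Fin N)} {p q : EuclideanSpace ℝ (Fin N)},
      Tendsto u l (𝓝 p) → Tendsto v l (𝓝 q) → Tendsto (fun k => ‖u k - v k‖) l (𝓝 0) → p = q := by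
    intro u v p q hu hv huv
    exact sub_eq_zero.1 (norm_eq_zero.1 (tendsto_nhds_unique ((hu.sub hv).norm) huv))
  have hxy : x = y := D.emb_closed.injective
    (heq ((hemb.tendsto x).comp hX) ((hemb.tendsto y).comp hY) hXY0)
  subst hxy
  have hξ0 : Tendsto (fun k => ‖D.emb (X k) - D.pos (r k, Y k)‖) l (𝓝 0) :=
    squeeze_zero (fun k => norm_nonneg _) (fun k => by
      have := hmin k 0 (by simpa using hr₀0.le)
      rwa [D.pos_zero] at this) hXY0
  have hper' : ∀ t : ℝ, |t| ≤ r₀ → ∀ s, D.pos (s, x) = D.pos (s + t, x) → t = 0 := by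
    intro t ht s hs
    have h1 := D.eq_of_pos_eq hs
    refine hper x t (ht.trans (by linarith)) ?_
    rw [φ.map_add] at h1
    have h2 := congrArg (φ (-s)) h1
    rw [← φ.map_add, ← φ.map_add] at h2
    simpa using h2.symm
  have hr0 : rlim = 0 := by
    refine hper' rlim (abs_le.2 hrlim) 0 ?_
    rw [zero_add, D.pos_zero]
    exact heq ((hemb.tendsto x).comp hX) (D.tendsto_pos hrl hY) hξ0
  subst hr0
  -- the second point
  set Z : ℕ → M := fun k => φ (r k) (Y k) with hZ
  have hZx : Tendsto Z l (𝓝 x) := by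
    have h1 : Tendsto (fun k => φ (r k) (Y k)) l (𝓝 (φ 0 x)) :=
      (D.flow_smooth.continuous.tendsto ((0 : ℝ), x)).comp (hrl.prodMk_nhds hY)
    rwa [φ.map_zero_apply] at h1
  have hZpos : ∀ k, D.pos (r k, Y k) = D.emb (Z k) := fun k => rfl
  set n : ℕ → ℝ := fun k =>
    ‖extChartAt (𝓡 (d + 1)) x (X k) - extChartAt (𝓡 (d + 1)) x (Z k)‖ with hn
  have hO := D.isBigO_pos 0 hX hZx (tendsto_const_nhds (x := (0 : ℝ)))
  simp only [add_zero, D.pos_zero] at hO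
  have hn0 : ∀ᶠ k in l, n k ≠ 0 := by
    obtain ⟨C, hC⟩ := hO.bound
    filter_upwards [hC] with k hk h0
    have h1 := hξ k
    rw [hZpos] at h1
    simp only [hn] at h0
    rw [h0, mul_zero] at hk
    linarith
  have hnl : Tendsto n l (𝓝 0) := by
    have hc := continuousAt_extChartAt (I := 𝓡 (d + 1)) x
    have := ((hc.tendsto.comp hX).sub (hc.tendsto.comp hZx)).norm
    rwa [sub_self, norm_zero] at this
  -- The limiting unit direction of the separation. The rest of the proof contradicts its existence.
  obtain ⟨v, hvs, hv⟩ := exists_tendsto_ultrafilter (hyperfilter ℕ)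
    (isCompact_closedBall (0 : EuclideanSpace ℝ (Fin (d + 1))) 1)
    (u := fun k => (n k)⁻¹ • (extChartAt (𝓡 (d + 1)) x (X k) - extChartAt (𝓡 (d + 1)) x (Z k)))
    (fun k => by
      rw [mem_closedBall, dist_zero_right, norm_smul, norm_inv, Real.norm_of_nonneg (norm_nonneg _)]
      exact inv_mul_le_one)
  have hv1 : ‖v‖ = 1 := by
    refine tendsto_nhds_unique hv.norm (tendsto_const_nhds.congr' ?_)
    filter_upwards [hn0] with k hk
    rw [norm_smul, norm_inv, Real.norm_of_nonneg (norm_nonneg _)]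
    exact (inv_mul_cancel₀ hk).symm
  have hnorm := fun (s : ℝ) {τ : ℕ → ℝ} {c : ℝ} (hτ : Tendsto τ l (𝓝 0))
    (hc : Tendsto (fun k => τ k / n k) l (𝓝 c)) =>
      D.tendsto_normalized s hX hZx hτ (fun k => rfl) hn0 hv hc
  have hξn : Tendsto (fun k => (n k)⁻¹ * ‖D.emb (X k) - D.emb (Z k)‖) l (𝓝 ‖D.J 0 x v‖) := by
    have h1 := (hnorm 0 (τ := fun _ => 0) (c := 0) tendsto_const_nhds (by simp)).norm
    simp only [add_zero, D.pos_zero, zero_smul, sub_zero] at h1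
    refine h1.congr fun k => ?_
    rw [norm_smul, norm_inv, Real.norm_of_nonneg (norm_nonneg _)]
  -- transversality
  have htrans : ∀ c : ℝ, ‖D.J 0 x v‖ ≤ ‖D.J 0 x v - c • D.W x‖ := by
    intro c
    have hτ : Tendsto (fun k => c * n k) l (𝓝 0) := by simpa using hnl.const_mul c
    have hc : Tendsto (fun k => c * n k / n k) l (𝓝 c) := by
      refine tendsto_const_nhds.congr' ?_
      filter_upwards [hn0] with k hk
      field_simp
    have h1 := (hnorm 0 hτ hc).norm
    rw [φ.map_zero_apply] at h1
    refine le_of_tendsto_of_tendsto hξn h1 ?_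
    -- This shift is admissible in the minimality of `r k` once it is small; the comparison says
    -- that, in the limit, subtracting a multiple of the velocity does not shorten the separation.
    have h2 : Tendsto (fun k => r k + c * n k) l (𝓝 0) := by simpa using hrl.add hτ
    filter_upwards [h2.eventually (ball_mem_nhds 0 hr₀0)] with k hk
    rw [norm_smul, norm_inv, Real.norm_of_nonneg (norm_nonneg _)]
    refine mul_le_mul_of_nonneg_left ?_ (inv_nonneg.2 (norm_nonneg _))
    have h3 := hmin k (r k + c * n k) (by
      have : dist (r k + c * n k) 0 < r₀ := hk
      rw [Real.dist_eq, sub_zero] at this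
      exact this.le)
    rw [hZpos, add_comm, D.pos_add] at h3
    rw [D.pos_zero, zero_add]
    exact h3
  -- boundedness
  have hbdd : ∀ s, ∃ c : ℝ, ‖D.J s x v - c • D.W (φ s x)‖ ≤ 2 * ‖D.J 0 x v‖ := by
    intro s
    choose r' hr' hr'max using fun k => hmax k s
    obtain ⟨rlim', hrlim', hr'l⟩ := exists_tendsto_ultrafilter (hyperfilter ℕ) (isCompact_Icc (a := -r₀)
      (b := r₀)) (u := r') (fun k => abs_le.1 (hr' k))
    have hal1 : Tendsto a l (𝓝 1) := by simpa using hal.add_const 1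
    have hr'0 : rlim' = 0 := by
      refine hper' rlim' (abs_le.2 hrlim') s (heq (D.tendsto_pos tendsto_const_nhds hX)
        (D.tendsto_pos (τ := fun k => a k * s + r' k) ?_ hY) (squeeze_zero (fun k => norm_nonneg _)
        hr'max (by simpa using hξ0.const_mul 2)))
      simpa using (hal1.mul_const s).add hr'l
    subst hr'0
    set τ : ℕ → ℝ := fun k => (a k - 1) * s + r' k - r k with hτdef
    have hτ : Tendsto τ l (𝓝 0) := by
      simpa using ((hal.mul_const s).add hr'l).sub hrl
    have hmaxZ : ∀ k, ‖D.pos (s, X k) - D.pos (s + τ k, Z k)‖ ≤ 2 * ‖D.emb (X k) - D.emb (Z k)‖ := by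
      intro k
      have h1 := hr'max k
      rw [hZpos] at h1
      rw [hZ, ← D.pos_add, show s + τ k + r k = a k * s + r' k by simp only [hτdef]; ring]
      exact h1
    -- `τ / n` is bounded
    have hτO : τ =O[l] n := by
      have h1 := D.expansion s hX hZx (tendsto_const_nhds (x := (0 : ℝ))) hτ
      simp only [add_zero, zero_sub] at h1
      have hW := norm_pos_iff.2 (D.W_ne_zero (φ s x))
      have h2 := h1.def (show 0 < ‖D.W (φ s x)‖ / 2 by positivity)
      obtain ⟨C, hC⟩ := hO.bound
      refine IsBigO.of_bound ((‖D.J s x‖ + 2 * C + ‖D.W (φ s x)‖) * (2 / ‖D.W (φ s x)‖)) ?_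
      filter_upwards [h2, hC] with k hk1 hk2
      set Δ := extChartAt (𝓡 (d + 1)) x (X k) - extChartAt (𝓡 (d + 1)) x (Z k) with hΔ
      set p := D.pos (s, X k) - D.pos (s + τ k, Z k) with hp
      have h3 : ‖p‖ ≤ 2 * (C * n k) := (hmaxZ k).trans (by linarith)
      have h4 : ‖(-τ k, Δ)‖ ≤ ‖τ k‖ + n k := by
        rw [Prod.norm_def, norm_neg]
        exact max_le (by linarith [norm_nonneg Δ]) (by linarith [norm_nonneg (τ k)])
      have h5 : ‖τ k‖ * ‖D.W (φ s x)‖ ≤ ‖p‖ + ‖D.J s x‖ * n k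
          + ‖p - (D.J s x Δ + -τ k • D.W (φ s x))‖ := by
        rw [← norm_smul]
        have h6 : τ k • D.W (φ s x) = (p - (D.J s x Δ + -τ k • D.W (φ s x))) - p + D.J s x Δ := by
          rw [neg_smul]; abel
        have h7 := (D.J s x).le_opNorm Δ
        calc ‖τ k • D.W (φ s x)‖ = ‖(p - (D.J s x Δ + -τ k • D.W (φ s x))) - p + D.J s x Δ‖ :=
              congrArg norm h6
          _ ≤ ‖p - (D.J s x Δ + -τ k • D.W (φ s x))‖ + ‖p‖ + ‖D.J s x Δ‖ :=
              (norm_add_le _ _).trans (add_le_add_left (norm_sub_le _ _) _)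
          _ ≤ _ := by linarith
      have hnk : 0 ≤ n k := norm_nonneg _
      rw [Real.norm_of_nonneg hnk]
      have h8 : ‖τ k‖ * (‖D.W (φ s x)‖ / 2) ≤ (‖D.J s x‖ + 2 * C + ‖D.W (φ s x)‖) * n k := by
        have h9 := mul_le_mul_of_nonneg_left h4 (show 0 ≤ ‖D.W (φ s x)‖ / 2 by positivity)
        nlinarith
      rw [show (‖D.J s x‖ + 2 * C + ‖D.W (φ s x)‖) * (2 / ‖D.W (φ s x)‖) * n k
        = (‖D.J s x‖ + 2 * C + ‖D.W (φ s x)‖) * n k / (‖D.W (φ s x)‖ / 2) by field_simp,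
        le_div_iff₀ (by positivity)]
      exact h8
    obtain ⟨C, hC⟩ := hτO.bound
    obtain ⟨c, -, hc⟩ : ∃ c ∈ Icc (-|C|) |C|, Tendsto (fun k => τ k / n k) l (𝓝 c) := by
      obtain ⟨c, hc, h1⟩ := (isCompact_Icc (a := -|C|) (b := |C|)).ultrafilter_le_nhds
        ((hyperfilter ℕ).map fun k => τ k / n k) (by
          rw [le_principal_iff]
          show ∀ᶠ k in l, τ k / n k ∈ Icc (-|C|) |C|
          filter_upwards [hC, hn0] with k hk hk0
          rw [mem_Icc, ← abs_le, abs_div, div_le_iff₀ (abs_pos.2 hk0)]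
          exact hk.trans (mul_le_mul_of_nonneg_right (le_abs_self C) (norm_nonneg _)))
      exact ⟨c, hc, h1⟩
    refine ⟨c, le_of_tendsto_of_tendsto (hnorm s hτ hc).norm (hξn.const_mul 2)
      (Eventually.of_forall fun k => ?_)⟩
    simp only
    rw [norm_smul, norm_inv, Real.norm_of_nonneg (norm_nonneg _)]
    have := mul_le_mul_of_nonneg_left (hmaxZ k) (inv_nonneg.2 (norm_nonneg
      (extChartAt (𝓡 (d + 1)) x (X k) - extChartAt (𝓡 (d + 1)) x (Z k))))
    simp only [hn]
    linarith
  -- A bounded direction is tangent to the flow, and subtracting this tangent part would shorten it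
  -- to 0, against transversality unless `v = 0`.
  obtain ⟨c, hc⟩ := hyp x v _ hbdd
  have h1 := htrans c
  rw [hc, sub_self, norm_zero, ← hc] at h1
  have h2 : v = 0 := D.injective_J_zero x (by rw [norm_le_zero_iff.1 h1, map_zero])
  rw [h2, norm_zero] at hv1
  exact zero_ne_one hv1

end EmbeddedFlow

end Expansivity

/-! ### Tangent flow and comparison of metrics. -/

section Hyperbolicity

open Set Asymptotics Bundle

universe u
variable {d : ℕ} {M : Type u} [TopologicalSpace M]
  [ChartedSpace (EuclideanSpace ℝ (Fin (d + 1))) M] [IsManifold (𝓡 (d + 1)) ∞ M]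

namespace EmbeddedFlow

variable {V : VField d M} {φ : Flow ℝ M} {N : ℕ} (D : EmbeddedFlow V φ N)
include D

theorem J_add (s t : ℝ) (x : M) (v : TangentSpace (𝓡 (d + 1)) x) :
    D.J (s + t) x v = D.J s (φ t x) (mfderiv (𝓡 (d + 1)) (𝓡 (d + 1)) (φ t) x v) := by
  have ht : MDifferentiableAt (𝓡 (d + 1)) (𝓡 (d + 1)) (φ t) x :=
    (D.flow_smooth.comp (contMDiff_const.prodMk contMDiff_id)).mdifferentiable (by simp) x
  have hs : MDifferentiableAt (𝓡 (d + 1)) (𝓡 N) (fun y => D.pos (s, y)) (φ t x) :=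
    (D.pos_smooth.comp (contMDiff_const.prodMk contMDiff_id)).mdifferentiable (by simp) _
  have h := mfderiv_comp x hs ht
  have e : ((fun y => D.pos (s, y)) ∘ φ t) = fun y => D.pos (s + t, y) :=
    funext fun y => (D.pos_add s t y).symm
  rw [e] at h
  exact congrArg (fun l => l v) h

/-- Differentiating `φ^s (φ^t x) = φ^{s+t} x` at `t = 0`: the flow direction is carried to the flow
direction, so its size stays between two positive constants. -/
theorem J_V (s : ℝ) (x : M) : D.J s x (V x) = D.W (φ s x) := by
  have hs : MDifferentiableAt (𝓡 (d + 1)) (𝓡 N) (fun y => D.pos (s, y)) (φ 0 x) :=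
    (D.pos_smooth.comp (contMDiff_const.prodMk contMDiff_id)).mdifferentiable (by simp) _
  have h2 := hs.hasMFDerivAt.comp 0 (D.flow_curve x 0)
  set L : EuclideanSpace ℝ (Fin (d + 1)) →L[ℝ] EuclideanSpace ℝ (Fin N) := D.J s (φ 0 x) with hL
  set v : EuclideanSpace ℝ (Fin (d + 1)) := V (φ 0 x) with hv
  have h3 : HasFDerivAt (fun t => D.pos (s, φ t x))
      (L.comp (ContinuousLinearMap.smulRight (1 : ℝ →L[ℝ] ℝ) v)) 0 := h2.hasFDerivAt
  have h4 := h3.hasDerivAt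
  rw [ContinuousLinearMap.comp_apply, ContinuousLinearMap.smulRight_apply,
    one_apply_eq_self, one_smul] at h4
  have h5 := (D.hasDerivAt_pos (s + 0) x).comp_const_add s 0
  have h6 : (fun t => D.pos (s + t, x)) = fun t => D.pos (s, φ t x) := funext fun t => D.pos_add s t x
  rw [h6, add_zero] at h5
  have h7 := h4.unique h5
  rw [hL, hv] at h7
  have key : ∀ y, y = x → D.J s y (V y) = D.W (φ s x) → D.J s x (V x) = D.W (φ s x) := by
    rintro _ rfl h; exact h
  exact key _ (φ.map_zero_apply x) h7

theorem J_zero_eq_fderiv (x₀ : M) : ∀ᶠ y in 𝓝 x₀, ∀ v : TangentSpace (𝓡 (d + 1)) y,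
    D.J 0 y v = fderiv ℝ (D.emb ∘ (extChartAt (𝓡 (d + 1)) x₀).symm) (extChartAt (𝓡 (d + 1)) x₀ y)
      ((trivializationAt (EuclideanSpace ℝ (Fin (d + 1))) (TangentSpace (𝓡 (d + 1))) x₀).continuousLinearMapAt
        ℝ y v) := by
  filter_upwards [(chartAt (EuclideanSpace ℝ (Fin (d + 1))) x₀).open_source.mem_nhds
    (mem_chart_source _ x₀)] with y hy v
  have hy' : y ∈ (extChartAt (𝓡 (d + 1)) x₀).source := by rwa [extChartAt_source]
  rw [TangentBundle.continuousLinearMapAt_trivializationAt hy, J_zero]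
  have h1 : DifferentiableAt ℝ (D.emb ∘ (extChartAt (𝓡 (d + 1)) x₀).symm)
      (extChartAt (𝓡 (d + 1)) x₀ y) := by
    have h3 := (contDiffAt_comp_extChartAt_symm D.pos_smooth 0 hy').differentiableAt (by simp)
    have h4 := h3.comp (f := fun y => ((0 : ℝ), y)) _
      ((differentiableAt_const (0 : ℝ)).prodMk differentiableAt_id)
    refine h4.congr_of_eventuallyEq (Eventually.of_forall fun z => ?_)
    simp [pos_zero]
  have h2 : D.emb =ᶠ[𝓝 y] (D.emb ∘ (extChartAt (𝓡 (d + 1)) x₀).symm) ∘ extChartAt (𝓡 (d + 1)) x₀ := by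
    filter_upwards [(isOpen_extChartAt_source x₀).mem_nhds hy'] with z hz
    simp only [Function.comp, (extChartAt (𝓡 (d + 1)) x₀).left_inv hz]
  rw [h2.mfderiv_eq, mfderiv_comp y h1.mdifferentiableAt (mdifferentiableAt_extChartAt hy),
    mfderiv_eq_fderiv]
  rfl

/-- Near a point, a trivialization of the tangent bundle compares both norms with the Euclidean one:
the Riemannian norm by continuity of the metric, the other because the derivative of the embedding
is continuous and injective at the point. -/
theorem exists_metric_comparison_nhds (m : ContMDiffRiemannianMetric (𝓡 (d + 1)) ∞
      (EuclideanSpace ℝ (Fin (d + 1))) (fun x : M => TangentSpace (𝓡 (d + 1)) x)) (x₀ : M) :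
    ∃ K : ℝ, ∀ᶠ y in 𝓝 x₀, ∀ v : TangentSpace (𝓡 (d + 1)) y,
      √(m.inner y v v) ≤ K * ‖D.J 0 y v‖ ∧ ‖D.J 0 y v‖ ≤ K * √(m.inner y v v) := by
  let _ : RiemannianBundle (fun x : M => TangentSpace (𝓡 (d + 1)) x) := ⟨m.toRiemannianMetric⟩
  have _ : IsContinuousRiemannianBundle (EuclideanSpace ℝ (Fin (d + 1)))
    (fun x : M => TangentSpace (𝓡 (d + 1)) x) := ⟨m.inner, m.contMDiff.continuous, fun _ _ _ => rfl⟩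
  have hnorm : ∀ (y : M) (v : TangentSpace (𝓡 (d + 1)) y), √(m.inner y v v) = ‖v‖ := fun y v =>
    (norm_eq_sqrt_real_inner v).symm
  simp only [hnorm]
  obtain ⟨C₁, hC₁0, hC₁⟩ := eventually_norm_trivializationAt_lt
    (EuclideanSpace ℝ (Fin (d + 1))) (fun x : M => TangentSpace (𝓡 (d + 1)) x) x₀
  obtain ⟨C₂, hC₂0, hC₂⟩ := eventually_norm_symmL_trivializationAt_lt
    (EuclideanSpace ℝ (Fin (d + 1))) (fun x : M => TangentSpace (𝓡 (d + 1)) x) x₀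
  set G := fun y => fderiv ℝ (D.emb ∘ (extChartAt (𝓡 (d + 1)) x₀).symm)
    (extChartAt (𝓡 (d + 1)) x₀ y) with hG
  have hGc : ContinuousAt G x₀ := by
    have h1 : ContDiffAt ℝ ∞ (D.emb ∘ (extChartAt (𝓡 (d + 1)) x₀).symm)
        (extChartAt (𝓡 (d + 1)) x₀ x₀) := by
      have h3 := contDiffAt_comp_extChartAt_symm D.pos_smooth 0 (mem_extChartAt_source
        (I := 𝓡 (d + 1)) x₀)
      have h4 := h3.comp (f := fun y => ((0 : ℝ), y)) _ (contDiffAt_const.prodMk contDiffAt_id)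
      refine h4.congr_of_eventuallyEq (Eventually.of_forall fun z => ?_)
      simp [pos_zero]
    exact (h1.continuousAt_fderiv (by simp)).comp (continuousAt_extChartAt x₀)
  have hGi : Function.Injective (G x₀) := by
    have h1 : D.J 0 x₀ = G x₀ := by
      rw [D.J_zero, mfderiv_eq_fderiv_extChartAt (D.emb_smooth.mdifferentiable (by simp) x₀)]
    rw [← h1]
    exact D.injective_J_zero x₀
  obtain ⟨k, hk0, hk⟩ := (G x₀).toLinearMap.exists_antilipschitzWith (LinearMap.ker_eq_bot.2 hGi)
  have hk' : ∀ w, ‖w‖ ≤ k * ‖G x₀ w‖ := fun w => by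
    have := hk.le_mul_dist w 0
    simpa [dist_eq_norm] using this
  have hk0' : (0 : ℝ) < k := hk0
  have hGev : ∀ᶠ y in 𝓝 x₀, ‖G y - G x₀‖ < 1 / (2 * k) := by
    have h1 : Tendsto (fun y => ‖G y - G x₀‖) (𝓝 x₀) (𝓝 ‖G x₀ - G x₀‖) :=
      (hGc.tendsto.sub_const _).norm
    have h2 : Tendsto (fun y => ‖G y - G x₀‖) (𝓝 x₀) (𝓝 0) := by simpa using h1
    exact h2.eventually (gt_mem_nhds (by positivity))
  have hGev2 : ∀ᶠ y in 𝓝 x₀, ‖G y‖ < ‖G x₀‖ + 1 :=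
    hGc.norm.tendsto.eventually (gt_mem_nhds (by linarith))
  refine ⟨2 * k * C₂ + (‖G x₀‖ + 1) * C₁, ?_⟩
  filter_upwards [hC₁, hC₂, hGev, hGev2, D.J_zero_eq_fderiv x₀,
    (chartAt (EuclideanSpace ℝ (Fin (d + 1))) x₀).open_source.mem_nhds (mem_chart_source _ x₀)]
    with y h1 h2 h3 h4 h5 hy v
  set w := (trivializationAt (EuclideanSpace ℝ (Fin (d + 1))) (TangentSpace (𝓡 (d + 1)))
    x₀).continuousLinearMapAt ℝ y v with hw
  have hJ : D.J 0 y v = G y w := h5 v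
  have hvw : v = (trivializationAt (EuclideanSpace ℝ (Fin (d + 1))) (TangentSpace (𝓡 (d + 1)))
      x₀).symmL ℝ y w := by
    rw [hw, Trivialization.symmL_continuousLinearMapAt]
    exact hy
  have e1 : ‖w‖ ≤ C₁ * ‖v‖ := ((ContinuousLinearMap.le_opNorm _ _)).trans
    (mul_le_mul_of_nonneg_right h1.le (norm_nonneg v))
  have e2 : ‖v‖ ≤ C₂ * ‖w‖ := by
    calc ‖v‖ = ‖(trivializationAt (EuclideanSpace ℝ (Fin (d + 1))) (TangentSpace (𝓡 (d + 1)))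
          x₀).symmL ℝ y w‖ := congrArg norm hvw
      _ ≤ _ := ((ContinuousLinearMap.le_opNorm _ _)).trans
        (mul_le_mul_of_nonneg_right h2.le (norm_nonneg w))
  have e3 : ‖w‖ ≤ 2 * k * ‖G y w‖ := by
    have h6 : ‖G x₀ w‖ ≤ ‖G y w‖ + 1 / (2 * k) * ‖w‖ := by
      have h7 := ((G y - G x₀).le_opNorm w).trans
        (mul_le_mul_of_nonneg_right h3.le (norm_nonneg w))
      have h8 : G x₀ w = G y w - (G y - G x₀) w := by simp
      calc ‖G x₀ w‖ = ‖G y w - (G y - G x₀) w‖ := congrArg norm h8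
        _ ≤ ‖G y w‖ + ‖(G y - G x₀) w‖ := norm_sub_le _ _
        _ ≤ _ := by linarith
    have h9 := (hk' w).trans (mul_le_mul_of_nonneg_left h6 hk0'.le)
    have h10 : (k : ℝ) * (1 / (2 * k) * ‖w‖) = ‖w‖ / 2 := by field_simp
    rw [mul_add, h10] at h9
    linarith
  have e4 : ‖G y w‖ ≤ (‖G x₀‖ + 1) * ‖w‖ := ((G y).le_opNorm w).trans
    (mul_le_mul_of_nonneg_right h4.le (norm_nonneg w))
  rw [hJ]
  constructor
  · calc ‖v‖ ≤ C₂ * (2 * k * ‖G y w‖) := e2.trans (by gcongr)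
      _ ≤ _ := by
        have : 0 ≤ (‖G x₀‖ + 1) * C₁ * ‖G y w‖ := by positivity
        nlinarith
  · calc ‖G y w‖ ≤ (‖G x₀‖ + 1) * (C₁ * ‖v‖) := e4.trans (by gcongr)
      _ ≤ _ := by
        have : 0 ≤ 2 * k * C₂ * ‖v‖ := by positivity
        nlinarith

theorem exists_metric_comparison [CompactSpace M] (m : ContMDiffRiemannianMetric (𝓡 (d + 1)) ∞
      (EuclideanSpace ℝ (Fin (d + 1))) (fun x : M => TangentSpace (𝓡 (d + 1)) x)) :
    ∃ K : ℝ, 0 < K ∧ ∀ (y : M) (v : TangentSpace (𝓡 (d + 1)) y),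
      √(m.inner y v v) ≤ K * ‖D.J 0 y v‖ ∧ ‖D.J 0 y v‖ ≤ K * √(m.inner y v v) := by
  suffices h : ∃ K : ℝ, 0 < K ∧ ∀ y ∈ (univ : Set M), ∀ v : TangentSpace (𝓡 (d + 1)) y,
      √(m.inner y v v) ≤ K * ‖D.J 0 y v‖ ∧ ‖D.J 0 y v‖ ≤ K * √(m.inner y v v) by
    obtain ⟨K, hK, h⟩ := h
    exact ⟨K, hK, fun y => h y (mem_univ y)⟩
  have hmono : ∀ {K K' : ℝ} {a b : ℝ}, 0 ≤ b → K ≤ K' → a ≤ K * b → a ≤ K' * b :=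
    fun hb hK h => h.trans (mul_le_mul_of_nonneg_right hK hb)
  refine isCompact_univ.induction_on (p := fun S => ∃ K : ℝ, 0 < K ∧ ∀ y ∈ S,
    ∀ v : TangentSpace (𝓡 (d + 1)) y, √(m.inner y v v) ≤ K * ‖D.J 0 y v‖ ∧
      ‖D.J 0 y v‖ ≤ K * √(m.inner y v v)) ⟨1, one_pos, fun y hy => hy.elim⟩ ?_ ?_ ?_
  · rintro S T hST ⟨K, hK, h⟩
    exact ⟨K, hK, fun y hy => h y (hST hy)⟩
  · rintro S T ⟨K, hK, h⟩ ⟨K', hK', h'⟩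
    refine ⟨max K K', lt_max_of_lt_left hK, fun y hy v => ?_⟩
    rcases hy with hy | hy
    · exact ⟨hmono (norm_nonneg _) (le_max_left _ _) (h y hy v).1,
        hmono (Real.sqrt_nonneg _) (le_max_left _ _) (h y hy v).2⟩
    · exact ⟨hmono (norm_nonneg _) (le_max_right _ _) (h' y hy v).1,
        hmono (Real.sqrt_nonneg _) (le_max_right _ _) (h' y hy v).2⟩
  · intro x _
    obtain ⟨K, hK⟩ := D.exists_metric_comparison_nhds m x
    refine ⟨_, nhdsWithin_le_nhds hK, max K 1, lt_max_of_lt_right one_pos, fun y hy v => ?_⟩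
    exact ⟨hmono (norm_nonneg _) (le_max_left _ _) (hy v).1,
      hmono (Real.sqrt_nonneg _) (le_max_left _ _) (hy v).2⟩

end EmbeddedFlow

end Hyperbolicity

/-! ### Anosov splitting: bounded directions are tangent to the flow. -/

section Escape

open Set Asymptotics Bundle

universe u
variable {d : ℕ} {M : Type u} [TopologicalSpace M]
  [ChartedSpace (EuclideanSpace ℝ (Fin (d + 1))) M] [IsManifold (𝓡 (d + 1)) ∞ M]

theorem iSup_three {α : Type*} [CompleteLattice α] (a b c : α) :
    ⨆ i, ![a, b, c] i = a ⊔ b ⊔ c := by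
  refine le_antisymm (iSup_le fun i => ?_) (sup_le (sup_le ?_ ?_) ?_)
  · fin_cases i
    · exact le_sup_left.trans le_sup_left
    · exact le_sup_right.trans le_sup_left
    · exact le_sup_right
  · exact le_iSup ![a, b, c] 0
  · exact le_iSup ![a, b, c] 1
  · exact le_iSup ![a, b, c] 2

theorem exists_decomposition {F : Type*} [AddCommGroup F] [Module ℝ F] {a b : Submodule ℝ F}
    {w : F} (h : DirectSum.IsInternal ![a, b, Submodule.span ℝ {w}]) (v : F) :
    ∃ e ∈ a, ∃ f ∈ b, ∃ c : ℝ, v = e + f + c • w := by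
  have htop := h.submodule_iSup_eq_top
  rw [iSup_three] at htop
  have hv : v ∈ a ⊔ b ⊔ Submodule.span ℝ {w} := by rw [htop]; trivial
  obtain ⟨p, hp, q, hq, rfl⟩ := Submodule.mem_sup.1 hv
  obtain ⟨e, he, f, hf, rfl⟩ := Submodule.mem_sup.1 hp
  obtain ⟨c, rfl⟩ := Submodule.mem_span_singleton.1 hq
  exact ⟨e, he, f, hf, c, rfl⟩

theorem exists_embeddedFlow [T2Space M] [CompactSpace M] {V : VField d M} {φ : Flow ℝ M}
    (hφ : ContMDiff (𝓘(ℝ, ℝ).prod (𝓡 (d + 1))) (𝓡 (d + 1)) ∞ (fun p : ℝ × M => φ p.1 p.2))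
    (hφV : ∀ x : M, IsMIntegralCurve (I := 𝓡 (d + 1)) (fun t : ℝ => φ t x) V)
    (h0 : ∀ x, V x ≠ 0) : ∃ N, Nonempty (EmbeddedFlow V φ N) := by
  obtain ⟨N, e, h1, h2, h3⟩ := exists_embedding_euclidean_of_compact (I := 𝓡 (d + 1)) (M := M)
  exact ⟨N, ⟨⟨e, h1, h2, h3, hφ, hφV, h0⟩⟩⟩

namespace EmbeddedFlow

variable {V : VField d M} {φ : Flow ℝ M} {N : ℕ} (D : EmbeddedFlow V φ N)
  {Eu Es : (x : M) → Submodule ℝ (TangentSpace (𝓡 (d + 1)) x)}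
include D

theorem exists_hyperbolic_constants [CompactSpace M] (hA : IsAnosov V φ Eu Es) :
    ∃ C l : ℝ, 0 < C ∧ 0 < l ∧ l < 1 ∧ ∀ t : ℝ, 0 ≤ t → ∀ x : M,
      (∀ v ∈ Es x, ‖D.J t x v‖ ≤ C * l ^ t * ‖D.J 0 x v‖) ∧
      (∀ v ∈ Eu x, ‖D.J (-t) x v‖ ≤ C * l ^ t * ‖D.J 0 x v‖) := by
  obtain ⟨m, C, l, hC, hl0, hl1, h⟩ := hA.hyperbolic
  obtain ⟨K, hK, hm⟩ := D.exists_metric_comparison m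
  refine ⟨K * C * K, l, by positivity, hl0, hl1, fun t ht x => ?_⟩
  have key : ∀ (s : ℝ) (v : TangentSpace (𝓡 (d + 1)) x),
      √(m.inner (φ s x) (mfderiv (𝓡 (d + 1)) (𝓡 (d + 1)) (φ s) x v)
        (mfderiv (𝓡 (d + 1)) (𝓡 (d + 1)) (φ s) x v)) ≤ C * l ^ t * √(m.inner x v v) →
      ‖D.J s x v‖ ≤ K * C * K * l ^ t * ‖D.J 0 x v‖ := by
    intro s v hv
    rw [D.J_eq]
    calc _ ≤ K * (C * l ^ t * (K * ‖D.J 0 x v‖)) :=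
          (hm _ _).2.trans (mul_le_mul_of_nonneg_left (hv.trans
            (mul_le_mul_of_nonneg_left (hm x v).1 (by positivity))) hK.le)
      _ = _ := by ring
  exact ⟨fun v hv => key _ v ((h t ht x).1 v hv), fun v hv => key _ v ((h t ht x).2 v hv)⟩

variable [T2Space M] [CompactSpace M]

/-- A direction that is contracted in positive or negative time stays away from the flow
direction. -/
theorem exists_angle_bound {E : (x : M) → Submodule ℝ (TangentSpace (𝓡 (d + 1)) x)} {σ C l : ℝ}
    (hl0 : 0 < l) (hl1 : l < 1)
    (hE : ∀ t : ℝ, 0 ≤ t → ∀ x : M, ∀ v ∈ E x, ‖D.J (σ * t) x v‖ ≤ C * l ^ t * ‖D.J 0 x v‖) :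
    ∃ K : ℝ, 0 < K ∧ ∀ x : M, ∀ v ∈ E x, ∀ c : ℝ, ‖D.J 0 x v‖ ≤ K * ‖D.J 0 x v - c • D.W x‖ := by
  obtain ⟨a, b, ha, hb, hW⟩ := D.exists_W_bounds
  have hlim : Tendsto (fun n : ℕ => C * l ^ n) atTop (𝓝 (C * 0)) :=
    (tendsto_pow_atTop_nhds_zero_of_lt_one hl0.le hl1).const_mul C
  rw [mul_zero] at hlim
  -- After time `n` the contracted vector is smaller than half of the image of the velocity part,
  -- with `a` and `b` the extreme speeds, while the difference grows by at most `Q`. Hence the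
  -- coefficient `c` is controlled by the difference.
  obtain ⟨n, hn⟩ := (hlim.eventually (gt_mem_nhds (show 0 < a / (2 * b) by positivity))).exists
  obtain ⟨Λ, hΛ, hL⟩ := D.exists_lipschitz
  obtain ⟨k, hk⟩ := exists_nat_ge |σ * n|
  set Q := Λ ^ k with hQ
  have hQ0 : 0 < Q := by positivity
  refine ⟨2 * (1 + b * Q / a), by positivity, fun x v hv c => ?_⟩
  have h1 : ‖D.J (σ * n) x v‖ ≤ a / (2 * b) * ‖D.J 0 x v‖ := by
    refine (hE n (Nat.cast_nonneg n) x v hv).trans ?_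
    rw [Real.rpow_natCast]
    exact mul_le_mul_of_nonneg_right hn.le (norm_nonneg _)
  have h2 : ‖D.J (σ * n) x (v - c • V x)‖ ≤ Q * ‖D.J 0 x (v - c • V x)‖ :=
    D.norm_J_le (D.lipschitz_iterate hΛ hL k _ hk) x _
  have e1 : ∀ s, D.J s x (v - c • V x) = D.J s x v - c • D.W (φ s x) := fun s => by
    rw [← D.J_V]
    exact (map_sub (D.J s x) v (c • V x)).trans (congrArg _ (map_smul (D.J s x) c (V x)))
  rw [e1, e1, φ.map_zero_apply] at h2
  set p := ‖D.J 0 x v‖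
  set q := ‖D.J 0 x v - c • D.W x‖
  have h3 : |c| * a ≤ a / (2 * b) * p + Q * q := by
    calc |c| * a ≤ ‖c • D.W (φ (σ * n) x)‖ := by
          rw [norm_smul, Real.norm_eq_abs]
          exact mul_le_mul_of_nonneg_left (hW _).1 (abs_nonneg c)
      _ = ‖D.J (σ * n) x v - (D.J (σ * n) x v - c • D.W (φ (σ * n) x))‖ := by rw [sub_sub_cancel]
      _ ≤ _ := (norm_sub_le _ _).trans (add_le_add h1 h2)
  have h4 : p ≤ q + |c| * b := by
    calc p = ‖(D.J 0 x v - c • D.W x) + c • D.W x‖ := by rw [sub_add_cancel]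
      _ ≤ q + ‖c • D.W x‖ := norm_add_le _ _
      _ ≤ _ := by
        rw [norm_smul, Real.norm_eq_abs]
        have := mul_le_mul_of_nonneg_left (hW x).2 (abs_nonneg c)
        linarith
  have h5 : |c| * b ≤ p / 2 + b * Q / a * q := by
    have : |c| * b = (|c| * a) * (b / a) := by field_simp
    rw [this]
    calc _ ≤ (a / (2 * b) * p + Q * q) * (b / a) := mul_le_mul_of_nonneg_right h3 (by positivity)
      _ = _ := by field_simp
  linarith

/-- Vectors of `E` shrink when carried back from time `σ n`, so `‖e‖ ≤ C l^n ‖Dφ^{σn} e‖`. The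
component in `F` is bounded, and the angle bound replaces "bounded modulo the flow direction" by
"bounded"; letting `n` grow kills `e`. -/
theorem eq_zero_of_bounded {E F : (x : M) → Submodule ℝ (TangentSpace (𝓡 (d + 1)) x)} {σ C l : ℝ}
    (hC : 0 < C) (hl0 : 0 < l) (hl1 : l < 1)
    (hE : ∀ t : ℝ, 0 ≤ t → ∀ x : M, ∀ v ∈ E x, ‖D.J (-σ * t) x v‖ ≤ C * l ^ t * ‖D.J 0 x v‖)
    (hF : ∀ t : ℝ, 0 ≤ t → ∀ x : M, ∀ v ∈ F x, ‖D.J (σ * t) x v‖ ≤ C * l ^ t * ‖D.J 0 x v‖)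
    (hmap : ∀ (t : ℝ) (x : M), ∀ v ∈ E x,
      mfderiv (𝓡 (d + 1)) (𝓡 (d + 1)) (φ t) x v ∈ E (φ t x))
    {x : M} {e f : TangentSpace (𝓡 (d + 1)) x} (he : e ∈ E x) (hf : f ∈ F x) (c₀ B : ℝ)
    (hb : ∀ s, ∃ c : ℝ, ‖D.J s x (e + f + c₀ • V x) - c • D.W (φ s x)‖ ≤ B) : e = 0 := by
  obtain ⟨K, hK, hang⟩ := D.exists_angle_bound hl0 hl1 hE
  have hlim : Tendsto (fun n : ℕ => C * (K * (B + C * ‖D.J 0 x f‖)) * l ^ n) atTop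
      (𝓝 (C * (K * (B + C * ‖D.J 0 x f‖)) * 0)) :=
    (tendsto_pow_atTop_nhds_zero_of_lt_one hl0.le hl1).const_mul _
  rw [mul_zero] at hlim
  have h0 : ‖D.J 0 x e‖ ≤ 0 := by
    refine ge_of_tendsto hlim (Eventually.of_forall fun n => ?_)
    set s : ℝ := σ * n with hs
    set w := mfderiv (𝓡 (d + 1)) (𝓡 (d + 1)) (φ s) x e with hw
    have h1 : ‖D.J 0 x e‖ ≤ C * l ^ n * ‖D.J 0 (φ s x) w‖ := by
      have := hE n (Nat.cast_nonneg n) _ w (hmap s x e he)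
      rw [Real.rpow_natCast, hw, ← D.J_add] at this
      have e0 : -σ * n + s = 0 := by rw [hs]; ring
      rwa [e0] at this
    obtain ⟨c, hc⟩ := hb s
    have h2 : D.J s x (e + f + c₀ • V x) = D.J 0 (φ s x) w + D.J s x f + c₀ • D.W (φ s x) := by
      rw [hw, ← D.J_eq, ← D.J_V]
      exact (map_add (D.J s x) (e + f) (c₀ • V x)).trans (congrArg₂ _ (map_add (D.J s x) e f)
        (map_smul (D.J s x) c₀ (V x)))
    have h3 : ‖D.J s x f‖ ≤ C * ‖D.J 0 x f‖ := by
      refine (hF n (Nat.cast_nonneg n) x f hf).trans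
        (mul_le_mul_of_nonneg_right ?_ (norm_nonneg _))
      rw [Real.rpow_natCast]
      exact mul_le_of_le_one_right hC.le (pow_le_one₀ hl0.le hl1.le)
    have h4 : ‖D.J 0 (φ s x) w - (c - c₀) • D.W (φ s x)‖ ≤ B + C * ‖D.J 0 x f‖ := by
      have : D.J 0 (φ s x) w - (c - c₀) • D.W (φ s x) =
          (D.J s x (e + f + c₀ • V x) - c • D.W (φ s x)) - D.J s x f := by
        rw [h2, sub_smul]; abel
      rw [this]
      exact (norm_sub_le _ _).trans (add_le_add hc h3)
    calc _ ≤ C * l ^ n * (K * (B + C * ‖D.J 0 x f‖)) :=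
          h1.trans (mul_le_mul_of_nonneg_left ((hang _ w (hmap s x e he) (c - c₀)).trans
            (mul_le_mul_of_nonneg_left h4 hK.le)) (by positivity))
      _ = _ := by ring
  have h1 : D.J 0 x e = D.J 0 x 0 := by
    rw [map_zero]; exact norm_le_zero_iff.1 h0
  exact D.injective_J_zero x h1

/-- The unstable component is killed by the future (`σ = 1`), the stable one by the past (`σ = -1`);
only the flow component survives. -/
theorem tangent_of_bounded (hA : IsAnosov V φ Eu Es) (x : M) (v : EuclideanSpace ℝ (Fin (d + 1)))
    (B : ℝ) (hb : ∀ s, ∃ c : ℝ, ‖D.J s x v - c • D.W (φ s x)‖ ≤ B) :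
    ∃ c : ℝ, D.J 0 x v = c • D.W x := by
  obtain ⟨C, l, hC, hl0, hl1, h⟩ := D.exists_hyperbolic_constants hA
  have hu : ∀ (t : ℝ) (x : M), ∀ v ∈ Eu x,
      mfderiv (𝓡 (d + 1)) (𝓡 (d + 1)) (φ t) x v ∈ Eu (φ t x) := fun t x v hv => by
    rw [← hA.map_unstable]; exact Submodule.mem_map_of_mem hv
  have hs : ∀ (t : ℝ) (x : M), ∀ v ∈ Es x,
      mfderiv (𝓡 (d + 1)) (𝓡 (d + 1)) (φ t) x v ∈ Es (φ t x) := fun t x v hv => by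
    rw [← hA.map_stable]; exact Submodule.mem_map_of_mem hv
  obtain ⟨e, he, f, hf, c₀, rfl⟩ : ∃ e ∈ Eu x, ∃ f ∈ Es x, ∃ c₀ : ℝ, v = e + f + c₀ • V x :=
    exists_decomposition (hA.isInternal x) v
  have e0 : e = 0 := by
    refine D.eq_zero_of_bounded (σ := 1) hC hl0 hl1 (fun t ht x v hv => ?_)
      (fun t ht x v hv => ?_) hu he hf c₀ B hb
    · rw [neg_one_mul]; exact (h t ht x).2 v hv
    · rw [one_mul]; exact (h t ht x).1 v hv
  have f0 : f = 0 := by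
    refine D.eq_zero_of_bounded (σ := -1) (E := Es) (F := Eu) (f := e) hC hl0 hl1
      (fun t ht x v hv => ?_) (fun t ht x v hv => ?_) hs hf he c₀ B ?_
    · rw [neg_neg, one_mul]; exact (h t ht x).1 v hv
    · rw [neg_one_mul]; exact (h t ht x).2 v hv
    · rw [add_comm f e]; exact hb
  refine ⟨c₀, ?_⟩
  rw [W_eq, e0, f0]
  have : (0 + 0 + c₀ • V x : TangentSpace (𝓡 (d + 1)) x) = c₀ • V x := by simp
  exact (congrArg (D.J 0 x) this).trans (map_smul (D.J 0 x) c₀ (V x))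

/-- Anosov flows are expansive. -/
theorem exists_expansivity_constant_of_isAnosov (hA : IsAnosov V φ Eu Es) :
    ∃ ε : ℝ, 0 < ε ∧ ∀ (x y : M) (a : ℝ), |a - 1| ≤ ε →
      (∀ s, ‖D.pos (s, x) - D.pos (a * s, y)‖ ≤ ε) → ∃ r, x = φ r y :=
  D.exists_expansivity_constant fun x v B hb => D.tangent_of_bounded hA x v B hb

end EmbeddedFlow

end Escape

/-! ### Exponential bound on the number of periodic orbits. -/

section Counting

open Set

/-- At level `n` the labels take at most `(2P + 3)^m Λ^{mn}` values, with `m` the number of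
coordinates; the weight `(2 Λ^m)^{-n}` leaves a geometric series of ratio 1/2. -/
theorem summable_pow_of_injective_cells {ι κ : Type*} [Fintype κ] {n : ι → ℕ} {c : ι → κ → ℤ}
    (hinj : ∀ a b, n a = n b → c a = c b → a = b) {P Λ : ℝ} (hP : 0 ≤ P) (hΛ : 1 ≤ Λ)
    (hc : ∀ a i, |(c a i : ℝ)| ≤ P * Λ ^ n a) :
    ∃ q : ℝ, 0 < q ∧ Summable fun a => q ^ n a := by
  classical
  set R : ℕ → ℕ := fun k => ⌈P * Λ ^ k⌉₊ with hR
  set A : ℕ → Finset (κ → ℤ) := fun k =>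
    Fintype.piFinset fun _ => Finset.Icc (-(R k : ℤ)) (R k) with hA
  set m := Fintype.card κ with hm
  refine ⟨(2 * Λ ^ m)⁻¹, by positivity, ?_⟩
  set q : ℝ := (2 * Λ ^ m)⁻¹ with hq
  have hq0 : 0 < q := by positivity
  have hsum : Summable fun p : Σ k : ℕ, A k => q ^ p.1 := by
    rw [summable_sigma_of_nonneg fun p => by positivity]
    refine ⟨fun k => (hasSum_fintype _).summable, ?_⟩
    have hcard : ∀ k, ((A k).card : ℝ) ≤ (2 * P + 3) ^ m * (Λ ^ m) ^ k := by
      intro k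
      have h1 : (A k).card = (2 * R k + 1) ^ m := by
        change (Fintype.piFinset fun _ => Finset.Icc (-(R k : ℤ)) (R k)).card = _
        rw [Fintype.card_piFinset, Finset.prod_const, Int.card_Icc, Finset.card_univ, ← hm]
        congr 1
        omega
      have h2 : (R k : ℝ) ≤ P * Λ ^ k + 1 := (Nat.ceil_lt_add_one (by positivity)).le
      have h3 : (1 : ℝ) ≤ Λ ^ k := one_le_pow₀ hΛ
      rw [h1, ← pow_mul, mul_comm m k, pow_mul, ← mul_pow]
      push_cast
      gcongr
      nlinarith
    refine Summable.of_nonneg_of_le (fun k => tsum_nonneg fun _ => by positivity) (fun k => ?_)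
      ((summable_geometric_two).mul_left ((2 * P + 3) ^ m))
    rw [tsum_fintype]
    change ∑ _p : A k, q ^ k ≤ _
    rw [Finset.sum_const, Finset.card_univ, Fintype.card_coe, nsmul_eq_mul]
    calc ((A k).card : ℝ) * q ^ k ≤ (2 * P + 3) ^ m * (Λ ^ m) ^ k * q ^ k :=
          mul_le_mul_of_nonneg_right (hcard k) (by positivity)
      _ = (2 * P + 3) ^ m * (1 / 2) ^ k := by
        rw [mul_assoc, ← mul_pow, hq]
        congr 2
        field_simp
  have hmem : ∀ a, c a ∈ A (n a) := by
    intro a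
    refine Fintype.mem_piFinset.2 fun i => ?_
    have h1 : |(c a i : ℝ)| ≤ (R (n a) : ℝ) := (hc a i).trans (Nat.le_ceil _)
    have h2 : |c a i| ≤ (R (n a) : ℤ) := by exact_mod_cast h1
    exact Finset.mem_Icc.2 (abs_le.1 h2)
  refine hsum.comp_injective (i := fun a => (⟨n a, ⟨c a, hmem a⟩⟩ : Σ k : ℕ, A k)) ?_
  intro a b hab
  have h1 : n a = n b := congrArg (fun p : Σ k : ℕ, A k => p.1) hab
  have h2 : c a = c b := congrArg (fun p : Σ k : ℕ, A k => (p.2 : κ → ℤ)) hab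
  exact hinj a b h1 h2

theorem norm_le_sum_abs {N : ℕ} (v : EuclideanSpace ℝ (Fin N)) : ‖v‖ ≤ ∑ i, |v i| := by
  rw [EuclideanSpace.norm_eq]
  refine Real.sqrt_le_iff.2 ⟨Finset.sum_nonneg fun _ _ => abs_nonneg _, ?_⟩
  exact Finset.sum_sq_le_sq_sum_of_nonneg fun i _ => abs_nonneg (v i)

theorem abs_sub_le_of_floor_eq {a b h : ℝ} (hh : 0 < h) (hab : ⌊a / h⌋ = ⌊b / h⌋) : |a - b| ≤ h := by
  have := Int.abs_sub_lt_one_of_floor_eq_floor hab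
  rw [← sub_div, abs_div, abs_of_pos hh, div_lt_one hh] at this
  exact this.le

universe u
variable {d : ℕ} {M : Type u} [TopologicalSpace M]
  [ChartedSpace (EuclideanSpace ℝ (Fin (d + 1))) M] [IsManifold (𝓡 (d + 1)) ∞ M]

namespace PeriodicOrbit

variable {φ : Flow ℝ M}

theorem base_mem (γ : PeriodicOrbit φ) : γ.base ∈ γ.carrier := γ.carrier_nonempty.some_mem

theorem carrier_eq_range (γ : PeriodicOrbit φ) {x : M} (hx : x ∈ γ.carrier) :
    γ.carrier = range fun t : ℝ => φ t x := by
  obtain ⟨y, hy⟩ := γ.isOrbit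
  rw [hy] at hx ⊢
  obtain ⟨s, rfl⟩ := hx
  ext z
  constructor
  · rintro ⟨t, rfl⟩
    exact ⟨t - s, by simp [← φ.map_add]⟩
  · rintro ⟨t, rfl⟩
    exact ⟨t + s, by simp [φ.map_add]⟩

theorem eq_of_carrier_of_len {γ γ' : PeriodicOrbit φ} (h : γ.carrier = γ'.carrier)
    (h' : γ.len = γ'.len) : γ = γ' := by
  cases γ; cases γ'
  simp only at h h'
  subst h h'
  rfl

theorem flow_zsmul_len (γ : PeriodicOrbit φ) {x : M} (hx : φ γ.len x = x) (k : ℤ) (s : ℝ) :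
    φ (k * γ.len + s) x = φ s x := by
  have h1 : ∀ k : ℕ, φ (k * γ.len) x = x := by
    intro k
    induction k with
    | zero => simp
    | succ k ih => push_cast; rw [add_mul, one_mul, φ.map_add, hx, ih]
  have h2 : ∀ k : ℤ, φ (k * γ.len) x = x := by
    intro k
    obtain ⟨n, rfl | rfl⟩ := k.eq_nat_or_neg
    · exact_mod_cast h1 n
    · push_cast
      have : φ (-(n : ℝ) * γ.len) (φ (n * γ.len) x) = x := by
        rw [← φ.map_add]; simp
      rwa [h1] at this
  rw [add_comm, φ.map_add, h2]

end PeriodicOrbit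

namespace EmbeddedFlow

variable {V : VField d M} {φ : Flow ℝ M} {N : ℕ} (D : EmbeddedFlow V φ N)
  [T2Space M] [CompactSpace M]
include D

/-- Rescaling time by the ratio of the lengths gives both orbits the same period, so closeness for
all times reduces to one period. There the Lipschitz bound controls the initial gap, the speed bound
controls the drift from rescaling, and expansivity applies. -/
theorem exists_eq_flow_of_close {ε C K : ℝ}
    (hε : ∀ (x y : M) (a : ℝ), |a - 1| ≤ ε →
      (∀ s, ‖D.pos (s, x) - D.pos (a * s, y)‖ ≤ ε) → ∃ r, x = φ r y)
    (hC : ∀ x, ‖D.W x‖ ≤ C) {γ γ' : PeriodicOrbit φ}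
    (hK : ∀ t, |t| ≤ γ.len → ∀ x y, ‖D.pos (t, x) - D.pos (t, y)‖ ≤ K * ‖D.emb x - D.emb y‖)
    (h1 : |γ'.len - γ.len| ≤ ε * γ.len) (h2 : C * |γ'.len - γ.len| ≤ ε / 2)
    (h3 : K * ‖D.emb γ.base - D.emb γ'.base‖ ≤ ε / 2) : ∃ r, γ.base = φ r γ'.base := by
  set S := γ.len with hS
  set T := γ'.len with hT
  have hS0 : 0 < S := γ.len_pos
  have hC0 : 0 ≤ C := (norm_nonneg _).trans (hC γ.base)
  refine hε _ _ (T / S) ?_ fun s => ?_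
  · rw [div_sub_one hS0.ne', abs_div, abs_of_pos hS0, div_le_iff₀ hS0]
    exact h1
  set k := ⌊s / S⌋ with hk
  set s' := s - k * S with hs'
  have hs0 : 0 ≤ s' := by
    have := (le_div_iff₀ hS0).1 (Int.floor_le (s / S))
    rw [hs']; linarith
  have hs1 : s' ≤ S := by
    have := (div_lt_iff₀ hS0).1 (Int.lt_floor_add_one (s / S))
    rw [hs', hk]; linarith
  have e1 : D.pos (s, γ.base) = D.pos (s', γ.base) := by
    have := γ.flow_zsmul_len γ.flow_len_base k s'
    rw [hs', ← hS, add_sub_cancel] at this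
    simp only [pos]
    rw [this, hs']
  have e2 : D.pos (T / S * s, γ'.base) = D.pos (T / S * s', γ'.base) := by
    have := γ'.flow_zsmul_len γ'.flow_len_base k (T / S * s')
    have h4 : (k : ℝ) * T + T / S * s' = T / S * s := by rw [hs']; field_simp; ring
    rw [← hT, h4] at this
    simp only [pos]
    rw [this]
  rw [e1, e2]
  have h5 : ‖D.pos (s', γ'.base) - D.pos (T / S * s', γ'.base)‖ ≤ ε / 2 := by
    refine (D.norm_pos_sub_le hC _ _ _).trans (le_trans ?_ h2)
    refine mul_le_mul_of_nonneg_left ?_ hC0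
    have : s' - T / S * s' = -((T - S) * (s' / S)) := by field_simp; ring
    rw [this, abs_neg, abs_mul]
    refine mul_le_of_le_one_right (abs_nonneg _) ?_
    rw [abs_of_nonneg (by positivity)]
    exact (div_le_one hS0).2 hs1
  calc _ = ‖(D.pos (s', γ.base) - D.pos (s', γ'.base)) +
        (D.pos (s', γ'.base) - D.pos (T / S * s', γ'.base))‖ := by rw [sub_add_sub_cancel]
    _ ≤ ε / 2 + ε / 2 := (norm_add_le _ _).trans (add_le_add ((hK s' (by rwa [abs_of_nonneg hs0]) _ _).trans h3) h5)
    _ = ε := by ring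

variable {Eu Es : (x : M) → Submodule ℝ (TangentSpace (𝓡 (d + 1)) x)}

/-- The number of periodic orbits of an Anosov flow of length at most `T` grows at most
exponentially with `T`. -/
theorem exists_summable_exp_len (hA : IsAnosov V φ Eu Es) :
    ∃ σ : ℝ, Summable fun γ : PeriodicOrbit φ => Real.exp (-σ * γ.len) := by
  obtain ⟨ε, hε0, hε⟩ := D.exists_expansivity_constant_of_isAnosov hA
  obtain ⟨T₀, hT₀, hper⟩ := D.exists_min_period
  obtain ⟨Λ₀, hΛ₀, hL₀⟩ := D.exists_lipschitz
  obtain ⟨_, C, _, hC0, hWC⟩ := D.exists_W_bounds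
  obtain ⟨B, hB0, hB⟩ := D.exists_bound_emb
  have hC : ∀ x, ‖D.W x‖ ≤ C := fun x => (hWC x).2
  -- At least 2, so that `Λ ^ n` also dominates `n`, hence the label that records the length.
  set Λ := max Λ₀ 2 with hΛdef
  have hΛ : 1 ≤ Λ := hΛ₀.trans (le_max_left _ _)
  have hL : ∀ (t : ℝ), |t| ≤ 1 → ∀ x y : M,
      ‖D.pos (t, x) - D.pos (t, y)‖ ≤ Λ * ‖D.emb x - D.emb y‖ := fun t ht x y =>
    (hL₀ t ht x y).trans (mul_le_mul_of_nonneg_right (le_max_left _ _) (norm_nonneg _))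
  -- The three terms ensure that the ratio of lengths is within `ε` of 1, that the drift over a
  -- period is at most `ε / 2`, and that two periods of one orbit differing by at most `δ` are
  -- equal.
  set δ := min (ε * T₀) (min (ε / 2 / C) T₀) with hδ
  have hδ0 : 0 < δ := by positivity
  -- Mesh of the grid for base points: after expansion by `Λ ^ n`, two points of one cell are still
  -- within `ε / 2`.
  set h : ℕ → ℝ := fun n => ε / (2 * (N + 1)) / Λ ^ n with hh
  have hh0 : ∀ n, 0 < h n := fun n => by positivity
  set n : PeriodicOrbit φ → ℕ := fun γ => ⌈γ.len⌉₊ with hn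
  set c : PeriodicOrbit φ → Option (Fin N) → ℤ := fun γ i =>
    i.elim ⌊γ.len / δ⌋ fun i => ⌊D.emb γ.base i / h (n γ)⌋ with hc
  have hlenT : ∀ γ : PeriodicOrbit φ, T₀ ≤ γ.len := by
    intro γ
    by_contra! hlt
    exact γ.len_pos.ne' (hper γ.base γ.len (by rw [abs_of_pos γ.len_pos]; exact hlt.le)
      γ.flow_len_base)
  have hinj : ∀ a b, n a = n b → c a = c b → a = b := by
    intro γ γ' h1 h2
    have h3 : |γ'.len - γ.len| ≤ δ := by
      rw [abs_sub_comm]; exact abs_sub_le_of_floor_eq hδ0 (congrFun h2 none)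
    have h4 : ‖D.emb γ.base - D.emb γ'.base‖ ≤ N * h (n γ) := by
      refine (norm_le_sum_abs _).trans ?_
      calc _ ≤ ∑ i : Fin N, h (n γ) := Finset.sum_le_sum fun i _ => by
            have h5 : ⌊D.emb γ.base i / h (n γ)⌋ = ⌊D.emb γ'.base i / h (n γ')⌋ :=
              congrFun h2 (some i)
            rw [← h1] at h5
            exact abs_sub_le_of_floor_eq (hh0 _) h5
        _ = _ := by simp
    obtain ⟨r, hr⟩ := D.exists_eq_flow_of_close (K := Λ ^ n γ) hε hC (γ := γ) (γ' := γ')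
      (fun t ht => D.lipschitz_iterate hΛ hL (n γ) t (ht.trans (Nat.le_ceil _)))
      (h3.trans ((min_le_left _ _).trans (mul_le_mul_of_nonneg_left (hlenT γ) hε0.le)))
      (by
        have := h3.trans ((min_le_right _ _).trans (min_le_left _ _))
        rw [le_div_iff₀ hC0] at this
        linarith)
      (by
        have h6 : Λ ^ n γ * (N * h (n γ)) ≤ ε / 2 := by
          have hp : (0 : ℝ) < Λ ^ n γ := by positivity
          have : Λ ^ n γ * (N * h (n γ)) = ε / 2 * (N / (N + 1)) := by
            rw [hh]; field_simp
          rw [this]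
          refine mul_le_of_le_one_right (by positivity) ?_
          rw [div_le_one (by positivity)]
          linarith
        exact (mul_le_mul_of_nonneg_left h4 (by positivity)).trans h6)
    have hcar : γ.carrier = γ'.carrier := by
      have h7 : γ.base ∈ γ'.carrier := by
        rw [γ'.carrier_eq_range γ'.base_mem]; exact ⟨r, hr.symm⟩
      rw [γ.carrier_eq_range γ.base_mem, γ'.carrier_eq_range h7]
    refine PeriodicOrbit.eq_of_carrier_of_len hcar ?_
    have h8 : φ γ'.len γ.base = γ.base := γ'.isPeriod _ (hcar ▸ γ.base_mem)
    have h9 : φ (γ.len - γ'.len) γ.base = γ.base := by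
      rw [← h8, ← φ.map_add, sub_add_cancel, γ.flow_len_base, h8]
    have := hper _ _ (by
      rw [abs_sub_comm]; exact h3.trans ((min_le_right _ _).trans (min_le_right _ _))) h9
    linarith
  have hfl : ∀ x : ℝ, |(⌊x⌋ : ℝ)| ≤ |x| + 1 := by
    intro x
    have h1 := Int.floor_le x
    have h2 := Int.lt_floor_add_one x
    rw [abs_le]
    constructor
    · linarith [neg_abs_le x]
    · linarith [le_abs_self x]
  obtain ⟨q, hq0, hq⟩ := summable_pow_of_injective_cells (n := n) (c := c) hinj
    (P := 1 / δ + B / (ε / (2 * (N + 1))) + 1) (Λ := Λ) (by positivity) hΛ (by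
      intro γ i
      have h1 : (1 : ℝ) ≤ Λ ^ n γ := one_le_pow₀ hΛ
      have h1' : (n γ : ℝ) ≤ Λ ^ n γ := by
        calc (n γ : ℝ) ≤ 2 ^ n γ := by exact_mod_cast (Nat.lt_two_pow_self).le
          _ ≤ _ := pow_le_pow_left₀ (by norm_num) (le_max_right _ _) _
      have h2 : 0 ≤ B / (ε / (2 * (N + 1))) * Λ ^ n γ := by positivity
      have h3 : 0 ≤ 1 / δ * Λ ^ n γ := by positivity
      cases i with
      | none =>
        refine (hfl (γ.len / δ)).trans ?_
        rw [abs_of_nonneg (div_nonneg γ.len_pos.le hδ0.le), div_eq_mul_one_div, mul_comm γ.len]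
        have h4 : 1 / δ * γ.len ≤ 1 / δ * Λ ^ n γ :=
          mul_le_mul_of_nonneg_left ((Nat.le_ceil _).trans h1') (by positivity)
        linarith
      | some i =>
        refine (hfl (D.emb γ.base i / h (n γ))).trans ?_
        rw [abs_div, abs_of_pos (hh0 _)]
        have h4 : |D.emb γ.base i| / h (n γ) ≤ B / h (n γ) := by
          refine div_le_div_of_nonneg_right ?_ (hh0 _).le
          exact (PiLp.norm_apply_le (D.emb γ.base) i).trans (hB _)
        have h5 : B / h (n γ) = B / (ε / (2 * (N + 1))) * Λ ^ n γ := by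
          rw [hh]; field_simp
        linarith)
  -- A ratio at most 1 has a nonpositive logarithm, which lets the exponent `⌈len⌉` be compared with
  -- `len`.
  have hq1 : Summable fun γ : PeriodicOrbit φ => (min q 1) ^ n γ :=
    Summable.of_nonneg_of_le (fun γ => by positivity)
      (fun γ => pow_le_pow_left₀ (by positivity) (min_le_left _ _) _) hq
  set q' := min q 1 with hq'
  have hq'0 : 0 < q' := by positivity
  have hlog : Real.log q' ≤ 0 := Real.log_nonpos hq'0.le (min_le_right _ _)
  refine ⟨-Real.log q', Summable.of_nonneg_of_le (fun γ => by positivity) (fun γ => ?_)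
    (hq1.mul_left q'⁻¹)⟩
  have h1 : (n γ : ℝ) ≤ γ.len + 1 := (Nat.ceil_lt_add_one γ.len_pos.le).le
  calc Real.exp (-(-Real.log q') * γ.len) ≤ Real.exp (-Real.log q' + Real.log q' * n γ) := by
        apply Real.exp_le_exp.2
        nlinarith
    _ = q'⁻¹ * q' ^ n γ := by
        rw [Real.exp_add, Real.exp_neg, Real.exp_log hq'0, mul_comm (Real.log q'),
          Real.exp_nat_mul, Real.exp_log hq'0]

end EmbeddedFlow

end Counting

/-! ### Lower bound for the determinants of long orbits. -/

section Determinant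

open Set MeasureTheory

/-- A linear map that expands some norm by a definite factor has a large determinant. -/
theorem pow_le_abs_det_of_antilipschitz {F G : Type*} [AddCommGroup F] [Module ℝ F]
    [FiniteDimensional ℝ F] [NormedAddCommGroup G] [NormedSpace ℝ G] (j : F →ₗ[ℝ] G)
    (hj : Function.Injective j) (f : F →ₗ[ℝ] F) {r : ℝ} (hr : 0 < r)
    (h : ∀ v, r * ‖j v‖ ≤ ‖j (f v)‖) : r ^ Module.finrank ℝ F ≤ |LinearMap.det f| := by
  let _ : NormedAddCommGroup F := NormedAddCommGroup.induced F G j hj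
  let _ : NormedSpace ℝ F := NormedSpace.induced ℝ F G j
  let _ : MeasurableSpace F := borel F
  have _ : BorelSpace F := ⟨rfl⟩
  have h' : ∀ v, r * ‖v‖ ≤ ‖f v‖ := h
  have hinj : Function.Injective f := by
    refine (injective_iff_map_eq_zero f).2 fun v hv => ?_
    have := h' v
    rw [hv, norm_zero] at this
    exact norm_le_zero_iff.1 (nonpos_of_mul_nonpos_right this hr)
  have hdet : LinearMap.det f ≠ 0 := by
    have hu : IsUnit f := (LinearMap.isUnit_iff_ker_eq_bot f).2 (LinearMap.ker_eq_bot.2 hinj)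
    exact (LinearMap.isUnit_det f hu).ne_zero
  set ν : Measure F := Measure.addHaar
  -- Compare volumes: the preimage of the unit ball has volume `|det f|⁻¹` times that of the ball,
  -- and lies in the ball of radius `r⁻¹`.
  have h1 := Measure.addHaar_preimage_linearMap ν hdet (ball 0 1)
  have h2 : f ⁻¹' ball 0 1 ⊆ ball 0 r⁻¹ := by
    intro v hv
    rw [mem_preimage, mem_ball_zero_iff] at hv
    rw [mem_ball_zero_iff, ← one_div, lt_div_iff₀ hr]
    linarith [h' v]
  have h3 := measure_mono (μ := ν) h2
  rw [h1, Measure.addHaar_ball_of_pos ν 0 (inv_pos.2 hr)] at h3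
  have h4 := (ENNReal.mul_le_mul_iff_left (measure_ball_pos ν 0 one_pos).ne'
    measure_ball_lt_top.ne).1 h3
  rw [ENNReal.ofReal_le_ofReal_iff (by positivity), abs_inv, inv_pow] at h4
  exact (inv_le_inv₀ (abs_pos.2 hdet) (by positivity)).1 h4

/-- On `a` the map doubles norms and on `b` it halves them, so `I - T` expands each by at least 1/2,
hence the sum for the maximum norm. The exponent is the dimension of `F` rather than of `a ⊔ b`,
which is weaker but uniform. -/
theorem pow_le_abs_det_id_sub_restrict {F G : Type*} [AddCommGroup F] [Module ℝ F]
    [FiniteDimensional ℝ F] [NormedAddCommGroup G] [NormedSpace ℝ G] {a b : Submodule ℝ F}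
    (hab : Disjoint a b) (T : F →ₗ[ℝ] F) (j : F →ₗ[ℝ] G) (hj : Function.Injective j)
    (hT : ∀ v ∈ a ⊔ b, T v ∈ a ⊔ b) (ha : ∀ v ∈ a, T v ∈ a) (hb : ∀ v ∈ b, T v ∈ b)
    (h1 : ∀ v ∈ a, ‖j v‖ ≤ 1 / 2 * ‖j (T v)‖) (h2 : ∀ v ∈ b, ‖j (T v)‖ ≤ 1 / 2 * ‖j v‖) :
    (1 / 2 : ℝ) ^ Module.finrank ℝ F ≤ |LinearMap.det (LinearMap.id - T.restrict hT)| := by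
  set e₀ : a × b →ₗ[ℝ] ↥(a ⊔ b) :=
    (Submodule.inclusion le_sup_left).coprod (Submodule.inclusion le_sup_right) with he₀
  have he₀v : ∀ p : a × b, (e₀ p : F) = p.1 + p.2 := fun p => rfl
  have hinj : Function.Injective e₀ := by
    refine (injective_iff_map_eq_zero e₀).2 fun p hp => ?_
    have h3 : (p.1 : F) + p.2 = 0 := by rw [← he₀v, hp]; rfl
    have h4 : (p.1 : F) ∈ a ⊓ b := ⟨p.1.2, by
      rw [eq_neg_of_add_eq_zero_left h3]; exact b.neg_mem p.2.2⟩
    rw [hab.eq_bot] at h4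
    have h5 : (p.1 : F) = 0 := h4
    rw [h5, zero_add] at h3
    exact Prod.ext (Subtype.ext h5) (Subtype.ext h3)
  have hsurj : Function.Surjective e₀ := by
    rintro ⟨v, hv⟩
    obtain ⟨x, hx, y, hy, rfl⟩ := Submodule.mem_sup.1 hv
    exact ⟨(⟨x, hx⟩, ⟨y, hy⟩), rfl⟩
  set e := LinearEquiv.ofBijective e₀ ⟨hinj, hsurj⟩ with he
  set f := LinearMap.id - T.restrict hT with hf
  set J : a × b →ₗ[ℝ] G × G := (j ∘ₗ a.subtype).prodMap (j ∘ₗ b.subtype) with hJ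
  have hJinj : Function.Injective J := by
    rintro ⟨x, y⟩ ⟨x', y'⟩ hxy
    have h3 := congrArg Prod.fst hxy
    have h4 := congrArg Prod.snd hxy
    exact Prod.ext (Subtype.ext (hj h3)) (Subtype.ext (hj h4))
  have key : ∀ p : a × b, (e.symm.toLinearMap ∘ₗ f ∘ₗ e.toLinearMap) p =
      (⟨p.1 - T p.1, a.sub_mem p.1.2 (ha _ p.1.2)⟩, ⟨p.2 - T p.2, b.sub_mem p.2.2 (hb _ p.2.2)⟩) := by
    intro p
    apply e.injective
    change e (e.symm (f (e p))) = _
    rw [e.apply_symm_apply]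
    apply Subtype.ext
    change ((p.1 : F) + p.2) - T (p.1 + p.2) = (p.1 - T p.1) + (p.2 - T p.2)
    rw [map_add]; abel
  have h3 := pow_le_abs_det_of_antilipschitz J hJinj (e.symm.toLinearMap ∘ₗ f ∘ₗ e.toLinearMap)
    (r := 1 / 2) (by norm_num) (by
      intro p
      rw [key]
      change 1 / 2 * max ‖j p.1‖ ‖j p.2‖ ≤ max ‖j ((p.1 : F) - T p.1)‖ ‖j ((p.2 : F) - T p.2)‖
      rw [map_sub, map_sub, mul_max_of_nonneg _ _ (by norm_num)]
      have h4 := h1 _ p.1.2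
      have h5 := h2 _ p.2.2
      have h6 := norm_sub_norm_le (j (T p.1)) (j p.1)
      rw [norm_sub_rev] at h6
      have h7 := norm_sub_norm_le (j p.2) (j (T p.2))
      exact max_le_max (by linarith [norm_nonneg (j (p.1 : F))]) (by linarith))
  have h4 : LinearMap.det (e.symm.toLinearMap ∘ₗ f ∘ₗ e.toLinearMap) = LinearMap.det f :=
    LinearMap.det_conj f e.symm
  rw [h4, e.finrank_eq] at h3
  exact (pow_le_pow_of_le_one (by norm_num) (by norm_num) (Submodule.finrank_le _)).trans h3

universe u
variable {d : ℕ} {M : Type u} [TopologicalSpace M]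
  [ChartedSpace (EuclideanSpace ℝ (Fin (d + 1))) M] [IsManifold (𝓡 (d + 1)) ∞ M]
  [T2Space M] [CompactSpace M]

variable {V : VField d M} {φ : Flow ℝ M} {N : ℕ} (D : EmbeddedFlow V φ N)
  {Eu Es : (x : M) → Submodule ℝ (TangentSpace (𝓡 (d + 1)) x)}
include D

/-- Once `C l^T ≤ 1/2`, the monodromy at least doubles unstable vectors and at least halves stable
ones, in the norm of the embedding. -/
theorem EmbeddedFlow.exists_absDet_ge (hA : IsAnosov V φ Eu Es) :
    ∃ t₀ : ℝ, ∀ γ : PeriodicOrbit φ, t₀ ≤ γ.len → (1 / 2 : ℝ) ^ (d + 1) ≤ γ.absDet hA := by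
  obtain ⟨C, l, hC, hl0, hl1, h⟩ := D.exists_hyperbolic_constants hA
  have hlim : Tendsto (fun n : ℕ => C * l ^ n) atTop (𝓝 (C * 0)) :=
    (tendsto_pow_atTop_nhds_zero_of_lt_one hl0.le hl1).const_mul C
  rw [mul_zero] at hlim
  obtain ⟨n, hn⟩ := (hlim.eventually (gt_mem_nhds (show (0 : ℝ) < 1 / 2 by norm_num))).exists
  refine ⟨n, fun γ hγ => ?_⟩
  have hC2 : C * l ^ γ.len ≤ 1 / 2 := by
    refine le_trans (mul_le_mul_of_nonneg_left ?_ hC.le) hn.le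
    rw [← Real.rpow_natCast]
    exact Real.rpow_le_rpow_of_exponent_ge hl0 hl1.le hγ
  set x := γ.base with hx
  have hJ : ∀ (s : ℝ) (v : EuclideanSpace ℝ (Fin (d + 1))),
      D.J s x (γ.monodromy v) = D.J (s + γ.len) x v := by
    intro s v
    have key : ∀ y, y = x → ∀ w, D.J s y w = D.J s x w := by rintro _ rfl w; rfl
    exact (key _ γ.flow_len_base _).symm.trans (D.J_add s γ.len x v).symm
  have hmu := γ.mem_of_mem_map (hA.map_unstable γ.len γ.base)
  have hms := γ.mem_of_mem_map (hA.map_stable γ.len γ.base)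
  have hdisj : Disjoint (Eu x) (Es x) :=
    (hA.isInternal x).submodule_iSupIndep.pairwiseDisjoint (show (0 : Fin 3) ≠ 1 by decide)
  have hfin : Module.finrank ℝ (TangentSpace (𝓡 (d + 1)) x) = d + 1 :=
    finrank_euclideanSpace_fin (𝕜 := ℝ)
  have _ : FiniteDimensional ℝ (TangentSpace (𝓡 (d + 1)) x) :=
    inferInstanceAs (FiniteDimensional ℝ (EuclideanSpace ℝ (Fin (d + 1))))
  have := pow_le_abs_det_id_sub_restrict (F := TangentSpace (𝓡 (d + 1)) x) hdisj γ.monodromy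
    (show TangentSpace (𝓡 (d + 1)) x →ₗ[ℝ] EuclideanSpace ℝ (Fin N) from (D.J 0 x).toLinearMap)
    (D.injective_J_zero x) (γ.monodromy_mem hA) hmu hms
    (fun v hv => by
      have h1 := (h γ.len γ.len_pos.le x).2 _ (hmu hv)
      have h2 : D.J (-γ.len) x (γ.monodromy v) = D.J 0 x v := by
        refine (hJ (-γ.len) v).trans ?_
        rw [neg_add_cancel]
      have h3 := (congrArg norm h2).symm.le.trans h1
      exact h3.trans (mul_le_mul_of_nonneg_right hC2 (norm_nonneg _)))
    (fun v hv => by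
      have h1 := (h γ.len γ.len_pos.le x).1 _ hv
      have h2 : D.J 0 x (γ.monodromy v) = D.J γ.len x v := by
        refine (hJ 0 v).trans ?_
        rw [zero_add]
      have h3 := (congrArg norm h2).le.trans h1
      exact h3.trans (mul_le_mul_of_nonneg_right hC2 (norm_nonneg _)))
  rw [hfin] at this
  exact this

end Determinant

/-! ### Absolute convergence of the orbit series. -/

section WeightSummable

open Set MeasureTheory

universe u
variable {d : ℕ} {M : Type u} [TopologicalSpace M]
  [ChartedSpace (EuclideanSpace ℝ (Fin (d + 1))) M] [IsManifold (𝓡 (d + 1)) ∞ M]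

variable {V : VField d M} {φ : Flow ℝ M}
  {Eu Es : (x : M) → Submodule ℝ (TangentSpace (𝓡 (d + 1)) x)}

theorem PeriodicOrbit.primLen_le_len (γ : PeriodicOrbit φ) : γ.primLen ≤ γ.len :=
  csInf_le ⟨0, by rintro _ ⟨γ', _, rfl⟩; exact γ'.len_pos.le⟩ ⟨γ, rfl, rfl⟩

theorem PeriodicOrbit.primLen_nonneg (γ : PeriodicOrbit φ) : 0 ≤ γ.primLen :=
  Real.sInf_nonneg (by rintro _ ⟨γ', _, rfl⟩; exact γ'.len_pos.le)

theorem PeriodicOrbit.norm_weight_div_len_le (γ : PeriodicOrbit φ) (hA : IsAnosov V φ Eu Es)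
    {g : M → ℂ} {G c : ℝ} (hG : ∀ x, ‖g x‖ ≤ G) (hc : 0 < c) (h : c ≤ γ.absDet hA) :
    ‖γ.weight hA g‖ / γ.len ≤ c⁻¹ * Real.exp (G * γ.len) := by
  have h1 : ‖γ.integral g‖ ≤ G * γ.len := by
    have := intervalIntegral.norm_integral_le_of_norm_le_const (a := 0) (b := γ.len) (C := G)
      (f := fun τ => g (φ τ γ.base)) fun τ _ => hG _
    rwa [sub_zero, abs_of_pos γ.len_pos] at this
  have h2 : ‖Complex.exp (γ.integral g)‖ ≤ Real.exp (G * γ.len) := by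
    rw [Complex.norm_exp]
    exact Real.exp_le_exp.2 ((Complex.re_le_norm _).trans h1)
  have h3 : 0 < γ.absDet hA := hc.trans_le h
  rw [weight, norm_div, norm_mul, Complex.norm_real, Complex.norm_real, Real.norm_eq_abs,
    Real.norm_eq_abs, abs_of_nonneg γ.primLen_nonneg, abs_of_pos h3, div_div,
    div_le_iff₀ (mul_pos h3 γ.len_pos)]
  calc γ.primLen * ‖Complex.exp (γ.integral g)‖ ≤ γ.len * Real.exp (G * γ.len) :=
        mul_le_mul γ.primLen_le_len h2 (norm_nonneg _) γ.len_pos.le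
    _ = c⁻¹ * Real.exp (G * γ.len) * (c * γ.len) := by field_simp
    _ ≤ _ := by
      have := γ.len_pos
      gcongr

variable {N : ℕ} [T2Space M] [CompactSpace M]

/-- The weight divided by the length is at most a constant times `e^{G T}` with `G = sup |g|` on
long orbits, and the number of orbits grows at most exponentially; a shift of the abscissa by `G`
suffices. -/
theorem exists_summable_weight (D : EmbeddedFlow V φ N) (hA : IsAnosov V φ Eu Es) {g : M → ℂ}
    (hg : Continuous g) : ∃ σ : ℝ, Summable fun γ : PeriodicOrbit φ =>
      ‖γ.weight hA g‖ / γ.len * Real.exp (-σ * γ.len) := by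
  obtain ⟨σ, hσ⟩ := D.exists_summable_exp_len hA
  obtain ⟨t₀, ht₀⟩ := D.exists_absDet_ge hA
  obtain ⟨G, hG⟩ := isCompact_univ.exists_bound_of_continuousOn hg.continuousOn
  refine ⟨σ + G, Summable.of_norm_bounded_eventually (hσ.mul_left ((1 / 2 : ℝ) ^ (d + 1))⁻¹) ?_⟩
  -- Short orbits, where the determinant is not controlled, are finitely many: the summable
  -- exponentials stay away from 0 on them.
  have hfin : ∀ᶠ γ : PeriodicOrbit φ in cofinite, t₀ ≤ γ.len := by
    filter_upwards [hσ.tendsto_cofinite_zero.eventually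
      (gt_mem_nhds (Real.exp_pos (-(|σ| * |t₀|))))] with γ hγ
    by_contra! hlt
    have h1 := Real.exp_lt_exp.1 hγ
    have h2 : σ * γ.len ≤ |σ| * |t₀| := by
      have h3 : γ.len ≤ |t₀| := hlt.le.trans (le_abs_self _)
      exact mul_le_mul (le_abs_self σ) h3 γ.len_pos.le (abs_nonneg _)
    linarith
  filter_upwards [hfin] with γ hγ
  have h1 := γ.norm_weight_div_len_le hA (fun x => hG x (mem_univ x)) (by positivity) (ht₀ γ hγ)
  have h2 := γ.len_pos
  rw [Real.norm_of_nonneg (by positivity)]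
  calc _ ≤ ((1 / 2 : ℝ) ^ (d + 1))⁻¹ * Real.exp (G * γ.len) * Real.exp (-(σ + G) * γ.len) :=
        mul_le_mul_of_nonneg_right h1 (Real.exp_pos _).le
    _ = _ := by
      rw [mul_assoc, ← Real.exp_add]
      congr 2
      ring

end WeightSummable

/-! ### Strongly continuous semigroups: growth and Laplace transforms. -/

section Semigroup

open Set MeasureTheory
open scoped NNReal

variable {B : Type*} [NormedAddCommGroup B] [NormedSpace ℂ B] {L : ℝ≥0 → B →L[ℂ] B}

theorem tendsto_semigroup_zero (h0 : L 0 = ContinuousLinearMap.id ℂ B)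
    (hL : ∀ b : B, Tendsto (fun t => L t b) (𝓝[>] 0) (𝓝 b)) (b : B) :
    Tendsto (fun t => L t b) (𝓝 0) (𝓝 b) := by
  have h1 : ContinuousAt (fun t => L t b) 0 := by
    rw [continuousAt_iff_punctured_nhds]
    have h2 : ({0}ᶜ : Set ℝ≥0) = Ioi 0 := by
      ext t; simp [pos_iff_ne_zero]
    rw [h2, h0]
    exact hL b
  have h3 := h1.tendsto
  rwa [h0] at h3

/-- Otherwise a sequence of times tending to 0 has unbounded norms although it converges at every
vector, against Banach-Steinhaus. -/
theorem exists_norm_semigroup_le_near_zero [CompleteSpace B]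
    (h0 : L 0 = ContinuousLinearMap.id ℂ B)
    (hL : ∀ b : B, Tendsto (fun t => L t b) (𝓝[>] 0) (𝓝 b)) :
    ∃ (δ : ℝ≥0) (K : ℝ), 0 < δ ∧ 1 ≤ K ∧ ∀ t ≤ δ, ‖L t‖ ≤ K := by
  by_contra! h
  choose t ht hK using fun n : ℕ => h (1 / ((n : ℝ≥0) + 1)) (n + 1) (by positivity) (by simp)
  have hlim : Tendsto t atTop (𝓝 0) := by
    refine tendsto_of_tendsto_of_tendsto_of_le_of_le tendsto_const_nhds ?_ (fun _ => zero_le) ht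
    exact tendsto_one_div_add_atTop_nhds_zero_nat
  obtain ⟨C, hC⟩ := banach_steinhaus (g := fun n => L (t n)) fun b => by
    obtain ⟨C, hC⟩ := ((tendsto_semigroup_zero h0 hL b).comp hlim).norm.bddAbove_range
    exact ⟨C, fun n => hC ⟨n, rfl⟩⟩
  obtain ⟨n, hn⟩ := exists_nat_gt C
  linarith [hC n, hK n]

theorem norm_semigroup_nsmul_le (h0 : L 0 = ContinuousLinearMap.id ℂ B)
    (hadd : ∀ s t, L (s + t) = (L s).comp (L t)) {K : ℝ} (hK : 1 ≤ K) {t : ℝ≥0} (ht : ‖L t‖ ≤ K)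
    (n : ℕ) : ‖L (n * t)‖ ≤ K ^ n := by
  induction n with
  | zero =>
    rw [Nat.cast_zero, zero_mul, h0, pow_zero]
    exact ContinuousLinearMap.norm_id_le
  | succ n ih =>
    rw [Nat.cast_succ, add_mul, one_mul, hadd, pow_succ]
    exact (ContinuousLinearMap.opNorm_comp_le _ _).trans
      (mul_le_mul ih ht (norm_nonneg _) (by positivity))

theorem exists_norm_semigroup_le [CompleteSpace B] (h0 : L 0 = ContinuousLinearMap.id ℂ B)
    (hadd : ∀ s t, L (s + t) = (L s).comp (L t))
    (hL : ∀ b : B, Tendsto (fun t => L t b) (𝓝[>] 0) (𝓝 b)) :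
    ∃ K κ : ℝ, 0 ≤ K ∧ 0 ≤ κ ∧ ∀ t, ‖L t‖ ≤ K * Real.exp (κ * t) := by
  obtain ⟨δ, K, hδ, hK, h⟩ := exists_norm_semigroup_le_near_zero h0 hL
  refine ⟨K, Real.log K / δ, by linarith, div_nonneg (Real.log_nonneg hK) δ.2, fun t => ?_⟩
  set n := ⌊t / δ⌋₊ with hn
  have hn1 : t / δ < n + 1 := Nat.lt_floor_add_one _
  have h1 : t / (n + 1) ≤ δ := by
    rw [div_le_iff₀ (by positivity)]
    rw [div_lt_iff₀ hδ] at hn1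
    rw [mul_comm]; exact hn1.le
  have h2 := norm_semigroup_nsmul_le h0 hadd hK (h _ h1) (n + 1)
  have h3 : ((n + 1 : ℕ) : ℝ≥0) * (t / (n + 1)) = t := by
    push_cast; field_simp
  rw [h3] at h2
  refine h2.trans ?_
  have h4 : (n : ℝ) ≤ t / δ := by
    have := Nat.floor_le (zero_le : 0 ≤ t / δ)
    exact_mod_cast this
  have hK0 : 0 < K := by linarith
  rw [pow_succ, mul_comm]
  refine mul_le_mul_of_nonneg_left ?_ hK0.le
  rw [← Real.exp_log (pow_pos hK0 n), Real.log_pow, Real.exp_le_exp]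
  calc (n : ℝ) * Real.log K ≤ t / δ * Real.log K :=
        mul_le_mul_of_nonneg_right h4 (Real.log_nonneg hK)
    _ = _ := by ring

theorem continuous_semigroup_apply [CompleteSpace B] (h0 : L 0 = ContinuousLinearMap.id ℂ B)
    (hadd : ∀ s t, L (s + t) = (L s).comp (L t))
    (hL : ∀ b : B, Tendsto (fun t => L t b) (𝓝[>] 0) (𝓝 b)) (b : B) :
    Continuous fun t => L t b := by
  obtain ⟨K, κ, hK, hκ, h⟩ := exists_norm_semigroup_le h0 hadd hL
  refine continuous_iff_continuousAt.2 fun t => ?_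
  have hd : Tendsto (fun s => nndist s t) (𝓝 t) (𝓝 0) := by
    have := (continuous_id.nndist continuous_const : Continuous fun s : ℝ≥0 => nndist s t).tendsto t
    simpa using this
  have h1 : Tendsto (fun s => K * Real.exp (κ * (t + 1)) * ‖L (nndist s t) b - b‖) (𝓝 t) (𝓝 0) := by
    have h2 := (((tendsto_semigroup_zero h0 hL b).comp hd).sub_const b).norm.const_mul
      (K * Real.exp (κ * (t + 1)))
    simpa using h2
  rw [ContinuousAt, tendsto_iff_norm_sub_tendsto_zero]
  refine squeeze_zero' (Eventually.of_forall fun _ => norm_nonneg _) ?_ h1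
  filter_upwards [gt_mem_nhds (show t < t + 1 from lt_add_of_pos_right t one_pos)] with s hs
  have key : ∀ r : ℝ≥0, r ≤ t + 1 → ∀ v : B, ‖L r v‖ ≤ K * Real.exp (κ * (t + 1)) * ‖v‖ := by
    intro r hr v
    refine (L r).le_of_opNorm_le ((h r).trans ?_) v
    have : (r : ℝ) ≤ t + 1 := by exact_mod_cast hr
    gcongr
  rcases le_total t s with hts | hts
  · have e : nndist s t = s - t := by
      apply NNReal.coe_injective
      rw [coe_nndist, NNReal.coe_sub hts, NNReal.dist_eq,
        abs_of_nonneg (sub_nonneg.2 (NNReal.coe_le_coe.2 hts))]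
    have e2 : L s b - L t b = L t (L (s - t) b - b) := by
      rw [map_sub]
      congr 1
      conv_lhs => rw [← add_tsub_cancel_of_le hts, hadd]
      rfl
    rw [e2, e]
    exact key t le_self_add _
  · have e : nndist s t = t - s := by
      apply NNReal.coe_injective
      rw [nndist_comm, coe_nndist, NNReal.coe_sub hts, NNReal.dist_eq,
        abs_of_nonneg (sub_nonneg.2 (NNReal.coe_le_coe.2 hts))]
    have e2 : L s b - L t b = -L s (L (t - s) b - b) := by
      rw [map_sub, neg_sub]
      congr 1
      conv_lhs => rw [← add_tsub_cancel_of_le hts, hadd]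
      rfl
    rw [e2, e, norm_neg]
    exact key s hs.le _

/-- Only the right derivative comes directly from the generator; with continuity of the orbit, it is
all that the fundamental theorem of calculus requires. -/
theorem hasDerivWithinAt_semigroup (hadd : ∀ s t, L (s + t) = (L s).comp (L t)) {u w : B}
    (hu : Tendsto (fun t : ℝ≥0 => ((t : ℝ) : ℂ)⁻¹ • (L t u - u)) (𝓝[>] 0) (𝓝 w))
    (l : B →L[ℂ] ℂ) {t : ℝ} (ht : 0 ≤ t) :
    HasDerivWithinAt (fun r : ℝ => l (L r.toNNReal u)) (l (L t.toNNReal w)) (Ioi t) t := by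
  rw [hasDerivWithinAt_iff_tendsto_slope' (by simp)]
  have h1 : Tendsto (fun r : ℝ => (r - t).toNNReal) (𝓝[>] t) (𝓝[>] 0) := by
    refine tendsto_nhdsWithin_iff.2 ⟨?_, ?_⟩
    · have : Continuous fun r : ℝ => (r - t).toNNReal := by fun_prop
      have h2 := this.tendsto t
      rw [sub_self, Real.toNNReal_zero] at h2
      exact h2.mono_left nhdsWithin_le_nhds
    · filter_upwards [self_mem_nhdsWithin] with r hr
      exact Real.toNNReal_pos.2 (sub_pos.2 hr)
  have h2 := ((l.comp (L t.toNNReal)).continuous.tendsto w).comp (hu.comp h1)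
  refine h2.congr' ?_
  filter_upwards [self_mem_nhdsWithin] with r hr
  have hr' : 0 ≤ r - t := (sub_pos.2 hr).le
  have e : r.toNNReal = t.toNNReal + (r - t).toNNReal := by
    rw [← Real.toNNReal_add ht hr', add_sub_cancel]
  simp only [Function.comp_apply, Real.coe_toNNReal _ hr', ContinuousLinearMap.comp_apply, map_smul,
    map_sub, slope_def_module, e, hadd]
  rw [← Complex.ofReal_inv, Complex.coe_smul]

/-- The functional equation of the semigroup on a vector `R b`, where `R` is the resolvent at `z`. -/
theorem integral_semigroup_eq [CompleteSpace B] (h0 : L 0 = ContinuousLinearMap.id ℂ B)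
    (hadd : ∀ s t, L (s + t) = (L s).comp (L t))
    (hL : ∀ b : B, Tendsto (fun t => L t b) (𝓝[>] 0) (𝓝 b)) {z : ℂ} {u b : B}
    (hu : Tendsto (fun t : ℝ≥0 => ((t : ℝ) : ℂ)⁻¹ • (L t u - u)) (𝓝[>] 0) (𝓝 (z • u - b)))
    (l : B →L[ℂ] ℂ) {T : ℝ} (hT : 0 ≤ T) :
    ∫ t in (0 : ℝ)..T, Complex.exp (-z * t) * l (L t.toNNReal b) =
      l u - Complex.exp (-z * T) * l (L T.toNNReal u) := by
  have hc : ∀ v : B, Continuous fun t : ℝ => l (L t.toNNReal v) := fun v =>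
    l.continuous.comp ((continuous_semigroup_apply h0 hadd hL v).comp continuous_real_toNNReal)
  have hexp : Continuous fun t : ℝ => Complex.exp (-z * t) := by fun_prop
  have h1 := intervalIntegral.integral_eq_sub_of_hasDeriv_right_of_le hT
    (f := fun t : ℝ => Complex.exp (-z * t) * l (L t.toNNReal u))
    (f' := fun t : ℝ => -(Complex.exp (-z * t) * l (L t.toNNReal b)))
    (hexp.mul (hc u)).continuousOn (fun t ht => by
      have h2 : HasDerivAt (fun t : ℝ => Complex.exp (-z * t)) (Complex.exp (-z * t) * (-z * 1)) t :=
        (((hasDerivAt_id t).ofReal_comp).const_mul (-z)).cexp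
      refine (h2.hasDerivWithinAt.mul (hasDerivWithinAt_semigroup hadd hu l ht.1.le)).congr_deriv ?_
      rw [map_sub, map_sub, map_smul, map_smul, smul_eq_mul]
      ring)
    ((hexp.mul (hc b)).neg.intervalIntegrable _ _)
  rw [intervalIntegral.integral_neg, neg_eq_iff_eq_neg, neg_sub] at h1
  rw [h1]
  simp [h0]

theorem integrableOn_exp_mul {c : ℝ → ℂ} (hc : Continuous c) {K C₀ : ℝ}
    (hK : ∀ t, 0 ≤ t → ‖c t‖ ≤ K * Real.exp (C₀ * t)) {z : ℂ} (hz : C₀ < z.re) :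
    IntegrableOn (fun t : ℝ => Complex.exp (-z * t) * c t) (Ioi 0) := by
  have h1 : IntegrableOn (fun t : ℝ => K * Real.exp (-(z.re - C₀) * t)) (Ioi 0) :=
    (exp_neg_integrableOn_Ioi 0 (sub_pos.2 hz)).const_mul K
  refine Integrable.mono' h1 (by fun_prop) ?_
  rw [ae_restrict_iff' measurableSet_Ioi]
  refine Eventually.of_forall fun t ht => ?_
  rw [norm_mul, Complex.norm_exp]
  calc _ ≤ Real.exp (-z * t).re * (K * Real.exp (C₀ * t)) :=
        mul_le_mul_of_nonneg_left (hK t (le_of_lt ht)) (Real.exp_pos _).le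
    _ = K * Real.exp (-(z.re - C₀) * t) := by
      rw [mul_left_comm, ← Real.exp_add]
      congr 2
      simp
      ring

theorem differentiableAt_laplace {c : ℝ → ℂ} (hc : Continuous c) {K C₀ : ℝ}
    (hK : ∀ t, 0 ≤ t → ‖c t‖ ≤ K * Real.exp (C₀ * t)) {z : ℂ} (hz : C₀ < z.re) :
    DifferentiableAt ℂ (fun z => ∫ t in Ioi (0 : ℝ), Complex.exp (-z * t) * c t) z := by
  obtain ⟨σ, h1, h2⟩ := exists_between hz
  have hK0 : 0 ≤ K := by
    have := (norm_nonneg _).trans (hK 0 le_rfl)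
    simpa using this
  refine (hasDerivAt_integral_of_dominated_loc_of_deriv_le (μ := volume.restrict (Ioi 0))
    (F := fun z t => Complex.exp (-z * t) * c t)
    (F' := fun z t => -t * Complex.exp (-z * t) * c t)
    (bound := fun t => K * (t ^ 1 * Real.exp (-(σ - C₀) * t)))
    (s := {w : ℂ | σ < w.re})
    ((isOpen_lt continuous_const Complex.continuous_re).mem_nhds h2)
    (Eventually.of_forall fun w => ?_) (integrableOn_exp_mul hc hK hz) ?_ ?_ ?_ ?_).2.differentiableAt
  · exact (by fun_prop : Continuous fun t : ℝ => Complex.exp (-w * t) * c t).aestronglyMeasurable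
  · exact (by fun_prop : Continuous fun t : ℝ => -t * Complex.exp (-z * t) * c t).aestronglyMeasurable
  · rw [ae_restrict_iff' measurableSet_Ioi]
    refine Eventually.of_forall fun t ht w hw => ?_
    have ht0 : 0 < t := ht
    rw [norm_mul, norm_mul, norm_neg, Complex.norm_real, Real.norm_of_nonneg ht0.le,
      Complex.norm_exp]
    have h3 : (-w * t).re ≤ -σ * t := by
      have : σ < w.re := hw
      simp only [Complex.mul_re, Complex.neg_re, Complex.ofReal_re, Complex.ofReal_im, mul_zero,
        sub_zero]
      nlinarith
    calc _ ≤ t * Real.exp (-σ * t) * (K * Real.exp (C₀ * t)) := by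
          gcongr
          exact hK t ht0.le
      _ = _ := by
        have h4 : Real.exp (-(σ - C₀) * t) = Real.exp (-σ * t) * Real.exp (C₀ * t) := by
          rw [← Real.exp_add]; congr 1; ring
        rw [h4]; ring
  · exact (integrableOn_pow_mul_exp 1 (sub_pos.2 h1)).const_mul K
  · refine Eventually.of_forall fun t w _ => ?_
    have h3 : HasDerivAt (fun w : ℂ => Complex.exp (-w * t)) (Complex.exp (-w * t) * (-1 * t)) w :=
      (((hasDerivAt_id w).neg).mul_const (t : ℂ)).cexp
    refine (h3.mul_const (c t)).congr_deriv ?_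
    ring

end Semigroup

/-! ### Resolvents, spectra and spectral projectors. -/

section Resolvent

open Set MeasureTheory
open scoped NNReal

universe u
variable {B : Type u} [NormedAddCommGroup B] [NormedSpace ℂ B] {G : Set (B × B)}

theorem isResolventAt_resolv {z : ℂ} (hz : z ∈ resSet G) : IsResolventAt G z (resolv G z) := by
  have h : ∃ R : B →L[ℂ] B, IsResolventAt G z R := hz
  rw [resolv, dif_pos h]
  exact h.choose_spec

theorem IsResolventAt.resolv_eq {z : ℂ} {R : B →L[ℂ] B} (h : IsResolventAt G z R) :
    resolv G z = R := by
  ext b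
  exact ((isResolventAt_resolv ⟨R, h⟩ b (R b)).2 ((h b (R b)).1 rfl))

/-- Formally `z - X = (z₀ - X) (1 + (z - z₀) R)` on the domain, and the bounded factor is inverted.
It yields both openness of the resolvent set and holomorphy of the resolvent. -/
theorem IsResolventAt.perturb {z₀ z : ℂ} {R : B →L[ℂ] B} (h : IsResolventAt G z₀ R)
    (hu : IsUnit (1 + (z - z₀) • R)) :
    IsResolventAt G z (Ring.inverse (1 + (z - z₀) • R) * R) := by
  intro b c
  set Q := 1 + (z - z₀) • R with hQ
  have e : z • c - b = z₀ • c - (b - (z - z₀) • c) := by rw [sub_smul]; abel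
  rw [e, ← h]
  have e2 : R (b - (z - z₀) • c) = c ↔ Q c = R b := by
    rw [map_sub, map_smul, sub_eq_iff_eq_add, eq_comm, hQ]
    rfl
  rw [e2]
  constructor
  · rintro rfl
    exact congrArg (fun T : B →L[ℂ] B => T (R b)) (Ring.mul_inverse_cancel Q hu)
  · intro hc
    change Ring.inverse Q (R b) = c
    rw [← hc]
    exact congrArg (fun T : B →L[ℂ] B => T c) (Ring.inverse_mul_cancel Q hu)

variable [CompleteSpace B]

theorem eventually_isUnit_perturb (R : B →L[ℂ] B) (z₀ : ℂ) :
    ∀ᶠ z in 𝓝 z₀, IsUnit (1 + (z - z₀) • R) := by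
  have h1 : Continuous fun z : ℂ => 1 + (z - z₀) • R := by fun_prop
  have h2 : IsUnit (1 + (z₀ - z₀) • R) := by simp
  exact h1.continuousAt.eventually (Units.isOpen.mem_nhds h2)

theorem isOpen_resSet : IsOpen (resSet G) := by
  refine isOpen_iff_mem_nhds.2 fun z₀ hz₀ => ?_
  filter_upwards [eventually_isUnit_perturb (resolv G z₀) z₀] with z hz
  exact ⟨_, (isResolventAt_resolv hz₀).perturb hz⟩

theorem differentiableAt_resolv {z₀ : ℂ} (hz₀ : z₀ ∈ resSet G) :
    DifferentiableAt ℂ (resolv G) z₀ := by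
  set R := resolv G z₀ with hR
  have h1 : (fun z => Ring.inverse (1 + (z - z₀) • R) * R) =ᶠ[𝓝 z₀] resolv G := by
    filter_upwards [eventually_isUnit_perturb R z₀] with z hz
    exact ((isResolventAt_resolv hz₀).perturb hz).resolv_eq.symm
  refine DifferentiableAt.congr_of_eventuallyEq ?_ h1.symm
  have h2 : DifferentiableAt ℂ (fun z : ℂ => 1 + (z - z₀) • R) z₀ := by fun_prop
  have h3 : DifferentiableAt ℂ (Ring.inverse : (B →L[ℂ] B) → (B →L[ℂ] B)) (1 + (z₀ - z₀) • R) :=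
    differentiableAt_inverse (by simp)
  exact (h3.comp z₀ h2).mul_const R

/-- Isolated points form a discrete subset of `ℂ`, which is countable by the Lindelöf property. -/
theorem countable_spectrum {C₀ : ℝ}
    (h : ∀ a : ℂ, C₀ < a.re → a ∉ resSet G → ∃ m : ℕ, IsIsolatedEigenvalue G a m) :
    {a : ℂ | C₀ < a.re ∧ a ∉ resSet G}.Countable := by
  set S := {a : ℂ | C₀ < a.re ∧ a ∉ resSet G} with hS
  have hd : DiscreteTopology S := by
    refine discreteTopology_subtype_iff.2 fun a ha => ?_
    obtain ⟨m, _, r, hr, hball, _⟩ := h a ha.1 ha.2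
    rw [← disjoint_iff]
    refine Filter.disjoint_iff.2 ⟨closedBall a r ∩ {a}ᶜ, ?_, S, mem_principal_self S, ?_⟩
    · exact inter_mem (mem_nhdsWithin_of_mem_nhds (closedBall_mem_nhds a hr)) self_mem_nhdsWithin
    · exact Set.disjoint_left.2 fun z hz hzS => hzS.2 (hball z hz.1 hz.2)
  exact (HereditarilyLindelofSpace.isLindelof S).countable hd

/-- The complement of a countable set in a right half-plane is preconnected. -/
theorem isPreconnected_halfPlane_diff {C₀ : ℝ} {S : Set ℂ} (hS : S.Countable) :
    IsPreconnected ({z : ℂ | C₀ < z.re} \ S) := by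
  -- A parametrization of the half-plane by `ℂ`, which reduces the claim to the connectedness of the
  -- complement of a countable set in the plane.
  set p : ℂ → ℂ := fun w => C₀ + Real.exp w.re + w.im * Complex.I with hp
  have hpre : ∀ w, (p w).re = C₀ + Real.exp w.re := fun w => by
    simp [hp, -Complex.ofReal_exp]
  have hpim : ∀ w, (p w).im = w.im := fun w => by simp [hp]
  have hinj : Function.Injective p := by
    intro w w' hww
    have h1 := congrArg Complex.re hww
    have h2 := congrArg Complex.im hww
    rw [hpre, hpre, add_right_inj, Real.exp_eq_exp] at h1
    rw [hpim, hpim] at h2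
    exact Complex.ext h1 h2
  have hc : Continuous p := by fun_prop
  have himage : p '' (p ⁻¹' S)ᶜ = {z : ℂ | C₀ < z.re} \ S := by
    ext z
    constructor
    · rintro ⟨w, hw, rfl⟩
      refine ⟨?_, hw⟩
      change C₀ < (p w).re
      rw [hpre]
      linarith [Real.exp_pos w.re]
    · rintro ⟨h1, h2⟩
      have h1' : 0 < z.re - C₀ := sub_pos.2 h1
      have e : p ⟨Real.log (z.re - C₀), z.im⟩ = z := by
        apply Complex.ext
        · rw [hpre, Real.exp_log h1']; ring
        · rw [hpim]
      exact ⟨_, by rw [mem_compl_iff, mem_preimage, e]; exact h2, e⟩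
  rw [← himage]
  refine IsPreconnected.image ?_ p hc.continuousOn
  have hr : 1 < Module.rank ℝ ℂ := by
    rw [Complex.rank_real_complex]; exact Cardinal.one_lt_two
  exact ((hS.preimage hinj).isConnected_compl_of_one_lt_rank hr).isPreconnected

variable {L : ℝ≥0 → B →L[ℂ] B}

/-- To the right of the growth bound of the semigroup the boundary term at infinity vanishes. This
bound depends on the Banach norm and may well exceed `C₀`. -/
theorem resolv_eq_laplace_of_large_re (h0 : L 0 = ContinuousLinearMap.id ℂ B)
    (hadd : ∀ s t, L (s + t) = (L s).comp (L t))
    (hL : ∀ b : B, Tendsto (fun t => L t b) (𝓝[>] 0) (𝓝 b))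
    (hG : ∀ b c : B, (b, c) ∈ G →
      Tendsto (fun t : ℝ≥0 => ((t : ℝ) : ℂ)⁻¹ • (L t b - b)) (𝓝[>] 0) (𝓝 c))
    (l : B →L[ℂ] ℂ) {b : B} {K C₀ : ℝ}
    (hK : ∀ t : ℝ, 0 ≤ t → ‖l (L t.toNNReal b)‖ ≤ K * Real.exp (C₀ * t)) :
    ∃ σ : ℝ, ∀ z ∈ resSet G, σ < z.re →
      l (resolv G z b) = ∫ t in Ioi (0 : ℝ), Complex.exp (-z * t) * l (L t.toNNReal b) := by
  obtain ⟨K', κ, hK', hκ, hbound⟩ := exists_norm_semigroup_le h0 hadd hL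
  refine ⟨max C₀ κ, fun z hz hσ => ?_⟩
  set u := resolv G z b with hu
  have huG : (u, z • u - b) ∈ G := (isResolventAt_resolv hz b u).1 rfl
  have hc : Continuous fun t : ℝ => l (L t.toNNReal b) :=
    l.continuous.comp ((continuous_semigroup_apply h0 hadd hL b).comp continuous_real_toNNReal)
  have h1 := intervalIntegral_tendsto_integral_Ioi 0
    (integrableOn_exp_mul hc hK ((le_max_left _ _).trans_lt hσ)) tendsto_id
  have h2 : Tendsto (fun T : ℝ => l u - Complex.exp (-z * T) * l (L T.toNNReal u)) atTop
      (𝓝 (l u - 0)) := by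
    refine tendsto_const_nhds.sub ?_
    have hz' : 0 < (z - κ).re := by
      have := (le_max_right C₀ κ).trans_lt hσ
      simpa using this
    have h3 := (tendsto_pow_mul_cexp 0 hz').norm.const_mul (‖l‖ * (K' * ‖u‖))
    rw [norm_zero, mul_zero] at h3
    refine squeeze_zero_norm' ?_ h3
    filter_upwards [eventually_ge_atTop 0] with T hT
    have h4 : ‖l (L T.toNNReal u)‖ ≤ ‖l‖ * (K' * Real.exp (κ * T) * ‖u‖) := by
      refine (l.le_opNorm _).trans (mul_le_mul_of_nonneg_left ?_ (norm_nonneg l))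
      refine (L T.toNNReal).le_of_opNorm_le ?_ u
      have := hbound T.toNNReal
      rwa [Real.coe_toNNReal _ hT] at this
    rw [norm_mul, norm_pow_mul_exp 0 _ hT, pow_zero, one_mul, Complex.norm_exp]
    have h5 : Real.exp (-(z - κ).re * T) = Real.exp (-z * T).re * Real.exp (κ * T) := by
      rw [← Real.exp_add]
      congr 1
      simp
      ring
    rw [h5]
    calc _ ≤ Real.exp (-z * T).re * (‖l‖ * (K' * Real.exp (κ * T) * ‖u‖)) :=
          mul_le_mul_of_nonneg_left h4 (Real.exp_pos _).le
      _ = _ := by ring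
  rw [sub_zero] at h2
  refine tendsto_nhds_unique h2 (h1.congr' ?_)
  filter_upwards [eventually_ge_atTop 0] with T hT
  exact integral_semigroup_eq h0 hadd hL (hG _ _ huG) l hT

/-- The Laplace integral of one matrix coefficient is holomorphic as far as its own growth `C₀`
allows; the equality known far to the right extends by analytic continuation, since removing the
countable spectrum does not disconnect the half-plane. -/
theorem resolv_eq_laplace (h0 : L 0 = ContinuousLinearMap.id ℂ B)
    (hadd : ∀ s t, L (s + t) = (L s).comp (L t))
    (hL : ∀ b : B, Tendsto (fun t => L t b) (𝓝[>] 0) (𝓝 b))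
    (hG : ∀ b c : B, (b, c) ∈ G →
      Tendsto (fun t : ℝ≥0 => ((t : ℝ) : ℂ)⁻¹ • (L t b - b)) (𝓝[>] 0) (𝓝 c))
    (l : B →L[ℂ] ℂ) {b : B} {K C₀ : ℝ}
    (hK : ∀ t : ℝ, 0 ≤ t → ‖l (L t.toNNReal b)‖ ≤ K * Real.exp (C₀ * t))
    (hspec : ∀ a : ℂ, C₀ < a.re → a ∉ resSet G → ∃ m : ℕ, IsIsolatedEigenvalue G a m)
    {z : ℂ} (hz : z ∈ resSet G) (hzC : C₀ < z.re) :
    l (resolv G z b) = ∫ t in Ioi (0 : ℝ), Complex.exp (-z * t) * l (L t.toNNReal b) := by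
  obtain ⟨σ, hσ⟩ := resolv_eq_laplace_of_large_re h0 hadd hL hG l hK
  have hc : Continuous fun t : ℝ => l (L t.toNNReal b) :=
    l.continuous.comp ((continuous_semigroup_apply h0 hadd hL b).comp continuous_real_toNNReal)
  have hScount := countable_spectrum hspec
  set S := {a : ℂ | C₀ < a.re ∧ a ∉ resSet G} with hS
  set U := {z : ℂ | C₀ < z.re} \ S with hU
  have hUeq : U = {z : ℂ | C₀ < z.re} ∩ resSet G := by
    ext w
    constructor
    · rintro ⟨h1, h2⟩
      exact ⟨h1, by by_contra h3; exact h2 ⟨h1, h3⟩⟩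
    · rintro ⟨h1, h2⟩
      exact ⟨h1, fun h3 => h3.2 h2⟩
  have hUo : IsOpen U := by
    rw [hUeq]
    exact (isOpen_lt continuous_const Complex.continuous_re).inter isOpen_resSet
  have hf : DifferentiableOn ℂ (fun z => l (resolv G z b)) U := fun w hw => by
    rw [hUeq] at hw
    have h1 := (differentiableAt_resolv hw.2).clm_apply (differentiableAt_const b)
    exact (l.differentiableAt.comp w h1).differentiableWithinAt
  have hg : DifferentiableOn ℂ
      (fun z => ∫ t in Ioi (0 : ℝ), Complex.exp (-z * t) * l (L t.toNNReal b)) U := fun w hw =>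
    (differentiableAt_laplace hc hK hw.1).differentiableWithinAt
  -- A countable set cannot fill a half-plane, so the resolvent set has points with large real part.
  obtain ⟨w, hw⟩ : ∃ w ∈ U, σ < w.re := by
    have hT : {z : ℂ | max C₀ σ < z.re}.Nonempty := ⟨((max C₀ σ + 1 : ℝ) : ℂ), by
      change max C₀ σ < max C₀ σ + 1
      linarith⟩
    by_contra! h
    have h1 : {z : ℂ | max C₀ σ < z.re} ⊆ S := by
      intro w hw
      have h2 : C₀ < w.re := (le_max_left _ _).trans_lt hw
      have h3 : σ < w.re := (le_max_right _ _).trans_lt hw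
      by_contra h4
      exact (h w ⟨h2, h4⟩).not_gt h3
    have h2 := (hScount.mono h1).dense_compl ℝ
    obtain ⟨w, hw1, hw2⟩ := h2.inter_open_nonempty _
      (isOpen_lt continuous_const Complex.continuous_re) hT
    exact hw2 hw1
  have hev : (fun z => l (resolv G z b)) =ᶠ[𝓝 w]
      fun z => ∫ t in Ioi (0 : ℝ), Complex.exp (-z * t) * l (L t.toNNReal b) := by
    filter_upwards [hUo.mem_nhds hw.1,
      (isOpen_lt continuous_const Complex.continuous_re).mem_nhds hw.2] with v hv1 hv2
    rw [hUeq] at hv1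
    exact hσ v hv1.2 hv2
  exact (hf.analyticOnNhd hUo).eqOn_of_preconnected_of_eventuallyEq (hg.analyticOnNhd hUo)
    (isPreconnected_halfPlane_diff hScount) hw.1 hev (by rw [hUeq]; exact ⟨hzC, hz⟩)

/-- The eigenvalues of the generator are controlled by the growth of the semigroup on a dense set,
measured by a separating family of functionals. -/
theorem eq_zero_of_isIsolatedEigenvalue (h0 : L 0 = ContinuousLinearMap.id ℂ B)
    (hadd : ∀ s t, L (s + t) = (L s).comp (L t))
    (hL : ∀ b : B, Tendsto (fun t => L t b) (𝓝[>] 0) (𝓝 b))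
    (hG : ∀ b c : B, (b, c) ∈ G →
      Tendsto (fun t : ℝ≥0 => ((t : ℝ) : ℂ)⁻¹ • (L t b - b)) (𝓝[>] 0) (𝓝 c))
    {C₀ : ℝ} (hspec : ∀ a : ℂ, C₀ < a.re → a ∉ resSet G → ∃ m : ℕ, IsIsolatedEigenvalue G a m)
    {S : Set B} (hS : Dense S) {Ψ : Type*} {l : Ψ → B →L[ℂ] ℂ}
    (hl : ∀ b, (∀ ψ, l ψ b = 0) → b = 0)
    (hK : ∀ b ∈ S, ∀ ψ, ∃ K : ℝ, ∀ t : ℝ, 0 ≤ t →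
      ‖l ψ (L t.toNNReal b)‖ ≤ K * Real.exp (C₀ * t))
    {a : ℂ} (ha : C₀ < a.re) {m : ℕ} (hm : IsIsolatedEigenvalue G a m) : m = 0 := by
  obtain ⟨_, r, hr, hball, _, hrank⟩ := hm
  have hdiff : ∀ z ∈ closedBall a r, z ≠ a → DifferentiableAt ℂ (resolv G) z := fun z hz hza =>
    differentiableAt_resolv (hball z hz hza)
  -- The circle is shrunk until it lies in the half-plane where the Laplace integrals are
  -- holomorphic; by Cauchy the contour integral is unchanged.
  set ρ := min r ((a.re - C₀) / 2) with hρ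
  have hρ0 : 0 < ρ := lt_min hr (by linarith)
  have hne : ∀ {z : ℂ} {s : ℝ}, 0 < s → s ≤ dist z a → z ≠ a := by
    rintro z s hs hz rfl
    rw [dist_self] at hz
    linarith
  have hcirc : (∮ z in C(a, r), resolv G z) = ∮ z in C(a, ρ), resolv G z := by
    refine Complex.circleIntegral_eq_of_differentiable_on_annulus_off_countable hρ0 (min_le_left _ _)
      countable_empty (fun z hz => ?_) fun z hz => ?_
    · have h1 : ρ ≤ dist z a := not_lt.1 hz.2
      exact (hdiff z hz.1 (hne hρ0 h1)).continuousAt.continuousWithinAt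
    · have h1 : ρ < dist z a := not_le.1 hz.1.2
      exact hdiff z (ball_subset_closedBall hz.1.1) (hne hρ0 h1.le)
  have hcont : ContinuousOn (resolv G) (sphere a ρ) := fun z hz =>
    (hdiff z ((closedBall_subset_closedBall (min_le_left _ _)) (sphere_subset_closedBall hz))
      (hne hρ0 (mem_sphere.1 hz).ge)).continuousAt.continuousWithinAt
  have hint : CircleIntegrable (resolv G) a ρ := hcont.circleIntegrable hρ0.le
  have hzero : ∀ b ∈ S, spectralProj G a r b = 0 := by
    intro b hb
    refine hl _ fun ψ => ?_
    obtain ⟨K, hK⟩ := hK b hb ψ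
    have hc : Continuous fun t : ℝ => l ψ (L t.toNNReal b) :=
      (l ψ).continuous.comp ((continuous_semigroup_apply h0 hadd hL b).comp continuous_real_toNNReal)
    have h1 : l ψ ((∮ z in C(a, ρ), resolv G z) b) = ∮ z in C(a, ρ), l ψ (resolv G z b) := by
      set E : (B →L[ℂ] B) →L[ℂ] ℂ := (l ψ).comp (ContinuousLinearMap.apply ℂ B b) with hE
      change E (∮ z in C(a, ρ), resolv G z) = ∮ z in C(a, ρ), E (resolv G z)
      rw [circleIntegral, circleIntegral, ← E.intervalIntegral_comp_comm hint.out]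
      simp only [map_smul]
    -- The coefficient of the resolvent extends holomorphically across `a` as a Laplace integral, so
    -- its contour integral is 0.
    have h2 : (∮ z in C(a, ρ), l ψ (resolv G z b)) = 0 := by
      have hre : ∀ z ∈ closedBall a ρ, C₀ < z.re := by
        intro z hz
        have h3 := (Complex.abs_re_le_norm (z - a)).trans (mem_closedBall_iff_norm.1 hz)
        have h4 : ρ ≤ (a.re - C₀) / 2 := min_le_right _ _
        rw [Complex.sub_re, abs_le] at h3
        linarith
      rw [circleIntegral.integral_congr hρ0.le (g := fun z =>
        ∫ t in Ioi (0 : ℝ), Complex.exp (-z * t) * l ψ (L t.toNNReal b)) fun z hz => ?_]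
      · refine Complex.circleIntegral_eq_zero_of_differentiable_on_off_countable hρ0.le
          countable_empty (fun z hz => ?_) fun z hz => ?_
        · exact (differentiableAt_laplace hc hK (hre z hz)).continuousAt.continuousWithinAt
        · exact differentiableAt_laplace hc hK (hre z (ball_subset_closedBall hz.1))
      · exact resolv_eq_laplace h0 hadd hL hG (l ψ) hK hspec
          (hball z ((closedBall_subset_closedBall (min_le_left _ _)) (sphere_subset_closedBall hz))
            (hne hρ0 (mem_sphere.1 hz).ge)) (hre z (sphere_subset_closedBall hz))
    rw [spectralProj, smul_apply, map_smul, hcirc, h1, h2, smul_zero]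
  have hproj : spectralProj G a r = 0 := by
    ext b
    have h1 : (spectralProj G a r : B → B) = fun _ => 0 :=
      (spectralProj G a r).continuous.ext_on hS continuous_const fun b hb => hzero b hb
    exact congrFun h1 b
  rw [← hrank, hproj]
  have : LinearMap.range ((0 : B →L[ℂ] B) : B →ₗ[ℂ] B) = ⊥ := LinearMap.range_zero
  rw [this, finrank_bot]

end Resolvent

/-! ### Smooth dependence of integrals on parameters. -/

section ParametricIntegral

open Set MeasureTheory
open scoped Convolution

/-- The integral is the value at 0 of the convolution of the indicator of `(a, b]` with `u ↦ f (-u,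
y)`, cut off by a bump equal to 1 on the interval; convolution with a compactly supported smooth
family is smooth in the parameter. -/
theorem contDiffOn_intervalIntegral {E F : Type*} [NormedAddCommGroup E] [NormedSpace ℝ E]
    [NormedAddCommGroup F] [NormedSpace ℝ F] [CompleteSpace F] {f : ℝ × E → F} {s : Set E}
    (hs : IsOpen s) (hf : ContDiffOn ℝ ∞ f (univ ×ˢ s)) {a b : ℝ} (hab : a ≤ b) :
    ContDiffOn ℝ ∞ (fun y => ∫ t in a..b, f (t, y)) s := by
  set R := |a| + |b| + 1 with hR
  have hR0 : 0 < R := by positivity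
  set χ : ContDiffBump (0 : ℝ) := ⟨R, R + 1, hR0, by linarith⟩ with hχ
  have hk : IsCompact (closedBall (0 : ℝ) (R + 1)) := isCompact_closedBall _ _
  have h1 := contDiffOn_convolution_right_with_param_comp (n := ⊤) (μ := volume)
    (ContinuousLinearMap.lsmul ℝ ℝ) (v := fun _ : E => (0 : ℝ)) contDiffOn_const
    (f := (Ioc a b).indicator fun _ => (1 : ℝ)) (g := fun y u => χ u • f (-u, y)) hs hk
    (fun y u _ hu => by
      have h2 : χ u = 0 := χ.zero_of_le_dist (by
        have := not_le.1 (mt mem_closedBall.2 hu)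
        exact this.le)
      rw [h2, zero_smul])
    ((integrable_indicator_iff measurableSet_Ioc).2 (by simp)).locallyIntegrable
    (by
      have h3 : ContDiffOn ℝ ∞ (fun p : E × ℝ => χ p.2) (s ×ˢ univ) :=
        (χ.contDiff.comp contDiff_snd).contDiffOn
      refine h3.smul (hf.comp (contDiff_snd.neg.prodMk contDiff_fst).contDiffOn ?_)
      exact fun p hp => ⟨mem_univ _, hp.1⟩)
  refine h1.congr fun y _ => ?_
  rw [convolution_def, intervalIntegral.integral_of_le hab, ← integral_indicator measurableSet_Ioc]
  refine integral_congr_ae (Eventually.of_forall fun t => ?_)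
  by_cases ht : t ∈ Ioc a b
  · have h4 : χ (-t) = 1 := χ.one_of_mem_closedBall (by
      rw [mem_closedBall_zero_iff, norm_neg, Real.norm_eq_abs, abs_le]
      change -R ≤ t ∧ t ≤ R
      constructor
      · linarith [ht.1, neg_abs_le a, abs_nonneg b]
      · linarith [ht.2, le_abs_self b, abs_nonneg a])
    simp [ht, h4]
  · simp [ht]

universe u
variable {d : ℕ} {M : Type u} [TopologicalSpace M]
  [ChartedSpace (EuclideanSpace ℝ (Fin (d + 1))) M] [IsManifold (𝓡 (d + 1)) ∞ M]

theorem contMDiffAt_of_contDiffAt_comp_symm {F : Type*} [NormedAddCommGroup F] [NormedSpace ℝ F]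
    {f : EuclideanSpace ℝ (Fin (d + 1)) → F} {x y : M}
    (hy : y ∈ (extChartAt (𝓡 (d + 1)) x).source)
    (hf : ContDiffAt ℝ ∞ f (extChartAt (𝓡 (d + 1)) x y)) :
    ContMDiffAt (𝓡 (d + 1)) 𝓘(ℝ, F) ∞ (fun z => f (extChartAt (𝓡 (d + 1)) x z)) y :=
  hf.contMDiffAt.comp y (contMDiffAt_extChartAt' (by rwa [extChartAt_source] at hy))

theorem contMDiff_intervalIntegral {F : Type*} [NormedAddCommGroup F] [NormedSpace ℝ F]
    [CompleteSpace F] {f : ℝ × M → F}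
    (hf : ContMDiff (𝓘(ℝ, ℝ).prod (𝓡 (d + 1))) 𝓘(ℝ, F) ∞ f) {a b : ℝ} (hab : a ≤ b) :
    ContMDiff (𝓡 (d + 1)) 𝓘(ℝ, F) ∞ (fun x => ∫ t in a..b, f (t, x)) := by
  intro x
  have ht := isOpen_extChartAt_target (I := 𝓡 (d + 1)) x
  have h1 := (contDiffOn_intervalIntegral ht (contDiffOn_comp_extChartAt_symm hf x) hab).contDiffAt
    (ht.mem_nhds (mem_extChartAt_target x))
  refine (contMDiffAt_of_contDiffAt_comp_symm (mem_extChartAt_source x) h1).congr_of_eventuallyEq ?_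
  filter_upwards [(isOpen_extChartAt_source (I := 𝓡 (d + 1)) x).mem_nhds (mem_extChartAt_source x)]
    with y hy
  simp only [(extChartAt (𝓡 (d + 1)) x).left_inv hy]

end ParametricIntegral

/-! ### Smooth volumes in charts. -/

section SmoothVolume

open Set MeasureTheory

theorem contDiff_det {n : ℕ} : ContDiff ℝ ∞
    (fun A : EuclideanSpace ℝ (Fin n) →L[ℝ] EuclideanSpace ℝ (Fin n) => A.det) := by
  set b := (EuclideanSpace.basisFun (Fin n) ℝ).toBasis
  have h1 : (fun A : EuclideanSpace ℝ (Fin n) →L[ℝ] EuclideanSpace ℝ (Fin n) => A.det) =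
      fun A => ∑ σ : Equiv.Perm (Fin n), Equiv.Perm.sign σ • ∏ i, A (b i) (σ i) := by
    funext A
    rw [ContinuousLinearMap.det, ← LinearMap.det_toMatrix b, Matrix.det_apply]
    simp [LinearMap.toMatrix_apply, b]
  rw [h1]
  refine ContDiff.sum fun σ _ => ContDiff.const_smul _ (contDiff_prod fun i _ => ?_)
  have h2 : (fun A : EuclideanSpace ℝ (Fin n) →L[ℝ] EuclideanSpace ℝ (Fin n) => A (b i) (σ i)) =
      ((EuclideanSpace.proj (σ i)).comp (ContinuousLinearMap.apply ℝ _ (b i)) :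
        (EuclideanSpace ℝ (Fin n) →L[ℝ] EuclideanSpace ℝ (Fin n)) →L[ℝ] ℝ) := rfl
  rw [h2]
  exact ContinuousLinearMap.contDiff _

universe u
variable {d : ℕ} {M : Type u} [TopologicalSpace M]
  [ChartedSpace (EuclideanSpace ℝ (Fin (d + 1))) M] [IsManifold (𝓡 (d + 1)) ∞ M]
  [MeasurableSpace M] [BorelSpace M] {μ : Measure M}

/-- `r` is the density of the volume `μ` in the preferred chart at `x`. -/
structure IsChartDensity (μ : Measure M) (x : M) (r : EuclideanSpace ℝ (Fin (d + 1)) → ℝ) :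
    Prop where
  contDiffOn : ContDiffOn ℝ ∞ r (extChartAt (𝓡 (d + 1)) x).target
  pos : ∀ y ∈ (extChartAt (𝓡 (d + 1)) x).target, 0 < r y
  map_eq : (μ.restrict (extChartAt (𝓡 (d + 1)) x).source).map (extChartAt (𝓡 (d + 1)) x) =
    (volume.restrict (extChartAt (𝓡 (d + 1)) x).target).withDensity fun y => ENNReal.ofReal (r y)

theorem IsSmoothVolume.exists_chartDensity (hμ : IsSmoothVolume (d := d) μ) (x : M) :
    ∃ r, IsChartDensity (d := d) μ x r := by
  obtain ⟨r, h1, h2, h3⟩ := hμ _ (chart_mem_atlas (EuclideanSpace ℝ (Fin (d + 1))) x)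
  have e1 : (extChartAt (𝓡 (d + 1)) x).target
      = (chartAt (EuclideanSpace ℝ (Fin (d + 1))) x).target := by simp [mfld_simps]
  have e2 : (extChartAt (𝓡 (d + 1)) x).source
      = (chartAt (EuclideanSpace ℝ (Fin (d + 1))) x).source := extChartAt_source _ x
  have e3 : ⇑(extChartAt (𝓡 (d + 1)) x) = chartAt (EuclideanSpace ℝ (Fin (d + 1))) x := by
    simp [mfld_simps]
  exact ⟨r, by rwa [e1], by rwa [e1], by rwa [e1, e2, e3]⟩

theorem aemeasurable_extChartAt (x : M) : AEMeasurable (extChartAt (𝓡 (d + 1)) x)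
    (μ.restrict (extChartAt (𝓡 (d + 1)) x).source) :=
  (continuousOn_extChartAt x).aemeasurable (isOpen_extChartAt_source x).measurableSet

namespace IsChartDensity

variable {x : M} {r : EuclideanSpace ℝ (Fin (d + 1)) → ℝ}

theorem aemeasurable (hr : IsChartDensity (d := d) μ x r) : AEMeasurable (fun y => ENNReal.ofReal (r y))
    (volume.restrict (extChartAt (𝓡 (d + 1)) x).target) :=
  (hr.contDiffOn.continuousOn.aemeasurable (isOpen_extChartAt_target x).measurableSet).ennreal_ofReal

theorem integral_eq (hr : IsChartDensity (d := d) μ x r) {F : M → ℂ} (hF : Continuous F)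
    (h0 : ∀ y ∉ (extChartAt (𝓡 (d + 1)) x).source, F y = 0) :
    ∫ y, F y ∂μ = ∫ u in (extChartAt (𝓡 (d + 1)) x).target,
      r u • F ((extChartAt (𝓡 (d + 1)) x).symm u) := by
  set e := extChartAt (𝓡 (d + 1)) x with he
  have ht : MeasurableSet e.target := (isOpen_extChartAt_target x).measurableSet
  have hs : MeasurableSet e.source := (isOpen_extChartAt_source x).measurableSet
  have hm : AEStronglyMeasurable (fun u => F (e.symm u))
      ((volume.restrict e.target).withDensity fun y => ENNReal.ofReal (r y)) :=
    ((hF.comp_continuousOn (continuousOn_extChartAt_symm x)).aestronglyMeasurable ht).mono_ac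
      (withDensity_absolutelyContinuous _ _)
  calc ∫ y, F y ∂μ = ∫ y in e.source, F y ∂μ :=
        (setIntegral_eq_integral_of_forall_compl_eq_zero h0).symm
    _ = ∫ y in e.source, F (e.symm (e y)) ∂μ :=
        setIntegral_congr_fun hs fun y hy => by simp only [e.left_inv hy]
    _ = ∫ u, F (e.symm u) ∂((μ.restrict e.source).map e) :=
        (integral_map (aemeasurable_extChartAt x) (by rw [hr.map_eq]; exact hm)).symm
    _ = ∫ u in e.target, (ENNReal.ofReal (r u)).toReal • F (e.symm u) := by
        rw [hr.map_eq, integral_withDensity_eq_integral_toReal_smul₀ hr.aemeasurable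
          (Eventually.of_forall fun _ => ENNReal.ofReal_lt_top)]
    _ = _ := setIntegral_congr_fun ht fun u hu => by
        simp only [ENNReal.toReal_ofReal (hr.pos u hu).le]

end IsChartDensity

/-- The density is continuous, hence bounded on a small ball of a chart, so the measure is locally
finite; compactness concludes. -/
theorem IsSmoothVolume.isFiniteMeasure [CompactSpace M] (hμ : IsSmoothVolume (d := d) μ) :
    IsFiniteMeasure μ := by
  have : IsLocallyFiniteMeasure μ := by
    refine ⟨fun x => ?_⟩
    obtain ⟨r, hr⟩ := hμ.exists_chartDensity x
    set e := extChartAt (𝓡 (d + 1)) x with he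
    obtain ⟨ε, hε, hball⟩ := Metric.isOpen_iff.1 (isOpen_extChartAt_target (I := 𝓡 (d + 1)) x) _
      (mem_extChartAt_target x)
    have hsub : closedBall (e x) (ε / 2) ⊆ e.target :=
      (closedBall_subset_ball (by linarith)).trans hball
    obtain ⟨C, hC⟩ := (isCompact_closedBall (e x) (ε / 2)).exists_bound_of_continuousOn
      (hr.contDiffOn.continuousOn.mono hsub)
    refine ⟨e.source ∩ e ⁻¹' ball (e x) (ε / 2), ?_, ?_⟩
    · exact inter_mem ((isOpen_extChartAt_source x).mem_nhds (mem_extChartAt_source x))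
        ((continuousAt_extChartAt x).preimage_mem_nhds (ball_mem_nhds _ (by linarith)))
    · have h1 : μ (e.source ∩ e ⁻¹' ball (e x) (ε / 2)) =
          ((μ.restrict e.source).map e) (ball (e x) (ε / 2)) := by
        rw [Measure.map_apply_of_aemeasurable (aemeasurable_extChartAt x) measurableSet_ball,
          Measure.restrict_apply₀' (isOpen_extChartAt_source x).measurableSet.nullMeasurableSet,
          inter_comm]
      rw [h1, hr.map_eq, withDensity_apply _ measurableSet_ball, Measure.restrict_restrict
        measurableSet_ball]
      calc _ ≤ ∫⁻ _ in ball (e x) (ε / 2) ∩ e.target, ENNReal.ofReal C := by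
            refine setLIntegral_mono measurable_const fun y hy => ENNReal.ofReal_le_ofReal ?_
            exact (le_abs_self _).trans (hC y (ball_subset_closedBall hy.1))
        _ = ENNReal.ofReal C * volume (ball (e x) (ε / 2) ∩ e.target) := setLIntegral_const _ _
        _ < ⊤ := ENNReal.mul_lt_top ENNReal.ofReal_lt_top
            ((measure_mono inter_subset_left).trans_lt measure_ball_lt_top)
  exact inferInstance

end SmoothVolume

/-! ### Change of variables under a diffeomorphism. -/

section ChangeOfVariables

open Set MeasureTheory

universe u
variable {d : ℕ} {M : Type u} [TopologicalSpace M]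
  [ChartedSpace (EuclideanSpace ℝ (Fin (d + 1))) M] [IsManifold (𝓡 (d + 1)) ∞ M]
  [MeasurableSpace M] [BorelSpace M] {μ : Measure M}

theorem contMDiffAt_mul_complex {f h : M → ℂ} {x : M}
    (hf : ContMDiffAt (𝓡 (d + 1)) 𝓘(ℝ, ℂ) ∞ f x) (hh : ContMDiffAt (𝓡 (d + 1)) 𝓘(ℝ, ℂ) ∞ h x) :
    ContMDiffAt (𝓡 (d + 1)) 𝓘(ℝ, ℂ) ∞ (fun y => f y * h y) x :=
  (contDiff_mul (𝕜 := ℝ) (𝔸 := ℂ) (n := ∞)).contMDiff.contMDiffAt.comp x (hf.prodMk_space hh)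

theorem contMDiff_mul_complex {f h : M → ℂ} (hf : ContMDiff (𝓡 (d + 1)) 𝓘(ℝ, ℂ) ∞ f)
    (hh : ContMDiff (𝓡 (d + 1)) 𝓘(ℝ, ℂ) ∞ h) :
    ContMDiff (𝓡 (d + 1)) 𝓘(ℝ, ℂ) ∞ (fun y => f y * h y) :=
  fun x => contMDiffAt_mul_complex (hf x) (hh x)

/-- When the support of `h` and its image each lie in one chart, this is the Euclidean change of
variables. The new density is `h ∘ Θ` times the Jacobian of the inverse corrected by the two chart
densities; it extends by 0 to a smooth function because of the support condition. -/
theorem exists_transpose_of_tsupport_subset (hμ : IsSmoothVolume (d := d) μ) {Φ Θ : M → M}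
    (hΦ : ContMDiff (𝓡 (d + 1)) (𝓡 (d + 1)) ∞ Φ) (hΘ : ContMDiff (𝓡 (d + 1)) (𝓡 (d + 1)) ∞ Θ)
    (hΘΦ : ∀ x, Θ (Φ x) = x) (hΦΘ : ∀ x, Φ (Θ x) = x) (x₀ : M) {h : M → ℂ}
    (hh : ContMDiff (𝓡 (d + 1)) 𝓘(ℝ, ℂ) ∞ h)
    (hsupp : tsupport h ⊆ (extChartAt (𝓡 (d + 1)) x₀).source ∩
      Φ ⁻¹' (extChartAt (𝓡 (d + 1)) (Φ x₀)).source) :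
    ∃ ψ : M → ℂ, ContMDiff (𝓡 (d + 1)) 𝓘(ℝ, ℂ) ∞ ψ ∧
      ∀ f : M → ℂ, Continuous f → ∫ x, f (Φ x) * h x ∂μ = ∫ x, f x * ψ x ∂μ := by
  obtain ⟨r, hr⟩ := hμ.exists_chartDensity x₀
  obtain ⟨r', hr'⟩ := hμ.exists_chartDensity (Φ x₀)
  set e := extChartAt (𝓡 (d + 1)) x₀ with he
  set e' := extChartAt (𝓡 (d + 1)) (Φ x₀) with he'
  set O := e.target ∩ e.symm ⁻¹' (Φ ⁻¹' e'.source) with hO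
  set O' := e'.target ∩ e'.symm ⁻¹' (Θ ⁻¹' e.source) with hO'
  set Ξ := e' ∘ Φ ∘ e.symm with hΞ
  set Ψ := e ∘ Θ ∘ e'.symm with hΨ
  have hΞd : ContDiffOn ℝ ∞ Ξ O := (contMDiff_iff.1 hΦ).2 x₀ (Φ x₀)
  have hΨd : ContDiffOn ℝ ∞ Ψ O' := (contMDiff_iff.1 hΘ).2 (Φ x₀) x₀
  have hOo : IsOpen O := (continuousOn_extChartAt_symm x₀).isOpen_inter_preimage
    (isOpen_extChartAt_target x₀) ((isOpen_extChartAt_source (Φ x₀)).preimage hΦ.continuous)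
  have hOo' : IsOpen O' := (continuousOn_extChartAt_symm (Φ x₀)).isOpen_inter_preimage
    (isOpen_extChartAt_target (Φ x₀)) ((isOpen_extChartAt_source x₀).preimage hΘ.continuous)
  have hsΨ : ∀ v ∈ O', e.symm (Ψ v) = Θ (e'.symm v) := fun v hv => e.left_inv hv.2
  have hsΞ : ∀ u ∈ O, e'.symm (Ξ u) = Φ (e.symm u) := fun u hu => e'.left_inv hu.2
  have hΨmem : ∀ v ∈ O', Ψ v ∈ O := fun v hv => ⟨e.map_source hv.2, by
    rw [mem_preimage, hsΨ v hv, mem_preimage, hΦΘ]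
    exact e'.map_target hv.1⟩
  have hΞmem : ∀ u ∈ O, Ξ u ∈ O' := fun u hu => ⟨e'.map_source hu.2, by
    rw [mem_preimage, hsΞ u hu, mem_preimage, hΘΦ]
    exact e.map_target hu.1⟩
  have hΞΨ : ∀ v ∈ O', Ξ (Ψ v) = v := fun v hv => by
    change e' (Φ (e.symm (Ψ v))) = v
    rw [hsΨ v hv, hΦΘ, e'.right_inv hv.1]
  have hΨΞ : ∀ u ∈ O, Ψ (Ξ u) = u := fun u hu => by
    change e (Θ (e'.symm (Ξ u))) = u
    rw [hsΞ u hu, hΘΦ, e.right_inv hu.1]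
  have himage : Ψ '' O' = O := by
    ext u
    exact ⟨by rintro ⟨v, hv, rfl⟩; exact hΨmem v hv, fun hu => ⟨Ξ u, hΞmem u hu, hΨΞ u hu⟩⟩
  have hΨf : ∀ v ∈ O', DifferentiableAt ℝ Ψ v := fun v hv =>
    (hΨd.contDiffAt (hOo'.mem_nhds hv)).differentiableAt (by simp)
  -- The Jacobian is nonzero by the chain rule for the two inverse maps; this is needed for its
  -- absolute value to be smooth.
  have hdet : ∀ v ∈ O', (fderiv ℝ Ψ v).det ≠ 0 := by
    intro v hv
    have h1 : (Ξ ∘ Ψ) =ᶠ[𝓝 v] id := by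
      filter_upwards [hOo'.mem_nhds hv] with w hw using hΞΨ w hw
    have hΞf : DifferentiableAt ℝ Ξ (Ψ v) :=
      (hΞd.contDiffAt (hOo.mem_nhds (hΨmem v hv))).differentiableAt (by simp)
    have h2 := h1.fderiv_eq (𝕜 := ℝ)
    rw [fderiv_comp v hΞf (hΨf v hv), fderiv_id] at h2
    have h3 := congrArg (fun A : EuclideanSpace ℝ (Fin (d + 1)) →L[ℝ]
      EuclideanSpace ℝ (Fin (d + 1)) => A.det) h2
    intro h4
    have h5 : ((fderiv ℝ Ξ (Ψ v)).comp (fderiv ℝ Ψ v)).det =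
        (fderiv ℝ Ξ (Ψ v)).det * (fderiv ℝ Ψ v).det :=
      LinearMap.det_comp (fderiv ℝ Ξ (Ψ v)).toLinearMap (fderiv ℝ Ψ v).toLinearMap
    rw [h5, h4, mul_zero] at h3
    have h6 : (ContinuousLinearMap.id ℝ (EuclideanSpace ℝ (Fin (d + 1)))).det = 1 :=
      LinearMap.det_id (A := ℝ) (M := EuclideanSpace ℝ (Fin (d + 1)))
    rw [h6] at h3
    exact zero_ne_one h3
  set jac : EuclideanSpace ℝ (Fin (d + 1)) → ℝ :=
    fun v => r (Ψ v) * |(fderiv ℝ Ψ v).det| / r' v with hjac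
  have hjacd : ∀ v ∈ O', ContDiffAt ℝ ∞ jac v := by
    intro v hv
    have hΨv := hΨd.contDiffAt (hOo'.mem_nhds hv)
    have h1 : ContDiffAt ℝ ∞ (fun v => r (Ψ v)) v :=
      (hr.contDiffOn.contDiffAt ((isOpen_extChartAt_target x₀).mem_nhds (hΨmem v hv).1)).comp v hΨv
    have h2 : ContDiffAt ℝ ∞ (fun v => |(fderiv ℝ Ψ v).det|) v :=
      (contDiff_det.contDiffAt.comp v (hΨv.fderiv_right (by simp))).abs (hdet v hv)
    have h3 := hr'.contDiffOn.contDiffAt ((isOpen_extChartAt_target (Φ x₀)).mem_nhds hv.1)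
    exact (h1.mul h2).div h3 (hr'.pos v hv.1).ne'
  have hψsupp : ∀ y, Θ y ∈ tsupport h → y ∈ e'.source ∧ e' y ∈ O' := by
    intro y hy
    have h1 := hsupp hy
    have h2 : y ∈ e'.source := by
      have := h1.2
      rwa [mem_preimage, hΦΘ] at this
    refine ⟨h2, e'.map_source h2, ?_⟩
    rw [mem_preimage, e'.left_inv h2]
    exact h1.1
  set ψ : M → ℂ := fun y => (jac (e' y) : ℂ) * h (Θ y) with hψ
  have hψd : ContMDiff (𝓡 (d + 1)) 𝓘(ℝ, ℂ) ∞ ψ := by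
    intro y
    by_cases hy : Θ y ∈ tsupport h
    · obtain ⟨h1, h2⟩ := hψsupp y hy
      have h3 : ContDiffAt ℝ ∞ (fun v => (jac v : ℂ)) (e' y) :=
        Complex.ofRealCLM.contDiff.contDiffAt.comp _ (hjacd _ h2)
      exact contMDiffAt_mul_complex (contMDiffAt_of_contDiffAt_comp_symm h1 h3) (hh.comp hΘ y)
    · have h1 : ψ =ᶠ[𝓝 y] fun _ => 0 := by
        filter_upwards [((isClosed_tsupport h).preimage hΘ.continuous).isOpen_compl.mem_nhds hy]
          with w hw
        rw [hψ]
        simp only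
        rw [image_eq_zero_of_notMem_tsupport hw, mul_zero]
      exact contMDiffAt_const.congr_of_eventuallyEq h1
  have hψ0 : ∀ y, ψ y ≠ 0 → y ∈ e'.source ∧ e' y ∈ O' := fun y hy =>
    hψsupp y (subset_tsupport h (right_ne_zero_of_mul hy))
  refine ⟨ψ, hψd, fun f hf => ?_⟩
  have hF₁0 : ∀ x, f (Φ x) * h x ≠ 0 → x ∈ e.source ∩ Φ ⁻¹' e'.source := fun x hx =>
    hsupp (subset_tsupport h (right_ne_zero_of_mul hx))
  rw [hr.integral_eq (F := fun x => f (Φ x) * h x) ((hf.comp hΦ.continuous).mul hh.continuous) fun x hx => by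
      by_contra h1; exact hx (hF₁0 x h1).1,
    hr'.integral_eq (F := fun x => f x * ψ x) (hf.mul hψd.continuous) fun x hx => by
      by_contra h1; exact hx (hψ0 x (right_ne_zero_of_mul h1)).1]
  rw [setIntegral_eq_of_subset_of_forall_sdiff_eq_zero (isOpen_extChartAt_target x₀).measurableSet
      (show O ⊆ e.target from inter_subset_left) fun u hu => by
        by_contra h1
        exact hu.2 ⟨hu.1, (hF₁0 _ (right_ne_zero_of_smul h1)).2⟩,
    setIntegral_eq_of_subset_of_forall_sdiff_eq_zero (isOpen_extChartAt_target (Φ x₀)).measurableSet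
      (show O' ⊆ e'.target from inter_subset_left) fun v hv => by
        by_contra h1
        have h2 := (hψ0 _ (right_ne_zero_of_mul (right_ne_zero_of_smul h1))).2
        rw [e'.right_inv hv.1] at h2
        exact hv.2 h2,
    ← himage, integral_image_eq_integral_abs_det_fderiv_smul volume hOo'.measurableSet
      (fun v hv => (hΨf v hv).hasFDerivAt.hasFDerivWithinAt) (fun v hv w hw hvw => by
        rw [← hΞΨ v hv, hvw, hΞΨ w hw])]
  refine setIntegral_congr_fun hOo'.measurableSet fun v hv => ?_
  change |(fderiv ℝ Ψ v).det| • (r (Ψ v) • (f (Φ (e.symm (Ψ v))) * h (e.symm (Ψ v)))) =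
    r' v • (f (e'.symm v) * ((jac (e' (e'.symm v)) : ℂ) * h (Θ (e'.symm v))))
  rw [hsΨ v hv, hΦΘ, e'.right_inv hv.1, hjac]
  have h1 : (r' v : ℂ) ≠ 0 := by exact_mod_cast (hr'.pos v hv.1).ne'
  simp only [Complex.real_smul]
  push_cast
  field_simp

/-- A partition of unity reduces to densities supported in a single pair of charts. -/
theorem exists_transpose [T2Space M] [CompactSpace M] (hμ : IsSmoothVolume (d := d) μ)
    {Φ Θ : M → M}
    (hΦ : ContMDiff (𝓡 (d + 1)) (𝓡 (d + 1)) ∞ Φ) (hΘ : ContMDiff (𝓡 (d + 1)) (𝓡 (d + 1)) ∞ Θ)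
    (hΘΦ : ∀ x, Θ (Φ x) = x) (hΦΘ : ∀ x, Φ (Θ x) = x) {h : M → ℂ}
    (hh : ContMDiff (𝓡 (d + 1)) 𝓘(ℝ, ℂ) ∞ h) :
    ∃ ψ : M → ℂ, ContMDiff (𝓡 (d + 1)) 𝓘(ℝ, ℂ) ∞ ψ ∧
      ∀ f : M → ℂ, Continuous f → ∫ x, f (Φ x) * h x ∂μ = ∫ x, f x * ψ x ∂μ := by
  have _ := hμ.isFiniteMeasure
  set U : M → Set M := fun x => (extChartAt (𝓡 (d + 1)) x).source ∩
      Φ ⁻¹' (extChartAt (𝓡 (d + 1)) (Φ x)).source with hU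
  have hUo : ∀ x, IsOpen (U x) := fun x => (isOpen_extChartAt_source x).inter
    ((isOpen_extChartAt_source (Φ x)).preimage hΦ.continuous)
  have hUx : ∀ x, x ∈ U x := fun x => ⟨mem_extChartAt_source x, mem_extChartAt_source (Φ x)⟩
  obtain ⟨t, ht⟩ := isCompact_univ.elim_nhds_subcover U fun x _ => (hUo x).mem_nhds (hUx x)
  obtain ⟨χ, hχ⟩ := SmoothPartitionOfUnity.exists_isSubordinate (𝓡 (d + 1)) isClosed_univ
    (fun x : t => U x) (fun x => hUo x) (by
      intro y hy
      obtain ⟨x, hx, hyx⟩ := mem_iUnion₂.1 (ht.2 hy)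
      exact mem_iUnion.2 ⟨⟨x, hx⟩, hyx⟩)
  have hχd : ∀ i, ContMDiff (𝓡 (d + 1)) 𝓘(ℝ, ℂ) ∞ fun x => (χ i x : ℂ) := fun i =>
    Complex.ofRealCLM.contDiff.contMDiff.comp (χ i).contMDiff
  have hloc : ∀ i : t, ∃ ψ : M → ℂ, ContMDiff (𝓡 (d + 1)) 𝓘(ℝ, ℂ) ∞ ψ ∧
      ∀ f : M → ℂ, Continuous f →
        ∫ x, f (Φ x) * ((χ i x : ℂ) * h x) ∂μ = ∫ x, f x * ψ x ∂μ := by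
    intro i
    refine exists_transpose_of_tsupport_subset hμ hΦ hΘ hΘΦ hΦΘ (i : M) (contMDiff_mul_complex (hχd i) hh) ?_
    refine (closure_mono fun x hx => ?_).trans (hχ i)
    have h1 : (χ i x : ℂ) ≠ 0 := left_ne_zero_of_mul hx
    exact_mod_cast h1
  choose ψ hψd hψ using hloc
  have hint : ∀ F : M → ℂ, Continuous F → Integrable F μ := fun F hF =>
    hF.integrable_of_hasCompactSupport (HasCompactSupport.of_compactSpace F)
  refine ⟨fun x => ∑ i, ψ i x, contMDiff_finsetSum fun i _ => hψd i, fun f hf => ?_⟩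
  have hsum : ∀ x, ∑ i, (χ i x : ℂ) = 1 := fun x => by
    have := χ.sum_eq_one (mem_univ x)
    rw [finsum_eq_sum_of_fintype] at this
    exact_mod_cast this
  calc ∫ x, f (Φ x) * h x ∂μ = ∫ x, ∑ i, f (Φ x) * ((χ i x : ℂ) * h x) ∂μ := by
        congr 1
        funext x
        rw [← Finset.mul_sum, ← Finset.sum_mul, hsum, one_mul]
    _ = ∑ i, ∫ x, f (Φ x) * ((χ i x : ℂ) * h x) ∂μ := integral_finsetSum _ fun i _ =>
        hint _ ((hf.comp hΦ.continuous).mul (contMDiff_mul_complex (hχd i) hh).continuous)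
    _ = ∑ i, ∫ x, f x * ψ i x ∂μ := Finset.sum_congr rfl fun i _ => hψ i f hf
    _ = ∫ x, ∑ i, f x * ψ i x ∂μ := (integral_finsetSum _ fun i _ =>
        hint _ (hf.mul (hψd i).continuous)).symm
    _ = _ := by simp only [Finset.mul_sum]

end ChangeOfVariables

/-! ### Upper bound for the real parts of resonances. -/

section ResonanceBound

open Set MeasureTheory

universe u
variable {d : ℕ} {M : Type u} [TopologicalSpace M]
  [ChartedSpace (EuclideanSpace ℝ (Fin (d + 1))) M] [IsManifold (𝓡 (d + 1)) ∞ M]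

theorem norm_koopman_le {φ : Flow ℝ M} {g : M → ℂ} {C : ℝ} (hC : ∀ x, ‖g x‖ ≤ C) {f : M → ℂ} {K : ℝ}
    (hK : ∀ x, ‖f x‖ ≤ K) {t : ℝ} (ht : 0 ≤ t) (x : M) :
    ‖koopman φ g t f x‖ ≤ K * Real.exp (C * t) := by
  have h1 : ‖∫ τ in (0 : ℝ)..t, g (φ τ x)‖ ≤ C * t := by
    have := intervalIntegral.norm_integral_le_of_norm_le_const (a := 0) (b := t) (C := C)
      (f := fun τ => g (φ τ x)) fun τ _ => hC _
    rwa [sub_zero, abs_of_nonneg ht] at this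
  rw [koopman, norm_mul, mul_comm, Complex.norm_exp]
  exact mul_le_mul (hK _) (Real.exp_le_exp.2 ((Complex.re_le_norm _).trans h1))
    (Real.exp_pos _).le ((norm_nonneg _).trans (hK x))

variable [MeasurableSpace M] [BorelSpace M] [T2Space M] [CompactSpace M] {μ : Measure M}
  {V : VField d M} {φ : Flow ℝ M} {g : M → ℂ}

/-- The transpose of the Koopman operator preserves smooth densities. -/
theorem exists_koopman_transpose (hμ : IsSmoothVolume (d := d) μ)
    (hφ : ContMDiff (𝓘(ℝ, ℝ).prod (𝓡 (d + 1))) (𝓡 (d + 1)) ∞ (fun p : ℝ × M => φ p.1 p.2))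
    (hg : ContMDiff (𝓡 (d + 1)) 𝓘(ℝ, ℂ) ∞ g) {t : ℝ} (ht : 0 ≤ t) (ψ : SmoothFn d M) :
    ∃ ψ' : SmoothFn d M, ∀ f : SmoothFn d M,
      ∫ x, koopman φ g t f x * ψ x ∂μ = ∫ x, f x * ψ' x ∂μ := by
  have hΦ : ∀ s : ℝ, ContMDiff (𝓡 (d + 1)) (𝓡 (d + 1)) ∞ (φ s) := fun s =>
    hφ.comp (contMDiff_const.prodMk contMDiff_id)
  have h1 : ContMDiff (𝓡 (d + 1)) 𝓘(ℝ, ℂ) ∞ fun x => ∫ τ in (0 : ℝ)..t, g (φ τ x) :=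
    contMDiff_intervalIntegral (f := fun p : ℝ × M => g (φ p.1 p.2)) (hg.comp hφ) ht
  have h2 : ContMDiff (𝓡 (d + 1)) 𝓘(ℝ, ℂ) ∞
      fun x => Complex.exp (∫ τ in (0 : ℝ)..t, g (φ τ x)) :=
    (Complex.contDiff_exp (𝕜 := ℝ)).contMDiff.comp h1
  obtain ⟨ψ', hψ', h⟩ := exists_transpose hμ (hΦ t) (hΦ (-t)) (fun x => by simp [← φ.map_add])
    (fun x => by simp [← φ.map_add]) (contMDiff_mul_complex h2 ψ.2)
  refine ⟨⟨ψ', hψ'⟩, fun f => ?_⟩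
  refine Eq.trans ?_ (h f (f.2 : ContMDiff _ _ _ _).continuous)
  congr 1
  funext x
  rw [koopman]
  ring

theorem exists_bound_smoothFn (f : SmoothFn d M) : ∃ K : ℝ, ∀ x, ‖f x‖ ≤ K := by
  obtain ⟨K, hK⟩ := isCompact_univ.exists_bound_of_continuousOn
    (f.2 : ContMDiff _ _ _ _).continuous.continuousOn
  exact ⟨K, fun x => hK x (mem_univ x)⟩

/-- The operator on the space is prescribed by duality only, which says something at `ψ` because the
transposed density `ψ'` is again smooth. It identifies the abstract semigroup with the concrete
correlations. -/
theorem AnisotropicSpace.toDistr_L_incl (hμ : IsSmoothVolume (d := d) μ)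
    (hφ : ContMDiff (𝓘(ℝ, ℝ).prod (𝓡 (d + 1))) (𝓡 (d + 1)) ∞ (fun p : ℝ × M => φ p.1 p.2))
    (hg : ContMDiff (𝓡 (d + 1)) 𝓘(ℝ, ℂ) ∞ g) {A : ℝ} {B : Type u} [NormedAddCommGroup B]
    [NormedSpace ℂ B] (S : AnisotropicSpace μ V φ g A B) (t : NNReal) (f ψ : SmoothFn d M) :
    S.toDistr (S.L t (S.incl f)) ψ = ∫ x, koopman φ g t f x * ψ x ∂μ := by
  obtain ⟨ψ', hψ'⟩ := exists_koopman_transpose hμ hφ hg t.2 ψ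
  rw [S.L_spec t (S.incl f) ψ ψ' hψ', S.toDistr_incl]
  exact (hψ' f).symm

/-- The real parts of the Ruelle resonances are bounded. -/
theorem exists_re_le_of_resMult_ne_zero (hμ : IsSmoothVolume (d := d) μ) (V : VField d M)
    (hφ : ContMDiff (𝓘(ℝ, ℝ).prod (𝓡 (d + 1))) (𝓡 (d + 1)) ∞ (fun p : ℝ × M => φ p.1 p.2))
    (hg : ContMDiff (𝓡 (d + 1)) 𝓘(ℝ, ℂ) ∞ g) :
    ∃ C₀ : ℝ, ∀ a, resMult μ V φ g a ≠ 0 → a.re ≤ C₀ := by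
  have _ := hμ.isFiniteMeasure
  obtain ⟨C, hC⟩ := exists_bound_smoothFn (⟨g, hg⟩ : SmoothFn d M)
  have hC' : ∀ x, ‖g x‖ ≤ max C 0 := fun x => (hC x).trans (le_max_left _ _)
  -- The maximum with 0 keeps the half-plane inside `Re z > -A`, where the spectrum is known to be
  -- discrete, whatever the positive `A` attached to the resonance.
  refine ⟨max C 0, fun a ha => ?_⟩
  have hne : {m | IsRuelleResonance μ V φ g a m}.Nonempty := by
    by_contra h
    rw [Set.not_nonempty_iff_eq_empty] at h
    exact ha (by rw [resMult, h, Nat.sInf_empty])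
  obtain ⟨m, hm, A, hA, haA, B, _, _, _, S, hS⟩ := hne
  by_contra! hre
  refine hm.ne' (eq_zero_of_isIsolatedEigenvalue (L := S.L) S.L_zero S.L_add S.L_tendsto
    (fun b c h => (S.generator b c).2 h) (C₀ := max C 0)
    (fun z hz => S.spectrum_discrete z (by linarith [le_max_right C 0])) S.denseRange_incl
    (l := fun ψ : SmoothFn d M => ⟨⟨⟨fun b => S.toDistr b ψ, fun b c => by simp⟩, fun c b => by simp⟩,
      S.toDistr_continuous ψ⟩)
    (fun b hb => ?_) ?_ hre hS)
  · apply S.toDistr_injective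
    rw [map_zero]
    exact ContinuousLinearMap.ext hb
  · rintro _ ⟨f, rfl⟩ ψ
    obtain ⟨K, hK⟩ := exists_bound_smoothFn f
    obtain ⟨K', hK'⟩ := exists_bound_smoothFn ψ
    refine ⟨K * K' * μ.real univ, fun t ht => ?_⟩
    change ‖S.toDistr (S.L t.toNNReal (S.incl f)) ψ‖ ≤ _
    rw [S.toDistr_L_incl hμ hφ hg, Real.coe_toNNReal _ ht]
    refine (norm_integral_le_of_norm_le_const (C := K * Real.exp (max C 0 * t) * K')
      (Eventually.of_forall fun x => ?_)).trans_eq (by ring)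
    rw [norm_mul]
    have h1 := norm_koopman_le (φ := φ) hC' hK ht x
    exact mul_le_mul h1 (hK' x) (norm_nonneg _) ((norm_nonneg _).trans h1)

end ResonanceBound

end RuelleTrace

end

theorem proposition1p1 {d : ℕ} (hd : 2 ≤ d) {M : Type*} [TopologicalSpace M]
    [ChartedSpace (EuclideanSpace ℝ (Fin (d + 1))) M] [IsManifold (𝓡 (d + 1)) ∞ M]
    [T2Space M] [CompactSpace M] [MeasurableSpace M] [BorelSpace M]
    (μ : MeasureTheory.Measure M) (hμ : IsSmoothVolume (d := d) μ)
    (V : VField d M) (hV : IsSmoothVField V)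
    (φ : Flow ℝ M)
    (hφ : ContMDiff (𝓘(ℝ, ℝ).prod (𝓡 (d + 1))) (𝓡 (d + 1)) ∞ (fun p : ℝ × M => φ p.1 p.2))
    (hφV : ∀ x : M, IsMIntegralCurve (I := 𝓡 (d + 1)) (fun t : ℝ => φ t x) V)
    (g : M → ℂ) (hg : ContMDiff (𝓡 (d + 1)) 𝓘(ℝ, ℂ) ∞ g)
    (Eu Es : (x : M) → Submodule ℝ (TangentSpace (𝓡 (d + 1)) x))
    (hA : IsAnosov V φ Eu Es) :
    ((∃ f : ℂ → ℂ, IsEntireExtension hA g f ∧ entireOrder f < ⊤ ∧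
        ∀ a : ℂ, analyticOrderAt f a = (resMult μ V φ g a : ℕ∞)) ↔
      (TraceFormula μ hA g ∧ ∃ ρ : ℝ, 0 ≤ ρ ∧
        Summable (fun a : ℂ => (resMult μ V φ g a : ℝ) / (1 + ‖a‖ ^ ρ)))) ∧
    (TraceFormula μ hA g → ∀ ρ : ℝ, 0 ≤ ρ →
      Summable (fun a : ℂ => (resMult μ V φ g a : ℝ) / (1 + ‖a‖ ^ ρ)) →
      ∀ f : ℂ → ℂ, IsEntireExtension hA g f →
        entireOrder f ≤ ((⌈ρ⌉₊ : ℝ) : EReal) ∧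
        ∃ (P : Polynomial ℂ) (Q : ℂ → ℂ), P.natDegree ≤ ⌈ρ⌉₊ ∧
          IsCanonicalProduct (resMult μ V φ g) Q ∧
          ∀ z : ℂ, f z = Complex.exp (P.eval z) * Q z) := by
  have hgc : Continuous g := hg.continuous
  obtain ⟨C₀, hres⟩ := exists_re_le_of_resMult_ne_zero hμ V hφ hg
  obtain ⟨N, ⟨D⟩⟩ := exists_embeddedFlow hφ hφV hA.ne_zero
  obtain ⟨σ, hw⟩ := exists_summable_weight D hA hgc
  refine ⟨⟨?_, ?_⟩, ?_⟩
  · rintro ⟨f, hf, hfo, hm⟩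
    exact traceFormula_of_entireExtension hA hf hfo hm
  · rintro ⟨hTF, ρ, hρ, hs⟩
    exact exists_entireExtension_of_traceFormula hA hw hres hTF hρ hs
  · intro hTF ρ hρ hs f hf
    exact factorization_of_traceFormula hA hres hTF hρ hs hf
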